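/- Let $\mathfrak g$ be a finite-dimensional real Lie algebra with an inner product invariant under the adjoint action (the Lie algebra of a Lie group with a bi-invariant inner product). Latin indices run over $1,2,3$ and repeated indices are summed. Let $\dot H^1_x$ be the completion of the $\mathfrak g$-valued Schwartz functions on $\mathbb R^3$ under $\|u\|_{\dot H^1}=\max_j\|\partial_j u\|_{L^2}$, that is, the space of $u\in L^6(\mathbb R^3)$ with weak gradient in $L^2$. Norms of expressions with several components are maxima over the components: $\|A\|_{\dot H^1}=\max_i\|A_i\|_{\dot H^1}$, and $\|\partial_x^{(k)}u\|_{L^2}$ is the largest $L^2$ norm of a weak derivative of $u$ of order $k$ ($\infty$ if one of them is not in $L^2$). For $\psi=\psi(x,s)$ put $$\|\psi\|_{\mathcal P^{3/4}\mathcal H^2_x(0,1]}=\sum_{k=1}^{2}\Big(\operatorname*{ess\,sup}_{0<s\le1}s^{(k-1)/2}\|\partial_x^{(k-1)}\psi(s)\|_{L^2_x}+\Big(\int_0^1 s^{k}\,\|\partial_x^{(k)}\psi(s)\|_{L^2_x}^2\,\frac{ds}{s}\Big)^{1/2}\Big).$$ Consider the covariant Yang--Mills heat flow in the DeTurck gauge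 $A_s=\partial^\ell A_\ell$, $$\partial_sA_i-\triangle A_i=2[A^\ell,\partial_\ell A_i]-[A^\ell,\partial_iA_\ell]+[A^\ell,[A_\ell,A_i]],\qquad A_i(s=0)=\overline A_i,\qquad(\ast)$$ understood in the sense of distributions. A \emph{solution of $(\ast)$ on $s\in[0,1]$} is an $A=(A_1,A_2,A_3)\in C_s([0,1],\dot H^1_x)$ with $\int_0^1\|\partial_x^{(2)}A(s)\|_{L^2_x}^2\,ds<\infty$ that satisfies $(\ast)$. A function $\psi$ of $x$ and of parameters ranging over a set $S$ (here $t\in I$, or $(t,s)\in I\times[0,1]$) is \emph{regular} if it belongs to $C^k(S,H^m_x)$ for all integers $k,m\ge0$. There is $\delta_P>0$ such that the following hold. (1) There is a constant $C>0$ such that for every $\overline A\in\dot H^1_x$ with $\|\overline A\|_{\dot H^1}\le\delta_P$ there is a unique solution $A$ of $(\ast)$ on $[0,1]$, and $\|\partial_xA\|_{\mathcal P^{3/4}\mathcal H^2_x(0,1]}\le C\|\overline A\|_{\dot H^1}$. (2) There is a positive function $C_{p,q}$, non-decreasing in $p$ and in $q$, such that for the solutions $A,A'$ with data $\overline A,\overline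 A'$ of norm at most $\delta_P$, $$\|\partial_x(A-A')\|_{\mathcal P^{3/4}\mathcal H^2_x(0,1]}\le C_{\|\overline A\|_{\dot H^1},\|\overline A'\|_{\dot H^1}}\,\|\overline A-\overline A'\|_{\dot H^1}.$$ (3) Persistence of regularity and smooth dependence on the initial data: (a) for every integer $m\ge0$, if $\|\overline A\|_{\dot H^1}\le\delta_P$ and $\partial_x\overline A\in H^m_x$, then the solution satisfies $\partial_xA\in C_s([0,1],H^m_x)$; (b) the map $\overline A\mapsto A$ from $\{\|\overline A\|_{\dot H^1}\le\delta_P\}$ to $C_s([0,1],\dot H^1_x)$ is infinitely differentiable; (c) let $I\subset\mathbb R$ be an open interval and $\overline A_i(t)$, $t\in I$, a one-parameter family of data in $\dot H^1_x$ with $\|\overline A(t)\|_{\dot H^1}\le\delta_P$, smooth on $I\times\mathbb R^3$, such that $\partial_t\overline A_i$ and $\partial_j\overline A_i$ are regular on $I\times\mathbb R^3$. Then the solutions $A_i=A_i(t,x,s)$ are smooth on $I\times\mathbb R^3\times[0,1]$, and $\partial_tA_i$ and $\partial_jA_i$ are regular there. -/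

import Mathlib

open MeasureTheory Set
open scoped ContDiff ENNReal

/-- A real Lie algebra with an inner product invariant under the adjoint action
(the Lie algebra of a Lie group with a bi-invariant inner product). -/
class InvariantLieAlgebra (𝔤 : Type*) extends
    NormedAddCommGroup 𝔤, LieRing 𝔤, InnerProductSpace ℝ 𝔤, LieAlgebra ℝ 𝔤 where
  inner_lie : ∀ x y z : 𝔤, Inner.inner ℝ ⁅x, y⁆ z = - Inner.inner ℝ y ⁅x, z⁆

namespace YMHeat

/-- The space `ℝ³`. -/
abbrev E3 : Type := EuclideanSpace ℝ (Fin 3)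

section Spaces

variable {F : Type*} [NormedAddCommGroup F] [NormedSpace ℝ F]

/-- The classical partial derivative `∂_j f`. -/
noncomputable def pd (j : Fin 3) (f : E3 → F) (x : E3) : F :=
  fderiv ℝ f x (EuclideanSpace.single j 1)

/-- The classical Laplacian `∑_ℓ ∂_ℓ ∂_ℓ f`. -/
noncomputable def lap (f : E3 → F) (x : E3) : F :=
  ∑ l : Fin 3, pd l (pd l f) x

/-- Iterated partial derivative `∂_{j₁} ⋯ ∂_{j_k} f` along `J = [j₁, …, j_k]`. -/
noncomputable def iterPd (J : List (Fin 3)) (f : E3 → F) : E3 → F :=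
  J.foldr pd f

/-- `v = ∂_{j₁} ⋯ ∂_{j_k} u` in the sense of distributions, for `J = [j₁, …, j_k]`. -/
def HasWeakDeriv (J : List (Fin 3)) (u v : E3 → F) : Prop :=
  LocallyIntegrable u volume ∧ LocallyIntegrable v volume ∧
    ∀ φ : E3 → ℝ, ContDiff ℝ ∞ φ → HasCompactSupport φ →
      ∫ x, iterPd J φ x • u x = (-1 : ℝ) ^ J.length • ∫ x, φ x • v x

/-- `‖∂_x^{(k)} u‖_{L²_x}` (the largest `L²` norm of the weak derivatives of order `k`),
equal to `∞` when one of these derivatives is not in `L²`. -/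
noncomputable def derivNorm (k : ℕ) (u : E3 → F) : ℝ≥0∞ :=
  ⨆ J : Fin k → Fin 3, ⨅ (v : E3 → F) (_ : HasWeakDeriv (List.ofFn J) u v), eLpNorm v 2 volume

/-- The norm `‖f‖_{𝓛_s^{ℓ,p}(J)} = ‖s^ℓ f(s)‖_{L^p(J, ds/s)}`. -/
noncomputable def pLs (l : ℝ) (p : ℝ≥0∞) (J : Set ℝ) (f : ℝ → ℝ≥0∞) : ℝ≥0∞ :=
  eLpNorm (fun s => ENNReal.ofReal (s ^ l) * f s) p
    ((volume.restrict J).withDensity fun s => ENNReal.ofReal (1 / s))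

/-- The p-normalized norm `‖u‖_{𝓗̇^k_x(s)} = s^{k/2 - 3/4} ‖∂_x^{(k)} u‖_{L²_x}`. -/
noncomputable def pHdot (k : ℕ) (s : ℝ) (u : E3 → F) : ℝ≥0∞ :=
  ENNReal.ofReal (s ^ ((k : ℝ) / 2 - 3 / 4)) * derivNorm k u

/-- The norm `‖ψ‖_{𝓟^ℓ 𝓗^m_x(J)} = ∑_{k=1}^m (‖ψ‖_{𝓛_s^{ℓ,∞} 𝓗̇^{k-1}_x(J)} +
‖ψ‖_{𝓛_s^{ℓ,2} 𝓗̇^k_x(J)})`; the summation index below is `k - 1`. -/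
noncomputable def pNorm (l : ℝ) (m : ℕ) (J : Set ℝ) (ψ : ℝ → E3 → F) : ℝ≥0∞ :=
  ∑ k ∈ Finset.range m,
    (pLs l ∞ J (fun s => pHdot k s (ψ s)) + pLs l 2 J (fun s => pHdot (k + 1) s (ψ s)))

/-- `u ∈ H^m_x`. -/
def MemH (m : ℕ) (u : E3 → F) : Prop :=
  ∀ J : List (Fin 3), J.length ≤ m → ∃ v : E3 → F, MemLp v 2 volume ∧ HasWeakDeriv J u v

/-- `ψ ∈ C^k(S, H^m_x)`: every weak `x`-derivative of order at most `m` is a `C^k` curve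
(or surface) in `L²_x`. -/
def IsCkHm {P : Type*} [NormedAddCommGroup P] [NormedSpace ℝ P]
    (k m : ℕ) (S : Set P) (ψ : P → E3 → F) : Prop :=
  ∀ J : List (Fin 3), J.length ≤ m →
    ∃ Φ : P → Lp F 2 (volume : Measure E3),
      ContDiffOn ℝ k Φ S ∧ ∀ p ∈ S, HasWeakDeriv J (ψ p) (Φ p)

/-- `ψ` is regular on `S × ℝ³`: `ψ ∈ C^k(S, H^m_x)` for all `k` and `m`. -/
def IsRegular {P : Type*} [NormedAddCommGroup P] [NormedSpace ℝ P]
    (S : Set P) (ψ : P → E3 → F) : Prop :=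
  ∀ k m : ℕ, IsCkHm k m S ψ

/-! ### Facts needed to make `Ḣ¹` a normed space -/

theorem contDiff_pd {j : Fin 3} {φ : E3 → ℝ} (h : ContDiff ℝ ∞ φ) : ContDiff ℝ ∞ (pd j φ) := by
  unfold pd
  exact (h.fderiv_right (m := ∞) (by simp)).clm_apply contDiff_const

theorem hasCompactSupport_pd {j : Fin 3} {φ : E3 → ℝ} (h : HasCompactSupport φ) :
    HasCompactSupport (pd j φ) :=
  h.fderiv_apply ℝ _

theorem integrable_test_smul {φ : E3 → ℝ} {u : E3 → F} (hu : LocallyIntegrable u volume)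
    (h : Continuous φ) (hc : HasCompactSupport φ) : Integrable (fun x => φ x • u x) volume :=
  hu.integrable_smul_left_of_hasCompactSupport h hc

theorem hasWeakDeriv_add {j : Fin 3} {u u' v v' : E3 → F} (h : HasWeakDeriv [j] u v)
    (h' : HasWeakDeriv [j] u' v') : HasWeakDeriv [j] (u + u') (v + v') := by
  refine ⟨h.1.add h'.1, h.2.1.add h'.2.1, fun φ hφ hc => ?_⟩
  have e1 := h.2.2 φ hφ hc
  have e2 := h'.2.2 φ hφ hc
  have c1 : Continuous (iterPd [j] φ) := (contDiff_pd hφ).continuous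
  have c2 : HasCompactSupport (iterPd [j] φ) := hasCompactSupport_pd hc
  simp only [Pi.add_apply, smul_add]
  rw [integral_add (integrable_test_smul h.1 c1 c2) (integrable_test_smul h'.1 c1 c2),
    integral_add (integrable_test_smul h.2.1 hφ.continuous hc)
      (integrable_test_smul h'.2.1 hφ.continuous hc), e1, e2, smul_add]

theorem hasWeakDeriv_smul {j : Fin 3} {u v : E3 → F} (c : ℝ) (h : HasWeakDeriv [j] u v) :
    HasWeakDeriv [j] (c • u) (c • v) := by
  refine ⟨h.1.smul c, h.2.1.smul c, fun φ hφ hc => ?_⟩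
  have e1 := h.2.2 φ hφ hc
  simp only [Pi.smul_apply, smul_comm _ c]
  rw [integral_smul, integral_smul, e1, smul_comm]

theorem hasWeakDeriv_congr {J : List (Fin 3)} {u u' v v' : E3 → F} (hu : u =ᵐ[volume] u')
    (hv : v =ᵐ[volume] v') (h : HasWeakDeriv J u v) : HasWeakDeriv J u' v' := by
  refine ⟨h.1.congr hu, h.2.1.congr hv, fun φ hφ hc => ?_⟩
  have e1 : ∫ x, iterPd J φ x • u' x = ∫ x, iterPd J φ x • u x :=
    integral_congr_ae (hu.mono fun x hx => by simp only [hx])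
  have e2 : ∫ x, φ x • v' x = ∫ x, φ x • v x :=
    integral_congr_ae (hv.mono fun x hx => by simp only [hx])
  rw [e1, e2]
  exact h.2.2 φ hφ hc

theorem hasWeakDeriv_zero (j : Fin 3) : HasWeakDeriv [j] (0 : E3 → F) 0 :=
  ⟨locallyIntegrable_zero, locallyIntegrable_zero, fun φ _ _ => by simp⟩

/-- A function in `L⁶` with vanishing weak gradient vanishes. -/
theorem ae_zero_of_grad_zero [FiniteDimensional ℝ F] {u : E3 → F} (hu : MemLp u 6 volume)
    (h : ∀ j : Fin 3, HasWeakDeriv [j] u 0) : u =ᵐ[volume] 0 := by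
  have : CompleteSpace F := FiniteDimensional.complete ℝ F
  have hloc : LocallyIntegrable u volume := (h 0).1
  refine ae_eq_zero_of_integral_contDiff_smul_eq_zero hloc fun φ hφ hc => ?_
  set ψ : E3 → ℝ := fun z => φ (-z) with hψ
  have hψs : ContDiff ℝ ∞ ψ := hφ.comp contDiff_neg
  have hψc : HasCompactSupport ψ := hc.comp_homeomorph (Homeomorph.neg E3)
  set L : F →L[ℝ] ℝ →L[ℝ] F := (ContinuousLinearMap.lsmul ℝ ℝ).flip with hL
  set G : E3 → F := convolution u ψ L volume with hG
  have hGe : ∀ y, G y = ∫ x, φ (x - y) • u x := by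
    intro y
    simp only [hG, convolution, hL, hψ, ContinuousLinearMap.flip_apply,
      ContinuousLinearMap.lsmul_apply, neg_sub]
  have hψ1 : ContDiff ℝ 1 ψ := hψs.of_le (by exact_mod_cast le_top)
  have hder : ∀ y, HasFDerivAt G (0 : E3 →L[ℝ] F) y := by
    intro y
    have hd := hψc.hasFDerivAt_convolution_right L hloc hψ1 y
    suffices hz : (convolution u (fderiv ℝ ψ) (L.precompR E3) volume) y = 0 by
      rw [hz] at hd; exact hd
    have hcomp : ∀ j : Fin 3,
        (convolution u (fderiv ℝ ψ) (L.precompR E3) volume) y (EuclideanSpace.single j 1) = 0 := by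
      intro j
      rw [convolution_precompR_apply L hloc (hψc.fderiv ℝ) (hψ1.continuous_fderiv one_ne_zero)]
      set χ : E3 → ℝ := fun x => ψ (y - x) with hχ
      have hχs : ContDiff ℝ ∞ χ := hψs.comp (contDiff_const.sub contDiff_id)
      have hχc : HasCompactSupport χ := hψc.comp_homeomorph (Homeomorph.subLeft y)
      have key := (h j).2.2 χ hχs hχc
      have hpd : ∀ x, iterPd [j] χ x =
          - (fderiv ℝ ψ (y - x)) (EuclideanSpace.single j 1) := by
        intro x
        have h1 : HasFDerivAt (fun x : E3 => y - x) (-(ContinuousLinearMap.id ℝ E3)) x := by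
          simpa using (hasFDerivAt_id x).const_sub y
        have h2 : HasFDerivAt ψ (fderiv ℝ ψ (y - x)) (y - x) :=
          (hψ1.differentiable one_ne_zero _).hasFDerivAt
        have h3 := h2.comp x h1
        have h4 : fderiv ℝ χ x = (fderiv ℝ ψ (y - x)).comp (-(ContinuousLinearMap.id ℝ E3)) :=
          h3.fderiv
        simp [iterPd, pd, h4]
      simp only [hpd, Pi.zero_apply, smul_zero, integral_zero, neg_smul, integral_neg,
        neg_eq_zero] at key
      simpa [convolution, hL] using key
    ext v
    have hv : v = ∑ j : Fin 3, v j • EuclideanSpace.single j (1 : ℝ) := by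
      ext i
      simp [Finset.sum_apply, Pi.single_apply]
    rw [hv, map_sum]
    simp only [map_smul, hcomp, smul_zero, Finset.sum_const_zero, zero_apply]
  have hconst : ∀ y, G y = G 0 := fun y =>
    is_const_of_fderiv_eq_zero (fun y => (hder y).differentiableAt)
      (fun y => (hder y).fderiv) y 0
  have h6 : Integrable (fun x => ‖u x‖ ^ 6) volume := by
    simpa using hu.integrable_norm_pow (by norm_num)
  obtain ⟨M, hM⟩ := hc.exists_bound_of_continuous hφ.continuous
  have hφi : Integrable φ volume := hφ.continuous.integrable_of_hasCompactSupport hc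
  have hbd : ∀ ε : ℝ, 0 < ε → ‖G 0‖ ≤ ε * ∫ x, |φ x| := by
    intro ε hε
    set y : ℕ → E3 := fun n => (n : ℝ) • EuclideanSpace.single (0 : Fin 3) (1 : ℝ) with hy
    have hyn : ∀ n, ‖y n‖ = n := fun n => by simp [hy, norm_smul]
    have hlim : Filter.Tendsto (fun n => ∫ x, |φ (x - y n)| * ‖u x‖ ^ 6) Filter.atTop
        (nhds (∫ _ : E3, (0 : ℝ))) := by
      refine tendsto_integral_of_dominated_convergence (fun x => M * ‖u x‖ ^ 6) ?_
        (h6.const_mul M) ?_ ?_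
      · intro n
        exact ((hφ.continuous.comp (continuous_id.sub continuous_const)).abs.aestronglyMeasurable).mul
          h6.aestronglyMeasurable
      · intro n
        refine Filter.Eventually.of_forall fun x => ?_
        rw [norm_mul, Real.norm_eq_abs, abs_abs, norm_pow, norm_norm]
        exact mul_le_mul_of_nonneg_right (hM _) (by positivity)
      · refine Filter.Eventually.of_forall fun x => ?_
        refine tendsto_const_nhds.congr' ?_
        obtain ⟨R, hR⟩ := hc.isCompact.isBounded.exists_norm_le
        filter_upwards [Filter.eventually_gt_atTop (Nat.ceil (R + ‖x‖))] with n hn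
        have hn' : R + ‖x‖ < n := lt_of_le_of_lt (Nat.le_ceil _) (by exact_mod_cast hn)
        have : φ (x - y n) = 0 := by
          by_contra hne
          have h1 := hR _ (subset_tsupport _ hne)
          have h2 : ‖y n‖ ≤ ‖x - y n‖ + ‖x‖ := by
            have := norm_sub_norm_le (y n) x
            rw [norm_sub_rev] at this
            linarith
          rw [hyn] at h2
          linarith
        simp [this]
    have hn : ∀ n, ‖G 0‖ ≤ ε * (∫ x, |φ x|) + (ε ^ 5)⁻¹ * ∫ x, |φ (x - y n)| * ‖u x‖ ^ 6 := by
      intro n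
      have i1 : Integrable (fun x => |φ (x - y n)|) volume := (hφi.comp_sub_right (y n)).abs
      have i2 : Integrable (fun x => |φ (x - y n)| * ‖u x‖ ^ 6) volume := by
        refine (h6.const_mul M).mono' (i1.aestronglyMeasurable.mul h6.aestronglyMeasurable) ?_
        refine Filter.Eventually.of_forall fun x => ?_
        rw [norm_mul, Real.norm_eq_abs, abs_abs, norm_pow, norm_norm]
        exact mul_le_mul_of_nonneg_right (hM _) (by positivity)
      rw [← hconst (y n), hGe]
      have hsh : ∫ x, |φ (x - y n)| = ∫ x, |φ x| :=
        integral_sub_right_eq_self (fun x => |φ x|) (y n)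
      rw [← hsh, ← integral_const_mul, ← integral_const_mul,
        ← integral_add (i1.const_mul _) (i2.const_mul _)]
      refine norm_integral_le_of_norm_le ((i1.const_mul _).add (i2.const_mul _))
        (Filter.Eventually.of_forall fun x => ?_)
      have ha : ‖u x‖ ≤ ε + (ε ^ 5)⁻¹ * ‖u x‖ ^ 6 := by
        rcases le_total ‖u x‖ ε with hle | hle
        · have : 0 ≤ (ε ^ 5)⁻¹ * ‖u x‖ ^ 6 := by positivity
          linarith
        · have h5 : ε ^ 5 ≤ ‖u x‖ ^ 5 := pow_le_pow_left₀ hε.le hle 5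
          have : ‖u x‖ ≤ (ε ^ 5)⁻¹ * ‖u x‖ ^ 6 := by
            rw [inv_mul_eq_div, le_div_iff₀ (by positivity)]
            calc ‖u x‖ * ε ^ 5 ≤ ‖u x‖ * ‖u x‖ ^ 5 :=
                  mul_le_mul_of_nonneg_left h5 (norm_nonneg _)
              _ = ‖u x‖ ^ 6 := by ring
          linarith
      rw [norm_smul, Real.norm_eq_abs]
      calc |φ (x - y n)| * ‖u x‖ ≤ |φ (x - y n)| * (ε + (ε ^ 5)⁻¹ * ‖u x‖ ^ 6) :=
            mul_le_mul_of_nonneg_left ha (abs_nonneg _)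
        _ = _ := by ring
    have hl2 : Filter.Tendsto
        (fun n => ε * (∫ x, |φ x|) + (ε ^ 5)⁻¹ * ∫ x, |φ (x - y n)| * ‖u x‖ ^ 6)
        Filter.atTop (nhds (ε * (∫ x, |φ x|) + (ε ^ 5)⁻¹ * 0)) := by
      refine tendsto_const_nhds.add (Filter.Tendsto.const_mul _ ?_)
      simpa using hlim
    simpa using ge_of_tendsto' hl2 hn
  have hG0 : ‖G 0‖ ≤ 0 := by
    have hl : Filter.Tendsto (fun ε : ℝ => ε * ∫ x, |φ x|) (nhdsWithin 0 (Ioi 0)) (nhds 0) := by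
      have : Filter.Tendsto (fun ε : ℝ => ε * ∫ x, |φ x|) (nhds 0) (nhds (0 * ∫ x, |φ x|)) :=
        Filter.tendsto_id.mul_const _
      rw [zero_mul] at this
      exact this.mono_left nhdsWithin_le_nhds
    exact ge_of_tendsto hl (eventually_mem_nhdsWithin.mono fun ε hε => hbd ε hε)
  have := norm_le_zero_iff.mp hG0
  rw [hGe] at this
  simpa using this

end Spaces

/-! ### The space `Ḣ¹_x` -/

section HDot

variable (F : Type*) [NormedAddCommGroup F] [NormedSpace ℝ F]

/-- The pairs `(u, (∂_j u)_j)` with `u ∈ L⁶` and weak gradient in `L²`. -/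
noncomputable def hdotGraph :
    Submodule ℝ (Lp F 6 (volume : Measure E3) × (Fin 3 → Lp F 2 (volume : Measure E3))) where
  carrier := {p | ∀ j : Fin 3, HasWeakDeriv [j] p.1 (p.2 j)}
  zero_mem' := fun j => hasWeakDeriv_congr (Lp.coeFn_zero F 6 volume).symm
    (Lp.coeFn_zero F 2 volume).symm (hasWeakDeriv_zero j)
  add_mem' := fun {p q} hp hq j => hasWeakDeriv_congr (Lp.coeFn_add p.1 q.1).symm
    (Lp.coeFn_add (p.2 j) (q.2 j)).symm (hasWeakDeriv_add (hp j) (hq j))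
  smul_mem' := fun c p hp j => hasWeakDeriv_congr (Lp.coeFn_smul c p.1).symm
    (Lp.coeFn_smul c (p.2 j)).symm (hasWeakDeriv_smul c (hp j))

/-- The homogeneous Sobolev space `Ḣ¹_x` of `F`-valued functions on `ℝ³`, the completion of the
Schwartz functions under `‖∂_x u‖_{L²}`, realized (through the Sobolev inequality) as the space of
`u ∈ L⁶` with weak gradient in `L²`. -/
def HDot1 : Type _ := hdotGraph F

noncomputable instance : AddCommGroup (HDot1 F) := inferInstanceAs (AddCommGroup (hdotGraph F))

noncomputable instance : Module ℝ (HDot1 F) := inferInstanceAs (Module ℝ (hdotGraph F))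

variable {F}

/-- The function underlying an element of `Ḣ¹_x` (defined almost everywhere). -/
noncomputable def HDot1.fn (u : HDot1 F) : E3 → F := u.1.1

variable (F) in
/-- The gradient `u ↦ (∂_1 u, ∂_2 u, ∂_3 u)`. -/
noncomputable def HDot1.grad : HDot1 F →ₗ[ℝ] (Fin 3 → Lp F 2 (volume : Measure E3)) :=
  (LinearMap.snd ℝ _ _).comp (hdotGraph F).subtype

theorem HDot1.grad_injective [FiniteDimensional ℝ F] : Function.Injective (HDot1.grad F) := by
  rw [← LinearMap.ker_eq_bot, LinearMap.ker_eq_bot']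
  intro u hu
  have hu' : u.1.2 = 0 := hu
  have h0 : (u.1.1 : E3 → F) =ᵐ[volume] 0 := by
    refine ae_zero_of_grad_zero (Lp.memLp u.1.1) fun j => ?_
    refine hasWeakDeriv_congr Filter.EventuallyEq.rfl ?_ (u.2 j)
    rw [hu']
    exact Lp.coeFn_zero F 2 volume
  refine Subtype.ext (Prod.ext ?_ hu')
  exact (Lp.eq_zero_iff_ae_eq_zero).2 h0

variable [FiniteDimensional ℝ F]

/-- `‖u‖_{Ḣ¹} = max_j ‖∂_j u‖_{L²}`. -/
noncomputable instance : NormedAddCommGroup (HDot1 F) :=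
  NormedAddCommGroup.induced (HDot1 F) _ (HDot1.grad F) HDot1.grad_injective

noncomputable instance : NormedSpace ℝ (HDot1 F) :=
  NormedSpace.induced ℝ (HDot1 F) _ (HDot1.grad F)

end HDot

/-! ### The flow -/

section Evolution

variable {𝔤 : Type*} [InvariantLieAlgebra 𝔤] [FiniteDimensional ℝ 𝔤]

variable (𝔤) in
/-- Spatial connection 1-forms `A = (A_1, A_2, A_3)` with components in `Ḣ¹_x`; the norm is
`‖A‖_{Ḣ¹} = max_i ‖A_i‖_{Ḣ¹}`. -/
abbrev Conn : Type _ := Fin 3 → HDot1 𝔤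

variable (𝔤) in
/-- Curves `s ↦ A(s)` in `C_s([0,1], Ḣ¹_x)`. -/
abbrev ConnFlow : Type _ := C(unitInterval, Conn 𝔤)

/-- The component `A_i(s)` of a curve at `s ∈ [0,1]` (constant continuation outside `[0,1]`). -/
noncomputable def ConnFlow.slice (A : ConnFlow 𝔤) (i : Fin 3) (s : ℝ) : HDot1 𝔤 :=
  Set.IccExtend zero_le_one A s i

/-- The nonlinearity
`2 [A^ℓ, ∂_ℓ A_i] - [A^ℓ, ∂_i A_ℓ] + [A^ℓ, [A_ℓ, A_i]]`, summed over `ℓ`. -/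
noncomputable def nonlin (A : Conn 𝔤) (i : Fin 3) (x : E3) : 𝔤 :=
  ∑ l : Fin 3, ((2 : ℝ) • ⁅(A l).fn x, HDot1.grad 𝔤 (A i) l x⁆
    - ⁅(A l).fn x, HDot1.grad 𝔤 (A l) i x⁆
    + ⁅(A l).fn x, ⁅(A l).fn x, (A i).fn x⁆⁆)

/-- `A ∈ C_s([0,1], Ḣ¹_x) ∩ L²_s((0,1], Ḣ²_x)` solves, in the sense of distributions in `x` and
integrated in `s`, the covariant Yang–Mills heat flow in the DeTurck gauge
`∂_s A_i - Δ A_i = 2 [A^ℓ, ∂_ℓ A_i] - [A^ℓ, ∂_i A_ℓ] + [A^ℓ, [A_ℓ, A_i]]`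
on `s ∈ [0,1]`, with initial data `A(s = 0) = a`. -/
structure IsDeTurckSolution (a : Conn 𝔤) (A : ConnFlow 𝔤) : Prop where
  initial : A 0 = a
  l2_hdot2 : ∀ i, ∫⁻ s in Ioc (0 : ℝ) 1, derivNorm 2 (A.slice i s).fn ^ 2 < ⊤
  equation : ∀ (i : Fin 3) (φ : E3 → ℝ), ContDiff ℝ ∞ φ → HasCompactSupport φ →
    ∀ s ∈ Icc (0 : ℝ) 1,
      (∫ x, φ x • (A.slice i s).fn x) - ∫ x, φ x • (a i).fn x =
        ∫ r in (0 : ℝ)..s, ((∫ x, lap φ x • (A.slice i r).fn x) +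
          ∫ x, φ x • nonlin (fun k => A.slice k r) i x)

/-- `‖∂_x A‖_{𝓟^{3/4} 𝓗²_x(0,1]}`, the maximum over the components `∂_j A_i`. -/
noncomputable def gradPNorm (A : ConnFlow 𝔤) : ℝ≥0∞ :=
  ⨆ (i : Fin 3) (j : Fin 3), pNorm (3 / 4) 2 (Ioc 0 1) fun s => HDot1.grad 𝔤 (A.slice i s) j

/-- `a(t)`, `t ∈ I`, is a one parameter family of data in `Ḣ¹_x` which is smooth on `I × ℝ³` and
such that `∂_{t,x} a_i` is regular on `I × ℝ³`. -/
def IsRegularDataFamily (I : Set ℝ) (a : ℝ → Conn 𝔤) : Prop :=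
  ∃ b : Fin 3 → ℝ × E3 → 𝔤, ∀ i : Fin 3,
    ContDiffOn ℝ ∞ (b i) (I ×ˢ univ) ∧
    (∀ t ∈ I, (a t i).fn =ᵐ[volume] fun x => b i (t, x)) ∧
    IsRegular I (fun t x => deriv (fun t' => b i (t', x)) t) ∧
    ∀ j : Fin 3, IsRegular I (fun t => pd j fun x => b i (t, x))

/-- The family of curves `A(t)`, `t ∈ I`, is smooth on `I × ℝ³ × [0,1]` and `∂_{t,x} A_i` is
regular on `I × ℝ³ × [0,1]`. -/
def IsRegularFlowFamily (I : Set ℝ) (A : ℝ → ConnFlow 𝔤) : Prop :=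
  ∃ B : Fin 3 → ℝ × E3 × ℝ → 𝔤, ∀ i : Fin 3,
    ContDiffOn ℝ ∞ (B i) (I ×ˢ univ ×ˢ Icc 0 1) ∧
    (∀ t ∈ I, ∀ s ∈ Icc (0 : ℝ) 1, ((A t).slice i s).fn =ᵐ[volume] fun x => B i (t, x, s)) ∧
    IsRegular (I ×ˢ Icc (0 : ℝ) 1)
      (fun (p : ℝ × ℝ) x => deriv (fun t' => B i (t', x, p.2)) p.1) ∧
    ∀ j : Fin 3, IsRegular (I ×ˢ Icc (0 : ℝ) 1)
      (fun p : ℝ × ℝ => pd j fun x => B i (p.1, x, p.2))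

end Evolution

end YMHeat

open YMHeat

/-! The problem is subcritical in `Ḣ¹`. Since `Ḣ¹ ⊂ L⁶`, the quadratic terms lie in `L^{3/2}` and
the cubic term in `L²`, and the heat operator `e^{λ²Δ}` maps both into `Ḣ¹` with norm `O(λ^{-3/2})`
for `λ ≤ 1`. With `λ = √(s - r)` the Duhamel kernel has size `(s - r)^{-3/4}`, which is integrable,
so `A = e^{sΔ} a + ∫ e^{(s-r)Δ} N(A(r)) dr` is an equation in the single Banach space `C([0,1],
Ḣ¹)`. As `N` is smooth and vanishes to second order at `0`, the inverse function theorem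
(`exists_smooth_solution`) gives small solutions depending smoothly on `a`.

Uniqueness needs no smallness of the competitor. A distributional solution is mild (`IsWeak.isMild`,
from uniqueness for the weak linear heat equation), and two mild solutions with the same data agree
by a Volterra inequality (`IsMild.unique`).

The parabolic estimates come from a translation trick. Put `(trC h A)(s) = A(s)(· + √s h)`. Because
`√s = c √(s - r) + √r` with `c ∈ [0, 1]`, the curve `trC h A` solves the same integral equation with
the heat kernels recentred (`trC_duh`, `trC_mild`). The vector `h` is therefore one more parameter
of the inverse function theorem (`exists_solution_map`), and differentiating at `h = 0` bounds `√s
∂` and `s ∂²` in `Ḣ¹`. This controls suprema but just misses the square integrals in `ds / s`. Hence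
`A` is split: the Duhamel part carries a spare factor `s^{1/8}`, which makes its square integrals
finite, and the free part `e^{sΔ} a` obeys energy identities (`heatG1_integral`, `heatG2_integral`).
The two are put together in `HeatSplit.pNorm_le`; Lipschitz dependence on `a` gives the difference
estimate, and comparison with `a = 0` the a priori bound.

By uniqueness the solution map commutes with translations. Membership of `∂ a` in `H^m` says that
translates of `a` form a `C^m` family, and the smooth solution map transports this to `A`
(`persistence`). For a regular family `a(t)`, the function `(x, t) ↦ S(τ_x a(t))` is smooth into
`C([0,1], Ḣ¹)`. Its derivatives in `x` are spatial derivatives, so the weak equation becomes an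
ordinary differential equation in `s` whose right side is as regular as the unknown; iteration gives
all derivatives in `s` (`HeatPair.treg_succ`). A continuous linear point evaluation in terms of `u`
and `Δ u` produces the smooth representative (`coeFn_eq_evZ`). Since `∂_t A` must lie in `L²` and
not only in `Ḣ¹`, the linearized equation is also solved in `L²` and the two solutions are
identified (`exists_time_flow`). The conclusion is `regular_family`. -/

namespace YMHeat

open Filter Topology
open scoped unitInterval SchwartzMap LineDeriv
open LineDeriv

set_option linter.unusedSectionVars false

/-! ### Smoothness criteria and superposition operators on spaces of continuous curves -/

section Smoothness

variable {E V X Y Z : Type*} [NormedAddCommGroup E] [NormedSpace ℝ E] [NormedAddCommGroup V]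
  [NormedSpace ℝ V] [NormedAddCommGroup X] [NormedSpace ℝ X] [NormedAddCommGroup Y]
  [NormedSpace ℝ Y] [NormedAddCommGroup Z] [NormedSpace ℝ Z]

/-- A family of functions closed under taking partial derivatives consists of smooth functions. -/
theorem contDiffOn_of_closed_family {r : ℕ} {S : Set E} (hS : UniqueDiffOn ℝ S)
    (l : Fin r → E →L[ℝ] ℝ) (𝓕 : Set (E → V))
    (h : ∀ f ∈ 𝓕, ∃ g : Fin r → E → V, (∀ m, g m ∈ 𝓕) ∧
      ∀ x ∈ S, HasFDerivWithinAt f (∑ m, (l m).smulRight (g m x)) S x)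
    {f : E → V} (hf : f ∈ 𝓕) : ContDiffOn ℝ ∞ f S := by
  rw [contDiffOn_infty]
  intro n
  induction n generalizing f with
  | zero =>
    obtain ⟨g, -, hg⟩ := h f hf
    exact contDiffOn_zero.2 fun x hx => (hg x hx).continuousWithinAt
  | succ n ih =>
    obtain ⟨g, hgm, hg⟩ := h f hf
    have e : ((n + 1 : ℕ) : WithTop ℕ∞) = (n : WithTop ℕ∞) + 1 := by push_cast; rfl
    rw [e, contDiffOn_succ_iff_fderivWithin hS]
    refine ⟨fun x hx => (hg x hx).differentiableWithinAt, by simp, ?_⟩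
    have : ContDiffOn ℝ n (fun x => ∑ m, (l m).smulRight (g m x)) S := by
      refine ContDiffOn.sum fun m _ => ?_
      exact ((ContinuousLinearMap.smulRightL ℝ E V (l m)).contDiff).comp_contDiffOn (ih (hgm m))
    exact this.congr fun x hx => (hg x hx).fderivWithin (hS x hx)

variable {K : Type*} [TopologicalSpace K] [CompactSpace K]

/-- The continuous bilinear map on spaces of continuous functions induced by a continuous
bilinear map. -/
noncomputable def bilinC (K : Type*) [TopologicalSpace K] [CompactSpace K]
    (B : X →L[ℝ] Y →L[ℝ] Z) : C(K, X) →L[ℝ] C(K, Y) →L[ℝ] C(K, Z) :=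
  LinearMap.mkContinuous₂
    (LinearMap.mk₂ ℝ (fun (f : C(K, X)) (g : C(K, Y)) =>
      (⟨fun c => B (f c) (g c), by fun_prop⟩ : C(K, Z)))
      (fun _ _ _ => by ext; simp) (fun _ _ _ => by ext; simp)
      (fun _ _ _ => by ext; simp) (fun _ _ _ => by ext; simp)) ‖B‖ (fun f g => by
      refine (ContinuousMap.norm_le _ (by positivity)).2 fun c => ?_
      calc ‖B (f c) (g c)‖ ≤ ‖B‖ * ‖f c‖ * ‖g c‖ := B.le_opNorm₂ _ _
        _ ≤ ‖B‖ * ‖f‖ * ‖g‖ := by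
          gcongr
          · exact f.norm_coe_le_norm c
          · exact g.norm_coe_le_norm c)

/-- Superposition operators are continuously differentiable. -/
theorem hasFDerivAt_postcomp {β : X → Y} (hβ : ContDiff ℝ 1 β) (f : C(K, X)) :
    HasFDerivAt (fun f : C(K, X) => (⟨β, hβ.continuous⟩ : C(X, Y)).comp f)
      (bilinC K (ContinuousLinearMap.id ℝ (X →L[ℝ] Y))
        ((⟨fderiv ℝ β, hβ.continuous_fderiv one_ne_zero⟩ : C(X, X →L[ℝ] Y)).comp f)) f := by
  rw [hasFDerivAt_iff_isLittleO_nhds_zero, Asymptotics.isLittleO_iff]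
  intro ε hε
  have hcont : Continuous (fderiv ℝ β) := hβ.continuous_fderiv one_ne_zero
  have hK : IsCompact (Set.range f) := isCompact_range f.continuous
  have h1 := hK.uniformContinuousAt_of_continuousAt (fderiv ℝ β)
    (fun a _ => hcont.continuousAt) (Metric.dist_mem_uniformity hε)
  obtain ⟨δ, hδ, h2⟩ := Metric.mem_uniformity_dist.1 h1
  filter_upwards [Metric.ball_mem_nhds (0 : C(K, X)) hδ] with g hg
  rw [mem_ball_zero_iff] at hg
  refine (ContinuousMap.norm_le _ (by positivity)).2 fun c => ?_
  have hgc : ‖g c‖ < δ := (g.norm_coe_le_norm c).trans_lt hg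
  have h3 := (convex_ball (f c) δ).norm_image_sub_le_of_norm_fderiv_le' (𝕜 := ℝ) (f := β)
    (φ := fderiv ℝ β (f c)) (C := ε) (x := f c) (y := f c + g c)
    (fun x _ => hβ.differentiable one_ne_zero x)
    (fun x hx => by
      have := h2 (a := f c) (b := x) (by rw [dist_comm]; exact hx) ⟨c, rfl⟩
      rw [← dist_eq_norm, dist_comm]
      exact le_of_lt this)
    (Metric.mem_ball_self hδ) (by simpa [Metric.mem_ball, dist_eq_norm] using hgc)
  rw [add_sub_cancel_left] at h3
  calc _ ≤ ε * ‖g c‖ := h3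
    _ ≤ ε * ‖g‖ := by gcongr; exact g.norm_coe_le_norm c

/-- Superposition operators with smooth functions are smooth. -/
theorem contDiff_postcomp.{u} {X Y : Type u} [NormedAddCommGroup X] [NormedSpace ℝ X]
    [NormedAddCommGroup Y] [NormedSpace ℝ Y] {β : X → Y} (hβ : ContDiff ℝ ∞ β) :
    ContDiff ℝ ∞ (fun f : C(K, X) => (⟨β, hβ.continuous⟩ : C(X, Y)).comp f) := by
  rw [contDiff_infty]
  intro n
  induction n generalizing Y with
  | zero =>
    exact contDiff_zero.2 (ContinuousMap.continuous_postcomp _)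
  | succ n ih =>
    have e : ((n + 1 : ℕ) : WithTop ℕ∞) = (n : WithTop ℕ∞) + 1 := by push_cast; rfl
    have hd := fun f => hasFDerivAt_postcomp (K := K) (hβ.of_le (by exact_mod_cast le_top)) f
    rw [e, contDiff_succ_iff_fderiv]
    refine ⟨fun f => (hd f).differentiableAt, by simp, ?_⟩
    rw [show fderiv ℝ _ = _ from funext fun f => (hd f).fderiv]
    exact (ContinuousLinearMap.contDiff _).comp (ih (hβ.fderiv_right (m := ∞) (by simp)))

end Smoothness

/-! ### The rescaled Duhamel operator for kernels of size `λ^{-3/2}` -/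

section Duhamel

variable {B W Z : Type*} [NormedAddCommGroup B] [NormedSpace ℝ B] [NormedAddCommGroup W]
  [NormedSpace ℝ W] [NormedAddCommGroup Z] [NormedSpace ℝ Z]

/-- A family of bilinear operators `Q_λ : B × W → Z`, `λ ∈ (0, 1]`, of size `λ^{-3/2}`. -/
structure SmoothingFamily (B W Z : Type*) [NormedAddCommGroup B] [NormedSpace ℝ B]
    [NormedAddCommGroup W] [NormedSpace ℝ W] [NormedAddCommGroup Z] [NormedSpace ℝ Z] where
  op : ℝ → B →L[ℝ] W →L[ℝ] Z
  const : ℝ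
  const_nonneg : 0 ≤ const
  bound : ∀ l ∈ Ioc (0 : ℝ) 1, ∀ b w, ‖op l b w‖ ≤ const * l ^ (-(3 / 2) : ℝ) * ‖b‖ * ‖w‖
  cont : ∀ b w, ContinuousOn (fun l => op l b w) (Ioc 0 1)

theorem SmoothingFamily.norm_op_le (Q : SmoothingFamily B W Z) {l : ℝ} (hl : l ∈ Ioc (0 : ℝ) 1) :
    ‖Q.op l‖ ≤ Q.const * l ^ (-(3 / 2) : ℝ) := by
  have h0 : 0 ≤ Q.const * l ^ (-(3 / 2) : ℝ) :=
    mul_nonneg Q.const_nonneg (Real.rpow_nonneg hl.1.le _)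
  exact ContinuousLinearMap.opNorm_le_bound₂ _ h0 fun b w => Q.bound l hl b w

/-- Strong continuity in `λ` upgrades to joint continuity because the operator norms are bounded
uniformly near each `λ > 0`. -/
theorem SmoothingFamily.continuousOn (Q : SmoothingFamily B W Z) :
    ContinuousOn (fun p : ℝ × B × W => Q.op p.1 p.2.1 p.2.2) (Ioc 0 1 ×ˢ univ) := by
  rintro ⟨l, b, w⟩ ⟨hl, -⟩
  simp only at hl
  have hbig : ∀ᶠ p : ℝ × B × W in 𝓝[Ioc 0 1 ×ˢ univ] (l, b, w),
      ‖Q.op p.1‖ ≤ Q.const * (l / 2) ^ (-(3 / 2) : ℝ) := by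
    have h1 : ∀ᶠ p : ℝ × B × W in 𝓝[Ioc 0 1 ×ˢ univ] (l, b, w), l / 2 < p.1 :=
      (continuous_fst.continuousAt.eventually (lt_mem_nhds (by linarith [hl.1]))).filter_mono
        nhdsWithin_le_nhds
    filter_upwards [h1, self_mem_nhdsWithin] with p hp hp2
    refine (Q.norm_op_le hp2.1).trans ?_
    refine mul_le_mul_of_nonneg_left ?_ Q.const_nonneg
    exact Real.rpow_le_rpow_of_nonpos (by linarith [hl.1]) hp.le (by norm_num)
  set M := Q.const * (l / 2) ^ (-(3 / 2) : ℝ)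
  rw [ContinuousWithinAt, tendsto_iff_norm_sub_tendsto_zero]
  have hlim : Tendsto (fun p : ℝ × B × W => M * ‖p.2.1‖ * ‖p.2.2 - w‖ + M * ‖p.2.1 - b‖ * ‖w‖ +
      ‖Q.op p.1 b w - Q.op l b w‖) (𝓝[Ioc 0 1 ×ˢ univ] (l, b, w)) (𝓝 0) := by
    have e1 : Tendsto (fun p : ℝ × B × W => M * ‖p.2.1‖ * ‖p.2.2 - w‖ + M * ‖p.2.1 - b‖ * ‖w‖)
        (𝓝 (l, b, w)) (𝓝 (M * ‖b‖ * ‖w - w‖ + M * ‖b - b‖ * ‖w‖)) := by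
      apply Continuous.tendsto' (by fun_prop) _ _ rfl
    simp only [sub_self, norm_zero, mul_zero, zero_mul, add_zero] at e1
    have e2 : Tendsto (fun p : ℝ × B × W => ‖Q.op p.1 b w - Q.op l b w‖)
        (𝓝[Ioc 0 1 ×ˢ univ] (l, b, w)) (𝓝 0) := by
      rw [← tendsto_iff_norm_sub_tendsto_zero]
      have := (Q.cont b w) l hl
      refine Tendsto.comp this (tendsto_nhdsWithin_iff.2 ⟨?_, ?_⟩)
      · exact (continuous_fst.tendsto _).mono_left nhdsWithin_le_nhds
      · filter_upwards [self_mem_nhdsWithin] with p hp using hp.1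
    simpa using (e1.mono_left nhdsWithin_le_nhds).add e2
  refine squeeze_zero' (Eventually.of_forall fun _ => norm_nonneg _) ?_ hlim
  filter_upwards [hbig] with p hp
  have key : Q.op p.1 p.2.1 p.2.2 - Q.op l b w = Q.op p.1 p.2.1 (p.2.2 - w)
      + Q.op p.1 (p.2.1 - b) w + (Q.op p.1 b w - Q.op l b w) := by
    simp only [map_sub, sub_apply]
    abel
  rw [key]
  have o : ∀ b' w', ‖Q.op p.1 b' w'‖ ≤ M * ‖b'‖ * ‖w'‖ := fun b' w' =>
    ((Q.op p.1).le_opNorm₂ b' w').trans (by gcongr)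
  exact (norm_add_le _ _).trans (by gcongr; exact (norm_add_le _ _).trans (add_le_add (o _ _) (o _ _)))

/-- The ratio `(√s - √r) / √(s - r)` for `r = ρ s`. -/
noncomputable def cpar (ρ : ℝ) : I :=
  projIcc 0 1 zero_le_one ((1 - √ρ) / √(1 - ρ))

theorem cpar_continuousOn : ContinuousOn cpar (Ioo 0 1) := by
  refine continuous_projIcc.comp_continuousOn (ContinuousOn.div (by fun_prop) (by fun_prop) ?_)
  intro x hx
  exact (Real.sqrt_pos.2 (by linarith [hx.2])).ne'

/-- For `0 < ρ < 1` the quotient already lies in `[0, 1]`, since `(1 - √ρ)² ≤ 1 - ρ`, so the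
projection in `cpar` does nothing. -/
theorem coe_cpar {ρ : ℝ} (h : ρ ∈ Ioo (0 : ℝ) 1) : (cpar ρ : ℝ) * √(1 - ρ) = 1 - √ρ := by
  have h1 : 0 < √(1 - ρ) := Real.sqrt_pos.2 (by linarith [h.2])
  have h2 : √ρ ≤ 1 := Real.sqrt_le_one.2 h.2.le
  have h3 : (1 - √ρ) / √(1 - ρ) ∈ Icc (0 : ℝ) 1 := by
    refine ⟨div_nonneg (by linarith) h1.le, (div_le_one h1).2 ?_⟩
    refine Real.le_sqrt_of_sq_le ?_
    nlinarith [Real.sq_sqrt h.1.le, Real.sqrt_nonneg ρ]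
  rw [cpar, projIcc_of_mem _ h3]
  field_simp

/-- The integrand of the rescaled Duhamel operator. -/
noncomputable def duhInt (Q : SmoothingFamily B W Z) (b : C(I, B)) (F : C(I, W)) (s ρ : ℝ) : Z :=
  s ^ (7 / 8 : ℝ) • Q.op √(s * (1 - ρ)) (b (cpar ρ)) (F (projIcc 0 1 zero_le_one (s * ρ)))

theorem sqrt_mem_Ioc {s ρ : ℝ} (hs : s ∈ Ioc (0 : ℝ) 1) (hρ : ρ ∈ Ioo (0 : ℝ) 1) :
    √(s * (1 - ρ)) ∈ Ioc (0 : ℝ) 1 := by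
  have : 0 < 1 - ρ := by linarith [hρ.2]
  refine ⟨Real.sqrt_pos.2 (mul_pos hs.1 this), Real.sqrt_le_one.2 ?_⟩
  nlinarith [hs.1, hs.2, hρ.1]

theorem sqrt_rpow_three_halves {x : ℝ} (hx : 0 ≤ x) :
    √x ^ (-(3 / 2) : ℝ) = x ^ (-(3 / 4) : ℝ) := by
  rw [Real.sqrt_eq_rpow, ← Real.rpow_mul hx]
  norm_num

/-- With `λ = √(s (1 - ρ))` one has `λ^{-3/2} = (s (1 - ρ))^{-3/4}`, and the prefactor `s^{7/8}`
leaves the positive power `s^{1/8}`. The value of `F` is kept inside the bound because the Volterra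
argument needs it pointwise. -/
theorem norm_duhInt_le' (Q : SmoothingFamily B W Z) (b : C(I, B)) (F : C(I, W)) {s ρ : ℝ}
    (hs : s ∈ Ioc (0 : ℝ) 1) (hρ : ρ ∈ Ioo (0 : ℝ) 1) :
    ‖duhInt Q b F s ρ‖ ≤ s ^ (1 / 8 : ℝ) * (1 - ρ) ^ (-(3 / 4) : ℝ) *
      (Q.const * ‖b‖ * ‖F (projIcc 0 1 zero_le_one (s * ρ))‖) := by
  have h1 : 0 < 1 - ρ := by linarith [hρ.2]
  have h2 := Q.bound _ (sqrt_mem_Ioc hs hρ) (b (cpar ρ)) (F (projIcc 0 1 zero_le_one (s * ρ)))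
  rw [sqrt_rpow_three_halves (mul_nonneg hs.1.le h1.le), Real.mul_rpow hs.1.le h1.le] at h2
  rw [duhInt, norm_smul, Real.norm_of_nonneg (Real.rpow_nonneg hs.1.le _)]
  have h3 : s ^ (7 / 8 : ℝ) * s ^ (-(3 / 4) : ℝ) = s ^ (1 / 8 : ℝ) := by
    rw [← Real.rpow_add hs.1]; norm_num
  have h4 := b.norm_coe_le_norm (cpar ρ)
  have h5 := Q.const_nonneg
  have h6 : 0 ≤ s ^ (-(3 / 4) : ℝ) := Real.rpow_nonneg hs.1.le _
  have h7 : 0 ≤ (1 - ρ) ^ (-(3 / 4) : ℝ) := Real.rpow_nonneg h1.le _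
  calc _ ≤ s ^ (7 / 8 : ℝ) * (Q.const * (s ^ (-(3 / 4) : ℝ) * (1 - ρ) ^ (-(3 / 4) : ℝ)) *
        ‖b‖ * ‖F (projIcc 0 1 zero_le_one (s * ρ))‖) := by
        refine mul_le_mul_of_nonneg_left (h2.trans ?_) (Real.rpow_nonneg hs.1.le _)
        gcongr
    _ = _ := by rw [← h3]; ring

theorem norm_duhInt_le (Q : SmoothingFamily B W Z) (b : C(I, B)) (F : C(I, W)) {s ρ : ℝ}
    (hs : s ∈ Icc (0 : ℝ) 1) (hρ : ρ ∈ Ioo (0 : ℝ) 1) :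
    ‖duhInt Q b F s ρ‖ ≤ s ^ (1 / 8 : ℝ) * (1 - ρ) ^ (-(3 / 4) : ℝ) * (Q.const * ‖b‖ * ‖F‖) := by
  have h1 : 0 < 1 - ρ := by linarith [hρ.2]
  rcases hs.1.eq_or_lt with h0 | h0
  · subst h0
    rw [duhInt, Real.zero_rpow (by norm_num), Real.zero_rpow (by norm_num)]
    simp
  · refine (norm_duhInt_le' Q b F ⟨h0, hs.2⟩ hρ).trans ?_
    have := F.norm_coe_le_norm (projIcc 0 1 zero_le_one (s * ρ))
    have h5 := Q.const_nonneg
    have h7 : 0 ≤ (1 - ρ) ^ (-(3 / 4) : ℝ) := Real.rpow_nonneg h1.le _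
    gcongr

theorem integrable_singular : IntegrableOn (fun ρ : ℝ => (1 - ρ) ^ (-(3 / 4) : ℝ)) (Ioo 0 1) := by
  have h := intervalIntegral.intervalIntegrable_rpow' (a := 0) (b := 1) (r := -(3 / 4))
    (by norm_num)
  have h2 := h.comp_sub_left 1
  simp only [sub_zero, sub_self] at h2
  have := (intervalIntegrable_iff_integrableOn_Ioo_of_le zero_le_one).1 h2.symm
  exact this

theorem duhInt_continuousOn (Q : SmoothingFamily B W Z) (b : C(I, B)) (F : C(I, W)) {s : ℝ}
    (hs : s ∈ Icc (0 : ℝ) 1) : ContinuousOn (duhInt Q b F s) (Ioo 0 1) := by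
  rcases hs.1.eq_or_lt with h0 | h0
  · subst h0
    have : duhInt Q b F 0 = fun _ => 0 := by
      funext ρ
      rw [duhInt, Real.zero_rpow (by norm_num), zero_smul]
    rw [this]; exact continuousOn_const
  · refine continuousOn_const.smul ?_
    refine Q.continuousOn.comp (f := fun ρ => (√(s * (1 - ρ)), b (cpar ρ),
      F (projIcc 0 1 zero_le_one (s * ρ)))) (ContinuousOn.prodMk (by fun_prop)
      (ContinuousOn.prodMk (b.continuous.comp_continuousOn cpar_continuousOn)
        ((F.continuous.comp (continuous_projIcc.comp (by fun_prop))).continuousOn))) ?_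
    exact fun ρ hρ => ⟨sqrt_mem_Ioc ⟨h0, hs.2⟩ hρ, mem_univ _⟩

theorem duhInt_integrable (Q : SmoothingFamily B W Z) (b : C(I, B)) (F : C(I, W)) {s : ℝ}
    (hs : s ∈ Icc (0 : ℝ) 1) : IntegrableOn (duhInt Q b F s) (Ioo 0 1) := by
  refine Integrable.mono' ((integrable_singular.const_mul (s ^ (1 / 8 : ℝ))).mul_const
    (Q.const * ‖b‖ * ‖F‖)) ((duhInt_continuousOn Q b F hs).aestronglyMeasurable measurableSet_Ioo) ?_
  filter_upwards [ae_restrict_mem measurableSet_Ioo] with ρ hρ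
  exact norm_duhInt_le Q b F hs hρ

/-- At `s = 0` the bound by `s^{1/8}` forces the limit zero; at `s > 0` the operators are jointly
continuous. This is why only part of the available power of `s` is split off in `duhamel`. -/
theorem duhInt_continuous_left (Q : SmoothingFamily B W Z) (b : C(I, B)) (F : C(I, W)) {ρ : ℝ}
    (hρ : ρ ∈ Ioo (0 : ℝ) 1) : Continuous fun s : I => duhInt Q b F s ρ := by
  rw [continuous_iff_continuousAt]
  intro s
  rcases s.2.1.eq_or_lt with h0 | h0
  · have e0 : duhInt Q b F s ρ = 0 := by
      rw [duhInt, ← h0, Real.zero_rpow (by norm_num), zero_smul]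
    rw [ContinuousAt, e0]
    refine squeeze_zero_norm (fun s' => norm_duhInt_le Q b F s'.2 hρ) ?_
    have : Continuous fun s' : I => (s' : ℝ) ^ (1 / 8 : ℝ) * (1 - ρ) ^ (-(3 / 4) : ℝ) *
        (Q.const * ‖b‖ * ‖F‖) := by
      refine (Continuous.mul ?_ continuous_const).mul continuous_const
      exact Continuous.rpow_const continuous_subtype_val (fun _ => Or.inr (by norm_num))
    refine (this.tendsto s).trans_eq ?_
    rw [← h0, Real.zero_rpow (by norm_num)]; simp
  · have hrp : ContinuousAt (fun s : I => (s : ℝ) ^ (7 / 8 : ℝ)) s :=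
      (Continuous.rpow_const continuous_subtype_val (fun _ => Or.inr (by norm_num))).continuousAt
    refine ContinuousAt.smul hrp ?_
    have hw : ContinuousWithinAt (fun p : ℝ × B × W => Q.op p.1 p.2.1 p.2.2) (Ioc 0 1 ×ˢ univ)
        (√(s * (1 - ρ)), b (cpar ρ), F (projIcc 0 1 zero_le_one (s * ρ))) :=
      Q.continuousOn _ ⟨sqrt_mem_Ioc ⟨h0, s.2.2⟩ hρ, mem_univ _⟩
    refine Tendsto.comp (f := fun s : I => (√(s * (1 - ρ)), b (cpar ρ),
      F (projIcc 0 1 zero_le_one (s * ρ)))) hw (tendsto_nhdsWithin_iff.2 ⟨?_, ?_⟩)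
    · apply Continuous.tendsto
      exact Continuous.prodMk (by fun_prop) (continuous_const.prodMk
        (F.continuous.comp (continuous_projIcc.comp (by fun_prop))))
    · have : ∀ᶠ s' : I in 𝓝 s, 0 < (s' : ℝ) :=
        continuous_subtype_val.continuousAt.eventually (lt_mem_nhds h0)
      filter_upwards [this] with s' hs'
      exact ⟨sqrt_mem_Ioc ⟨hs', s'.2.2⟩ hρ, mem_univ _⟩

variable [CompleteSpace Z]

/-- The operator `F ↦ s^{-1/8} ∫_0^s Q_{√(s-r)}(b((√s-√r)/√(s-r))) F(r) dr` in the variable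
`ρ = r / s`. -/
noncomputable def duhFun (Q : SmoothingFamily B W Z) (b : C(I, B)) (F : C(I, W)) : C(I, Z) where
  toFun s := ∫ ρ in Ioo (0 : ℝ) 1, duhInt Q b F s ρ
  continuous_toFun := by
    refine continuous_of_dominated
      (bound := fun ρ => (1 - ρ) ^ (-(3 / 4) : ℝ) * (Q.const * ‖b‖ * ‖F‖)) ?_ ?_ ?_ ?_
    · exact fun s => (duhInt_integrable Q b F s.2).aestronglyMeasurable
    · intro s
      filter_upwards [ae_restrict_mem measurableSet_Ioo] with ρ hρ
      refine (norm_duhInt_le Q b F s.2 hρ).trans ?_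
      have h1 : 0 < 1 - ρ := by linarith [hρ.2]
      have : (s : ℝ) ^ (1 / 8 : ℝ) ≤ 1 := Real.rpow_le_one s.2.1 s.2.2 (by norm_num)
      have h5 := Q.const_nonneg
      have h7 : 0 ≤ (1 - ρ) ^ (-(3 / 4) : ℝ) := Real.rpow_nonneg h1.le _
      have : (s : ℝ) ^ (1 / 8 : ℝ) * (1 - ρ) ^ (-(3 / 4) : ℝ) ≤ 1 * (1 - ρ) ^ (-(3 / 4) : ℝ) := by
        gcongr
      rw [one_mul] at this
      gcongr
    · exact integrable_singular.mul_const _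
    · filter_upwards [ae_restrict_mem measurableSet_Ioo] with ρ hρ
      exact duhInt_continuous_left Q b F hρ

theorem duhFun_apply (Q : SmoothingFamily B W Z) (b : C(I, B)) (F : C(I, W)) (s : I) :
    duhFun Q b F s = ∫ ρ in Ioo (0 : ℝ) 1, duhInt Q b F s ρ := rfl

theorem integral_singular_nonneg : 0 ≤ ∫ ρ in Ioo (0 : ℝ) 1, (1 - ρ) ^ (-(3 / 4) : ℝ) :=
  setIntegral_nonneg measurableSet_Ioo fun ρ hρ => Real.rpow_nonneg (by linarith [hρ.2]) _

theorem norm_duhFun_le (Q : SmoothingFamily B W Z) (b : C(I, B)) (F : C(I, W)) :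
    ‖duhFun Q b F‖ ≤
      (∫ ρ in Ioo (0 : ℝ) 1, (1 - ρ) ^ (-(3 / 4) : ℝ)) * Q.const * ‖b‖ * ‖F‖ := by
  have h5 := Q.const_nonneg
  have h6 := integral_singular_nonneg
  refine (ContinuousMap.norm_le _ (by positivity)).2 fun s => ?_
  rw [duhFun_apply, mul_assoc, mul_assoc, ← mul_assoc Q.const, ← integral_mul_const]
  refine norm_integral_le_of_norm_le (integrable_singular.mul_const _) ?_
  filter_upwards [ae_restrict_mem measurableSet_Ioo] with ρ hρ
  refine (norm_duhInt_le Q b F s.2 hρ).trans ?_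
  have h1 : 0 < 1 - ρ := by linarith [hρ.2]
  have h8 : (s : ℝ) ^ (1 / 8 : ℝ) ≤ 1 := Real.rpow_le_one s.2.1 s.2.2 (by norm_num)
  have h7 : 0 ≤ (1 - ρ) ^ (-(3 / 4) : ℝ) := Real.rpow_nonneg h1.le _
  have : (s : ℝ) ^ (1 / 8 : ℝ) * (1 - ρ) ^ (-(3 / 4) : ℝ) ≤ 1 * (1 - ρ) ^ (-(3 / 4) : ℝ) := by
    gcongr
  rw [one_mul] at this
  gcongr

/-- The rescaled Duhamel operator as a continuous bilinear map. -/
noncomputable def duh (Q : SmoothingFamily B W Z) : C(I, B) →L[ℝ] C(I, W) →L[ℝ] C(I, Z) :=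
  LinearMap.mkContinuous₂
    (LinearMap.mk₂ ℝ (duhFun Q)
      (fun b b' F => by
        ext s
        simp only [duhFun_apply, ContinuousMap.add_apply]
        rw [← integral_add (duhInt_integrable Q b F s.2) (duhInt_integrable Q b' F s.2)]
        simp only [duhInt, ContinuousMap.add_apply, map_add, add_apply,
          smul_add])
      (fun c b F => by
        ext s
        simp only [duhFun_apply, ContinuousMap.smul_apply]
        rw [← integral_smul]
        simp only [duhInt, ContinuousMap.smul_apply, map_smul, smul_apply]
        simp only [smul_comm c])
      (fun b F F' => by
        ext s
        simp only [duhFun_apply, ContinuousMap.add_apply]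
        rw [← integral_add (duhInt_integrable Q b F s.2) (duhInt_integrable Q b F' s.2)]
        simp only [duhInt, ContinuousMap.add_apply, map_add, smul_add])
      (fun c b F => by
        ext s
        simp only [duhFun_apply, ContinuousMap.smul_apply]
        rw [← integral_smul]
        simp only [duhInt, ContinuousMap.smul_apply, map_smul]
        simp only [smul_comm c]))
    ((∫ ρ in Ioo (0 : ℝ) 1, (1 - ρ) ^ (-(3 / 4) : ℝ)) * Q.const) (norm_duhFun_le Q)

theorem duh_apply (Q : SmoothingFamily B W Z) (b : C(I, B)) (F : C(I, W)) (s : I) :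
    duh Q b F s = ∫ ρ in Ioo (0 : ℝ) 1, duhInt Q b F s ρ := rfl

end Duhamel

/-! ### A Volterra inequality with weakly singular kernel -/

section Volterra

theorem integrable_singular_seven_eighths :
    IntegrableOn (fun ρ : ℝ => (1 - ρ) ^ (-(7 / 8) : ℝ)) (Ioo 0 1) := by
  have h := intervalIntegral.intervalIntegrable_rpow' (a := 0) (b := 1) (r := -(7 / 8))
    (by norm_num)
  have h2 := h.comp_sub_left 1
  simp only [sub_zero, sub_self] at h2
  exact (intervalIntegrable_iff_integrableOn_Ioo_of_le zero_le_one).1 h2.symm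

/-- Trades exponential decay for a small inverse power: the singularity `(1 - ρ)^{-3/4}` worsens
only to `(1 - ρ)^{-7/8}`, still integrable, while a factor `L^{-1/8}` is gained. -/
theorem exp_neg_le_rpow {x : ℝ} (hx : 0 < x) : Real.exp (-x) ≤ x ^ (-(1 / 8) : ℝ) := by
  rw [Real.exp_neg, Real.rpow_neg hx.le]
  refine inv_anti₀ (Real.rpow_pos_of_pos hx _) ?_
  calc x ^ (1 / 8 : ℝ) ≤ (x + 1) ^ (1 / 8 : ℝ) := by
        apply Real.rpow_le_rpow hx.le <;> linarith
    _ ≤ (x + 1) ^ (1 : ℝ) := Real.rpow_le_rpow_of_exponent_le (by linarith) (by norm_num)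
    _ = x + 1 := Real.rpow_one _
    _ ≤ Real.exp x := Real.add_one_le_exp x

/-- A homogeneous Volterra inequality with the kernel `(s - r)^{-3/4}` has only the zero
solution. -/
theorem eq_zero_of_volterra {g : I → ℝ} (hg : Continuous g) (h0 : ∀ s, 0 ≤ g s) {C : ℝ}
    (hC : 0 ≤ C)
    (h : ∀ s : I, g s ≤ (s : ℝ) ^ (1 / 8 : ℝ) * ∫ ρ in Ioo (0 : ℝ) 1,
      (s : ℝ) ^ (1 / 8 : ℝ) * (1 - ρ) ^ (-(3 / 4) : ℝ) *
        (C * g (projIcc 0 1 zero_le_one (s * ρ)))) (s : I) : g s = 0 := by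
  set κ := ∫ ρ in Ioo (0 : ℝ) 1, (1 - ρ) ^ (-(7 / 8) : ℝ)
  have hκ : 0 ≤ κ :=
    setIntegral_nonneg measurableSet_Ioo fun ρ hρ => Real.rpow_nonneg (by linarith [hρ.2]) _
  -- Chosen so that `C κ / m < 1`. With the weight `exp (-L s)` and `L = m⁸`, the integral operator
  -- acquires the factor `L^{-1/8} = 1 / m`.
  set m := 2 * C * κ + 1
  have hm : 0 < m := by positivity
  set L := m ^ (8 : ℝ)
  have hL : 0 < L := Real.rpow_pos_of_pos hm _
  have hL8 : L ^ (-(1 / 8) : ℝ) = m⁻¹ := by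
    rw [← Real.rpow_mul hm.le, ← Real.rpow_neg_one]; norm_num
  -- `G` is the maximum of the exponentially weighted function; it remains to show `G ≤ θ G` for
  -- some `θ < 1`.
  obtain ⟨t, -, ht⟩ := isCompact_univ.exists_isMaxOn (univ_nonempty (α := I))
    (f := fun s : I => Real.exp (-(L * s)) * g s) (by fun_prop)
  set G := Real.exp (-(L * t)) * g t
  have hG : ∀ s : I, Real.exp (-(L * s)) * g s ≤ G := fun s => ht (mem_univ s)
  have hG0 : 0 ≤ G := mul_nonneg (Real.exp_pos _).le (h0 t)
  have hgs : ∀ s : I, g s ≤ Real.exp (L * s) * G := by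
    intro s
    have := mul_le_mul_of_nonneg_left (hG s) (Real.exp_pos (L * s)).le
    rwa [← mul_assoc, ← Real.exp_add, add_neg_cancel, Real.exp_zero, one_mul] at this
  have key : G ≤ (C * κ * m⁻¹) * G := by
    rcases t.2.1.eq_or_lt with ht0 | ht0
    · have := h t
      rw [← ht0, Real.zero_rpow (by norm_num), zero_mul] at this
      have h1 : G = 0 := by
        have : g t = 0 := le_antisymm this (h0 t)
        simp [G, this]
      rw [h1, mul_zero]
    · have hb : ∀ ρ ∈ Ioo (0 : ℝ) 1, Real.exp (-(L * t)) * ((t : ℝ) ^ (1 / 8 : ℝ) *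
          ((t : ℝ) ^ (1 / 8 : ℝ) * (1 - ρ) ^ (-(3 / 4) : ℝ) *
          (C * g (projIcc 0 1 zero_le_one (t * ρ))))) ≤
          C * m⁻¹ * G * (1 - ρ) ^ (-(7 / 8) : ℝ) := by
        intro ρ hρ
        have h1 : 0 < 1 - ρ := by linarith [hρ.2]
        have hmem : (t : ℝ) * ρ ∈ Icc (0 : ℝ) 1 :=
          ⟨mul_nonneg t.2.1 hρ.1.le, mul_le_one₀ t.2.2 hρ.1.le hρ.2.le⟩
        have h2 := hgs (projIcc 0 1 zero_le_one (t * ρ))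
        rw [projIcc_of_mem _ hmem] at h2 ⊢
        simp only at h2
        have h3 : Real.exp (-(L * t)) * Real.exp (L * (t * ρ)) ≤
            m⁻¹ * (t : ℝ) ^ (-(1 / 8) : ℝ) * (1 - ρ) ^ (-(1 / 8) : ℝ) := by
          rw [← Real.exp_add, show -(L * (t : ℝ)) + L * (t * ρ) = -(L * t * (1 - ρ)) by ring]
          refine (exp_neg_le_rpow (by positivity)).trans_eq ?_
          rw [Real.mul_rpow (by positivity) h1.le, Real.mul_rpow hL.le ht0.le, hL8]
        have h4 : (t : ℝ) ^ (1 / 8 : ℝ) ≤ 1 := Real.rpow_le_one t.2.1 t.2.2 (by norm_num)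
        -- One of the two powers `t^{1/8}` cancels the singularity `t^{-1/8}` produced by the
        -- exponential; the other is bounded by one.
        have h5 : (t : ℝ) ^ (1 / 8 : ℝ) * (t : ℝ) ^ (-(1 / 8) : ℝ) = 1 := by
          rw [← Real.rpow_add ht0]; norm_num
        have h6 : (1 - ρ) ^ (-(3 / 4) : ℝ) * (1 - ρ) ^ (-(1 / 8) : ℝ) =
            (1 - ρ) ^ (-(7 / 8) : ℝ) := by
          rw [← Real.rpow_add h1]; norm_num
        have n1 : 0 ≤ (t : ℝ) ^ (1 / 8 : ℝ) := Real.rpow_nonneg ht0.le _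
        have n2 : 0 ≤ (1 - ρ) ^ (-(3 / 4) : ℝ) := Real.rpow_nonneg h1.le _
        have n3 : 0 ≤ (1 - ρ) ^ (-(7 / 8) : ℝ) := Real.rpow_nonneg h1.le _
        have n4 := h0 ⟨(t : ℝ) * ρ, hmem⟩
        calc _ ≤ Real.exp (-(L * t)) * (1 * ((t : ℝ) ^ (1 / 8 : ℝ) *
              (1 - ρ) ^ (-(3 / 4) : ℝ) * (C * (Real.exp (L * (t * ρ)) * G)))) := by gcongr
          _ = (t : ℝ) ^ (1 / 8 : ℝ) * (1 - ρ) ^ (-(3 / 4) : ℝ) * (C * G) *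
              (Real.exp (-(L * t)) * Real.exp (L * (t * ρ))) := by ring
          _ ≤ (t : ℝ) ^ (1 / 8 : ℝ) * (1 - ρ) ^ (-(3 / 4) : ℝ) * (C * G) *
              (m⁻¹ * (t : ℝ) ^ (-(1 / 8) : ℝ) * (1 - ρ) ^ (-(1 / 8) : ℝ)) := by gcongr
          _ = ((t : ℝ) ^ (1 / 8 : ℝ) * (t : ℝ) ^ (-(1 / 8) : ℝ)) * (C * m⁻¹ * G) *
              ((1 - ρ) ^ (-(3 / 4) : ℝ) * (1 - ρ) ^ (-(1 / 8) : ℝ)) := by ring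
          _ = _ := by rw [h5, h6, one_mul]
      calc G ≤ Real.exp (-(L * t)) * ((t : ℝ) ^ (1 / 8 : ℝ) * ∫ ρ in Ioo (0 : ℝ) 1,
            (t : ℝ) ^ (1 / 8 : ℝ) * (1 - ρ) ^ (-(3 / 4) : ℝ) *
            (C * g (projIcc 0 1 zero_le_one (t * ρ)))) :=
            mul_le_mul_of_nonneg_left (h t) (Real.exp_pos _).le
        _ = ∫ ρ in Ioo (0 : ℝ) 1, Real.exp (-(L * t)) * ((t : ℝ) ^ (1 / 8 : ℝ) *
          ((t : ℝ) ^ (1 / 8 : ℝ) * (1 - ρ) ^ (-(3 / 4) : ℝ) *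
          (C * g (projIcc 0 1 zero_le_one (t * ρ))))) := by
            rw [integral_const_mul, integral_const_mul]
        _ ≤ ∫ ρ in Ioo (0 : ℝ) 1, C * m⁻¹ * G * (1 - ρ) ^ (-(7 / 8) : ℝ) := by
            refine integral_mono_of_nonneg ?_ (integrable_singular_seven_eighths.const_mul _) ?_
            · filter_upwards [ae_restrict_mem measurableSet_Ioo] with ρ hρ
              have h1 : 0 < 1 - ρ := by linarith [hρ.2]
              have := h0 (projIcc 0 1 zero_le_one (t * ρ))
              have n1 : 0 ≤ (t : ℝ) ^ (1 / 8 : ℝ) := Real.rpow_nonneg ht0.le _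
              have n2 : 0 ≤ (1 - ρ) ^ (-(3 / 4) : ℝ) := Real.rpow_nonneg h1.le _
              simp only [Pi.zero_apply]
              positivity
            · filter_upwards [ae_restrict_mem measurableSet_Ioo] with ρ hρ using hb ρ hρ
        _ = _ := by rw [integral_const_mul]; ring
  have hlt : C * κ * m⁻¹ < 1 := by
    rw [← div_eq_mul_inv, div_lt_one hm]
    have : 0 ≤ C * κ := by positivity
    simp only [m]; linarith
  have hGz : G = 0 := by nlinarith
  exact le_antisymm ((hgs s).trans_eq (by rw [hGz, mul_zero])) (h0 s)

end Volterra

/-! ### Smooth dependence of small solutions on parameters -/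

section Implicit

variable {H D X Y : Type*} [NormedAddCommGroup H] [NormedSpace ℝ H] [CompleteSpace H]
  [NormedAddCommGroup D] [NormedSpace ℝ D] [CompleteSpace D] [NormedAddCommGroup X]
  [NormedSpace ℝ X] [CompleteSpace X] [NormedAddCommGroup Y] [NormedSpace ℝ Y]

/-- Small solutions of `A = ℰ(h) a + 𝒟(h) N(A)` depend smoothly on `(h, a)` when `N` vanishes to
second order. -/
theorem exists_smooth_solution {ℰ : H → D →L[ℝ] X} {𝒟 : H → Y →L[ℝ] X} {N : X → Y}
    (hℰ : ContDiff ℝ ∞ ℰ) (h𝒟 : ContDiff ℝ ∞ 𝒟) (hN : ContDiff ℝ ∞ N) (hN0 : N 0 = 0)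
    (hN' : HasFDerivAt N (0 : X →L[ℝ] Y) 0) :
    ∃ (U : Set (H × D)) (S : H × D → X) (ε : ℝ), IsOpen U ∧ 0 ∈ U ∧ ContDiffOn ℝ ∞ S U ∧
      S 0 = 0 ∧ 0 < ε ∧ (∀ p ∈ U, S p = ℰ p.1 p.2 + 𝒟 p.1 (N (S p))) ∧
      ∀ p ∈ U, ∀ A, ‖A‖ < ε → A = ℰ p.1 p.2 + 𝒟 p.1 (N A) → A = S p := by
  set Φ : (H × D) × X → X := fun z => z.2 - ℰ z.1.1 z.1.2 - 𝒟 z.1.1 (N z.2) with hΦ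
  -- The implicit equation is solved by inverting `(p, A) ↦ (p, Φ(p, A))` locally and reading off
  -- the second component over `(p, 0)`.
  set Ξ : (H × D) × X → (H × D) × X := fun z => (z.1, Φ z) with hΞ
  have hΦs : ContDiff ℝ ∞ Φ := by
    refine (contDiff_snd.sub ((hℰ.comp (contDiff_fst.comp contDiff_fst)).clm_apply
      (contDiff_snd.comp contDiff_fst))).sub ((h𝒟.comp (contDiff_fst.comp contDiff_fst)).clm_apply
      (hN.comp contDiff_snd))
  have hΞs : ContDiff ℝ ∞ Ξ := contDiff_fst.prodMk hΦs
  set T : (H × D) →L[ℝ] X := (ℰ 0).comp (ContinuousLinearMap.snd ℝ H D)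
  -- Since `N` and its derivative vanish at `0`, the linearization is the shear `(p, A) ↦ (p, A -
  -- ℰ(0) a)`, which is invertible whatever `ℰ` is.
  set e : ((H × D) × X) ≃L[ℝ] ((H × D) × X) :=
    (ContinuousLinearEquiv.refl ℝ (H × D)).skewProd (ContinuousLinearEquiv.refl ℝ X) (-T) with he
  have hΦ0 : HasFDerivAt Φ (ContinuousLinearMap.snd ℝ (H × D) X -
      T.comp (ContinuousLinearMap.fst ℝ (H × D) X)) 0 := by
    have d1 : HasFDerivAt (fun z : (H × D) × X => ℰ z.1.1)
        ((fderiv ℝ ℰ 0).comp ((ContinuousLinearMap.fst ℝ H D).comp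
          (ContinuousLinearMap.fst ℝ (H × D) X))) 0 :=
      HasFDerivAt.comp (g := ℰ) (0 : (H × D) × X)
        (hℰ.differentiable (by simp) _).hasFDerivAt (hasFDerivAt_fst.comp _ hasFDerivAt_fst)
    have d2 : HasFDerivAt (fun z : (H × D) × X => 𝒟 z.1.1)
        ((fderiv ℝ 𝒟 0).comp ((ContinuousLinearMap.fst ℝ H D).comp
          (ContinuousLinearMap.fst ℝ (H × D) X))) 0 :=
      HasFDerivAt.comp (g := 𝒟) (0 : (H × D) × X)
        (h𝒟.differentiable (by simp) _).hasFDerivAt (hasFDerivAt_fst.comp _ hasFDerivAt_fst)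
    have d3 : HasFDerivAt (fun z : (H × D) × X => N z.2)
        ((0 : X →L[ℝ] Y).comp (ContinuousLinearMap.snd ℝ (H × D) X)) 0 :=
      HasFDerivAt.comp (g := N) (0 : (H × D) × X) hN' hasFDerivAt_snd
    have d4 : HasFDerivAt (fun z : (H × D) × X => z.1.2)
        ((ContinuousLinearMap.snd ℝ H D).comp (ContinuousLinearMap.fst ℝ (H × D) X)) 0 :=
      hasFDerivAt_snd.comp _ hasFDerivAt_fst
    have := ((hasFDerivAt_snd (p := (0 : (H × D) × X))).sub (d1.clm_apply d4)).sub
      (d2.clm_apply d3)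
    refine this.congr_fderiv ?_
    ext z <;> simp [T, hN0]
  have hΞ0 : HasFDerivAt Ξ (e : ((H × D) × X) →L[ℝ] ((H × D) × X)) 0 := by
    refine ((hasFDerivAt_fst (p := (0 : (H × D) × X))).prodMk hΦ0).congr_fderiv ?_
    ext z <;> simp [he, ContinuousLinearEquiv.skewProd]
  have hne : (∞ : WithTop ℕ∞) ≠ 0 := by simp
  set f := hΞs.contDiffAt.toOpenPartialHomeomorph Ξ hΞ0 hne with hf
  have hfc : ∀ z, f z = Ξ z := fun z => rfl
  have h0s : (0 : (H × D) × X) ∈ f.source :=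
    hΞs.contDiffAt.mem_toOpenPartialHomeomorph_source hΞ0 hne
  have hΞ00 : Ξ 0 = 0 := by
    simp [hΞ, hΦ, hN0]
  -- The inverse function is smooth at every point where the derivative of `Ξ` is invertible. This
  -- is an open condition, so smoothness holds on a neighbourhood and not only at the origin.
  set O : Set ((H × D) × X) := {z | fderiv ℝ Ξ z ∈
    Set.range ((↑) : (((H × D) × X) ≃L[ℝ] ((H × D) × X)) → _)}
  have hO : IsOpen O := (ContinuousLinearEquiv.isOpen).preimage
    (hΞs.continuous_fderiv (by simp))
  have h0O : (0 : (H × D) × X) ∈ O := ⟨e, hΞ0.fderiv.symm⟩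
  have hV : IsOpen (f.target ∩ f.symm ⁻¹' O) := f.symm.isOpen_inter_preimage hO
  have h0V : (0 : (H × D) × X) ∈ f.target ∩ f.symm ⁻¹' O := by
    have e1 : f 0 = 0 := hΞ00
    have e2 : f.symm 0 = 0 := by
      have := f.left_inv h0s
      rwa [e1] at this
    refine ⟨?_, ?_⟩
    · rw [← e1]; exact f.map_source h0s
    · show f.symm 0 ∈ O
      rw [e2]; exact h0O
  -- Injectivity of `Ξ` on this ball yields uniqueness among all `A` of norm less than `ε`.
  obtain ⟨ε, hε, hball⟩ := Metric.isOpen_iff.1 f.open_source 0 h0s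
  set ι : H × D → (H × D) × X := fun p => (p, 0)
  have hι : ContDiff ℝ ∞ ι := contDiff_id.prodMk contDiff_const
  refine ⟨ι ⁻¹' (f.target ∩ f.symm ⁻¹' O) ∩ Metric.ball 0 ε, fun p => (f.symm (ι p)).2, ε,
    (hV.preimage hι.continuous).inter Metric.isOpen_ball, ⟨h0V, Metric.mem_ball_self hε⟩,
    ?_, ?_, hε, ?_, ?_⟩
  · rintro p ⟨⟨hp1, e', he'⟩, -⟩
    refine ContDiffAt.contDiffWithinAt ?_
    refine contDiff_snd.contDiffAt.comp p (ContDiffAt.comp p ?_ hι.contDiffAt)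
    refine f.contDiffAt_symm hp1 (f₀' := e') ?_ hΞs.contDiffAt
    rw [he']
    exact (hΞs.differentiable (by simp) _).hasFDerivAt
  · have e1 : f 0 = 0 := hΞ00
    have e2 : f.symm 0 = 0 := by
      have := f.left_inv h0s
      rwa [e1] at this
    show (f.symm 0).2 = 0
    rw [e2]; rfl
  · rintro p ⟨⟨hp1, -⟩, -⟩
    have h1 : Ξ (f.symm (ι p)) = ι p := f.right_inv hp1
    have h2 : (f.symm (ι p)).1 = p := congrArg Prod.fst h1
    have h3 : Φ (f.symm (ι p)) = 0 := congrArg Prod.snd h1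
    simp only [hΦ, h2] at h3
    rw [sub_sub, sub_eq_zero] at h3
    exact h3
  · rintro p ⟨-, hp⟩ A hA hAe
    have hmem : ((p, A) : (H × D) × X) ∈ f.source := by
      refine hball ?_
      rw [mem_ball_zero_iff] at hp ⊢
      exact max_lt hp hA
    have h1 : f (p, A) = ι p := by
      rw [hfc]
      refine Prod.ext rfl ?_
      show A - ℰ p.1 p.2 - 𝒟 p.1 (N A) = 0
      rw [sub_sub, sub_eq_zero]; exact hAe
    have h2 := f.left_inv hmem
    rw [h1] at h2
    show A = (f.symm (ι p)).2
    rw [h2]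

end Implicit

/-! ### Schwartz kernels in a weighted supremum norm; the Gaussian -/

section Kernels

/-- The `j`-th coordinate vector. -/
noncomputable abbrev ej (j : Fin 3) : E3 := EuclideanSpace.single j 1

theorem E3.sum_coord (v : E3) : v = ∑ j : Fin 3, v j • ej j := by
  ext i
  simp [Finset.sum_apply, Pi.single_apply]

theorem exists_one_add_norm_pow_mul_le {G : Type*} [NormedAddCommGroup G] [NormedSpace ℝ G]
    (f : 𝓢(E3, G)) : ∃ C, 0 ≤ C ∧ ∀ x, (1 + ‖x‖) ^ 4 * ‖f x‖ ≤ C := by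
  have h := fun x => SchwartzMap.one_add_le_sup_seminorm_apply (𝕜 := ℝ) (m := (4, 0)) (k := 4)
    (n := 0) le_rfl le_rfl f x
  exact ⟨_, le_trans (by positivity) (h 0), fun x => by simpa using h x⟩

/-- The kernel `k(· - h)` divided by the weight `(1 + |z|)^{-4}`. -/
noncomputable def wker (k : 𝓢(E3, ℝ)) (h : E3) : BoundedContinuousFunction E3 ℝ :=
  BoundedContinuousFunction.ofNormedAddCommGroup (fun z => (1 + ‖z‖) ^ 4 * k (z - h))
    (by have := k.continuous; fun_prop) ((exists_one_add_norm_pow_mul_le (k.compSubConstCLM ℝ h)).choose)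
    (fun z => by
      have := (exists_one_add_norm_pow_mul_le (k.compSubConstCLM ℝ h)).choose_spec.2 z
      rw [norm_mul, Real.norm_of_nonneg (by positivity)]
      simpa using this)

theorem wker_apply (k : 𝓢(E3, ℝ)) (h z : E3) : wker k h z = (1 + ‖z‖) ^ 4 * k (z - h) := rfl

/-- Taylor's formula to second order with the decay retained: for `|u - y| ≤ 1` one has `1 + |y| ≤ 2
(1 + |u|)`, so the weighted bound for the second derivative at `u` may be read at `y` at the cost of
`2⁴`. -/
theorem norm_sub_fderiv_le_of_schwartz (k : 𝓢(E3, ℝ)) : ∃ C, 0 ≤ C ∧ ∀ y l : E3, ‖l‖ ≤ 1 →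
    (1 + ‖y‖) ^ 4 * ‖k (y - l) - k y + fderiv ℝ k y l‖ ≤ C * ‖l‖ ^ 2 := by
  obtain ⟨C, hC, h⟩ := exists_one_add_norm_pow_mul_le
    (SchwartzMap.fderivCLM ℝ _ _ (SchwartzMap.fderivCLM ℝ _ _ k))
  refine ⟨2 ^ 4 * C, by positivity, fun y l hl => ?_⟩
  have hpos : 0 < (1 + ‖y‖) ^ 4 := by positivity
  set s := Metric.closedBall y ‖l‖
  set M := 2 ^ 4 * C / (1 + ‖y‖) ^ 4
  have hM : 0 ≤ M := by positivity
  have h2 : ∀ u ∈ s, ‖fderiv ℝ (fderiv ℝ k) u‖ ≤ M := by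
    intro u hu
    rw [mem_closedBall_iff_norm'] at hu
    have h3 := h u
    have h4 : ‖y‖ ≤ ‖u‖ + 1 := by
      have := norm_sub_norm_le y u; linarith
    have h5 : (1 + ‖y‖) ^ 4 ≤ 2 ^ 4 * (1 + ‖u‖) ^ 4 := by
      rw [← mul_pow]
      gcongr
      have := norm_nonneg u
      linarith
    rw [le_div_iff₀ hpos]
    have e : SchwartzMap.fderivCLM ℝ _ _ (SchwartzMap.fderivCLM ℝ _ _ k) u
        = fderiv ℝ (fderiv ℝ k) u := rfl
    rw [e] at h3
    calc ‖fderiv ℝ (fderiv ℝ k) u‖ * (1 + ‖y‖) ^ 4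
        ≤ ‖fderiv ℝ (fderiv ℝ k) u‖ * (2 ^ 4 * (1 + ‖u‖) ^ 4) := by gcongr
      _ = 2 ^ 4 * ((1 + ‖u‖) ^ 4 * ‖fderiv ℝ (fderiv ℝ k) u‖) := by ring
      _ ≤ 2 ^ 4 * C := by gcongr
  have hconv : Convex ℝ s := convex_closedBall _ _
  have hys : y ∈ s := Metric.mem_closedBall_self (norm_nonneg _)
  have h3 : ∀ u ∈ s, ‖fderiv ℝ k u - fderiv ℝ k y‖ ≤ M * ‖l‖ := by
    intro u hu
    have := hconv.norm_image_sub_le_of_norm_fderiv_le (𝕜 := ℝ) (f := fderiv ℝ k)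
      (fun x _ => (SchwartzMap.fderivCLM ℝ E3 ℝ k).differentiableAt) h2 hys hu
    refine this.trans ?_
    gcongr
    rwa [← mem_closedBall_iff_norm]
  have h4 := hconv.norm_image_sub_le_of_norm_fderiv_le' (𝕜 := ℝ) (f := k)
    (φ := fderiv ℝ k y) (fun x _ => k.differentiableAt) h3 hys
    (show y - l ∈ s by rw [mem_closedBall_iff_norm]; simp)
  have e : k (y - l) - k y - (fderiv ℝ k y) (y - l - y) = k (y - l) - k y + fderiv ℝ k y l := by
    rw [sub_sub_cancel_left, map_neg, sub_neg_eq_add]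
  rw [e, sub_sub_cancel_left, norm_neg] at h4
  calc _ ≤ (1 + ‖y‖) ^ 4 * (M * ‖l‖ * ‖l‖) := by gcongr
    _ = _ := by simp only [M]; field_simp

/-- Moving the centre of the kernel differentiates it with a minus sign. The Taylor remainder decays
in `z - h`, and `1 + |z| ≤ (1 + |h|) (1 + |z - h|)` turns this into decay in `z`. -/
theorem hasFDerivAt_wker (k : 𝓢(E3, ℝ)) (h : E3) :
    HasFDerivAt (wker k) (∑ j : Fin 3, (EuclideanSpace.proj j : E3 →L[ℝ] ℝ).smulRight
      (wker (-∂_{ej j} k) h)) h := by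
  rw [hasFDerivAt_iff_isLittleO_nhds_zero]
  obtain ⟨C, hC, hb⟩ := norm_sub_fderiv_le_of_schwartz k
  have hO : (fun l => wker k (h + l) - wker k h - (∑ j : Fin 3,
      (EuclideanSpace.proj j : E3 →L[ℝ] ℝ).smulRight (wker (-∂_{ej j} k) h)) l)
      =O[𝓝 0] fun l : E3 => ‖l‖ ^ 2 := by
    refine Asymptotics.IsBigO.of_bound ((1 + ‖h‖) ^ 4 * C) ?_
    filter_upwards [Metric.closedBall_mem_nhds (0 : E3) one_pos] with l hl
    rw [mem_closedBall_zero_iff] at hl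
    rw [norm_pow, norm_norm]
    refine (BoundedContinuousFunction.norm_le (by positivity)).2 fun z => ?_
    have e : (wker k (h + l) - wker k h - (∑ j : Fin 3,
        (EuclideanSpace.proj j : E3 →L[ℝ] ℝ).smulRight (wker (-∂_{ej j} k) h)) l) z
        = (1 + ‖z‖) ^ 4 * (k (z - h - l) - k (z - h) + fderiv ℝ k (z - h) l) := by
      have e1 : fderiv ℝ k (z - h) l = ∑ j : Fin 3, l j * fderiv ℝ k (z - h) (ej j) := by
        conv_lhs => rw [E3.sum_coord l]
        simp [map_sum]
      rw [e1]
      simp only [sum_apply, ContinuousLinearMap.smulRight_apply,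
        BoundedContinuousFunction.coe_sub, Pi.sub_apply, BoundedContinuousFunction.coe_sum,
        Finset.sum_apply, BoundedContinuousFunction.coe_smul, wker_apply, sub_add_eq_sub_sub]
      simp only [PiLp.proj_apply, neg_apply, SchwartzMap.lineDerivOp_apply_eq_fderiv, smul_eq_mul]
      simp only [Fin.sum_univ_three]
      ring
    rw [e, norm_mul, Real.norm_of_nonneg (by positivity)]
    have h1 : 1 + ‖z‖ ≤ (1 + ‖h‖) * (1 + ‖z - h‖) := by
      have : ‖z‖ ≤ ‖h‖ + ‖z - h‖ := by
        have := norm_add_le h (z - h); rwa [add_sub_cancel] at this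
      nlinarith [norm_nonneg h, norm_nonneg (z - h)]
    calc _ ≤ ((1 + ‖h‖) * (1 + ‖z - h‖)) ^ 4 *
          ‖k (z - h - l) - k (z - h) + fderiv ℝ k (z - h) l‖ := by gcongr
      _ = (1 + ‖h‖) ^ 4 * ((1 + ‖z - h‖) ^ 4 *
          ‖k (z - h - l) - k (z - h) + fderiv ℝ k (z - h) l‖) := by ring
      _ ≤ (1 + ‖h‖) ^ 4 * (C * ‖l‖ ^ 2) :=
          mul_le_mul_of_nonneg_left (hb _ _ hl) (by positivity)
      _ = _ := by ring
  refine hO.trans_isLittleO ?_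
  have := Asymptotics.isLittleO_norm_pow_id (E' := E3) one_lt_two
  exact this

/-- The derivatives of a recentred kernel are again recentred Schwartz kernels, so the maps `wker k`
form a family closed under differentiation. -/
theorem contDiff_wker (k : 𝓢(E3, ℝ)) : ContDiff ℝ ∞ (wker k) := by
  rw [← contDiffOn_univ]
  refine contDiffOn_of_closed_family uniqueDiffOn_univ
    (fun j => (EuclideanSpace.proj j : E3 →L[ℝ] ℝ)) (Set.range wker) ?_ ⟨k, rfl⟩
  rintro _ ⟨k, rfl⟩
  exact ⟨fun j => wker (-∂_{ej j} k), fun j => ⟨_, rfl⟩, fun h _ =>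
    (hasFDerivAt_wker k h).hasFDerivWithinAt⟩

/-- Combine `(1 + r)^M ≤ M! e^{1+r}` with `1 + r - r²/4 ≤ 2`, which is `(r/2 - 1)² ≥ 0`. -/
theorem pow_mul_exp_neg_sq_le (M : ℕ) (r : ℝ) (hr : 0 ≤ r) :
    (1 + r) ^ M * Real.exp (-(r ^ 2 / 4)) ≤ M.factorial * Real.exp 2 := by
  have h1 : (1 + r) ^ M ≤ M.factorial * Real.exp (1 + r) := by
    have := Real.pow_div_factorial_le_exp (1 + r) (by linarith) M
    rwa [div_le_iff₀ (by positivity), mul_comm] at this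
  calc _ ≤ (M.factorial * Real.exp (1 + r)) * Real.exp (-(r ^ 2 / 4)) := by gcongr
    _ = M.factorial * Real.exp (1 + r + -(r ^ 2 / 4)) := by rw [mul_assoc, ← Real.exp_add]
    _ ≤ _ := by
      gcongr
      nlinarith [sq_nonneg (r / 2 - 1)]

/-- The unnormalized Gaussian `exp(-|z|²/4)`. -/
noncomputable def gauss0 : 𝓢(E3, ℝ) where
  toFun z := Real.exp (-(‖z‖ ^ 2 / 4))
  smooth' := Real.contDiff_exp.comp ((contDiff_norm_sq ℝ).div_const 4).neg
  decay' k n := by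
    have ht : Function.HasTemperateGrowth (fun z : E3 => -(‖z‖ ^ 2 / 4)) := by
      have h1 := (Function.hasTemperateGrowth_norm_sq (H := E3)).mul
        (Function.HasTemperateGrowth.const (-(1 / 4) : ℝ))
      have e : (fun z : E3 => -(‖z‖ ^ 2 / 4)) = (fun z : E3 => ‖z‖ ^ 2) * fun _ => -(1 / 4 : ℝ) := by
        funext z; simp; ring
      rw [e]; exact h1
    obtain ⟨m, C, hC, hb⟩ := ht.norm_iteratedFDeriv_le_uniform n
    have hs : ContDiff ℝ ∞ (fun z : E3 => -(‖z‖ ^ 2 / 4)) :=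
      ((contDiff_norm_sq ℝ).div_const 4).neg
    refine ⟨n.factorial * (1 + C) ^ n * ((k + m * n).factorial * Real.exp 2), fun x => ?_⟩
    -- Bound for the derivatives of a composition: all derivatives of `exp` are `exp`, and those of
    -- the quadratic exponent grow polynomially. The enlarged constant `1 + C` makes the base at
    -- least one, so that it is bounded by its `i`-th power.
    have h1 := norm_iteratedFDeriv_comp_le (𝕜 := ℝ) (n := n) (N := ∞) Real.contDiff_exp hs
      (by exact_mod_cast le_top) x (C := Real.exp (-(‖x‖ ^ 2 / 4)))
      (D := (1 + C) * (1 + ‖x‖) ^ m) (fun i _ => by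
        rw [norm_iteratedFDeriv_eq_norm_iteratedDeriv, iteratedDeriv_eq_iterate,
          Real.iter_deriv_exp, Real.norm_of_nonneg (Real.exp_pos _).le])
      (fun i hi1 hi2 => by
        have h1 : 1 ≤ (1 + C) * (1 + ‖x‖) ^ m := by
          have : 1 ≤ (1 + ‖x‖) ^ m := one_le_pow₀ (by linarith [norm_nonneg x])
          nlinarith
        calc _ ≤ C * (1 + ‖x‖) ^ m := hb i hi2 x
          _ ≤ (1 + C) * (1 + ‖x‖) ^ m := by gcongr; linarith
          _ ≤ _ := le_self_pow₀ h1 (by omega))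
    calc ‖x‖ ^ k * _ ≤ (1 + ‖x‖) ^ k * (n.factorial * Real.exp (-(‖x‖ ^ 2 / 4)) *
          ((1 + C) * (1 + ‖x‖) ^ m) ^ n) := by
          gcongr
          · linarith
          · exact h1
      _ = n.factorial * (1 + C) ^ n * ((1 + ‖x‖) ^ (k + m * n) * Real.exp (-(‖x‖ ^ 2 / 4))) := by
          rw [mul_pow, ← pow_mul, pow_add]; ring
      _ ≤ _ := mul_le_mul_of_nonneg_left (pow_mul_exp_neg_sq_le _ _ (norm_nonneg x))
          (by positivity)

theorem gauss0_apply (z : E3) : gauss0 z = Real.exp (-(‖z‖ ^ 2 / 4)) := rfl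

theorem integral_gauss0_pos : 0 < ∫ z, gauss0 z := by
  have := GaussianFourier.integral_rexp_neg_mul_sq_norm (V := E3) (b := 1 / 4) (by norm_num)
  have e : ∀ z : E3, gauss0 z = Real.exp (-(1 / 4) * ‖z‖ ^ 2) := fun z => by
    rw [gauss0_apply]; congr 1; ring
  simp only [e]
  rw [this]
  positivity

/-- The heat kernel at time `1`. -/
noncomputable def gauss : 𝓢(E3, ℝ) := (∫ z, gauss0 z)⁻¹ • gauss0

theorem integral_gauss : ∫ z, gauss z = 1 := by
  have : ∀ z, gauss z = (∫ z, gauss0 z)⁻¹ * gauss0 z := fun z => rfl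
  simp only [this]
  rw [integral_const_mul, inv_mul_cancel₀ integral_gauss0_pos.ne']

/-- The kernels `k` for which `s^{-(n+3)/2} k(z / √s)` solves the heat equation. -/
def IsHeatKernel (n : ℕ) (k : 𝓢(E3, ℝ)) : Prop :=
  ∀ y, (n + 3 : ℝ) * k y + fderiv ℝ k y y = -2 * ∑ j : Fin 3, (∂_{ej j} (∂_{ej j} k)) y

theorem fderiv_gauss0 (y v : E3) : fderiv ℝ gauss0 y v = -(1 / 2) * inner ℝ y v * gauss0 y := by
  have h1 : HasFDerivAt (fun z : E3 => -(‖z‖ ^ 2 / 4)) (-(1 / 4 : ℝ) • (2 • innerSL ℝ y)) y := by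
    have := ((hasStrictFDerivAt_norm_sq y).hasFDerivAt).const_mul (-(1 / 4 : ℝ))
    refine this.congr_of_eventuallyEq (Eventually.of_forall fun z => ?_)
    simp only; ring
  have h2 := h1.exp
  have : HasFDerivAt gauss0 _ y := h2
  rw [this.fderiv]
  simp [gauss0_apply]
  ring

/-- From `∇ g = -(y/2) g` both sides equal `(3 - |y|²/2) g`; the normalizing factor plays no role.
-/
theorem isHeatKernel_gauss : IsHeatKernel 0 gauss := by
  have key : ∀ y, 3 * gauss0 y + fderiv ℝ gauss0 y y =
      -2 * ∑ j : Fin 3, (∂_{ej j} (∂_{ej j} gauss0)) y := by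
    intro y
    have h1 : ∀ j : Fin 3, ∀ z, (∂_{ej j} gauss0) z = -(1 / 2) * z j * gauss0 z := by
      intro j z
      rw [SchwartzMap.lineDerivOp_apply_eq_fderiv, fderiv_gauss0]
      simp [EuclideanSpace.inner_single_right]
    have h2 : ∀ j : Fin 3, (∂_{ej j} (∂_{ej j} gauss0)) y =
        -(1 / 2) * gauss0 y + (1 / 4) * (y j) ^ 2 * gauss0 y := by
      intro j
      rw [SchwartzMap.lineDerivOp_apply_eq_fderiv]
      have e : ((∂_{ej j} gauss0 : 𝓢(E3, ℝ)) : E3 → ℝ) =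
        fun z => -(1 / 2) * (EuclideanSpace.proj j : E3 →L[ℝ] ℝ) z * gauss0 z := funext (h1 j)
      rw [e]
      have d1 : HasFDerivAt (fun z : E3 => -(1 / 2) * (EuclideanSpace.proj j : E3 →L[ℝ] ℝ) z)
          (-(1 / 2 : ℝ) • (EuclideanSpace.proj j : E3 →L[ℝ] ℝ)) y :=
        ((EuclideanSpace.proj j : E3 →L[ℝ] ℝ).hasFDerivAt).const_mul _
      have d2 : HasFDerivAt (fun z : E3 =>
          -(1 / 2) * (EuclideanSpace.proj j : E3 →L[ℝ] ℝ) z * gauss0 z) _ y := d1.mul (gauss0.differentiableAt (x := y)).hasFDerivAt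
      rw [d2.fderiv]
      simp [fderiv_gauss0, EuclideanSpace.inner_single_right]
      ring
    simp only [h2, fderiv_gauss0, real_inner_self_eq_norm_sq, EuclideanSpace.norm_sq_eq,
      Fin.sum_univ_three, Real.norm_eq_abs, sq_abs]
    ring
  intro y
  set c := (∫ z, gauss0 z)⁻¹
  have e1 : gauss = c • gauss0 := rfl
  have e2 : ∀ v : E3, (∂_{v} gauss : 𝓢(E3, ℝ)) = c • ∂_{v} gauss0 := fun v => by
    rw [e1, lineDerivOp_smul]
  have e3 : fderiv ℝ gauss y y = c * fderiv ℝ gauss0 y y := by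
    rw [← SchwartzMap.lineDerivOp_apply_eq_fderiv, e2, ← SchwartzMap.lineDerivOp_apply_eq_fderiv]
    rfl
  rw [e3]
  simp only [e2, lineDerivOp_smul]
  simp only [e1, smul_apply, smul_eq_mul, ← Finset.mul_sum]
  have := key y
  push_cast
  linear_combination c * this

/-- Differentiating the defining identity along `e_i`, the Euler field `y · ∇` contributes one
additional copy of `∂_i k`, which raises `n` by one. -/
theorem IsHeatKernel.lineDeriv {n : ℕ} {k : 𝓢(E3, ℝ)} (hk : IsHeatKernel n k) (i : Fin 3) :
    IsHeatKernel (n + 1) (∂_{ej i} k) := by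
  intro y
  have comm : ∀ (f : 𝓢(E3, ℝ)) (v w : E3), (∂_{v} (∂_{w} f) : 𝓢(E3, ℝ)) = ∂_{w} (∂_{v} f) := by
    intro f v w
    ext z
    have h := (f.contDiffAt (n := 2) (x := z)).isSymmSndFDerivAt (by simp)
    have e : ∀ a b : E3, (∂_{a} (∂_{b} f)) z = fderiv ℝ (fderiv ℝ f) z a b := by
      intro a b
      rw [SchwartzMap.lineDerivOp_apply_eq_fderiv]
      have : ((∂_{b} f : 𝓢(E3, ℝ)) : E3 → ℝ) = fun z => fderiv ℝ f z b := rfl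
      have hd : DifferentiableAt ℝ (fderiv ℝ f) z :=
        (SchwartzMap.fderivCLM ℝ E3 ℝ f).differentiableAt
      rw [this, fderiv_clm_apply hd (differentiableAt_const _)]
      simp
    rw [e, e]; exact h v w
  have hfun : (fun y => (n + 3 : ℝ) * k y + fderiv ℝ k y y) =
      fun y => -2 * ∑ j : Fin 3, (∂_{ej j} (∂_{ej j} k)) y := funext hk
  have d1 : HasFDerivAt (fun y => (n + 3 : ℝ) * k y + fderiv ℝ k y y)
      ((n + 3 : ℝ) • fderiv ℝ k y + ((fderiv ℝ k y).comp (ContinuousLinearMap.id ℝ E3) +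
        (fderiv ℝ (fderiv ℝ k) y).flip y)) y := by
    refine (k.differentiableAt.hasFDerivAt.const_mul _).add ?_
    exact ((SchwartzMap.fderivCLM ℝ E3 ℝ k).differentiableAt.hasFDerivAt).clm_apply
      (hasFDerivAt_id y)
  have d2 : HasFDerivAt (fun y => -2 * ∑ j : Fin 3, (∂_{ej j} (∂_{ej j} k)) y)
      ((-2 : ℝ) • ∑ j : Fin 3, fderiv ℝ (∂_{ej j} (∂_{ej j} k) : 𝓢(E3, ℝ)) y) y := by
    refine HasFDerivAt.const_mul (HasFDerivAt.fun_sum fun j _ => ?_) _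
    exact (SchwartzMap.differentiableAt _).hasFDerivAt
  rw [hfun] at d1
  have h1 := congrArg (fun T : E3 →L[ℝ] ℝ => T (ej i)) (d1.unique d2)
  simp only [add_apply, smul_apply, ContinuousLinearMap.comp_id, ContinuousLinearMap.flip_apply,
    sum_apply, smul_eq_mul] at h1
  have h2 : fderiv ℝ (fderiv ℝ k) y (ej i) y = fderiv ℝ (∂_{ej i} k : 𝓢(E3, ℝ)) y y := by
    have h := (k.contDiffAt (n := 2) (x := y)).isSymmSndFDerivAt (by simp)
    have : ((∂_{ej i} k : 𝓢(E3, ℝ)) : E3 → ℝ) = fun z => fderiv ℝ k z (ej i) := rfl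
    have hd : DifferentiableAt ℝ (fderiv ℝ k) y :=
      (SchwartzMap.fderivCLM ℝ E3 ℝ k).differentiableAt
    rw [this, fderiv_clm_apply hd (differentiableAt_const _)]
    simpa using h (ej i) y
  have h3 : ∀ j : Fin 3, fderiv ℝ (∂_{ej j} (∂_{ej j} k) : 𝓢(E3, ℝ)) y (ej i) =
      (∂_{ej j} (∂_{ej j} (∂_{ej i} k))) y := by
    intro j
    rw [← SchwartzMap.lineDerivOp_apply_eq_fderiv, comm _ (ej i) (ej j), comm k (ej i) (ej j)]
  simp only [h3] at h1
  rw [h2] at h1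
  rw [← h1, SchwartzMap.lineDerivOp_apply_eq_fderiv]
  push_cast
  ring

end Kernels

/-! ### Translation actions, averages of translates, and the heat equation for averages -/

/-- A strongly continuous isometric linear action of the translation group `ℝ³`. -/
class TransRep (V : Type*) [NormedAddCommGroup V] [NormedSpace ℝ V] where
  /-- the translation by a vector -/
  act : E3 → V →L[ℝ] V
  act_zero : ∀ v, act 0 v = v
  act_add : ∀ h k v, act (h + k) v = act h (act k v)
  norm_act : ∀ h v, ‖act h v‖ = ‖v‖
  continuous_act : ∀ v, Continuous fun h => act h v

section Rep

variable {V V' : Type*} [NormedAddCommGroup V] [NormedSpace ℝ V] [TransRep V]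
  [NormedAddCommGroup V'] [NormedSpace ℝ V'] [TransRep V']

/-- The translation by `h`. -/
noncomputable def tr (h : E3) : V →L[ℝ] V := TransRep.act h

theorem tr_zero (v : V) : tr 0 v = v := TransRep.act_zero v

theorem tr_add (h k : E3) (v : V) : tr (h + k) v = tr h (tr k v) := TransRep.act_add h k v

theorem norm_tr (h : E3) (v : V) : ‖tr h v‖ = ‖v‖ := TransRep.norm_act h v

theorem continuous_tr (v : V) : Continuous fun h => tr h v := TransRep.continuous_act v

theorem continuous_tr_uncurry : Continuous fun p : E3 × V => tr p.1 p.2 := by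
  rw [continuous_iff_continuousAt]
  rintro ⟨h, v⟩
  rw [ContinuousAt, tendsto_iff_norm_sub_tendsto_zero]
  have hlim : Tendsto (fun p : E3 × V => ‖p.2 - v‖ + ‖tr p.1 v - tr h v‖) (𝓝 (h, v)) (𝓝 0) := by
    have c : Continuous fun p : E3 × V => ‖p.2 - v‖ + ‖tr p.1 v - tr h v‖ := by
      have := (continuous_tr v).comp (continuous_fst (X := E3) (Y := V))
      simp only [Function.comp_def] at this
      fun_prop
    exact c.tendsto' _ _ (by simp)
  refine squeeze_zero (fun _ => norm_nonneg _) (fun p => ?_) hlim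
  have : tr p.1 p.2 - tr h v = tr p.1 (p.2 - v) + (tr p.1 v - tr h v) := by
    rw [map_sub]; abel
  rw [this]
  refine (norm_add_le _ _).trans ?_
  rw [norm_tr]

noncomputable instance : TransRep (Fin 3 → V) where
  act h := ContinuousLinearMap.pi fun i => (tr h).comp (ContinuousLinearMap.proj i)
  act_zero v := by ext i; simp [tr_zero]
  act_add h k v := by ext i; simp [tr_add]
  norm_act h v := by
    simp only [Pi.norm_def, ContinuousLinearMap.coe_pi', ContinuousLinearMap.comp_apply,
      ContinuousLinearMap.proj_apply]
    congr 2
    funext i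
    exact NNReal.eq (norm_tr h (v i))
  continuous_act v := continuous_pi fun i => continuous_tr (v i)

theorem tr_pi_apply (h : E3) (v : Fin 3 → V) (i : Fin 3) : tr h v i = tr h (v i) := rfl

noncomputable instance : TransRep (V × V') where
  act h := (tr h).prodMap (tr h)
  act_zero v := by ext <;> simp [tr_zero]
  act_add h k v := by ext <;> simp [tr_add]
  norm_act h v := by simp [Prod.norm_def, norm_tr]
  continuous_act v := (continuous_tr v.1).prodMk (continuous_tr v.2)

theorem tr_prod (h : E3) (v : V × V') : tr h v = (tr h v.1, tr h v.2) := rfl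

/-- `g` is the gradient of `v` with respect to translations. -/
def HasTD (v : V) (g : Fin 3 → V) : Prop :=
  ∀ h : E3, HasFDerivAt (fun h => tr h v)
    (∑ j : Fin 3, (EuclideanSpace.proj j : E3 →L[ℝ] ℝ).smulRight (tr h (g j))) h

/-- By the group law `τ_k = τ_h τ_{k-h}`, differentiability at the origin propagates to every `h`.
-/
theorem HasTD.of_zero {v : V} {g : Fin 3 → V} (hv : HasFDerivAt (fun h => tr h v)
    (∑ j : Fin 3, (EuclideanSpace.proj j : E3 →L[ℝ] ℝ).smulRight (g j)) 0) : HasTD v g := by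
  intro h
  have e : (fun k => tr k v) = fun k => tr h (tr (k - h) v) := by
    funext k; rw [← tr_add, add_sub_cancel]
  rw [e]
  have h1 : HasFDerivAt (fun k : E3 => tr (k - h) v)
      (∑ j : Fin 3, (EuclideanSpace.proj j : E3 →L[ℝ] ℝ).smulRight (g j)) h := by
    have := HasFDerivAt.comp (f := fun k : E3 => k - h) (g := fun k => tr k v) h
      (by rwa [sub_self]) ((hasFDerivAt_id h).sub_const h)
    rwa [ContinuousLinearMap.comp_id] at this
  refine ((tr h).hasFDerivAt.comp h h1).congr_fderiv ?_
  ext l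
  simp [map_sum]

theorem HasTD.add {v w : V} {g g' : Fin 3 → V} (h : HasTD v g) (h' : HasTD w g') :
    HasTD (v + w) (g + g') := by
  intro k
  have := (h k).add (h' k)
  refine (this.congr_of_eventuallyEq (Eventually.of_forall fun x => by simp)).congr_fderiv ?_
  ext l; simp [Finset.sum_add_distrib]

theorem HasTD.smul {v : V} {g : Fin 3 → V} (c : ℝ) (h : HasTD v g) : HasTD (c • v) (c • g) := by
  intro k
  have := (h k).const_smul c
  refine (this.congr_of_eventuallyEq (Eventually.of_forall fun x => by simp)).congr_fderiv ?_
  ext l; simp [Finset.smul_sum, smul_comm c]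

theorem HasTD.map {v : V} {g : Fin 3 → V} (h : HasTD v g) (Λ : V →L[ℝ] V')
    (hΛ : ∀ k u, Λ (tr k u) = tr k (Λ u)) : HasTD (Λ v) fun j => Λ (g j) := by
  intro k
  have := Λ.hasFDerivAt.comp k (h k)
  refine (this.congr_of_eventuallyEq (Eventually.of_forall fun x => by simp [hΛ])).congr_fderiv ?_
  ext l; simp [map_sum, hΛ]

/-- The weight `(1 + |z|)^{-4}`. -/
noncomputable def wt (z : E3) : ℝ := ((1 + ‖z‖) ^ 4)⁻¹

theorem wt_pos (z : E3) : 0 < wt z := by unfold wt; positivity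

theorem continuous_wt : Continuous wt := by
  unfold wt
  exact Continuous.inv₀ (by fun_prop) fun z => by positivity

/-- The decay exponent four exceeds the dimension three. -/
theorem integrable_wt : Integrable wt := by
  have := integrable_one_add_norm (E := E3) (μ := volume) (r := 4) (by
    simp only [finrank_euclideanSpace_fin]; norm_num)
  refine this.congr (Eventually.of_forall fun z => ?_)
  simp only [wt]
  rw [Real.rpow_neg (by positivity)]
  norm_cast

theorem wt_mul_wker (k : 𝓢(E3, ℝ)) (h z : E3) : wt z * wker k h z = k (z - h) := by
  rw [wt, wker_apply, ← mul_assoc, inv_mul_cancel₀ (by positivity), one_mul]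

/-- Bounded continuous functions on `ℝ³`. -/
abbrev Bd : Type := BoundedContinuousFunction E3 ℝ

theorem norm_wt_mul_le (b : Bd) (z : E3) : ‖wt z * b z‖ ≤ wt z * ‖b‖ := by
  rw [norm_mul, Real.norm_of_nonneg (wt_pos z).le]
  exact mul_le_mul_of_nonneg_left (b.norm_coe_le_norm z) (wt_pos z).le

theorem integrable_wt_mul (b : Bd) : Integrable fun z => wt z * b z :=
  (integrable_wt.mul_const ‖b‖).mono' ((continuous_wt.mul b.continuous).aestronglyMeasurable)
    (Eventually.of_forall (norm_wt_mul_le b))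

variable [CompleteSpace V] [CompleteSpace V']

theorem continuous_cv_integrand (l : ℝ) (b : Bd) (v : V) :
    Continuous fun z => (wt z * b z) • tr (l • z) v :=
  (continuous_wt.mul b.continuous).smul ((continuous_tr v).comp (continuous_const_smul l))

theorem norm_cv_integrand_le (l : ℝ) (b : Bd) (v : V) (z : E3) :
    ‖(wt z * b z) • tr (l • z) v‖ ≤ wt z * (‖b‖ * ‖v‖) := by
  rw [norm_smul, norm_tr, ← mul_assoc]
  exact mul_le_mul_of_nonneg_right (norm_wt_mul_le b z) (norm_nonneg v)

theorem integrable_cv (l : ℝ) (b : Bd) (v : V) :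
    Integrable fun z => (wt z * b z) • tr (l • z) v :=
  (integrable_wt.mul_const (‖b‖ * ‖v‖)).mono' (continuous_cv_integrand l b v).aestronglyMeasurable
    (Eventually.of_forall (norm_cv_integrand_le l b v))

/-- The averages `∫ (1+|z|)^{-4} b(z) τ_{λz} v dz` of translates. -/
noncomputable def cv (l : ℝ) : Bd →L[ℝ] V →L[ℝ] V :=
  LinearMap.mkContinuous₂
    (LinearMap.mk₂ ℝ (fun (b : Bd) (v : V) => ∫ z, (wt z * b z) • tr (l • z) v)
      (fun b b' v => by
        rw [← integral_add (integrable_cv l b v) (integrable_cv l b' v)]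
        simp only [BoundedContinuousFunction.coe_add, Pi.add_apply, mul_add, add_smul])
      (fun c b v => by
        rw [← integral_smul]
        simp only [BoundedContinuousFunction.coe_smul, smul_eq_mul, smul_smul, mul_left_comm])
      (fun b v v' => by
        rw [← integral_add (integrable_cv l b v) (integrable_cv l b v')]
        simp only [map_add, smul_add])
      (fun c b v => by
        rw [← integral_smul]
        simp only [map_smul, smul_comm c]))
    (∫ z, wt z) (fun b v => by
      rw [mul_assoc, ← integral_mul_const]
      exact norm_integral_le_of_norm_le (integrable_wt.mul_const _)
        (Eventually.of_forall (norm_cv_integrand_le l b v)))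

theorem cv_apply (l : ℝ) (b : Bd) (v : V) : cv l b v = ∫ z, (wt z * b z) • tr (l • z) v := rfl

theorem integral_wt_nonneg : 0 ≤ ∫ z, wt z := integral_nonneg fun z => (wt_pos z).le

theorem norm_cv_le (l : ℝ) (b : Bd) (v : V) : ‖cv l b v‖ ≤ (∫ z, wt z) * ‖b‖ * ‖v‖ := by
  have h : ‖(cv l : Bd →L[ℝ] V →L[ℝ] V)‖ ≤ ∫ z, wt z :=
    LinearMap.mkContinuous₂_norm_le _ integral_wt_nonneg _
  refine ((cv l).le_opNorm₂ b v).trans ?_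
  gcongr

theorem continuous_cv (b : Bd) (v : V) : Continuous fun l : ℝ => cv l b v := by
  simp only [cv_apply]
  refine continuous_of_dominated (fun l => (continuous_cv_integrand l b v).aestronglyMeasurable)
    (fun l => Eventually.of_forall (norm_cv_integrand_le l b v)) (integrable_wt.mul_const _)
    (Eventually.of_forall fun z => ?_)
  exact continuous_const.smul ((continuous_tr v).comp (continuous_id.smul continuous_const))

theorem continuous_cv_uncurry (b : Bd) : Continuous fun p : ℝ × V => cv p.1 b p.2 := by
  simp only [cv_apply]
  rw [continuous_iff_continuousAt]
  rintro ⟨l, v⟩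
  refine continuousAt_of_dominated (bound := fun z => wt z * (‖b‖ * (‖v‖ + 1)))
    (Eventually.of_forall fun p => (continuous_cv_integrand p.1 b p.2).aestronglyMeasurable)
    ?_ (integrable_wt.mul_const _) (Eventually.of_forall fun z => ?_)
  · have : ∀ᶠ p : ℝ × V in 𝓝 (l, v), ‖p.2‖ < ‖v‖ + 1 :=
      continuous_snd.norm.continuousAt.eventually (gt_mem_nhds (by simp))
    filter_upwards [this] with p hp
    refine Eventually.of_forall fun z => (norm_cv_integrand_le p.1 b p.2 z).trans ?_
    have := (wt_pos z).le
    gcongr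
  · have : Continuous fun p : ℝ × V => tr (p.1 • z) p.2 :=
      continuous_tr_uncurry.comp ((continuous_fst.smul continuous_const).prodMk continuous_snd)
    exact (continuous_const.smul this).continuousAt

/-- Averages are integrals of translates, so every continuous linear map commuting with translations
commutes with them. It is applied to coordinates, to embeddings, and to translations and averages
themselves. -/
theorem map_cv (Λ : V →L[ℝ] V') (hΛ : ∀ k u, Λ (tr k u) = tr k (Λ u)) (l : ℝ) (b : Bd) (v : V) :
    Λ (cv l b v) = cv l b (Λ v) := by
  rw [cv_apply, cv_apply, ← Λ.integral_comp_comm (integrable_cv l b v)]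
  simp only [map_smul, hΛ]

theorem tr_cv (h : E3) (l : ℝ) (b : Bd) (v : V) : tr h (cv l b v) = cv l b (tr h v) :=
  map_cv (tr h) (fun k u => by rw [← tr_add, ← tr_add, add_comm]) l b v

theorem cv_wker (l : ℝ) (k : 𝓢(E3, ℝ)) (h : E3) (v : V) :
    cv l (wker k h) v = ∫ z, k (z - h) • tr (l • z) v := by
  simp only [cv_apply, wt_mul_wker]

/-- The substitution `z ↦ z + h'` moves the translation from the vector to the kernel. Everything
later about derivatives of averages and about parabolic translation rests on this. -/
theorem tr_cv_wker (l : ℝ) (k : 𝓢(E3, ℝ)) (h h' : E3) (v : V) :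
    tr (l • h') (cv l (wker k h) v) = cv l (wker k (h + h')) v := by
  rw [tr_cv, cv_wker, cv_wker, ← integral_add_right_eq_self (fun z => k (z - (h + h')) • tr (l • z) v) h']
  refine integral_congr_ae (Eventually.of_forall fun z => ?_)
  simp only
  rw [smul_add, tr_add, show z + h' - (h + h') = z - h by abel]

/-- Width `λ = 0` is allowed, and unit mass makes it the identity; this encodes the initial
condition of the heat flow. -/
theorem cv_zero_gauss (v : V) : cv 0 (wker gauss 0) v = v := by
  rw [cv_wker]
  simp only [sub_zero, zero_smul, tr_zero]
  rw [integral_smul_const, integral_gauss, one_smul]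

/-- Translating the average by `h` recentres the kernel at `h / l`, so the derivative falls on `k`
with the factor `-1/l`; no regularity of `v` is needed. -/
theorem hasTD_cv {l : ℝ} (hl : l ≠ 0) (k : 𝓢(E3, ℝ)) (v : V) :
    HasTD (cv l (wker k 0) v) fun j => -l⁻¹ • cv l (wker (∂_{ej j} k) 0) v := by
  refine HasTD.of_zero ?_
  have e : (fun h => tr h (cv l (wker k 0) v)) = fun h => cv l (wker k (l⁻¹ • h)) v := by
    funext h
    conv_lhs => rw [show h = l • (l⁻¹ • h) by rw [smul_smul, mul_inv_cancel₀ hl, one_smul]]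
    rw [tr_cv_wker, zero_add]
  rw [e]
  have d0 : HasFDerivAt (fun h : E3 => l⁻¹ • h) (l⁻¹ • ContinuousLinearMap.id ℝ E3) 0 :=
    (hasFDerivAt_id 0).const_smul l⁻¹
  have d1 := HasFDerivAt.comp (g := wker k) (0 : E3) (hasFDerivAt_wker k (l⁻¹ • 0)) d0
  have d2 := (((cv l : Bd →L[ℝ] V →L[ℝ] V).flip v).hasFDerivAt).comp (0 : E3) d1
  refine d2.congr_fderiv ?_
  ext h
  have hneg : ∀ j, wker (-∂_{ej j} k) 0 = -wker (∂_{ej j} k) 0 := fun j => by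
    ext z; simp [wker_apply]
  simp only [smul_zero, hneg, ContinuousLinearMap.comp_apply, sum_apply,
    ContinuousLinearMap.smulRight_apply, map_sum, map_smul, map_neg, smul_apply,
    ContinuousLinearMap.id_apply, ContinuousLinearMap.flip_apply, PiLp.proj_apply, smul_neg, smul_smul, neg_smul, mul_comm, Finset.smul_sum]

/-- The Laplacian of a Schwartz function. -/
noncomputable def slap (k : 𝓢(E3, ℝ)) : 𝓢(E3, ℝ) := ∑ j : Fin 3, ∂_{ej j} (∂_{ej j} k)

/-- The chain rule for the self-similar profile produces `(n + 3) k + y · ∇k` at the rescaled point,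
which `IsHeatKernel` replaces by `-2 Δk`. -/
theorem hasDerivAt_heat_kernel {n : ℕ} {k : 𝓢(E3, ℝ)} (hk : IsHeatKernel n k) (z : E3) {s : ℝ}
    (hs : 0 < s) : HasDerivAt (fun s : ℝ => s ^ (-((n : ℝ) + 3) / 2) * k (s ^ (-(1 / 2) : ℝ) • z))
      (s ^ (-((n : ℝ) + 3) / 2 - 1) * slap k (s ^ (-(1 / 2) : ℝ) • z)) s := by
  have d1 := Real.hasDerivAt_rpow_const (x := s) (p := -((n : ℝ) + 3) / 2) (Or.inl hs.ne')
  have d2 : HasDerivAt (fun s : ℝ => s ^ (-(1 / 2) : ℝ) • z)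
      ((-(1 / 2) * s ^ (-(1 / 2) - 1 : ℝ)) • z) s :=
    (Real.hasDerivAt_rpow_const (x := s) (p := -(1 / 2)) (Or.inl hs.ne')).smul_const z
  have d3 := (k.differentiableAt (x := s ^ (-(1 / 2) : ℝ) • z)).hasFDerivAt.comp_hasDerivAt s d2
  refine (d1.mul d3).congr_deriv ?_
  have h1 := hk (s ^ (-(1 / 2) : ℝ) • z)
  have h2 : (-(1 / 2) * s ^ (-(1 / 2) - 1 : ℝ)) • z = (-(1 / 2) * s⁻¹) • (s ^ (-(1 / 2) : ℝ) • z) := by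
    rw [smul_smul, Real.rpow_sub_one hs.ne']; congr 1; field_simp
  rw [h2, map_smul, Real.rpow_sub_one hs.ne', slap]
  simp only [sum_apply, smul_eq_mul, Function.comp_apply]
  field_simp
  linear_combination -h1

/-- Undoing the scaling in `z` freezes the translations and puts the whole dependence on `s` into
the kernel, where it can be differentiated for arbitrary `v`. -/
theorem heat_cv_eq {n : ℕ} (k : 𝓢(E3, ℝ)) (v : V) {s : ℝ} (hs : 0 < s) :
    s ^ (-(n : ℝ) / 2) • cv √s (wker k 0) v =
      ∫ z, (s ^ (-((n : ℝ) + 3) / 2) * k (s ^ (-(1 / 2) : ℝ) • z)) • tr z v := by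
  have h0 : 0 < √s := Real.sqrt_pos.2 hs
  have hinv : s ^ (-(1 / 2) : ℝ) = (√s)⁻¹ := by
    rw [Real.rpow_neg hs.le, Real.sqrt_eq_rpow]
  have h1 := Measure.integral_comp_inv_smul_of_nonneg (volume : Measure E3)
    (fun z => k z • tr (√s • z) v) h0.le
  rw [finrank_euclideanSpace_fin] at h1
  have h2 : ∀ z : E3, √s • ((√s)⁻¹ • z) = z := fun z => by
    rw [smul_smul, mul_inv_cancel₀ h0.ne', one_smul]
  simp only [h2] at h1
  rw [cv_wker]
  simp only [sub_zero, hinv, mul_smul]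
  rw [integral_smul, h1, smul_smul]
  congr 1
  have h3 : √s ^ 3 = s ^ (3 / 2 : ℝ) := by
    rw [Real.sqrt_eq_rpow, ← Real.rpow_natCast, ← Real.rpow_mul hs.le]; norm_num
  rw [h3, ← Real.rpow_add hs]
  congr 1; ring

/-- Differentiation under the integral. For `s/2 < r < 1` the dilation by `r^{-1/2}` enlarges `z`,
so the decay of the kernel at the dilated point is dominated by the weight at `z`; this is where `s
< 1` is used. -/
theorem hasDerivAt_heat {n : ℕ} {k : 𝓢(E3, ℝ)} (hk : IsHeatKernel n k) (v : V) {s : ℝ}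
    (hs : s ∈ Ioo (0 : ℝ) 1) :
    HasDerivAt (fun s : ℝ => s ^ (-(n : ℝ) / 2) • cv √s (wker k 0) v)
      (s ^ (-((n + 2 : ℕ) : ℝ) / 2) • cv √s (wker (slap k) 0) v) s := by
  rw [heat_cv_eq (n := n + 2) (slap k) v hs.1]
  have hev : (fun s : ℝ => s ^ (-(n : ℝ) / 2) • cv √s (wker k 0) v) =ᶠ[𝓝 s]
      fun s => ∫ z, (s ^ (-((n : ℝ) + 3) / 2) * k (s ^ (-(1 / 2) : ℝ) • z)) • tr z v := by
    filter_upwards [lt_mem_nhds hs.1] with r hr using heat_cv_eq k v hr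
  refine HasDerivAt.congr_of_eventuallyEq ?_ hev
  obtain ⟨C, hC, hb⟩ := exists_one_add_norm_pow_mul_le (slap k)
  have hexp : ∀ r : ℝ, r ^ (-(((n + 2 : ℕ) : ℝ) + 3) / 2) = r ^ (-((n : ℝ) + 3) / 2 - 1) := by
    intro r; congr 1; push_cast; ring
  simp only [hexp]
  have hcont : ∀ (k : 𝓢(E3, ℝ)) (c d : ℝ), Continuous fun z : E3 => (c * k (d • z)) • tr z v :=
    fun k c d => (continuous_const.mul (k.continuous.comp (continuous_const_smul d))).smul
      (continuous_tr v)
  have hI : Integrable (fun z => (s ^ (-((n : ℝ) + 3) / 2) * k (s ^ (-(1 / 2) : ℝ) • z)) • tr z v)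
      := by
    have h1 : Integrable fun z => k (s ^ (-(1 / 2) : ℝ) • z) :=
      (k.integrable (μ := volume)).comp_smul (Real.rpow_pos_of_pos hs.1 _).ne'
    refine ((h1.const_mul (s ^ (-((n : ℝ) + 3) / 2))).norm.mul_const ‖v‖).mono'
      (hcont _ _ _).aestronglyMeasurable (Eventually.of_forall fun z => ?_)
    rw [norm_smul, norm_tr]
  refine (hasDerivAt_integral_of_dominated_loc_of_deriv_le
    (F := fun (s : ℝ) z => (s ^ (-((n : ℝ) + 3) / 2) * k (s ^ (-(1 / 2) : ℝ) • z)) • tr z v)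
    (F' := fun (s : ℝ) z =>
      (s ^ (-((n : ℝ) + 3) / 2 - 1) * slap k (s ^ (-(1 / 2) : ℝ) • z)) • tr z v)
    (s := Ioo (s / 2) 1) (bound := fun z => (s / 2) ^ (-((n : ℝ) + 3) / 2 - 1) * C * wt z * ‖v‖)
    (Ioo_mem_nhds (by linarith [hs.1]) hs.2)
    (Eventually.of_forall fun r => (hcont _ _ _).aestronglyMeasurable) hI
    (hcont _ _ _).aestronglyMeasurable (Eventually.of_forall fun z r hr => ?_)
    ((integrable_wt.const_mul _).mul_const _) (Eventually.of_forall fun z r hr => ?_)).2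
  · have hs2 : 0 < s / 2 := by linarith [hs.1]
    have hr0 : 0 < r := hs2.trans hr.1
    rw [norm_smul, norm_tr, norm_mul, Real.norm_of_nonneg (Real.rpow_nonneg hr0.le _), mul_assoc _ C]
    have h1 : r ^ (-((n : ℝ) + 3) / 2 - 1) ≤ (s / 2) ^ (-((n : ℝ) + 3) / 2 - 1) := by
      refine Real.rpow_le_rpow_of_nonpos hs2 hr.1.le ?_
      have : (0 : ℝ) ≤ n := n.cast_nonneg
      linarith
    have h2 : ‖slap k (r ^ (-(1 / 2) : ℝ) • z)‖ ≤ C * wt z := by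
      have h3 := hb (r ^ (-(1 / 2) : ℝ) • z)
      have h4 : 1 ≤ r ^ (-(1 / 2) : ℝ) :=
        Real.one_le_rpow_of_pos_of_le_one_of_nonpos hr0 hr.2.le (by norm_num)
      have h5 : ‖z‖ ≤ ‖r ^ (-(1 / 2) : ℝ) • z‖ := by
        rw [norm_smul, Real.norm_of_nonneg (by positivity)]
        nlinarith [norm_nonneg z]
      rw [wt, ← div_eq_mul_inv, le_div_iff₀ (by positivity), mul_comm]
      refine le_trans ?_ h3
      gcongr
    have := Real.rpow_nonneg hs2.le (-((n : ℝ) + 3) / 2 - 1)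
    gcongr
  · have hs2 : 0 < s / 2 := by linarith [hs.1]
    exact (hasDerivAt_heat_kernel hk z (hs2.trans hr.1)).smul_const _

end Rep

/-! ### Translations on `L^p`, `p < ∞` -/

section LpRep

variable {F : Type*} [NormedAddCommGroup F] [InnerProductSpace ℝ F]

instance fact_one_le_six : Fact ((1 : ℝ≥0∞) ≤ 6) := ⟨by norm_num⟩
instance fact_one_le_three : Fact ((1 : ℝ≥0∞) ≤ 3) := ⟨by norm_num⟩
instance fact_one_le_three_halves : Fact ((1 : ℝ≥0∞) ≤ 3 / 2) :=
  ⟨by rw [ENNReal.le_div_iff_mul_le (by simp) (by simp)]; norm_num⟩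
instance fact_two_ne_top : Fact ((2 : ℝ≥0∞) ≠ ⊤) := ⟨by simp⟩
instance fact_six_ne_top : Fact ((6 : ℝ≥0∞) ≠ ⊤) := ⟨by simp⟩
instance fact_three_ne_top : Fact ((3 : ℝ≥0∞) ≠ ⊤) := ⟨by simp⟩
instance fact_three_halves_ne_top : Fact ((3 / 2 : ℝ≥0∞) ≠ ⊤) :=
  ⟨ENNReal.div_ne_top (by simp) (by simp)⟩

variable {p : ℝ≥0∞} [Fact (1 ≤ p)] [Fact (p ≠ ⊤)]

theorem measurePreserving_shift (h : E3) :
    MeasurePreserving (fun x : E3 => x + h) volume volume :=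
  measurePreserving_add_right volume h

noncomputable instance : TransRep (Lp F p (volume : Measure E3)) where
  act h := (Lp.compMeasurePreservingₗᵢ ℝ (fun x : E3 => x + h)
    (measurePreserving_shift h)).toContinuousLinearMap
  act_zero v := by
    refine Lp.ext ((Lp.coeFn_compMeasurePreserving v (measurePreserving_shift 0)).trans ?_)
    exact Eventually.of_forall fun x => by simp
  act_add h k v := by
    refine Lp.ext ((Lp.coeFn_compMeasurePreserving v (measurePreserving_shift (h + k))).trans ?_)
    refine EventuallyEq.symm
      ((Lp.coeFn_compMeasurePreserving _ (measurePreserving_shift h)).trans ?_)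
    have h1 := (measurePreserving_shift h).quasiMeasurePreserving.ae_eq
      (Lp.coeFn_compMeasurePreserving v (measurePreserving_shift k))
    refine EventuallyEq.trans h1 ?_
    exact Eventually.of_forall fun x => by simp [add_assoc]
  norm_act h v := (Lp.compMeasurePreservingₗᵢ ℝ (fun x : E3 => x + h)
    (measurePreserving_shift h)).norm_map v
  continuous_act v := by
    let g : E3 → C(E3, E3) := fun h => ⟨fun x => x + h, by fun_prop⟩
    have hg : Continuous g := ContinuousMap.continuous_of_continuous_uncurry _ (by
      simp only [g, Function.uncurry_def, ContinuousMap.coe_mk]; fun_prop)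
    exact Continuous.compMeasurePreservingLp (f := fun _ : E3 => v) continuous_const hg
      (fun h => measurePreserving_shift h) (Fact.out)

theorem coeFn_tr (h : E3) (v : Lp F p (volume : Measure E3)) :
    ((tr h v : Lp F p (volume : Measure E3)) : E3 → F) =ᵐ[volume] fun x => v (x + h) :=
  Lp.coeFn_compMeasurePreserving v (measurePreserving_shift h)

end LpRep

/-! ### Test functions, pairings, and weak derivatives of translates -/

/-- Smooth compactly supported functions. -/
abbrev Test : Type := {φ : E3 → ℝ // ContDiff ℝ ∞ φ ∧ HasCompactSupport φ}

instance : CoeFun Test fun _ => E3 → ℝ := ⟨Subtype.val⟩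

namespace Test

/-- A smooth compactly supported function as a test function. -/
def mk (φ : E3 → ℝ) (h : ContDiff ℝ ∞ φ) (h' : HasCompactSupport φ) : Test := ⟨φ, h, h'⟩

theorem continuous (φ : Test) : Continuous φ := φ.2.1.continuous

/-- The partial derivative of a test function. -/
noncomputable def pd (j : Fin 3) (φ : Test) : Test :=
  ⟨YMHeat.pd j φ, contDiff_pd φ.2.1, hasCompactSupport_pd φ.2.2⟩

/-- The translate `φ(· - h)`. -/
noncomputable def shift (h : E3) (φ : Test) : Test :=
  ⟨fun x => φ (x - h), φ.2.1.comp (contDiff_id.sub contDiff_const),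
    φ.2.2.comp_homeomorph (Homeomorph.subRight h)⟩

/-- The Laplacian of a test function. -/
noncomputable def lap (φ : Test) : Test :=
  ⟨YMHeat.lap φ, by
    unfold YMHeat.lap
    exact ContDiff.sum fun l _ => contDiff_pd (contDiff_pd φ.2.1), by
    have h : YMHeat.lap (φ : E3 → ℝ) = fun x => ∑ l : Fin 3, YMHeat.pd l (YMHeat.pd l φ) x := rfl
    rw [h]
    simp only [Fin.sum_univ_three]
    exact ((hasCompactSupport_pd (hasCompactSupport_pd φ.2.2)).add
      (hasCompactSupport_pd (hasCompactSupport_pd φ.2.2))).add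
      (hasCompactSupport_pd (hasCompactSupport_pd φ.2.2))⟩

theorem lap_apply (φ : Test) (x : E3) : φ.lap x = ∑ l, (φ.pd l).pd l x := rfl

theorem memLp (φ : Test) (p : ℝ≥0∞) : MemLp φ p volume :=
  φ.continuous.memLp_of_hasCompactSupport φ.2.2

end Test

section Pairing

variable {F : Type*} [NormedAddCommGroup F] [InnerProductSpace ℝ F]
variable {p q : ℝ≥0∞} [Fact (1 ≤ p)] [Fact (1 ≤ q)]

theorem Lp.locallyIntegrable' (u : Lp F p (volume : Measure E3)) :
    LocallyIntegrable u volume := (Lp.memLp u).locallyIntegrable Fact.out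

variable [CompleteSpace F]

theorem exists_pairing (φ : Test) :
    ∃ Λ : Lp F p (volume : Measure E3) →L[ℝ] F, ∀ u, Λ u = ∫ x, φ x • u x := by
  have hp : (1 : ℝ≥0∞) ≤ p := Fact.out
  have : ENNReal.HolderConjugate p p.conjExponent := ENNReal.HolderConjugate.conjExponent hp
  have : ENNReal.HolderConjugate p.conjExponent p := ENNReal.HolderConjugate.symm
  have : Fact (1 ≤ p.conjExponent) := ⟨ENNReal.HolderConjugate.one_le p.conjExponent p⟩
  refine ⟨(ContinuousLinearMap.lsmul ℝ ℝ).lpPairing volume p.conjExponent p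
    ((φ.memLp p.conjExponent).toLp φ), fun u => ?_⟩
  rw [ContinuousLinearMap.lpPairing_eq_integral]
  refine integral_congr_ae ((φ.memLp p.conjExponent).coeFn_toLp.mono fun x hx => ?_)
  simp only [hx, ContinuousLinearMap.lsmul_apply]

/-- The pairing `u ↦ ∫ φ u`. -/
noncomputable def pr (φ : Test) : Lp F p (volume : Measure E3) →L[ℝ] F :=
  (exists_pairing φ).choose

theorem pr_apply (φ : Test) (u : Lp F p (volume : Measure E3)) : pr φ u = ∫ x, φ x • u x :=
  (exists_pairing φ).choose_spec u

/-- The two exponents may differ, so the lemma also identifies elements of different Lebesgue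
spaces. -/
theorem ae_eq_of_pr {u : Lp F p (volume : Measure E3)} {v : Lp F q (volume : Measure E3)}
    (h : ∀ φ : Test, pr φ u = pr φ v) : (u : E3 → F) =ᵐ[volume] v :=
  ae_eq_of_integral_contDiff_smul_eq (Lp.locallyIntegrable' u) (Lp.locallyIntegrable' v)
    fun g hg hc => by
      have := h (Test.mk g hg hc)
      rwa [pr_apply, pr_apply] at this

theorem pr_ext {u v : Lp F p (volume : Measure E3)} (h : ∀ φ : Test, pr φ u = pr φ v) : u = v :=
  Lp.ext (ae_eq_of_pr h)

theorem pr_congr {u : Lp F p (volume : Measure E3)} {v : Lp F q (volume : Measure E3)}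
    (h : (u : E3 → F) =ᵐ[volume] v) (φ : Test) : pr φ u = pr φ v := by
  rw [pr_apply, pr_apply]
  exact integral_congr_ae (h.mono fun x hx => by simp only [hx])

theorem hasWeakDeriv_iff {j : Fin 3} {u : Lp F p (volume : Measure E3)}
    {v : Lp F q (volume : Measure E3)} :
    HasWeakDeriv [j] u v ↔ ∀ φ : Test, pr φ v = -pr (φ.pd j) u := by
  constructor
  · intro h φ
    have := h.2.2 φ φ.2.1 φ.2.2
    rw [pr_apply, pr_apply]
    simp only [List.length_singleton, pow_one, neg_smul, one_smul] at this
    exact (neg_eq_iff_eq_neg.2 this).symm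
  · refine fun h => ⟨Lp.locallyIntegrable' u, Lp.locallyIntegrable' v, fun φ hφ hc => ?_⟩
    have := h (Test.mk φ hφ hc)
    rw [pr_apply, pr_apply] at this
    simp only [List.length_singleton, pow_one, neg_smul, one_smul]
    exact (neg_eq_iff_eq_neg.2 this).symm

/-- The integral is the convolution of `u` with the reflected test function, and convolution with a
smooth compactly supported function may be differentiated on that factor. -/
theorem hasFDerivAt_integral_shift (φ : Test) {u : E3 → F} (hu : LocallyIntegrable u volume)
    (h : E3) : HasFDerivAt (fun h => ∫ x, φ (x - h) • u x)
      (∑ j : Fin 3, (EuclideanSpace.proj j : E3 →L[ℝ] ℝ).smulRight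
        (-∫ x, φ.pd j (x - h) • u x)) h := by
  set ψ : E3 → ℝ := fun z => φ (-z) with hψ
  have hψs : ContDiff ℝ ∞ ψ := φ.2.1.comp contDiff_neg
  have hψc : HasCompactSupport ψ := φ.2.2.comp_homeomorph (Homeomorph.neg E3)
  set L : F →L[ℝ] ℝ →L[ℝ] F := (ContinuousLinearMap.lsmul ℝ ℝ).flip with hL
  have hGe : (fun h => ∫ x, φ (x - h) • u x) = convolution u ψ L volume := by
    funext y
    simp only [convolution, hL, hψ, ContinuousLinearMap.flip_apply,
      ContinuousLinearMap.lsmul_apply, neg_sub]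
  have hψ1 : ContDiff ℝ 1 ψ := hψs.of_le (by exact_mod_cast le_top)
  rw [hGe]
  refine (hψc.hasFDerivAt_convolution_right L hu hψ1 h).congr_fderiv ?_
  have hcomp : ∀ j : Fin 3,
      (convolution u (fderiv ℝ ψ) (L.precompR E3) volume) h (EuclideanSpace.single j 1) =
        -∫ x, φ.pd j (x - h) • u x := by
    intro j
    rw [convolution_precompR_apply L hu (hψc.fderiv ℝ) (hψ1.continuous_fderiv one_ne_zero)]
    have hpd : ∀ x, (fderiv ℝ ψ (h - x)) (EuclideanSpace.single j 1) = -φ.pd j (x - h) := by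
      intro x
      have h1 : HasFDerivAt (fun x : E3 => -x) (-(ContinuousLinearMap.id ℝ E3)) (h - x) :=
        (hasFDerivAt_id _).neg
      have h2 : HasFDerivAt φ (fderiv ℝ φ (-(h - x))) (-(h - x)) :=
        ((φ.2.1.differentiable (by simp)) _).hasFDerivAt
      have h3 := (h2.comp (h - x) h1).fderiv
      have h4 : fderiv ℝ ψ (h - x) = (fderiv ℝ φ (-(h - x))).comp (-(ContinuousLinearMap.id ℝ E3)) :=
        h3
      rw [h4]
      simp [Test.pd, YMHeat.pd]
    simp only [convolution, hL, ContinuousLinearMap.flip_apply, ContinuousLinearMap.lsmul_apply,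
      hpd, neg_smul, integral_neg]
  ext v
  conv_lhs => rw [E3.sum_coord v, map_sum]
  simp only [map_smul, sum_apply, ContinuousLinearMap.smulRight_apply, PiLp.proj_apply, ej, hcomp]

variable [Fact (p ≠ ⊤)] [Fact (q ≠ ⊤)]

theorem pr_tr (φ : Test) (h : E3) (u : Lp F p (volume : Measure E3)) :
    pr φ (tr h u) = ∫ x, φ (x - h) • u x := by
  rw [pr_apply, ← integral_add_right_eq_self (fun x => φ (x - h) • u x) h]
  refine integral_congr_ae ((coeFn_tr h u).mono fun x hx => ?_)
  simp only [hx, add_sub_cancel_right]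

theorem pr_tr_eq_shift (φ : Test) (h : E3) (u : Lp F p (volume : Measure E3)) :
    pr φ (tr h u) = pr (φ.shift h) u := by
  rw [pr_tr, pr_apply]; rfl

theorem hasFDerivAt_pr_tr (φ : Test) (u : Lp F p (volume : Measure E3)) (h : E3) :
    HasFDerivAt (fun h => pr φ (tr h u)) (∑ j : Fin 3, (EuclideanSpace.proj j : E3 →L[ℝ] ℝ).smulRight
        (-pr (φ.pd j) (tr h u))) h := by
  simp only [pr_tr]
  exact hasFDerivAt_integral_shift φ (Lp.locallyIntegrable' u) h

/-- The derivative at the origin of `h ↦ ∫ φ τ_h u` is computed twice: from the hypothesis, and by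
differentiating the test function. -/
theorem HasTD.hasWeakDeriv {u : Lp F p (volume : Measure E3)}
    {v : Fin 3 → Lp F p (volume : Measure E3)} (h : HasTD u v) (j : Fin 3) :
    HasWeakDeriv [j] u (v j) := by
  rw [hasWeakDeriv_iff]
  intro φ
  have h1 := (pr φ).hasFDerivAt.comp (0 : E3) (h 0)
  have h2 := congrArg (fun L => L (ej j)) (h1.unique (hasFDerivAt_pr_tr φ u 0))
  simpa [ej, tr_zero, Finset.sum_ite_eq, Pi.single_apply] using h2

theorem pr_tr_weak {j : Fin 3} {u : Lp F p (volume : Measure E3)}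
    {v : Lp F q (volume : Measure E3)} (hw : HasWeakDeriv [j] u v) (φ : Test) (h : E3) :
    pr φ (tr h v) = -pr (φ.pd j) (tr h u) := by
  have h1 := hasWeakDeriv_iff.1 hw (φ.shift h)
  rw [pr_tr_eq_shift, h1, pr_tr, pr_apply]
  congr 1
  refine integral_congr_ae (Eventually.of_forall fun x => ?_)
  have : (φ.shift h).pd j x = φ.pd j (x - h) := by
    have h1 : HasFDerivAt (fun x : E3 => x - h) (ContinuousLinearMap.id ℝ E3) x :=
      (hasFDerivAt_id x).sub_const h
    have h2 : HasFDerivAt φ (fderiv ℝ φ (x - h)) (x - h) :=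
      ((φ.2.1.differentiable (by simp)) _).hasFDerivAt
    have h3 := (h2.comp x h1).fderiv
    have h4 : fderiv ℝ (φ.shift h : E3 → ℝ) x =
      (fderiv ℝ φ (x - h)).comp (ContinuousLinearMap.id ℝ E3) := h3
    simp only [Test.pd, YMHeat.pd]
    rw [h4]; rfl
  simp only [this]

theorem HasWeakDeriv.tr {j : Fin 3} {u : Lp F p (volume : Measure E3)}
    {v : Lp F q (volume : Measure E3)} (hw : HasWeakDeriv [j] u v) (h : E3) :
    HasWeakDeriv [j] (tr h u : Lp F p (volume : Measure E3))
      (YMHeat.tr h v : Lp F q (volume : Measure E3)) :=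
  hasWeakDeriv_iff.2 fun φ => pr_tr_weak hw φ h

end Pairing

/-! ### Weak gradients as derivatives of translations -/

/-- A continuous candidate for the derivative which is the derivative after composition with a
separating family of continuous linear maps is the derivative. -/
theorem hasFDerivAt_of_separating {E V F ι : Type*} [NormedAddCommGroup E] [NormedSpace ℝ E]
    [NormedAddCommGroup V] [NormedSpace ℝ V] [CompleteSpace V] [NormedAddCommGroup F]
    [NormedSpace ℝ F] [CompleteSpace F] (Λ : ι → V →L[ℝ] F)
    (hΛ : ∀ v w : V, (∀ i, Λ i v = Λ i w) → v = w) {U : Set E} (hU : IsOpen U) {f : E → V}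
    {f' : E → E →L[ℝ] V}
    (hc : ContinuousOn f' U) (hd : ∀ i, ∀ x ∈ U, HasFDerivAt (fun x => Λ i (f x)) ((Λ i).comp (f' x)) x)
    {x : E} (hx : x ∈ U) : HasFDerivAt f (f' x) x := by
  obtain ⟨r, hr, hball⟩ := Metric.isOpen_iff.1 hU x hx
  have hmem : ∀ y ∈ Metric.ball x r, ∀ θ ∈ Icc (0 : ℝ) 1, x + θ • (y - x) ∈ Metric.ball x r := by
    intro y hy θ hθ
    have := (convex_ball x r).add_smul_sub_mem (Metric.mem_ball_self hr) hy hθ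
    exact this
  have hcθ : ∀ y ∈ Metric.ball x r,
      ContinuousOn (fun θ : ℝ => f' (x + θ • (y - x)) (y - x)) (Icc 0 1) := by
    intro y hy
    refine ContinuousOn.clm_apply (hc.comp (by fun_prop) fun θ hθ => hball (hmem y hy θ hθ))
      continuousOn_const
  -- The fundamental theorem of calculus along the segment holds after each functional `Λ i`; since
  -- these separate points it holds in `V`, and continuity of `f'` then gives the derivative.
  have hint : ∀ y ∈ Metric.ball x r,
      f y - f x = ∫ θ in (0 : ℝ)..1, f' (x + θ • (y - x)) (y - x) := by
    intro y hy
    have hii : IntervalIntegrable (fun θ : ℝ => f' (x + θ • (y - x)) (y - x)) volume 0 1 :=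
      ContinuousOn.intervalIntegrable (by rw [uIcc_of_le zero_le_one]; exact hcθ y hy)
    refine hΛ _ _ fun i => ?_
    rw [← (Λ i).intervalIntegral_comp_comm hii]
    rw [intervalIntegral.integral_eq_sub_of_hasDerivAt
      (f := fun θ : ℝ => Λ i (f (x + θ • (y - x))))]
    · simp
    · intro θ hθ
      rw [uIcc_of_le zero_le_one] at hθ
      have h1 := hd i _ (hball (hmem y hy θ hθ))
      have h2 : HasDerivAt (fun θ : ℝ => x + θ • (y - x)) (y - x) θ := by
        simpa using ((hasDerivAt_id θ).smul_const (y - x)).const_add x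
      have h3 := h1.comp_hasDerivAt θ h2
      exact h3
    · refine ContinuousOn.intervalIntegrable ?_
      rw [uIcc_of_le zero_le_one]
      exact (Λ i).continuous.comp_continuousOn (hcθ y hy)
  rw [hasFDerivAt_iff_isLittleO, Asymptotics.isLittleO_iff]
  intro ε hε
  have hcx := (hc.continuousAt (hU.mem_nhds hx))
  obtain ⟨d, hd0, hdb⟩ := Metric.continuousAt_iff.1 hcx ε hε
  filter_upwards [Metric.ball_mem_nhds x (lt_min hr hd0)] with y hy
  have hyr : y ∈ Metric.ball x r := Metric.ball_subset_ball (min_le_left _ _) hy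
  have hyd : dist y x < d := lt_of_lt_of_le hy (min_le_right _ _)
  have e : f y - f x - f' x (y - x) =
      ∫ θ in (0 : ℝ)..1, (f' (x + θ • (y - x)) - f' x) (y - x) := by
    simp only [sub_apply]
    rw [intervalIntegral.integral_sub, ← hint y hyr]
    · simp
    · exact ContinuousOn.intervalIntegrable (by rw [uIcc_of_le zero_le_one]; exact hcθ y hyr)
    · exact intervalIntegrable_const
  rw [e]
  refine (intervalIntegral.norm_integral_le_of_norm_le_const (C := ε * ‖y - x‖) ?_).trans (by simp)
  intro θ hθ
  rw [uIoc_of_le zero_le_one] at hθ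
  refine (ContinuousLinearMap.le_opNorm _ _).trans ?_
  refine mul_le_mul_of_nonneg_right ?_ (norm_nonneg _)
  rw [← dist_eq_norm]
  refine (hdb ?_).le
  rw [dist_eq_norm, add_sub_cancel_left, norm_smul, Real.norm_of_nonneg hθ.1.le]
  rw [dist_eq_norm] at hyd
  refine lt_of_le_of_lt ?_ hyd
  exact mul_le_of_le_one_left (norm_nonneg _) hθ.2

section Pairing2

variable {F : Type*} [NormedAddCommGroup F] [InnerProductSpace ℝ F] [CompleteSpace F]
variable {p : ℝ≥0∞} [Fact (1 ≤ p)] [Fact (p ≠ ⊤)]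

/-- Tested against any `φ`, the derivative of `h ↦ τ_h u` is given by the translates of `v`. These
depend continuously on `h` in `L^p`, so the weak derivative is a norm derivative. -/
theorem hasTD_of_hasWeakDeriv {u : Lp F p (volume : Measure E3)}
    {v : Fin 3 → Lp F p (volume : Measure E3)} (h : ∀ j, HasWeakDeriv [j] u (v j)) :
    HasTD u v := by
  intro k
  refine hasFDerivAt_of_separating (U := univ) (fun φ : Test => pr φ) (fun v w => pr_ext)
    isOpen_univ (f' := fun k => ∑ j : Fin 3, (EuclideanSpace.proj j : E3 →L[ℝ] ℝ).smulRight
      (tr k (v j))) ?_ ?_ (mem_univ k)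
  · refine Continuous.continuousOn (continuous_finsetSum _ fun j _ => ?_)
    exact (ContinuousLinearMap.smulRightL ℝ E3 (Lp F p (volume : Measure E3))
      (EuclideanSpace.proj j)).continuous.comp (continuous_tr (v j))
  · intro φ k _
    refine (hasFDerivAt_pr_tr φ u k).congr_fderiv ?_
    ext l
    simp only [sum_apply, ContinuousLinearMap.smulRight_apply, ContinuousLinearMap.comp_apply,
      map_sum, map_smul, pr_tr_weak (h _)]

theorem HasWeakDeriv.append {J : List (Fin 3)} {j : Fin 3} {u v w : E3 → F}
    (h : HasWeakDeriv J u v) (h' : HasWeakDeriv [j] v w) : HasWeakDeriv (J ++ [j]) u w := by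
  refine ⟨h.1, h'.2.1, fun φ hφ hc => ?_⟩
  have e : iterPd (J ++ [j]) φ = iterPd J (pd j φ) := by simp [iterPd]
  rw [e, h.2.2 _ (contDiff_pd hφ) (hasCompactSupport_pd hc)]
  have := h'.2.2 φ hφ hc
  simp only [iterPd, List.foldr] at this
  rw [this, smul_smul]
  simp [pow_succ]

theorem HasWeakDeriv.unique {J : List (Fin 3)} {u v w : E3 → F}
    (h : HasWeakDeriv J u v) (h' : HasWeakDeriv J u w) : v =ᵐ[volume] w := by
  refine ae_eq_of_integral_contDiff_smul_eq h.2.1 h'.2.1 fun g hg hc => ?_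
  have := (h.2.2 g hg hc).symm.trans (h'.2.2 g hg hc)
  exact smul_right_injective F (pow_ne_zero _ (by norm_num)) this

end Pairing2

/-- A test function equal to one on a given ball. -/
theorem exists_test_one (R : ℝ) : ∃ φ : Test, ∀ x : E3, ‖x‖ ≤ R → φ x = 1 := by
  let f : ContDiffBump (0 : E3) :=
    { rIn := max R 1, rOut := max R 1 + 1, rIn_pos := by positivity, rIn_lt_rOut := by simp }
  refine ⟨Test.mk f f.contDiff f.hasCompactSupport, fun x hx => ?_⟩
  exact f.one_of_mem_closedBall (by simpa [f] using Or.inl hx)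

/-! ### Pointwise form of the averages and the bound from `L^{3/2}` to `L²` -/

section Pointwise

variable {F : Type*} [NormedAddCommGroup F] [InnerProductSpace ℝ F] [CompleteSpace F]

/-- The pointwise average `∫ (1+|z|)^{-4} b(z) u(x+λz) dz`. -/
noncomputable def cvf (l : ℝ) (b : Bd) (u : E3 → F) (x : E3) : F :=
  ∫ z, (wt z * b z) • u (x + l • z)

theorem shift_scale_quasi {l : ℝ} (hl : l ≠ 0) (x : E3) :
    Measure.QuasiMeasurePreserving (fun z : E3 => x + l • z) volume volume := by
  have h1 : Measure.QuasiMeasurePreserving (fun z : E3 => l • z) volume volume := by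
    refine ⟨measurable_const_smul l, ?_⟩
    rw [Measure.map_addHaar_smul _ hl]
    exact Measure.smul_absolutelyContinuous
  exact (measurePreserving_add_left volume x).quasiMeasurePreserving.comp h1

theorem cvf_congr {l : ℝ} (hl : l ≠ 0) (b : Bd) {u v : E3 → F} (h : u =ᵐ[volume] v) :
    cvf l b u = cvf l b v := by
  funext x
  refine integral_congr_ae (((shift_scale_quasi hl x).ae_eq h).mono fun z hz => ?_)
  simp only [Function.comp_apply] at hz
  simp only [hz]

theorem lintegral_shift_scale {l : ℝ} (hl : 0 < l) (x : E3) {U : E3 → ℝ≥0∞} (hU : Measurable U) :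
    ∫⁻ z, U (x + l • z) = ENNReal.ofReal (l ^ (-3 : ℝ)) * ∫⁻ z, U z := by
  have h1 : ∫⁻ z, U (x + l • z) = ∫⁻ y, U (x + y) ∂(Measure.map (fun z : E3 => l • z) volume) := by
    rw [lintegral_map (by fun_prop) (measurable_const_smul l)]
  rw [h1, Measure.map_addHaar_smul _ hl.ne', lintegral_smul_measure,
    lintegral_add_left_eq_self U x, smul_eq_mul, finrank_euclideanSpace_fin,
    abs_of_nonneg (by positivity)]
  congr 2
  rw [Real.rpow_neg hl.le]; norm_cast

/-- The weight as an extended nonnegative function. -/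
noncomputable def ewt (z : E3) : ℝ≥0∞ := ENNReal.ofReal (wt z)

theorem measurable_ewt : Measurable ewt := (continuous_wt.measurable).ennreal_ofReal

theorem ewt_le_one (z : E3) : ewt z ≤ 1 := by
  refine ENNReal.ofReal_le_one.2 ?_
  rw [wt]
  exact inv_le_one_of_one_le₀ (one_le_pow₀ (by linarith [norm_nonneg z]))

/-- The total mass of the weight. -/
noncomputable def wtMass : ℝ≥0∞ := ∫⁻ z, ewt z

theorem wtMass_ne_top : wtMass ≠ ⊤ := by
  have := integrable_wt.lintegral_lt_top
  exact this.ne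

/-- Hölder's inequality for the finite measure `w dz`, written with `w = w^{1-1/p} w^{1/p}`. -/
theorem lintegral_ewt_mul_le {p : ℝ} (hp : 1 < p) {U : E3 → ℝ≥0∞} (hU : Measurable U) :
    ∫⁻ z, ewt z * U z ≤ wtMass ^ (1 - 1 / p) * (∫⁻ z, ewt z * U z ^ p) ^ (1 / p) := by
  have hp0 : 0 < p := by linarith
  have hpq := (Real.HolderConjugate.conjExponent hp).symm
  have h := ENNReal.lintegral_mul_le_Lp_mul_Lq volume hpq
    (f := fun z => ewt z ^ (1 - 1 / p)) (g := fun z => ewt z ^ (1 / p) * U z)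
    (measurable_ewt.pow_const _).aemeasurable ((measurable_ewt.pow_const _).mul hU).aemeasurable
  have hq : 1 - 1 / p = 1 / p.conjExponent := by
    have := hpq.inv_add_inv_eq_one
    simp only [one_div]; linarith
  have hq0 : 0 < p.conjExponent := hpq.pos
  have hne : ∀ z, ewt z ≠ ⊤ := fun z => ENNReal.ofReal_ne_top
  have h0 : ∀ z, ewt z ≠ 0 := fun z => (ENNReal.ofReal_pos.2 (wt_pos z)).ne'
  have e1 : ∀ z, ((fun z => ewt z ^ (1 - 1 / p)) * fun z => ewt z ^ (1 / p) * U z) z =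
      ewt z * U z := by
    intro z
    simp only [Pi.mul_apply]
    rw [← mul_assoc, ← ENNReal.rpow_add _ _ (h0 z) (hne z), sub_add_cancel, ENNReal.rpow_one]
  have e2 : ∀ z, (ewt z ^ (1 - 1 / p)) ^ p.conjExponent = ewt z := by
    intro z
    rw [← ENNReal.rpow_mul, hq, one_div_mul_cancel hq0.ne', ENNReal.rpow_one]
  have e3 : ∀ z, (ewt z ^ (1 / p) * U z) ^ p = ewt z * U z ^ p := by
    intro z
    rw [ENNReal.mul_rpow_of_nonneg _ _ hp0.le, ← ENNReal.rpow_mul, one_div_mul_cancel hp0.ne',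
      ENNReal.rpow_one]
  simp only [e1, e2, e3] at h
  rw [hq]
  exact h

theorem enorm_cvf_le (l : ℝ) (b : Bd) (u : E3 → F) (x : E3) :
    ‖cvf l b u x‖ₑ ≤ ‖b‖ₑ * ∫⁻ z, ewt z * ‖u (x + l • z)‖ₑ := by
  refine (enorm_integral_le_lintegral_enorm _).trans ?_
  rw [← lintegral_const_mul' _ _ (by simp)]
  refine lintegral_mono fun z => ?_
  rw [enorm_smul, ← mul_assoc]
  refine mul_le_mul_left ?_ _
  rw [Real.enorm_eq_ofReal_abs, ← ofReal_norm b, ewt, ← ENNReal.ofReal_mul (norm_nonneg _)]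
  refine ENNReal.ofReal_le_ofReal ?_
  rw [mul_comm ‖b‖]
  exact norm_wt_mul_le b z

theorem measurable_shift_scale (l : ℝ) : Measurable fun q : E3 × E3 => q.1 + l • q.2 := by
  fun_prop

/-- A weighted form of Young's inequality. With `H(x) = ∫ w(z) |u(x + l z)|^{3/2} dz`, Hölder bounds
the square of the average by `H^{4/3} = H^{1/3} H`. The factor `H^{1/3}` is at most `l^{-1}` times a
power of `‖u‖`, by change of variables and `w ≤ 1`, and `∫ H` is the mass of `w` times `∫
|u|^{3/2}`. The square root yields `l^{-1/2}`. -/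
theorem eLpNorm_cvf_le {l : ℝ} (hl : 0 < l) (b : Bd) {u : E3 → F} (hu : StronglyMeasurable u) :
    eLpNorm (cvf l b u) 2 volume ≤ ‖b‖ₑ * (wtMass ^ (5 / 6 : ℝ) *
      ENNReal.ofReal (l ^ (-(1 / 2) : ℝ)) * eLpNorm u (3 / 2) volume) := by
  set U : E3 → ℝ≥0∞ := fun x => ‖u x‖ₑ with hUdef
  have hU : Measurable U := hu.enorm
  set T0 : ℝ≥0∞ := ∫⁻ z, U z ^ (3 / 2 : ℝ) with hI
  set H : E3 → ℝ≥0∞ := fun x => ∫⁻ z, ewt z * U (x + l • z) ^ (3 / 2 : ℝ) with hH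
  set c : ℝ≥0∞ := ENNReal.ofReal (l ^ (-3 : ℝ)) with hc
  have hHle : ∀ x, H x ≤ c * T0 := by
    intro x
    rw [hI, hc, ← lintegral_shift_scale hl x (hU.pow_const _)]
    exact lintegral_mono fun z => mul_le_of_le_one_left zero_le (ewt_le_one z)
  have hHint : ∫⁻ x, H x = wtMass * T0 := by
    rw [hH]
    rw [lintegral_lintegral_swap]
    · have : ∀ z, ∫⁻ x, ewt z * U (x + l • z) ^ (3 / 2 : ℝ) = ewt z * T0 := by
        intro z
        rw [lintegral_const_mul _ (by fun_prop),
          lintegral_add_right_eq_self (fun x => U x ^ (3 / 2 : ℝ)) (l • z)]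
      simp only [this]
      rw [lintegral_mul_const _ measurable_ewt, wtMass]
    · exact ((measurable_ewt.comp measurable_snd).mul
        ((hU.comp (measurable_shift_scale l)).pow_const _)).aemeasurable
  have hK : ∀ x, ‖cvf l b u x‖ₑ ^ (2 : ℝ) ≤ ‖b‖ₑ ^ (2 : ℝ) *
      (wtMass ^ (2 / 3 : ℝ) * (c * T0) ^ (1 / 3 : ℝ) * H x) := by
    intro x
    have h1 := lintegral_ewt_mul_le (p := 3 / 2) (by norm_num)
      (hU.comp ((measurable_shift_scale l).comp (measurable_const.prodMk measurable_id)) :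
        Measurable fun z => U (x + l • z))
    have h2 := (enorm_cvf_le l b u x).trans (mul_le_mul_right h1 _)
    refine (ENNReal.rpow_le_rpow h2 (by norm_num : (0 : ℝ) ≤ 2)).trans ?_
    rw [ENNReal.mul_rpow_of_nonneg _ _ (by norm_num), ENNReal.mul_rpow_of_nonneg _ _ (by norm_num),
      ← ENNReal.rpow_mul, ← ENNReal.rpow_mul]
    norm_num
    refine mul_le_mul_right ?_ _
    rw [mul_assoc]
    refine mul_le_mul_right ?_ _
    have : (4 / 3 : ℝ) = 1 / 3 + 1 := by norm_num
    rw [this, ENNReal.rpow_add_of_nonneg _ _ (by norm_num) (by norm_num), ENNReal.rpow_one]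
    refine mul_le_mul_left (ENNReal.rpow_le_rpow (hHle x) (by norm_num)) _
  have h32 : ((3 / 2 : ℝ≥0∞)).toReal = 3 / 2 := by simp
  rw [eLpNorm_eq_lintegral_rpow_enorm_toReal (by simp) (by simp),
    eLpNorm_eq_lintegral_rpow_enorm_toReal (by simp) (ENNReal.div_ne_top (by simp) (by simp)), h32]
  simp only [ENNReal.toReal_ofNat]
  have hmeas : Measurable H := by
    refine Measurable.lintegral_prod_right' (f := fun q : E3 × E3 =>
      ewt q.2 * U (q.1 + l • q.2) ^ (3 / 2 : ℝ)) ?_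
    exact (measurable_ewt.comp measurable_snd).mul
      ((hU.comp (measurable_shift_scale l)).pow_const _)
  refine (ENNReal.rpow_le_rpow (lintegral_mono hK) (by norm_num)).trans ?_
  rw [lintegral_const_mul _ (hmeas.const_mul _), lintegral_const_mul _ hmeas, hHint]
  have hI' : ∫⁻ x, ‖u x‖ₑ ^ (3 / 2 : ℝ) = T0 := rfl
  rw [hI']
  rw [ENNReal.mul_rpow_of_nonneg _ _ (by norm_num), ← ENNReal.rpow_mul]
  norm_num
  refine mul_le_mul_right ?_ _
  rw [ENNReal.mul_rpow_of_nonneg c T0 (by norm_num)]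
  have e : wtMass ^ (2 / 3 : ℝ) * (c ^ (1 / 3 : ℝ) * T0 ^ (1 / 3 : ℝ)) * (wtMass * T0) =
      (wtMass ^ (2 / 3 : ℝ) * wtMass ^ (1 : ℝ)) * c ^ (1 / 3 : ℝ) *
        (T0 ^ (1 / 3 : ℝ) * T0 ^ (1 : ℝ)) := by
    rw [ENNReal.rpow_one, ENNReal.rpow_one]; ring
  rw [e, ← ENNReal.rpow_add_of_nonneg _ _ (by norm_num) (by norm_num),
    ← ENNReal.rpow_add_of_nonneg _ _ (by norm_num) (by norm_num),
    ENNReal.mul_rpow_of_nonneg _ _ (by norm_num), ENNReal.mul_rpow_of_nonneg _ _ (by norm_num),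
    ← ENNReal.rpow_mul, ← ENNReal.rpow_mul, ← ENNReal.rpow_mul, hc,
    ENNReal.ofReal_rpow_of_nonneg (by positivity) (by norm_num), ← Real.rpow_mul hl.le]
  norm_num

variable {p : ℝ≥0∞} [Fact (1 ≤ p)] [Fact (p ≠ ⊤)]

/-- For fixed `z`, Hölder bounds the integral in `x` uniformly by translation invariance; the weight
then integrates in `z`. This justifies Fubini in the identification of the averages. -/
theorem integrable_prod_cv (l : ℝ) (b : Bd) (u : Lp F p (volume : Measure E3)) (φ : Test) :
    Integrable (fun q : E3 × E3 => φ q.1 • ((wt q.2 * b q.2) • u (q.1 + l • q.2)))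
      (volume.prod volume) := by
  have hu := Lp.stronglyMeasurable u
  have hm : StronglyMeasurable
      (fun q : E3 × E3 => φ q.1 • ((wt q.2 * b q.2) • u (q.1 + l • q.2))) := by
    refine StronglyMeasurable.smul (φ.continuous.comp continuous_fst).stronglyMeasurable
      (StronglyMeasurable.smul ?_ (hu.comp_measurable (measurable_shift_scale l)))
    exact ((continuous_wt.mul b.continuous).comp continuous_snd).stronglyMeasurable
  have hp : (1 : ℝ≥0∞) ≤ p := Fact.out
  have : ENNReal.HolderConjugate p p.conjExponent := ENNReal.HolderConjugate.conjExponent hp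
  have : ENNReal.HolderConjugate p.conjExponent p := ENNReal.HolderConjugate.symm
  set C : ℝ≥0∞ := eLpNorm φ p.conjExponent volume * eLpNorm u p volume with hC
  have hCt : C ≠ ⊤ := ENNReal.mul_ne_top (φ.memLp _).2.ne (Lp.eLpNorm_ne_top u)
  have hslice : ∀ z : E3, ∫⁻ x, ‖φ x • u (x + l • z)‖ₑ ≤ C := by
    intro z
    have h1 := eLpNorm_smul_le_mul_eLpNorm (p := p.conjExponent) (q := p) (r := 1)
      (μ := (volume : Measure E3)) (f := (u : E3 → F) ∘ fun x => x + l • z) (φ := φ)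
      (hu.comp_measurable (by fun_prop)).aestronglyMeasurable φ.continuous.aestronglyMeasurable
    rw [eLpNorm_comp_measurePreserving hu.aestronglyMeasurable (measurePreserving_shift _),
      eLpNorm_one_eq_lintegral_enorm] at h1
    exact h1
  refine ⟨hm.aestronglyMeasurable, ?_⟩
  rw [hasFiniteIntegral_iff_enorm, lintegral_prod_symm _ hm.enorm.aemeasurable]
  refine lt_of_le_of_lt (lintegral_mono (g := fun z => ‖wt z * b z‖ₑ * C) fun z => ?_) ?_
  · have : ∀ x, ‖φ x • ((wt z * b z) • u (x + l • z))‖ₑ =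
        ‖wt z * b z‖ₑ * ‖φ x • u (x + l • z)‖ₑ := by
      intro x; rw [smul_comm, enorm_smul]
    simp only [this]
    rw [lintegral_const_mul' _ _ enorm_ne_top]
    exact mul_le_mul_right (hslice z) _
  · rw [lintegral_mul_const' _ _ hCt]
    exact ENNReal.mul_lt_top (integrable_wt_mul b).2 hCt.lt_top

/-- The `L^p`-valued integral and the pointwise integral have the same pairings with test functions,
by Fubini. Cutoffs equal to one on a ball give the local integrability needed to conclude. -/
theorem coeFn_cv (l : ℝ) (b : Bd) (u : Lp F p (volume : Measure E3)) :
    ((cv l b u : Lp F p (volume : Measure E3)) : E3 → F) =ᵐ[volume] cvf l b u := by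
  have hφ : ∀ φ : Test, Integrable (fun x => φ x • cvf l b u x) := by
    intro φ
    refine (integrable_prod_cv l b u φ).integral_prod_left.congr (Eventually.of_forall fun x => ?_)
    simp only [cvf]
    rw [integral_smul]
  have hloc : LocallyIntegrable (cvf l b u) volume := by
    rw [locallyIntegrable_iff]
    intro k hk
    obtain ⟨R, hR⟩ := hk.isBounded.exists_norm_le
    obtain ⟨φ, h1⟩ := exists_test_one R
    refine ((hφ φ).integrableOn (s := k)).congr_fun (fun x hx => ?_) hk.measurableSet
    simp only [h1 x (hR x hx), one_smul]
  refine ae_eq_of_integral_contDiff_smul_eq (Lp.locallyIntegrable' _) hloc fun g hg hc => ?_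
  set φ := Test.mk g hg hc
  have e1 : ∫ x, g x • ((cv l b u : Lp F p (volume : Measure E3)) : E3 → F) x = pr φ (cv l b u) := (pr_apply φ _).symm
  rw [e1, cv_apply, ← (pr φ).integral_comp_comm (integrable_cv l b u)]
  have e2 : ∀ z, pr φ ((wt z * b z) • tr (l • z) u) =
      ∫ x, φ x • ((wt z * b z) • u (x + l • z)) := by
    intro z
    rw [map_smul, pr_apply, ← integral_smul]
    refine integral_congr_ae ((coeFn_tr (l • z) u).mono fun x hx => ?_)
    simp only [hx]
    rw [smul_comm]
  simp only [e2]
  rw [integral_integral_swap (f := fun z x => φ x • ((wt z * b z) • u (x + l • z)))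
    (integrable_prod_cv l b u φ).swap]
  refine integral_congr_ae (Eventually.of_forall fun x => ?_)
  simp only [cvf]
  rw [integral_smul]; rfl

end Pointwise

/-! ### Averages as operators from `L^{3/2}` to `L²` and as point evaluations on `L⁶` -/

section SmoothingOps

/-- The bound is uniform on `l > l₀ / 2`, so near each `l₀` the curve for `v` is a uniform limit of
continuous curves. -/
theorem continuousOn_family_of_dense {V W : Type*} [NormedAddCommGroup V] [NormedSpace ℝ V]
    [NormedAddCommGroup W] [NormedSpace ℝ W] {T : ℝ → V →L[ℝ] W} {C : ℝ} (hC : 0 ≤ C)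
    (hb : ∀ l ∈ Ioc (0 : ℝ) 1, ∀ v, ‖T l v‖ ≤ C * l ^ (-(3 / 2) : ℝ) * ‖v‖) {D : Set V}
    (hD : Dense D) (h : ∀ v ∈ D, ContinuousOn (fun l => T l v) (Ioc 0 1)) (v : V) :
    ContinuousOn (fun l => T l v) (Ioc 0 1) := by
  refine continuousOn_of_locally_uniform_approx_of_continuousWithinAt fun l hl u hu => ?_
  obtain ⟨ε, hε, hεu⟩ := Metric.mem_uniformity_dist.1 hu
  have hl2 : 0 < l / 2 := by linarith [hl.1]
  set K := C * (l / 2) ^ (-(3 / 2) : ℝ) + 1 with hK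
  have hK0 : 0 < K := by positivity
  obtain ⟨w, hw, hwD⟩ := Metric.dense_iff.1 hD v (ε / K) (by positivity)
  refine ⟨Ioc 0 1 ∩ Ioi (l / 2), inter_mem_nhdsWithin _ (Ioi_mem_nhds (by linarith [hl.1])),
    fun l => T l w, h w hwD l hl, fun y hy => hεu ?_⟩
  rw [dist_eq_norm, ← map_sub]
  refine lt_of_le_of_lt (hb y hy.1 _) ?_
  have h1 : C * y ^ (-(3 / 2) : ℝ) ≤ K := by
    have : y ^ (-(3 / 2) : ℝ) ≤ (l / 2) ^ (-(3 / 2) : ℝ) :=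
      Real.rpow_le_rpow_of_nonpos hl2 hy.2.le (by norm_num)
    nlinarith
  have h2 : ‖v - w‖ < ε / K := by
    rwa [← dist_eq_norm, dist_comm]
  calc C * y ^ (-(3 / 2) : ℝ) * ‖v - w‖ ≤ K * ‖v - w‖ :=
        mul_le_mul_of_nonneg_right h1 (norm_nonneg _)
    _ < K * (ε / K) := mul_lt_mul_of_pos_left h2 hK0
    _ = ε := mul_div_cancel₀ _ hK0.ne'

variable {F : Type*} [NormedAddCommGroup F] [InnerProductSpace ℝ F] [CompleteSpace F]

variable (F) in
/-- `L²`. -/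
abbrev V2 : Type _ := Lp F 2 (volume : Measure E3)
variable (F) in
/-- `L^{3/2}`. -/
abbrev V32 : Type _ := Lp F (3 / 2) (volume : Measure E3)
variable (F) in
/-- `L⁶`. -/
abbrev V6 : Type _ := Lp F 6 (volume : Measure E3)

theorem rpow_half_le {l : ℝ} (hl : l ∈ Ioc (0 : ℝ) 1) :
    l ^ (-(1 / 2) : ℝ) ≤ l ^ (-(3 / 2) : ℝ) :=
  Real.rpow_le_rpow_of_exponent_ge hl.1 hl.2 (by norm_num)

theorem dense_compactSupport (p : ℝ≥0∞) [Fact (1 ≤ p)] [Fact (p ≠ ⊤)] :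
    Dense {u : Lp F p (volume : Measure E3) | ∃ g : E3 → F, Continuous g ∧ HasCompactSupport g ∧
      (u : E3 → F) =ᵐ[volume] g} := by
  rw [Metric.dense_iff]
  intro u r hr
  obtain ⟨g, hc, hle, hg, hgp⟩ := (Lp.memLp u).exists_hasCompactSupport_eLpNorm_sub_le
    (Fact.out : p ≠ ⊤) (ε := ENNReal.ofReal (r / 2)) (by simp [hr])
  refine ⟨hgp.toLp g, ?_, g, hg, hc, hgp.coeFn_toLp⟩
  rw [Metric.mem_ball, dist_comm, dist_eq_norm, Lp.norm_def]
  have e : eLpNorm (u - hgp.toLp g : Lp F p (volume : Measure E3)) p volume =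
      eLpNorm ((u : E3 → F) - g) p volume := by
    refine eLpNorm_congr_ae ?_
    filter_upwards [Lp.coeFn_sub u (hgp.toLp g), hgp.coeFn_toLp] with x h1 h2
    rw [h1, Pi.sub_apply, Pi.sub_apply, h2]
  rw [e]
  refine lt_of_le_of_lt (ENNReal.toReal_mono (by simp) hle) ?_
  rw [ENNReal.toReal_ofReal (by positivity)]
  linarith

theorem eLpNorm_cv_le {l : ℝ} (hl : 0 < l) (b : Bd) (u : V32 F) :
    eLpNorm (cv l b u : V32 F) 2 volume ≤ ‖b‖ₑ * (wtMass ^ (5 / 6 : ℝ) *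
      ENNReal.ofReal (l ^ (-(1 / 2) : ℝ)) * ‖u‖ₑ) := by
  rw [eLpNorm_congr_ae (coeFn_cv l b u), Lp.enorm_def]
  exact eLpNorm_cvf_le hl b (Lp.stronglyMeasurable u)

theorem exists_smoothing {l : ℝ} (hl : 0 < l) : ∃ T : Bd →L[ℝ] V32 F →L[ℝ] V2 F,
    (∀ b u, (T b u : E3 → F) =ᵐ[volume] (cv l b u : V32 F)) ∧
    ∀ b u, ‖T b u‖ ≤ (wtMass ^ (5 / 6 : ℝ)).toReal * l ^ (-(1 / 2) : ℝ) * ‖b‖ * ‖u‖ := by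
  have hM : wtMass ^ (5 / 6 : ℝ) ≠ ⊤ := ENNReal.rpow_ne_top_of_nonneg (by norm_num) wtMass_ne_top
  have hfin : ∀ (b : Bd) (u : V32 F), ‖b‖ₑ * (wtMass ^ (5 / 6 : ℝ) *
      ENNReal.ofReal (l ^ (-(1 / 2) : ℝ)) * ‖u‖ₑ) ≠ ⊤ := fun b u =>
    ENNReal.mul_ne_top enorm_ne_top (ENNReal.mul_ne_top
      (ENNReal.mul_ne_top hM ENNReal.ofReal_ne_top) enorm_ne_top)
  have hmem : ∀ (b : Bd) (u : V32 F), MemLp (cv l b u : V32 F) 2 volume := fun b u =>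
    ⟨Lp.aestronglyMeasurable _, (eLpNorm_cv_le hl b u).trans_lt (hfin b u).lt_top⟩
  have hco := fun (b : Bd) (u : V32 F) => (hmem b u).coeFn_toLp
  have hbd : ∀ (b : Bd) (u : V32 F), ‖(hmem b u).toLp _‖ ≤
      (wtMass ^ (5 / 6 : ℝ)).toReal * l ^ (-(1 / 2) : ℝ) * ‖b‖ * ‖u‖ := by
    intro b u
    rw [Lp.norm_toLp]
    refine (ENNReal.toReal_mono (hfin b u) (eLpNorm_cv_le hl b u)).trans (le_of_eq ?_)
    rw [ENNReal.toReal_mul, ENNReal.toReal_mul, ENNReal.toReal_mul,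
      ENNReal.toReal_ofReal (by positivity), toReal_enorm, toReal_enorm]
    ring
  refine ⟨LinearMap.mkContinuous₂ (LinearMap.mk₂ ℝ
    (fun (b : Bd) (u : V32 F) => (hmem b u).toLp _) ?_ ?_ ?_ ?_) _ hbd, hco, hbd⟩
  · intro b b' u
    rw [← MemLp.toLp_add]
    refine MemLp.toLp_congr _ _ ?_
    rw [map_add, add_apply]
    exact Lp.coeFn_add _ _
  · intro c b u
    rw [← MemLp.toLp_const_smul]
    refine MemLp.toLp_congr _ _ ?_
    rw [map_smul, smul_apply]
    exact Lp.coeFn_smul _ _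
  · intro b u u'
    rw [← MemLp.toLp_add]
    refine MemLp.toLp_congr _ _ ?_
    rw [map_add]
    exact Lp.coeFn_add _ _
  · intro c b u
    rw [← MemLp.toLp_const_smul]
    refine MemLp.toLp_congr _ _ ?_
    rw [map_smul]
    exact Lp.coeFn_smul _ _

open Classical in
/-- The operators `cv` from `L^{3/2}` to `L²`. -/
noncomputable def cvT (l : ℝ) : Bd →L[ℝ] V32 F →L[ℝ] V2 F :=
  if hl : 0 < l then (exists_smoothing hl).choose else 0

theorem coeFn_cvT {l : ℝ} (hl : 0 < l) (b : Bd) (u : V32 F) :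
    (cvT l b u : E3 → F) =ᵐ[volume] (cv l b u : V32 F) := by
  rw [cvT, dif_pos hl]; exact (exists_smoothing hl).choose_spec.1 b u

theorem norm_cvT_le {l : ℝ} (hl : 0 < l) (b : Bd) (u : V32 F) :
    ‖cvT l b u‖ ≤ (wtMass ^ (5 / 6 : ℝ)).toReal * l ^ (-(1 / 2) : ℝ) * ‖b‖ * ‖u‖ := by
  rw [cvT, dif_pos hl]; exact (exists_smoothing hl).choose_spec.2 b u

/-- On continuous compactly supported functions the operator agrees with the averages acting on
`L²`, which are strongly continuous; these functions are dense in `L^{3/2}`. -/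
theorem continuousOn_cvT (b : Bd) (u : V32 F) : ContinuousOn (fun l => cvT l b u) (Ioc 0 1) := by
  refine continuousOn_family_of_dense (T := fun l => cvT l b)
    (C := (wtMass ^ (5 / 6 : ℝ)).toReal * ‖b‖) (by positivity) (fun l hl v => ?_)
    (dense_compactSupport (3 / 2)) ?_ u
  · refine (norm_cvT_le hl.1 b v).trans ?_
    have h1 := rpow_half_le hl
    refine mul_le_mul_of_nonneg_right ?_ (norm_nonneg _)
    rw [mul_right_comm]
    exact mul_le_mul_of_nonneg_left h1 (by positivity)
  · rintro v ⟨g, hg, hgc, hvg⟩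
    have hg2 : MemLp g 2 (volume : Measure E3) := hg.memLp_of_hasCompactSupport hgc
    refine (continuous_cv b (hg2.toLp g)).continuousOn.congr fun l hl => Lp.ext ?_
    refine (coeFn_cvT hl.1 b v).trans ((coeFn_cv l b v).trans (EventuallyEq.trans ?_
      (coeFn_cv l b (hg2.toLp g)).symm))
    rw [cvf_congr hl.1.ne' b (hvg.trans hg2.coeFn_toLp.symm)]

/-- Hölder with exponent six against the weight, then a change of variables: `(l^{-3})^{1/6} =
l^{-1/2}`. Averages of `L⁶` functions are thus bounded at every point. -/
theorem lintegral_ewt_le {l : ℝ} (hl : 0 < l) (u : V6 F) (x : E3) :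
    ∫⁻ z, ewt z * ‖u (x + l • z)‖ₑ ≤ wtMass ^ (5 / 6 : ℝ) *
      ENNReal.ofReal (l ^ (-(1 / 2) : ℝ)) * ‖u‖ₑ := by
  have hu := Lp.stronglyMeasurable u
  have hU : Measurable fun z => ‖u z‖ₑ := hu.enorm
  have h1 := lintegral_ewt_mul_le (p := 6) (by norm_num)
    (hU.comp ((measurable_shift_scale l).comp (measurable_const.prodMk measurable_id)) :
      Measurable fun z => ‖u (x + l • z)‖ₑ)
  refine h1.trans ?_
  have e0 : (1 - 1 / 6 : ℝ) = 5 / 6 := by norm_num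
  rw [e0, mul_assoc]
  refine mul_le_mul_right ?_ _
  have h2 : ∫⁻ z, ewt z * ‖u (x + l • z)‖ₑ ^ (6 : ℝ) ≤
      ENNReal.ofReal (l ^ (-3 : ℝ)) * ∫⁻ z, ‖u z‖ₑ ^ (6 : ℝ) := by
    rw [← lintegral_shift_scale hl x (hU.pow_const _)]
    exact lintegral_mono fun z => mul_le_of_le_one_left zero_le (ewt_le_one z)
  refine (ENNReal.rpow_le_rpow h2 (by norm_num)).trans (le_of_eq ?_)
  rw [Lp.enorm_def, eLpNorm_eq_lintegral_rpow_enorm_toReal (by simp) (by simp),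
    ENNReal.mul_rpow_of_nonneg _ _ (by norm_num),
    ENNReal.ofReal_rpow_of_nonneg (by positivity) (by norm_num), ← Real.rpow_mul hl.le]
  norm_num

theorem integrable_cvf {l : ℝ} (hl : 0 < l) (b : Bd) (u : V6 F) (x : E3) :
    Integrable fun z => (wt z * b z) • u (x + l • z) := by
  refine ⟨?_, ?_⟩
  · exact ((continuous_wt.mul b.continuous).aestronglyMeasurable).smul
      ((Lp.stronglyMeasurable u).comp_measurable (by fun_prop)).aestronglyMeasurable
  · rw [hasFiniteIntegral_iff_enorm]
    refine lt_of_le_of_lt (lintegral_mono (g := fun z => ‖b‖ₑ * (ewt z * ‖u (x + l • z)‖ₑ))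
      fun z => ?_) ?_
    · simp only [enorm_smul, ← mul_assoc]
      refine mul_le_mul_left ?_ _
      rw [Real.enorm_eq_ofReal_abs, ← ofReal_norm b, ewt, ← ENNReal.ofReal_mul (norm_nonneg _)]
      refine ENNReal.ofReal_le_ofReal ?_
      rw [mul_comm ‖b‖]
      exact norm_wt_mul_le b z
    · rw [lintegral_const_mul' _ _ enorm_ne_top]
      refine ENNReal.mul_lt_top enorm_lt_top (lt_of_le_of_lt (lintegral_ewt_le hl u x) ?_)
      exact ENNReal.mul_lt_top (ENNReal.mul_lt_top
        (ENNReal.rpow_lt_top_of_nonneg (by norm_num) wtMass_ne_top) ENNReal.ofReal_lt_top)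
        enorm_lt_top

theorem norm_cvf_le {l : ℝ} (hl : 0 < l) (b : Bd) (u : V6 F) (x : E3) :
    ‖cvf l b u x‖ ≤ (wtMass ^ (5 / 6 : ℝ)).toReal * l ^ (-(1 / 2) : ℝ) * ‖b‖ * ‖u‖ := by
  have h := (enorm_cvf_le l b u x).trans (mul_le_mul_right (lintegral_ewt_le hl u x) _)
  have hM : wtMass ^ (5 / 6 : ℝ) ≠ ⊤ := ENNReal.rpow_ne_top_of_nonneg (by norm_num) wtMass_ne_top
  have := ENNReal.toReal_mono (ENNReal.mul_ne_top enorm_ne_top (ENNReal.mul_ne_top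
      (ENNReal.mul_ne_top hM ENNReal.ofReal_ne_top) enorm_ne_top)) h
  rw [ENNReal.toReal_mul, ENNReal.toReal_mul, ENNReal.toReal_mul,
      ENNReal.toReal_ofReal (by positivity), toReal_enorm, toReal_enorm, toReal_enorm] at this
  linarith

theorem exists_cvEval {l : ℝ} (hl : 0 < l) : ∃ T : Bd →L[ℝ] V6 F →L[ℝ] F,
    ∀ b u, T b u = cvf l b u 0 := by
  refine ⟨LinearMap.mkContinuous₂ (LinearMap.mk₂ ℝ
    (fun (b : Bd) (u : V6 F) => cvf l b u 0) ?_ ?_ ?_ ?_)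
    ((wtMass ^ (5 / 6 : ℝ)).toReal * l ^ (-(1 / 2) : ℝ)) fun b u => norm_cvf_le hl b u 0,
    fun _ _ => rfl⟩
  · intro b b' u
    simp only [cvf]
    rw [← integral_add (integrable_cvf hl b u 0) (integrable_cvf hl b' u 0)]
    simp only [BoundedContinuousFunction.coe_add, Pi.add_apply, mul_add, add_smul]
  · intro c b u
    simp only [cvf]
    rw [← integral_smul]
    simp only [BoundedContinuousFunction.coe_smul, smul_eq_mul, smul_smul, mul_left_comm]
  · intro b u u'
    rw [cvf_congr hl.ne' b (Lp.coeFn_add u u')]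
    simp only [cvf]
    rw [← integral_add (integrable_cvf hl b u 0) (integrable_cvf hl b u' 0)]
    simp only [Pi.add_apply, smul_add]
  · intro c b u
    rw [cvf_congr hl.ne' b (Lp.coeFn_smul c u)]
    simp only [cvf]
    rw [← integral_smul]
    simp only [Pi.smul_apply, smul_comm c]

open Classical in
/-- The value at the origin of the averages `cv`, on `L⁶`. -/
noncomputable def cvEval (l : ℝ) : Bd →L[ℝ] V6 F →L[ℝ] F :=
  if hl : 0 < l then (exists_cvEval hl).choose else 0

theorem cvEval_apply {l : ℝ} (hl : 0 < l) (b : Bd) (u : V6 F) :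
    cvEval l b u = cvf l b u 0 := by
  rw [cvEval, dif_pos hl]; exact (exists_cvEval hl).choose_spec b u

theorem cvEval_tr {l : ℝ} (hl : 0 < l) (b : Bd) (u : V6 F) (x : E3) :
    cvEval l b (tr x u) = cvf l b u x := by
  rw [cvEval_apply hl, cvf_congr hl.ne' b (coeFn_tr x u)]
  refine integral_congr_ae (Eventually.of_forall fun z => ?_)
  simp only [zero_add, add_comm x]

theorem continuousOn_cvEval (b : Bd) (u : V6 F) :
    ContinuousOn (fun l => cvEval l b u) (Ioc 0 1) := by
  refine continuousOn_family_of_dense (T := fun l => cvEval l b)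
    (C := (wtMass ^ (5 / 6 : ℝ)).toReal * ‖b‖) (by positivity) (fun l hl v => ?_)
    (dense_compactSupport 6) ?_ u
  · rw [cvEval_apply hl.1]
    refine (norm_cvf_le hl.1 b v 0).trans ?_
    have h1 := rpow_half_le hl
    refine mul_le_mul_of_nonneg_right ?_ (norm_nonneg _)
    rw [mul_right_comm]
    exact mul_le_mul_of_nonneg_left h1 (by positivity)
  · rintro v ⟨g, hg, hgc, hvg⟩
    obtain ⟨M, hM⟩ := hgc.exists_bound_of_continuous hg
    have hc : Continuous fun l => cvf l b g 0 := by
      simp only [cvf]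
      refine continuous_of_dominated (bound := fun z => wt z * ‖b‖ * M) (fun l => ?_) (fun l => ?_)
        ((integrable_wt.mul_const _).mul_const _) (Eventually.of_forall fun z => ?_)
      · exact ((continuous_wt.mul b.continuous).smul (hg.comp (by fun_prop))).aestronglyMeasurable
      · refine Eventually.of_forall fun z => ?_
        rw [norm_smul]
        exact mul_le_mul (norm_wt_mul_le b z) (hM _) (norm_nonneg _)
          (mul_nonneg (wt_pos z).le (norm_nonneg _))
      · exact continuous_const.smul (hg.comp (by fun_prop))
    refine hc.continuousOn.congr fun l hl => ?_
    simp only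
    rw [cvEval_apply hl.1, cvf_congr hl.1.ne' b hvg]

end SmoothingOps

/-! ### Dilated cutoffs -/

section Cutoff

/-- A bump function equal to one on the unit ball and supported in the ball of radius two. -/
noncomputable def bump : ContDiffBump (0 : E3) :=
  { rIn := 1, rOut := 2, rIn_pos := one_pos, rIn_lt_rOut := one_lt_two }

/-- The cutoff `x ↦ χ(x/n)`. -/
noncomputable def cut (n : ℕ) (x : E3) : ℝ := bump ((n : ℝ)⁻¹ • x)

theorem contDiff_cut (n : ℕ) : ContDiff ℝ ∞ (cut n) := bump.contDiff.comp (contDiff_const_smul _)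

theorem hasCompactSupport_cut {n : ℕ} (hn : 1 ≤ n) : HasCompactSupport (cut n) :=
  bump.hasCompactSupport.comp_smul (inv_ne_zero (by positivity))

theorem norm_cut_le (n : ℕ) (x : E3) : ‖cut n x‖ ≤ 1 := by
  rw [cut, Real.norm_of_nonneg bump.nonneg]; exact bump.le_one

theorem fderiv_cut (n : ℕ) (x : E3) :
    fderiv ℝ (cut n) x = (n : ℝ)⁻¹ • fderiv ℝ bump ((n : ℝ)⁻¹ • x) := by
  have h1 : HasFDerivAt (fun x : E3 => (n : ℝ)⁻¹ • x) ((n : ℝ)⁻¹ • ContinuousLinearMap.id ℝ E3) x :=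
    (hasFDerivAt_id x).const_smul (n : ℝ)⁻¹
  have h2 : HasFDerivAt bump (fderiv ℝ bump ((n : ℝ)⁻¹ • x)) ((n : ℝ)⁻¹ • x) :=
    ((bump.contDiff (n := 1)).differentiable one_ne_zero _).hasFDerivAt
  have h3 := (h2.comp x h1).fderiv
  have h4 : fderiv ℝ (cut n) x = (fderiv ℝ bump ((n : ℝ)⁻¹ • x)).comp
    ((n : ℝ)⁻¹ • ContinuousLinearMap.id ℝ E3) := h3
  rw [h4]; ext v; simp

theorem norm_inv_smul_lt {n : ℕ} {x : E3} (h : ‖x‖ < n) : ‖(n : ℝ)⁻¹ • x‖ < 1 := by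
  have hn : (0 : ℝ) < n := lt_of_le_of_lt (norm_nonneg x) h
  rw [norm_smul, norm_inv, Real.norm_natCast, inv_mul_eq_div, div_lt_one hn]
  exact h

theorem fderiv_cut_eq_zero {n : ℕ} {x : E3} (h : ‖x‖ < n) : fderiv ℝ (cut n) x = 0 := by
  rw [fderiv_cut]
  have h1 : bump =ᶠ[𝓝 ((n : ℝ)⁻¹ • x)] fun _ => (1 : ℝ) :=
    bump.eventuallyEq_one_of_mem_ball (by
      rw [mem_ball_zero_iff]; exact norm_inv_smul_lt h)
  rw [h1.fderiv_eq]
  simp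

theorem cut_eq_one {n : ℕ} {x : E3} (h : ‖x‖ < n) : cut n x = 1 :=
  bump.one_of_mem_closedBall (by
    rw [mem_closedBall_zero_iff]; exact (norm_inv_smul_lt h).le)

theorem continuous_fderiv_bump : Continuous (fderiv ℝ bump) :=
  (bump.contDiff (n := 1)).continuous_fderiv one_ne_zero

theorem continuous_fderiv_cut (n : ℕ) : Continuous (fderiv ℝ (cut n)) :=
  ((contDiff_cut n).of_le (by exact_mod_cast le_top)).continuous_fderiv
    one_ne_zero

/-- The cutoff bound that suits functions in `L²`, through `1/∞ + 1/2 = 1/2`. -/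
theorem exists_eLpNorm_fderiv_cut_top : ∃ K : ℝ≥0∞, K ≠ ⊤ ∧ ∀ n : ℕ, 1 ≤ n →
    eLpNorm (fderiv ℝ (cut n)) ⊤ volume ≤ K := by
  obtain ⟨M, hM⟩ := (bump.hasCompactSupport.fderiv ℝ).exists_bound_of_continuous
    continuous_fderiv_bump
  refine ⟨ENNReal.ofReal M, ENNReal.ofReal_ne_top, fun n hn => ?_⟩
  rw [eLpNorm_exponent_top]
  refine eLpNormEssSup_le_of_ae_bound (Eventually.of_forall fun x => ?_)
  rw [fderiv_cut, norm_smul, norm_inv, Real.norm_natCast]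
  have h1 : ((n : ℝ)⁻¹) ≤ 1 := inv_le_one_of_one_le₀ (by exact_mod_cast hn)
  have h2 := hM ((n : ℝ)⁻¹ • x)
  have h3 := norm_nonneg (fderiv ℝ bump ((n : ℝ)⁻¹ • x))
  nlinarith

/-- Dilation by `n` multiplies the cube of the gradient by `n^{-3}` and volumes by `n³`, so the `L³`
norm is scale invariant in dimension three. This suits functions in `L⁶`, through `1/3 + 1/6 = 1/2`.
-/
theorem exists_eLpNorm_fderiv_cut_three : ∃ K : ℝ≥0∞, K ≠ ⊤ ∧ ∀ n : ℕ, 1 ≤ n →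
    eLpNorm (fderiv ℝ (cut n)) 3 volume ≤ K := by
  have hmem : MemLp (fderiv ℝ bump) 3 (volume : Measure E3) :=
    continuous_fderiv_bump.memLp_of_hasCompactSupport (bump.hasCompactSupport.fderiv ℝ)
  refine ⟨eLpNorm (fderiv ℝ bump) 3 volume, hmem.2.ne, fun n hn => ?_⟩
  have hn0 : (0 : ℝ) < n := by exact_mod_cast hn
  rw [eLpNorm_eq_lintegral_rpow_enorm_toReal (by simp) (by simp),
    eLpNorm_eq_lintegral_rpow_enorm_toReal (by simp) (by simp)]
  refine ENNReal.rpow_le_rpow (le_of_eq ?_) (by simp)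
  have h := lintegral_shift_scale (inv_pos.2 hn0) 0
    (U := fun y => ‖fderiv ℝ bump y‖ₑ ^ ENNReal.toReal 3)
    (continuous_fderiv_bump.enorm.measurable.pow_const _)
  simp only [zero_add] at h
  simp only [fderiv_cut, enorm_smul]
  simp only [ENNReal.mul_rpow_of_nonneg _ _ (ENNReal.toReal_nonneg (a := 3))]
  rw [lintegral_const_mul' _ _ (ENNReal.rpow_ne_top_of_nonneg ENNReal.toReal_nonneg enorm_ne_top),
    h, ← mul_assoc, Real.enorm_of_nonneg (by positivity), ENNReal.toReal_ofNat,
    ENNReal.ofReal_rpow_of_nonneg (by positivity) (by norm_num),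
    ← ENNReal.ofReal_mul (by positivity), ← Real.rpow_add (by positivity)]
  norm_num

end Cutoff

/-! ### The Sobolev inequality without compact support -/

section Sobolev

variable {F : Type*} [NormedAddCommGroup F] [InnerProductSpace ℝ F] [FiniteDimensional ℝ F]

/-- The inequality for compact support is applied to `χ_n f`. The error `f ∇χ_n` is controlled by
Hölder after subtracting from `f` a compactly supported approximation, and Fatou removes the cutoff.
-/
theorem eLpNorm_six_le_of_contDiff {f : E3 → F} (hf : ContDiff ℝ 1 f) {p q : ℝ≥0∞}
    [ENNReal.HolderTriple q p 2] (hp : p ≠ ⊤) (hfp : MemLp f p volume) {K : ℝ≥0∞} (hK : K ≠ ⊤)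
    (hχ : ∀ n : ℕ, 1 ≤ n → eLpNorm (fderiv ℝ (cut n)) q volume ≤ K) :
    eLpNorm f 6 volume ≤
      (SNormLESNormFDerivOfEqConst F (volume : Measure E3) 2 : ℝ≥0∞) *
        eLpNorm (fderiv ℝ f) 2 volume := by
  set S : ℝ≥0∞ := (SNormLESNormFDerivOfEqConst F (volume : Measure E3) 2 : ℝ≥0∞) with hS
  set D := eLpNorm (fderiv ℝ f) 2 volume with hD
  have hST : S ≠ ⊤ := ENNReal.coe_ne_top
  have hfc := hf.continuous
  have hf' : Continuous (fderiv ℝ f) := hf.continuous_fderiv one_ne_zero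
  have key : ∀ ε : ℝ≥0∞, ε ≠ 0 → eLpNorm f 6 volume ≤ S * (D + K * ε) := by
    intro ε hε
    obtain ⟨g, hgc, hle, hg, hgp⟩ := hfp.exists_hasCompactSupport_eLpNorm_sub_le hp hε
    obtain ⟨R, hR⟩ := hgc.isCompact.isBounded.exists_norm_le
    have hn : ∀ᶠ n : ℕ in atTop, eLpNorm (fun x => cut n x • f x) 6 volume ≤ S * (D + K * ε) := by
      filter_upwards [eventually_ge_atTop (max 1 (Nat.ceil R + 1))] with n hn
      have hn1 : 1 ≤ n := le_trans (le_max_left _ _) hn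
      have hnR : R < n := by
        have h1 : Nat.ceil R + 1 ≤ n := le_trans (le_max_right _ _) hn
        exact lt_of_le_of_lt (Nat.le_ceil R) (by exact_mod_cast h1)
      have hcd : ContDiff ℝ 1 (cut n) := (contDiff_cut n).of_le (by exact_mod_cast le_top)
      have h1 := eLpNorm_le_eLpNorm_fderiv_of_eq (volume : Measure E3) (u := fun x => cut n x • f x)
        (hcd.smul hf) (hasCompactSupport_cut hn1).smul_right (p := 2) (p' := 6) (by norm_num)
        (by simp) (by simp; norm_num)
      refine h1.trans (mul_le_mul_right ?_ _)
      -- `∇χ_n` vanishes for `|x| < n` and `g` vanishes for `|x| ≥ n`, so `g` may be subtracted for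
      -- free; the error term is then of size `ε`.
      have hder : fderiv ℝ (fun x => cut n x • f x) = fun x =>
          cut n x • fderiv ℝ f x + (fderiv ℝ (cut n) x).smulRight (f x - g x) := by
        funext x
        rw [fderiv_fun_smul (hcd.differentiable one_ne_zero x) (hf.differentiable one_ne_zero x)]
        congr 1
        rcases lt_or_ge ‖x‖ n with hx | hx
        · rw [fderiv_cut_eq_zero hx]; ext; simp
        · have : g x = 0 := by
            by_contra hne
            have := hR x (subset_tsupport _ hne)
            linarith
          rw [this, sub_zero]
      rw [hder]
      have hm1 : AEStronglyMeasurable (fun x => cut n x • fderiv ℝ f x) volume :=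
        (hcd.continuous.smul hf').aestronglyMeasurable
      have hm2 : AEStronglyMeasurable
          (fun x => (fderiv ℝ (cut n) x).smulRight (f x - g x)) volume := by
        have := continuous_fderiv_cut n
        have h := hfc.sub hg
        exact ((ContinuousLinearMap.smulRightL ℝ E3 F).continuous.comp this |>.clm_apply
          h).aestronglyMeasurable
      refine (eLpNorm_add_le hm1 hm2 (by norm_num)).trans (add_le_add ?_ ?_)
      · refine eLpNorm_mono fun x => ?_
        rw [norm_smul]
        exact mul_le_of_le_one_left (norm_nonneg _) (norm_cut_le n x)
      · have h2 := eLpNorm_le_eLpNorm_mul_eLpNorm_of_nnnorm (p := q) (q := p) (r := 2)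
          (μ := (volume : Measure E3)) (f := fderiv ℝ (cut n)) (g := f - g)
          (continuous_fderiv_cut n).aestronglyMeasurable (hfc.sub hg).aestronglyMeasurable
          (fun L y => L.smulRight y) 1 (Eventually.of_forall fun x => by
            rw [one_mul]
            exact (ContinuousLinearMap.nnnorm_smulRight_apply _ _).le)
        refine h2.trans ?_
        rw [ENNReal.coe_one, one_mul]
        exact mul_le_mul' (hχ n hn1) hle
    refine (Lp.eLpNorm_lim_le_liminf_eLpNorm (f := fun n x => cut n x • f x) (fun n => ?_) f
      (Eventually.of_forall fun x => ?_)).trans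
        (Filter.liminf_le_of_frequently_le' hn.frequently)
    · exact ((contDiff_cut n).continuous.smul hfc).aestronglyMeasurable
    · refine tendsto_const_nhds.congr' ?_
      filter_upwards [eventually_gt_atTop (Nat.ceil ‖x‖)] with n hn
      rw [cut_eq_one, one_smul]
      exact lt_of_le_of_lt (Nat.le_ceil _) (by exact_mod_cast hn)
  refine ENNReal.le_of_forall_pos_le_add fun ε hε _ => ?_
  have hSK : S * K + 1 ≠ ⊤ := ENNReal.add_ne_top.2 ⟨ENNReal.mul_ne_top hST hK, by simp⟩
  have h := key (ε / (S * K + 1)) (ENNReal.div_ne_zero.2 ⟨by exact_mod_cast hε.ne', hSK⟩)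
  refine h.trans ?_
  rw [mul_add, ← mul_assoc]
  refine add_le_add le_rfl ?_
  calc S * K * (ε / (S * K + 1)) ≤ (S * K + 1) * (ε / (S * K + 1)) :=
        mul_le_mul_left le_self_add _
    _ = ε := ENNReal.mul_div_cancel (by simp) hSK

/-- The dilate `l⁻³ φ(·/l)` of a test function. -/
noncomputable def Test.dil (l : ℝ) (hl : 0 < l) (φ : Test) : Test :=
  ⟨fun z => l ^ (-3 : ℝ) * φ (l⁻¹ • z),
    contDiff_const.mul (φ.2.1.comp (contDiff_const_smul _)),
    (φ.2.2.comp_smul (inv_ne_zero hl.ne')).mul_left⟩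

/-- A test function as a Schwartz function. -/
noncomputable def Test.toS (φ : Test) : 𝓢(E3, ℝ) := φ.2.2.toSchwartzMap φ.2.1

theorem Test.toS_apply (φ : Test) (x : E3) : φ.toS x = φ x := rfl

theorem integral_dil {l : ℝ} (hl : 0 < l) (φ : Test) (u : E3 → F) (x : E3) :
    cvf l (wker φ.toS 0) u x = ∫ y, (φ.dil l hl) (y - x) • u y := by
  rw [cvf, ← integral_add_right_eq_self (fun y => (φ.dil l hl) (y - x) • u y) x]
  have h0 : ∀ z, wt z * wker φ.toS 0 z = φ z := fun z => by
    rw [wt_mul_wker, sub_zero, Test.toS_apply]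
  simp only [h0, add_sub_cancel_right]
  have h1 := Measure.integral_comp_inv_smul_of_nonneg (volume : Measure E3)
    (fun z => φ z • u (x + l • z)) hl.le
  rw [finrank_euclideanSpace_fin] at h1
  have h2 : ∀ z : E3, l • (l⁻¹ • z) = z := fun z => by
    rw [smul_smul, mul_inv_cancel₀ hl.ne', one_smul]
  simp only [h2] at h1
  have h3 : ∀ z, (φ.dil l hl) z • u (z + x) = l ^ (-3 : ℝ) • (φ (l⁻¹ • z) • u (x + z)) := fun z => by
    rw [smul_smul, add_comm]; rfl
  simp only [h3]
  rw [integral_smul, h1, smul_smul, Real.rpow_neg hl.le]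
  have : l ^ (3 : ℝ) = l ^ 3 := by norm_cast
  rw [this, inv_mul_cancel₀ (by positivity), one_smul]

theorem exists_mollifier : ∃ φ : Test, ∫ x, φ x = 1 := by
  refine ⟨Test.mk (bump.normed volume) bump.contDiff_normed bump.hasCompactSupport_normed, ?_⟩
  exact bump.integral_normed

variable {p : ℝ≥0∞} [Fact (1 ≤ p)] [Fact (p ≠ ⊤)]

theorem coeFn_cv_toS [CompleteSpace F] (φ : Test) {l : ℝ} (hl : 0 < l)
    (u : Lp F p (volume : Measure E3)) :
    ((cv l (wker φ.toS 0) u : Lp F p (volume : Measure E3)) : E3 → F) =ᵐ[volume]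
      fun x => pr (φ.dil l hl) (tr x u) := by
  have h := coeFn_cv l (wker φ.toS 0) u
  filter_upwards [h] with x hx
  rw [hx, integral_dil hl, pr_tr]

-- The mollified function has the `C¹` representative `x ↦ ∫ ψ τ_x u`, whose partial derivatives are
-- the same pairings with the weak gradient. The classical inequality therefore applies.
set_option maxHeartbeats 1000000 in
theorem eLpNorm_six_cv_le {q : ℝ≥0∞}
    [ENNReal.HolderTriple q p 2] {K : ℝ≥0∞} (hK : K ≠ ⊤)
    (hχ : ∀ n : ℕ, 1 ≤ n → eLpNorm (fderiv ℝ (cut n)) q volume ≤ K)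
    {u : Lp F p (volume : Measure E3)} {g : Fin 3 → V2 F} (hg : ∀ j, HasWeakDeriv [j] u (g j))
    (φ : Test) {l : ℝ} (hl : 0 < l) :
    eLpNorm (cv l (wker φ.toS 0) u : Lp F p (volume : Measure E3)) 6 volume ≤
      (SNormLESNormFDerivOfEqConst F (volume : Measure E3) 2 : ℝ≥0∞) *
        ∑ j, ‖(cv l (wker φ.toS 0) (g j) : V2 F)‖ₑ := by
  have : CompleteSpace F := FiniteDimensional.complete ℝ F
  set ψ := φ.dil l hl with hψ
  obtain ⟨f, hf⟩ : ∃ f : E3 → F, f = fun x => pr ψ (tr x u) := ⟨_, rfl⟩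
  have hfu := (coeFn_cv_toS φ hl u).trans hf.symm.eventuallyEq
  have hder : ∀ x, HasFDerivAt f (∑ j : Fin 3, (EuclideanSpace.proj j : E3 →L[ℝ] ℝ).smulRight
      (pr ψ (tr x (g j)))) x := by
    intro x
    rw [hf]
    refine (hasFDerivAt_pr_tr ψ u x).congr_fderiv ?_
    simp only [pr_tr_weak (hg _)]
  have hfd : fderiv ℝ f = fun x => ∑ j : Fin 3, (EuclideanSpace.proj j : E3 →L[ℝ] ℝ).smulRight
      (pr ψ (tr x (g j))) := funext fun x => (hder x).fderiv
  have hcont : ∀ j, Continuous fun x => pr ψ (tr x (g j)) := fun j =>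
    (pr ψ).continuous.comp (continuous_tr (g j))
  have hf1 : ContDiff ℝ 1 f := by
    rw [contDiff_one_iff_fderiv]
    refine ⟨fun x => (hder x).differentiableAt, ?_⟩
    rw [hfd]
    refine continuous_finsetSum _ fun j _ => ?_
    exact (ContinuousLinearMap.smulRightL ℝ E3 F (EuclideanSpace.proj j)).continuous.comp (hcont j)
  have hmem : MemLp f p volume := (memLp_congr_ae hfu).1 (Lp.memLp _)
  rw [eLpNorm_congr_ae hfu]
  refine (eLpNorm_six_le_of_contDiff hf1 (Fact.out : p ≠ ⊤) hmem hK hχ).trans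
    (mul_le_mul_right ?_ _)
  rw [hfd]
  have hms : ∀ j, AEStronglyMeasurable (fun x => (EuclideanSpace.proj j : E3 →L[ℝ] ℝ).smulRight
      (pr ψ (tr x (g j)))) volume := fun j =>
    ((ContinuousLinearMap.smulRightL ℝ E3 F (EuclideanSpace.proj j)).continuous.comp
      (hcont j)).aestronglyMeasurable
  have e : (fun x => ∑ j : Fin 3, (EuclideanSpace.proj j : E3 →L[ℝ] ℝ).smulRight
      (pr ψ (tr x (g j)))) = ∑ j : Fin 3, fun x => (EuclideanSpace.proj j : E3 →L[ℝ] ℝ).smulRight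
      (pr ψ (tr x (g j))) := by
    funext x; simp [Finset.sum_apply]
  rw [e]
  refine (eLpNorm_sum_le (fun j _ => hms j) (by norm_num)).trans (Finset.sum_le_sum fun j _ => ?_)
  have hgu := coeFn_cv_toS φ hl (g j)
  rw [Lp.enorm_def, eLpNorm_congr_ae hgu]
  refine eLpNorm_mono fun x => ?_
  rw [ContinuousLinearMap.norm_smulRight_apply]
  refine mul_le_of_le_one_left (norm_nonneg _) ?_
  refine ContinuousLinearMap.opNorm_le_bound _ zero_le_one fun v => ?_
  rw [one_mul]
  exact PiLp.norm_apply_le v j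

/-- The bound for mollifications is uniform in the scale. Along a sequence of scales tending to zero
they converge in `L^p`, a subsequence converges almost everywhere, and Fatou gives the bound for
`u`. -/
theorem sobolev_aux {q : ℝ≥0∞} [ENNReal.HolderTriple q p 2] {K : ℝ≥0∞} (hK : K ≠ ⊤)
    (hχ : ∀ n : ℕ, 1 ≤ n → eLpNorm (fderiv ℝ (cut n)) q volume ≤ K) :
    ∃ C : ℝ, 0 ≤ C ∧ ∀ (u : Lp F p (volume : Measure E3)) (g : Fin 3 → V2 F),
      (∀ j, HasWeakDeriv [j] u (g j)) → eLpNorm u 6 volume ≤ ENNReal.ofReal (C * ‖g‖) := by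
  have : CompleteSpace F := FiniteDimensional.complete ℝ F
  obtain ⟨φ, hφ⟩ := exists_mollifier
  set S := SNormLESNormFDerivOfEqConst F (volume : Measure E3) 2
  set N : ℝ := (∫ z, wt z) * ‖wker φ.toS 0‖
  have hN : 0 ≤ N := mul_nonneg integral_wt_nonneg (norm_nonneg _)
  refine ⟨S * (3 * N), by positivity, fun u g hg => ?_⟩
  have hbound : ∀ l : ℝ, 0 < l →
      eLpNorm (cv l (wker φ.toS 0) u : Lp F p (volume : Measure E3)) 6 volume ≤
        ENNReal.ofReal (S * (3 * N) * ‖g‖) := by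
    intro l hl
    refine (eLpNorm_six_cv_le hK hχ hg φ hl).trans ?_
    have h1 : ∀ j, ‖(cv l (wker φ.toS 0) (g j) : V2 F)‖ₑ ≤ ENNReal.ofReal (N * ‖g‖) := by
      intro j
      rw [← ofReal_norm]
      refine ENNReal.ofReal_le_ofReal ((norm_cv_le l _ (g j)).trans ?_)
      exact mul_le_mul_of_nonneg_left (norm_le_pi_norm g j) hN
    refine (mul_le_mul_right (Finset.sum_le_sum fun j _ => h1 j) _).trans (le_of_eq ?_)
    have e : S * (3 * N) * ‖g‖ = S * (3 * (N * ‖g‖)) := by ring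
    rw [Finset.sum_const, Finset.card_univ, Fintype.card_fin, nsmul_eq_mul, e,
      ENNReal.ofReal_mul S.coe_nonneg,
      ENNReal.ofReal_mul (p := 3) (q := N * ‖g‖) (by norm_num)]
    rw [show ENNReal.ofReal (S : ℝ) = (S : ℝ≥0∞) from ENNReal.ofReal_coe_nnreal]
    rw [ENNReal.ofReal_ofNat, Nat.cast_ofNat]
  have h0 : cv 0 (wker φ.toS 0) u = u := by
    rw [cv_wker]
    simp only [sub_zero, zero_smul, tr_zero]
    rw [integral_smul_const]
    have : ∫ z, φ.toS z = 1 := hφ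
    rw [this, one_smul]
  have hlim : Tendsto (fun n : ℕ => cv ((n : ℝ) + 1)⁻¹ (wker φ.toS 0) u) atTop (𝓝 u) := by
    have h1 := ((continuous_cv (wker φ.toS 0) u).tendsto 0)
    rw [h0] at h1
    refine h1.comp ?_
    have := tendsto_one_div_add_atTop_nhds_zero_nat (𝕜 := ℝ)
    simpa using this
  obtain ⟨ns, hns, hae⟩ := (tendstoInMeasure_of_tendsto_Lp hlim).exists_seq_tendsto_ae
  refine (Lp.eLpNorm_lim_le_liminf_eLpNorm (fun n => Lp.aestronglyMeasurable _) u hae).trans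
    (Filter.liminf_le_of_frequently_le' (Eventually.of_forall fun n => ?_).frequently)
  exact hbound _ (by positivity)

theorem sobolev_six : ∃ C : ℝ, 0 ≤ C ∧ ∀ (u : V6 F) (g : Fin 3 → V2 F),
    (∀ j, HasWeakDeriv [j] u (g j)) → ‖u‖ ≤ C * ‖g‖ := by
  obtain ⟨K, hK, hχ⟩ := exists_eLpNorm_fderiv_cut_three
  have : ENNReal.HolderTriple 3 6 2 := ⟨by
    rw [← ENNReal.toReal_eq_toReal_iff' (by simp) (by simp),
      ENNReal.toReal_add (by simp) (by simp)]
    simp; norm_num⟩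
  obtain ⟨C, hC, h⟩ := sobolev_aux (F := F) (p := 6) hK hχ
  refine ⟨C, hC, fun u g hg => ?_⟩
  have := ENNReal.toReal_mono ENNReal.ofReal_ne_top (h u g hg)
  rwa [ENNReal.toReal_ofReal (by positivity), ← Lp.norm_def] at this

theorem memLp_six_of_hasWeakDeriv {u : V2 F} {g : Fin 3 → V2 F}
    (hg : ∀ j, HasWeakDeriv [j] u (g j)) : MemLp u 6 volume := by
  obtain ⟨K, hK, hχ⟩ := exists_eLpNorm_fderiv_cut_top
  obtain ⟨C, hC, h⟩ := sobolev_aux (F := F) (p := 2) hK hχ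
  exact ⟨Lp.aestronglyMeasurable u, (h u g hg).trans_lt ENNReal.ofReal_lt_top⟩

end Sobolev

/-! ### `Ḣ¹` as a Banach space with translations -/

section HDotSpace

variable {F : Type*} [NormedAddCommGroup F] [InnerProductSpace ℝ F] [FiniteDimensional ℝ F]

/-- The element of `Ḣ¹` with given function and weak gradient. -/
noncomputable def HDot1.mk (u : V6 F) (g : Fin 3 → V2 F) (h : ∀ j, HasWeakDeriv [j] u (g j)) :
    HDot1 F := ⟨(u, g), h⟩

variable (F) in
/-- The gradient as an isometric embedding. -/
noncomputable def gradL : HDot1 F →L[ℝ] (Fin 3 → V2 F) :=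
  (HDot1.grad F).mkContinuous 1 fun u => by rw [one_mul]; rfl

theorem norm_gradL (u : HDot1 F) : ‖gradL F u‖ = ‖u‖ := rfl

variable (F) in
/-- The Sobolev embedding of `Ḣ¹` into `L⁶`. -/
noncomputable def emb6 : HDot1 F →L[ℝ] V6 F :=
  ((LinearMap.fst ℝ _ _).comp (hdotGraph F).subtype : HDot1 F →ₗ[ℝ] V6 F).mkContinuousOfExistsBound
    (by
      obtain ⟨C, _, h⟩ := sobolev_six (F := F)
      exact ⟨C, fun u => h u.1.1 u.1.2 u.2⟩)

theorem emb6_apply (u : HDot1 F) : (emb6 F u : E3 → F) = u.fn := rfl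

theorem gradL_mk (u : V6 F) (g : Fin 3 → V2 F) (h : ∀ j, HasWeakDeriv [j] u (g j)) :
    gradL F (HDot1.mk u g h) = g := rfl

theorem emb6_hasWeakDeriv (u : HDot1 F) (j : Fin 3) :
    HasWeakDeriv [j] (emb6 F u) (gradL F u j) := u.2 j

theorem gradL_injective : Function.Injective (gradL F) := HDot1.grad_injective

theorem emb6_injective : Function.Injective (emb6 F) := by
  intro u v h
  refine gradL_injective (funext fun j => Lp.ext ?_)
  have h1 := emb6_hasWeakDeriv u j
  rw [h] at h1
  exact h1.unique (emb6_hasWeakDeriv v j)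

/-- This is how averages of source terms, which live in `L²` together with their gradients, are
recognized as elements of `Ḣ¹`. -/
theorem exists_hDot1_of_L2 {u : V2 F} {g : Fin 3 → V2 F} (h : ∀ j, HasWeakDeriv [j] u (g j)) :
    ∃ z : HDot1 F, z.fn =ᵐ[volume] u ∧ gradL F z = g := by
  have hm := memLp_six_of_hasWeakDeriv h
  refine ⟨HDot1.mk (hm.toLp u) g fun j => hasWeakDeriv_congr hm.coeFn_toLp.symm
    EventuallyEq.rfl (h j), hm.coeFn_toLp, rfl⟩

/-- A Cauchy sequence converges in `L⁶` by the Sobolev inequality and its gradients converge in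
`L²`; the weak derivative relation passes to the limit in each pairing. -/
instance : CompleteSpace (HDot1 F) := by
  refine Metric.complete_of_cauchySeq_tendsto fun z hz => ?_
  have hz6 : CauchySeq fun n => emb6 F (z n) := (emb6 F).uniformContinuous.comp_cauchySeq hz
  have hzg : CauchySeq fun n => gradL F (z n) := (gradL F).uniformContinuous.comp_cauchySeq hz
  obtain ⟨u, hu⟩ := cauchySeq_tendsto_of_complete hz6
  obtain ⟨g, hg⟩ := cauchySeq_tendsto_of_complete hzg
  have hw : ∀ j, HasWeakDeriv [j] u (g j) := by
    intro j
    rw [hasWeakDeriv_iff]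
    intro φ
    have h1 := ((pr φ).continuous.tendsto (g j)).comp (tendsto_pi_nhds.1 hg j)
    have h2 := (((pr (φ.pd j)).continuous.tendsto u).comp hu).neg
    refine tendsto_nhds_unique h1 (h2.congr fun n => ?_)
    exact (hasWeakDeriv_iff.1 (emb6_hasWeakDeriv (z n) j) φ).symm
  refine ⟨HDot1.mk u g hw, ?_⟩
  rw [tendsto_iff_norm_sub_tendsto_zero] at hg ⊢
  refine hg.congr fun n => ?_
  rw [← norm_gradL, map_sub, gradL_mk]

noncomputable instance : TransRep (HDot1 F) where
  act h := LinearMap.mkContinuous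
    { toFun := fun u => HDot1.mk (tr h (emb6 F u)) (fun j => tr h (gradL F u j))
        fun j => (emb6_hasWeakDeriv u j).tr h
      map_add' := fun u v => emb6_injective ((congrArg (tr h) (map_add (emb6 F) u v)).trans
        (map_add (tr h) (emb6 F u) (emb6 F v)))
      map_smul' := fun c u => emb6_injective ((congrArg (tr h) (map_smul (emb6 F) c u)).trans
        (map_smul (tr h) c (emb6 F u))) } 1 fun u => by
      have : ‖tr h (gradL F u)‖ = ‖gradL F u‖ := norm_tr h _
      rw [one_mul, ← norm_gradL, ← norm_gradL, ← this]
      exact le_of_eq rfl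
  act_zero v := emb6_injective (tr_zero (emb6 F v))
  act_add h k v := emb6_injective (tr_add h k (emb6 F v))
  norm_act h v := norm_tr h (gradL F v)
  continuous_act v := by
    have h1 := continuous_tr (gradL F v)
    rw [continuous_iff_continuousAt] at h1 ⊢
    intro h
    have h2 := h1 h
    rw [ContinuousAt, tendsto_iff_norm_sub_tendsto_zero] at h2 ⊢
    refine h2.congr fun k => ?_
    rw [← norm_gradL (_ - _), map_sub]
    rfl

theorem emb6_tr (h : E3) (u : HDot1 F) : emb6 F (tr h u) = tr h (emb6 F u) := rfl

theorem gradL_tr (h : E3) (u : HDot1 F) : gradL F (tr h u) = tr h (gradL F u) := rfl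

theorem isClosed_range_gradL : IsClosed (range (gradL F)) := by
  have : Isometry (gradL F) := AddMonoidHomClass.isometry_of_norm _ norm_gradL
  exact this.isClosedEmbedding.isClosed_range

/-- The gradient is isometric on a complete space, so its range is closed, and orthogonal projection
onto the range inverts it. The product is renormed with the `ℓ²` norm to be a Hilbert space. -/
theorem exists_gradL_leftInverse :
    ∃ P : (Fin 3 → V2 F) →L[ℝ] HDot1 F, ∀ z, P (gradL F z) = z := by
  set e := PiLp.continuousLinearEquiv 2 ℝ (fun _ : Fin 3 => V2 F) with he
  set G : HDot1 F →L[ℝ] PiLp 2 (fun _ : Fin 3 => V2 F) :=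
    (e.symm : (Fin 3 → V2 F) →L[ℝ] _).comp (gradL F) with hG
  have hcl : IsClosed (range G) := by
    have : range G = e.symm '' range (gradL F) := by
      rw [← range_comp]; rfl
    rw [this]
    exact e.symm.toHomeomorph.isClosedMap _ isClosed_range_gradL
  have hinj : Function.Injective G := e.symm.injective.comp gradL_injective
  have hcl' : IsClosed (G.range : Set (PiLp 2 (fun _ : Fin 3 => V2 F))) := hcl
  have hc : CompleteSpace G.range := hcl'.completeSpace_coe
  obtain ⟨P, hP⟩ := ContinuousLinearMap.HasLeftInverse.of_injective_of_isClosed_range_of_closedComplement_range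
    hinj hcl ⟨G.range.orthogonalProjectionOnto,
      Submodule.orthogonalProjectionOnto_mem_subspace_eq_self⟩
  exact ⟨P.comp (e.symm : (Fin 3 → V2 F) →L[ℝ] PiLp 2 (fun _ : Fin 3 => V2 F)), fun z => hP z⟩

variable (F) in
/-- A left inverse of the gradient. -/
noncomputable def gradInv : (Fin 3 → V2 F) →L[ℝ] HDot1 F := exists_gradL_leftInverse.choose

theorem gradInv_gradL (z : HDot1 F) : gradInv F (gradL F z) = z :=
  exists_gradL_leftInverse.choose_spec z

end HDotSpace

/-! ### Componentwise operators -/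

section Lifts

variable {B W Z : Type*} [NormedAddCommGroup B] [NormedSpace ℝ B]
    [NormedAddCommGroup W] [NormedSpace ℝ W] [NormedAddCommGroup Z] [NormedSpace ℝ Z]

variable (W Z) in
/-- Componentwise application of an operator. -/
noncomputable def piOp : (W →L[ℝ] Z) →L[ℝ] ((Fin 3 → W) →L[ℝ] (Fin 3 → Z)) :=
  ∑ i : Fin 3, (ContinuousLinearMap.compL ℝ (Fin 3 → W) Z (Fin 3 → Z)
      (ContinuousLinearMap.single ℝ (fun _ => Z) i)).comp
    ((ContinuousLinearMap.compL ℝ (Fin 3 → W) W Z).flip (ContinuousLinearMap.proj i))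

theorem piOp_apply (T : W →L[ℝ] Z) (w : Fin 3 → W) (i : Fin 3) : piOp W Z T w i = T (w i) := by
  simp only [piOp, sum_apply, ContinuousLinearMap.comp_apply, ContinuousLinearMap.compL_apply,
    ContinuousLinearMap.flip_apply, ContinuousLinearMap.proj_apply, Finset.sum_apply,
    ContinuousLinearMap.single_apply]
  simp [Pi.single_apply]

/-- Componentwise application of a smoothing family. -/
noncomputable def SmoothingFamily.pi (Q : SmoothingFamily B W Z) :
    SmoothingFamily B (Fin 3 → W) (Fin 3 → Z) where
  op l := (piOp W Z).comp (Q.op l)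
  const := Q.const
  const_nonneg := Q.const_nonneg
  bound l hl b w := by
    have h0 : 0 ≤ l ^ (-(3 / 2) : ℝ) := Real.rpow_nonneg hl.1.le _
    have h1 := Q.const_nonneg
    refine (pi_norm_le_iff_of_nonneg (by positivity)).2 fun i => ?_
    rw [ContinuousLinearMap.comp_apply, piOp_apply]
    exact (Q.bound l hl b (w i)).trans (mul_le_mul_of_nonneg_left (norm_le_pi_norm w i)
      (by positivity))
  cont b w := by
    refine continuousOn_pi.2 fun i => ?_
    simp only [ContinuousLinearMap.comp_apply, piOp_apply]
    exact Q.cont b (w i)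

theorem SmoothingFamily.pi_apply (Q : SmoothingFamily B W Z) (l : ℝ) (b : B) (w : Fin 3 → W)
    (i : Fin 3) : Q.pi.op l b w i = Q.op l b (w i) := by
  simp only [SmoothingFamily.pi, ContinuousLinearMap.comp_apply, piOp_apply]

end Lifts

/-! ### Averages of source terms with values in `L²` and in `Ḣ¹` -/

section Ops

variable {F : Type*} [NormedAddCommGroup F] [InnerProductSpace ℝ F] [FiniteDimensional ℝ F]

variable (F) in
/-- The space of source terms. -/
abbrev Src : Type _ := V32 F × V2 F

/-- The averages on source terms, with values in `L²`. -/
noncomputable def cvW (l : ℝ) : Bd →L[ℝ] Src F →L[ℝ] V2 F :=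
  ((ContinuousLinearMap.compL ℝ (Src F) (V32 F) (V2 F)).flip
      (ContinuousLinearMap.fst ℝ (V32 F) (V2 F))).comp (cvT l) +
  ((ContinuousLinearMap.compL ℝ (Src F) (V2 F) (V2 F)).flip
      (ContinuousLinearMap.snd ℝ (V32 F) (V2 F))).comp (cv l)

theorem cvW_apply (l : ℝ) (b : Bd) (w : Src F) : cvW l b w = cvT l b w.1 + cv l b w.2 := rfl

/-- The constant in the bound for `cvW`. -/
noncomputable def cvConst : ℝ := (wtMass ^ (5 / 6 : ℝ)).toReal + ∫ z, wt z

theorem cvConst_nonneg : 0 ≤ cvConst := add_nonneg ENNReal.toReal_nonneg integral_wt_nonneg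

theorem norm_cvW_le {l : ℝ} (hl : l ∈ Ioc (0 : ℝ) 1) (b : Bd) (w : Src F) :
    ‖cvW l b w‖ ≤ cvConst * l ^ (-(1 / 2) : ℝ) * ‖b‖ * ‖w‖ := by
  have h1 := norm_cvT_le hl.1 b w.1
  have h2 := norm_cv_le l b w.2
  have h3 : 1 ≤ l ^ (-(1 / 2) : ℝ) := Real.one_le_rpow_of_pos_of_le_one_of_nonpos hl.1 hl.2
    (by norm_num)
  have h4 := integral_wt_nonneg
  have h5 : ‖w.1‖ ≤ ‖w‖ := norm_fst_le w
  have h6 : ‖w.2‖ ≤ ‖w‖ := norm_snd_le w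
  have h7 : 0 ≤ (wtMass ^ (5 / 6 : ℝ)).toReal := ENNReal.toReal_nonneg
  rw [cvW_apply, cvConst, add_mul, add_mul, add_mul]
  refine (norm_add_le _ _).trans (add_le_add (h1.trans ?_) (h2.trans ?_))
  · exact mul_le_mul_of_nonneg_left h5 (by positivity)
  · refine mul_le_mul ?_ h6 (norm_nonneg _) (by positivity)
    refine mul_le_mul_of_nonneg_right ?_ (norm_nonneg _)
    exact le_mul_of_one_le_right h4 h3

theorem continuousOn_cvW (b : Bd) (w : Src F) : ContinuousOn (fun l => cvW l b w) (Ioc 0 1) :=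
  (continuousOn_cvT b w.1).add (continuous_cv b w.2).continuousOn

/-- The averages on source terms as a smoothing family into `L²`. -/
noncomputable def smL2 : SmoothingFamily Bd (Src F) (V2 F) where
  op := cvW
  const := cvConst
  const_nonneg := cvConst_nonneg
  bound l hl b w := by
    refine (norm_cvW_le hl b w).trans ?_
    have := cvConst_nonneg
    have h := rpow_half_le hl
    gcongr
  cont := continuousOn_cvW

/-- The smoothing family into `Ḣ¹` with prescribed gradient kernels. -/
noncomputable def smZ : SmoothingFamily (Fin 3 → Bd) (Src F) (HDot1 F) where
  -- Three arbitrary kernels need not produce a gradient. Composing with `gradInv` keeps the family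
  -- linear in all of `b`, and the factor `l⁻¹` from the derivative turns the size `l^{-1/2}` into
  -- `l^{-3/2}`.
  op l := ∑ j : Fin 3, (ContinuousLinearMap.compL ℝ (Src F) (V2 F) (HDot1 F)
      ((gradInv F).comp (ContinuousLinearMap.single ℝ (fun _ => V2 F) j))).comp
    ((-l⁻¹ • (cvW l : Bd →L[ℝ] Src F →L[ℝ] V2 F)).comp (ContinuousLinearMap.proj j))
  const := ‖gradInv F‖ * 3 * cvConst
  const_nonneg := by have := cvConst_nonneg; positivity
  bound l hl b w := by
    have hc := cvConst_nonneg
    have h0 : 0 ≤ l ^ (-(1 / 2) : ℝ) := Real.rpow_nonneg hl.1.le _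
    simp only [sum_apply, ContinuousLinearMap.comp_apply, ContinuousLinearMap.compL_apply]
    refine (norm_sum_le _ _).trans ?_
    have h1 : ∀ j : Fin 3, ‖gradInv F (ContinuousLinearMap.single ℝ (fun _ => V2 F) j
        ((-l⁻¹ • (cvW l : Bd →L[ℝ] Src F →L[ℝ] V2 F)) (b j) w))‖ ≤
        ‖gradInv F‖ * (cvConst * l ^ (-(3 / 2) : ℝ) * ‖b‖ * ‖w‖) := by
      intro j
      refine ((gradInv F).le_opNorm _).trans (mul_le_mul_of_nonneg_left ?_ (norm_nonneg _))
      have h2 : ‖ContinuousLinearMap.single ℝ (fun _ => V2 F) j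
        ((-l⁻¹ • (cvW l : Bd →L[ℝ] Src F →L[ℝ] V2 F)) (b j) w)‖ =
          ‖(-l⁻¹ • (cvW l : Bd →L[ℝ] Src F →L[ℝ] V2 F)) (b j) w‖ := Pi.norm_single ..
      rw [h2, smul_apply, smul_apply, norm_smul, norm_neg, norm_inv,
        Real.norm_of_nonneg hl.1.le]
      have h3 := norm_cvW_le hl (b j) w
      have h4 : l ^ (-(3 / 2) : ℝ) = l⁻¹ * l ^ (-(1 / 2) : ℝ) := by
        rw [← Real.rpow_neg_one, ← Real.rpow_add hl.1]; norm_num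
      rw [h4]
      have h5 : 0 ≤ l⁻¹ := inv_nonneg.2 hl.1.le
      calc l⁻¹ * ‖cvW l (b j) w‖ ≤ l⁻¹ * (cvConst * l ^ (-(1 / 2) : ℝ) * ‖b j‖ * ‖w‖) :=
            mul_le_mul_of_nonneg_left h3 h5
        _ ≤ l⁻¹ * (cvConst * l ^ (-(1 / 2) : ℝ) * ‖b‖ * ‖w‖) := by
            refine mul_le_mul_of_nonneg_left (mul_le_mul_of_nonneg_right ?_ (norm_nonneg _)) h5
            exact mul_le_mul_of_nonneg_left (norm_le_pi_norm b j) (by positivity)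
        _ = _ := by ring
    refine (Finset.sum_le_sum fun j _ => h1 j).trans (le_of_eq ?_)
    rw [Finset.sum_const, Finset.card_univ, Fintype.card_fin]
    ring
  cont b w := by
    simp only [sum_apply, ContinuousLinearMap.comp_apply, ContinuousLinearMap.compL_apply,
      ContinuousLinearMap.proj_apply, smul_apply]
    refine continuousOn_finsetSum _ fun j _ => ?_
    refine (gradInv F).continuous.comp_continuousOn
      ((ContinuousLinearMap.single ℝ (fun _ => V2 F) j).continuous.comp_continuousOn ?_)
    have h1 : ContinuousOn (fun l : ℝ => -l⁻¹) (Ioc 0 1) :=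
      (continuousOn_inv₀.mono fun x hx => hx.1.ne').neg
    exact h1.smul (continuousOn_cvW (b j) w)

theorem smZ_apply (l : ℝ) (b : Fin 3 → Bd) (w : Src F) :
    smZ.op l b w = gradInv F fun j => -l⁻¹ • cvW l (b j) w := by
  have h : (fun j => -l⁻¹ • cvW l (b j) w) = ∑ j : Fin 3,
      ContinuousLinearMap.single ℝ (fun _ => V2 F) j (-l⁻¹ • cvW l (b j) w) := by
    funext i
    simp [Finset.sum_apply, Pi.single_apply]
  rw [h, map_sum]
  simp only [smZ, sum_apply, ContinuousLinearMap.comp_apply, ContinuousLinearMap.compL_apply,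
      ContinuousLinearMap.proj_apply, smul_apply]

/-- The kernels `∂_j k(· - h)`, relative to the weight. -/
noncomputable def gker (k : 𝓢(E3, ℝ)) (h : E3) : Fin 3 → Bd := fun j => wker (∂_{ej j} k) h

theorem contDiff_gker (k : 𝓢(E3, ℝ)) : ContDiff ℝ ∞ (gker k) :=
  contDiff_pi.2 fun j => contDiff_wker (∂_{ej j} k)

variable {p q : ℝ≥0∞} [Fact (1 ≤ p)] [Fact (p ≠ ⊤)] [Fact (1 ≤ q)] [Fact (q ≠ ⊤)]

theorem tr_ae_congr {u : Lp F p (volume : Measure E3)} {v : Lp F q (volume : Measure E3)}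
    (h : (u : E3 → F) =ᵐ[volume] v) (k : E3) :
    ((tr k u : Lp F p (volume : Measure E3)) : E3 → F) =ᵐ[volume]
      (tr k v : Lp F q (volume : Measure E3)) := by
  filter_upwards [coeFn_tr k u, coeFn_tr k v,
    (measurePreserving_shift k).quasiMeasurePreserving.ae_eq h] with x h1 h2 h3
  rw [h1, h2]; exact h3

theorem tr_cvT {l : ℝ} (hl : 0 < l) (h : E3) (b : Bd) (u : V32 F) :
    tr h (cvT l b u) = cvT l b (tr h u) := by
  refine Lp.ext ((tr_ae_congr (coeFn_cvT hl b u) h).trans ?_)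
  rw [tr_cv]
  exact (coeFn_cvT hl b (tr h u)).symm

theorem tr_cvW {l : ℝ} (hl : 0 < l) (h : E3) (b : Bd) (w : Src F) :
    tr h (cvW l b w) = cvW l b (tr h w) := by
  rw [cvW_apply, cvW_apply, map_add, tr_cvT hl, tr_cv]; rfl

theorem tr_cvW_wker {l : ℝ} (hl : 0 < l) (k : 𝓢(E3, ℝ)) (h : E3) (w : Src F) :
    tr (l • h) (cvW l (wker k 0) w) = cvW l (wker k h) w := by
  rw [cvW_apply, cvW_apply, map_add, tr_cv_wker, zero_add]
  congr 1
  refine Lp.ext ((tr_ae_congr (coeFn_cvT hl _ w.1) (l • h)).trans ?_)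
  rw [tr_cv_wker, zero_add]
  exact (coeFn_cvT hl _ w.1).symm

theorem hasWeakDeriv_cvW {l : ℝ} (hl : 0 < l) (k : 𝓢(E3, ℝ)) (w : Src F) (j : Fin 3) :
    HasWeakDeriv [j] (cvW l (wker k 0) w : V2 F) (-l⁻¹ • cvW l (gker k 0 j) w : V2 F) := by
  have h1 := (hasTD_cv hl.ne' k w.1).hasWeakDeriv j
  have h2 := (hasTD_cv hl.ne' k w.2).hasWeakDeriv j
  have h1' : HasWeakDeriv [j] (cvT l (wker k 0) w.1 : V2 F)
      (-l⁻¹ • cvT l (gker k 0 j) w.1 : V2 F) := by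
    refine hasWeakDeriv_congr (coeFn_cvT hl _ w.1).symm ?_ h1
    refine (Lp.coeFn_smul _ _).trans (EventuallyEq.trans ?_ (Lp.coeFn_smul _ _).symm)
    exact (coeFn_cvT hl _ w.1).symm.const_smul _
  refine hasWeakDeriv_congr (Lp.coeFn_add _ _).symm ?_ (hasWeakDeriv_add h1' h2)
  rw [cvW_apply, smul_add]
  exact (Lp.coeFn_add _ _).symm

/-- When the kernels are the partial derivatives of one kernel, the three components are a genuine
gradient, on which `gradInv` acts as the exact inverse. -/
theorem smZ_spec {l : ℝ} (hl : 0 < l) (k : 𝓢(E3, ℝ)) (w : Src F) :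
    (smZ.op l (gker k 0) w : HDot1 F).fn =ᵐ[volume] (cvW l (wker k 0) w : V2 F) ∧
    gradL F (smZ.op l (gker k 0) w) = fun j => -l⁻¹ • cvW l (gker k 0 j) w := by
  obtain ⟨z, hz1, hz2⟩ := exists_hDot1_of_L2 (hasWeakDeriv_cvW hl k w)
  have : smZ.op l (gker k 0) w = z := by
    rw [smZ_apply, ← hz2, gradInv_gradL]
  rw [this]
  exact ⟨hz1, hz2⟩

theorem tr_smZ_gker {l : ℝ} (hl : 0 < l) (k : 𝓢(E3, ℝ)) (h : E3) (w : Src F) :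
    tr (l • h) (smZ.op l (gker k 0) w : HDot1 F) = smZ.op l (gker k h) w := by
  rw [← gradInv_gradL (tr (l • h) (smZ.op l (gker k 0) w)), gradL_tr, (smZ_spec hl k w).2,
    smZ_apply]
  congr 1
  funext j
  rw [tr_pi_apply, map_smul, gker, tr_cvW_wker hl]; rfl

theorem tr_smZ {l : ℝ} (hl : 0 < l) (k : 𝓢(E3, ℝ)) (h : E3) (w : Src F) :
    tr h (smZ.op l (gker k 0) w : HDot1 F) = smZ.op l (gker k 0) (tr h w) := by
  refine gradL_injective ?_
  rw [gradL_tr, (smZ_spec hl k w).2, (smZ_spec hl k _).2]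
  funext j
  rw [tr_pi_apply, map_smul, tr_cvW hl]

end Ops

/-! ### The nonlinearity as a smooth translation-equivariant map into `L^{3/2} × L²` -/

section Nonlinearity

variable {𝔤 : Type*} [InvariantLieAlgebra 𝔤] [FiniteDimensional ℝ 𝔤]

variable (𝔤) in
/-- The Lie bracket as a continuous bilinear map. -/
noncomputable def lieL : 𝔤 →L[ℝ] 𝔤 →L[ℝ] 𝔤 :=
  (LinearMap.mk₂ ℝ (fun x y : 𝔤 => ⁅x, y⁆) add_lie smul_lie lie_add
    lie_smul).toContinuousBilinearMap

instance holderTriple_six_two : ENNReal.HolderTriple 6 2 (3 / 2) := ⟨by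
  rw [← ENNReal.toReal_eq_toReal_iff' (by simp) (by simp), ENNReal.toReal_add (by simp) (by simp)]
  simp; norm_num⟩

instance holderTriple_six_six : ENNReal.HolderTriple 6 6 3 := ⟨by
  rw [← ENNReal.toReal_eq_toReal_iff' (by simp) (by simp), ENNReal.toReal_add (by simp) (by simp)]
  simp; norm_num⟩

instance holderTriple_six_three : ENNReal.HolderTriple 6 3 2 := ⟨by
  rw [← ENNReal.toReal_eq_toReal_iff' (by simp) (by simp), ENNReal.toReal_add (by simp) (by simp)]
  simp; norm_num⟩

variable (𝔤) in
/-- The bracket `L⁶ × L² → L^{3/2}`. -/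
noncomputable def br62 : V6 𝔤 →L[ℝ] V2 𝔤 →L[ℝ] V32 𝔤 := (lieL 𝔤).holderL volume 6 2 (3 / 2)

variable (𝔤) in
/-- The bracket `L⁶ × L⁶ → L³`. -/
noncomputable def br66 : V6 𝔤 →L[ℝ] V6 𝔤 →L[ℝ] Lp 𝔤 3 (volume : Measure E3) :=
  (lieL 𝔤).holderL volume 6 6 3

variable (𝔤) in
/-- The bracket `L⁶ × L³ → L²`. -/
noncomputable def br63 : V6 𝔤 →L[ℝ] Lp 𝔤 3 (volume : Measure E3) →L[ℝ] V2 𝔤 :=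
  (lieL 𝔤).holderL volume 6 3 2

theorem tr_holder {p q r : ℝ≥0∞} [Fact (1 ≤ p)] [Fact (p ≠ ⊤)] [Fact (1 ≤ q)] [Fact (q ≠ ⊤)]
    [Fact (1 ≤ r)] [Fact (r ≠ ⊤)] [ENNReal.HolderTriple p q r] (h : E3)
    (u : Lp 𝔤 p (volume : Measure E3)) (v : Lp 𝔤 q (volume : Measure E3)) :
    (lieL 𝔤).holderL volume p q r (tr h u) (tr h v) =
      tr h ((lieL 𝔤).holderL volume p q r u v) := by
  refine Lp.ext ?_
  have h1 := (lieL 𝔤).coeFn_holder (r := r) (tr h u) (tr h v)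
  have h2 := (measurePreserving_shift h).quasiMeasurePreserving.ae_eq
    ((lieL 𝔤).coeFn_holder (r := r) u v)
  filter_upwards [h1, h2, coeFn_tr h ((lieL 𝔤).holderL volume p q r u v), coeFn_tr h u,
    coeFn_tr h v] with x e1 e2 e3 e4 e5
  rw [e3]
  refine e1.trans ?_
  rw [e4, e5]
  exact e2.symm

/-- The nonlinearity. -/
noncomputable def nl (A : Conn 𝔤) (i : Fin 3) : Src 𝔤 :=
  (∑ l : Fin 3, ((2 : ℝ) • br62 𝔤 (emb6 𝔤 (A l)) (gradL 𝔤 (A i) l)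
      - br62 𝔤 (emb6 𝔤 (A l)) (gradL 𝔤 (A l) i)),
    ∑ l : Fin 3, br63 𝔤 (emb6 𝔤 (A l)) (br66 𝔤 (emb6 𝔤 (A l)) (emb6 𝔤 (A i))))

theorem nl_zero : nl (0 : Conn 𝔤) = 0 := by
  funext i
  simp [nl]

theorem nl_tr (h : E3) (A : Conn 𝔤) : nl (tr h A) = tr h (nl A) := by
  funext i
  rw [tr_pi_apply, tr_prod]
  simp only [nl, map_sum, map_sub, map_smul, tr_pi_apply, emb6_tr, gradL_tr, br62, br66, br63,
    tr_holder]

theorem nl_ae (A : Conn 𝔤) (i : Fin 3) :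
    nonlin A i =ᵐ[volume] fun x => (nl A i).1 x + (nl A i).2 x := by
  have e1 := fun l => (lieL 𝔤).coeFn_holder (r := 3 / 2) (emb6 𝔤 (A l)) (gradL 𝔤 (A i) l)
  have e2 := fun l => (lieL 𝔤).coeFn_holder (r := 3 / 2) (emb6 𝔤 (A l)) (gradL 𝔤 (A l) i)
  have e3 := fun l => (lieL 𝔤).coeFn_holder (r := 3) (emb6 𝔤 (A l)) (emb6 𝔤 (A i))
  have e4 := fun l => (lieL 𝔤).coeFn_holder (r := 2) (emb6 𝔤 (A l))
    (br66 𝔤 (emb6 𝔤 (A l)) (emb6 𝔤 (A i)))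
  have a1 : ((nl A i).1 : E3 → 𝔤) =ᵐ[volume] fun x => ∑ l : Fin 3,
      ((2 : ℝ) • ⁅(A l).fn x, HDot1.grad 𝔤 (A i) l x⁆ - ⁅(A l).fn x, HDot1.grad 𝔤 (A l) i x⁆) := by
    have hs := fun l => (Lp.coeFn_sub ((2 : ℝ) • br62 𝔤 (emb6 𝔤 (A l)) (gradL 𝔤 (A i) l))
      (br62 𝔤 (emb6 𝔤 (A l)) (gradL 𝔤 (A l) i)))
    have hm := fun l => Lp.coeFn_smul (2 : ℝ) (br62 𝔤 (emb6 𝔤 (A l)) (gradL 𝔤 (A i) l))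
    refine (Lp.coeFn_finsetSum _ _).trans ?_
    filter_upwards [ae_all_iff.2 e1, ae_all_iff.2 e2, ae_all_iff.2 hs, ae_all_iff.2 hm]
      with x h1 h2 h3 h4
    rw [Finset.sum_apply]
    refine Finset.sum_congr rfl fun l _ => ?_
    rw [h3, Pi.sub_apply, h4, Pi.smul_apply]
    exact congrArg₂ (fun a b => (2 : ℝ) • a - b) (h1 l) (h2 l)
  have a2 : ((nl A i).2 : E3 → 𝔤) =ᵐ[volume] fun x => ∑ l : Fin 3,
      ⁅(A l).fn x, ⁅(A l).fn x, (A i).fn x⁆⁆ := by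
    refine (Lp.coeFn_finsetSum _ _).trans ?_
    filter_upwards [ae_all_iff.2 e3, ae_all_iff.2 e4] with x h1 h2
    rw [Finset.sum_apply]
    refine Finset.sum_congr rfl fun l _ => ?_
    refine (h2 l).trans ?_
    exact congrArg (fun y => ⁅(A l).fn x, y⁆) (h1 l)
  filter_upwards [a1, a2] with x h1 h2
  rw [h1, h2, nonlin, ← Finset.sum_add_distrib]

theorem contDiff_bilin {V X Y Y' : Type*} [NormedAddCommGroup V] [NormedSpace ℝ V]
    [NormedAddCommGroup X] [NormedSpace ℝ X] [NormedAddCommGroup Y] [NormedSpace ℝ Y]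
    [NormedAddCommGroup Y'] [NormedSpace ℝ Y'] (B : X →L[ℝ] Y →L[ℝ] Y') {f : V → X} {g : V → Y}
    (hf : ContDiff ℝ ∞ f) (hg : ContDiff ℝ ∞ g) : ContDiff ℝ ∞ fun x => B (f x) (g x) :=
  (B.contDiff.comp hf).clm_apply hg

theorem contDiff_nl : ContDiff ℝ ∞ (nl : Conn 𝔤 → Fin 3 → Src 𝔤) := by
  have c1 : ∀ l, ContDiff ℝ ∞ fun A : Conn 𝔤 => emb6 𝔤 (A l) := fun l =>
    (emb6 𝔤).contDiff.comp (contDiff_apply ℝ (HDot1 𝔤) l)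
  have c2 : ∀ l j, ContDiff ℝ ∞ fun A : Conn 𝔤 => gradL 𝔤 (A l) j := fun l j =>
    contDiff_pi.1 ((gradL 𝔤).contDiff.comp (contDiff_apply ℝ (HDot1 𝔤) l)) j
  refine contDiff_pi.2 fun i => ContDiff.prodMk (ContDiff.sum fun l _ => ?_)
    (ContDiff.sum fun l _ => ?_)
  · exact ((contDiff_bilin (br62 𝔤) (c1 l) (c2 i l)).const_smul (2 : ℝ)).sub
      (contDiff_bilin (br62 𝔤) (c1 l) (c2 l i))
  · exact contDiff_bilin (br63 𝔤) (c1 l) (contDiff_bilin (br66 𝔤) (c1 l) (c1 i))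

theorem hasFDerivAt_bilin_zero {V X Y Y' : Type*} [NormedAddCommGroup V] [NormedSpace ℝ V]
    [NormedAddCommGroup X] [NormedSpace ℝ X] [NormedAddCommGroup Y] [NormedSpace ℝ Y]
    [NormedAddCommGroup Y'] [NormedSpace ℝ Y'] (B : X →L[ℝ] Y →L[ℝ] Y') {f : V → X} {g : V → Y}
    {f' : V →L[ℝ] X} {g' : V →L[ℝ] Y} (hf : HasFDerivAt f f' 0) (hg : HasFDerivAt g g' 0)
    (hf0 : f 0 = 0) (hg0 : g 0 = 0) :
    HasFDerivAt (fun A => B (f A) (g A)) (0 : V →L[ℝ] Y') 0 := by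
  refine (B.hasFDerivAt_of_bilinear hf hg).congr_fderiv ?_
  ext v
  simp [hf0, hg0]

/-- Every term is bilinear in quantities that vanish at `A = 0`. -/
theorem hasFDerivAt_nl_zero :
    HasFDerivAt (nl : Conn 𝔤 → Fin 3 → Src 𝔤) (0 : Conn 𝔤 →L[ℝ] (Fin 3 → Src 𝔤)) 0 := by
  have c1 : ∀ l, HasFDerivAt (fun A : Conn 𝔤 => emb6 𝔤 (A l))
      ((emb6 𝔤).comp (ContinuousLinearMap.proj l)) 0 := fun l =>
    ((emb6 𝔤).comp (ContinuousLinearMap.proj (R := ℝ) (φ := fun _ : Fin 3 => HDot1 𝔤)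
      l)).hasFDerivAt
  have c2 : ∀ l j, HasFDerivAt (fun A : Conn 𝔤 => gradL 𝔤 (A l) j)
      ((ContinuousLinearMap.proj j).comp ((gradL 𝔤).comp (ContinuousLinearMap.proj l))) 0 :=
    fun l j => ((ContinuousLinearMap.proj (R := ℝ) (φ := fun _ : Fin 3 => V2 𝔤) j).comp
      ((gradL 𝔤).comp (ContinuousLinearMap.proj (R := ℝ) (φ := fun _ : Fin 3 => HDot1 𝔤)
        l))).hasFDerivAt
  have h1 := fun i l => hasFDerivAt_bilin_zero (br62 𝔤) (c1 l) (c2 i l) (by simp) (by simp)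
  have h2 := fun i l => hasFDerivAt_bilin_zero (br62 𝔤) (c1 l) (c2 l i) (by simp) (by simp)
  have h3 := fun i l => hasFDerivAt_bilin_zero (br66 𝔤) (c1 l) (c1 i) (by simp) (by simp)
  have h4 := fun i l => hasFDerivAt_bilin_zero (br63 𝔤) (c1 l) (h3 i l) (by simp) (by simp)
  refine hasFDerivAt_pi'.2 fun i => ?_
  have h5 := (HasFDerivAt.fun_sum (u := Finset.univ) fun l _ =>
    ((h1 i l).const_smul (2 : ℝ)).sub (h2 i l)).prodMk
    (HasFDerivAt.fun_sum (u := Finset.univ) fun l _ => h4 i l)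
  refine h5.congr_fderiv ?_
  ext v <;> simp

end Nonlinearity

attribute [local irreducible] cv cvT cvW pr duh wker

/-! ### The Duhamel operator in the original time variable -/

section Duhamel

variable {B W Z G : Type*} [NormedAddCommGroup B] [NormedSpace ℝ B]
    [NormedAddCommGroup W] [NormedSpace ℝ W] [NormedAddCommGroup Z] [NormedSpace ℝ Z]
    [NormedAddCommGroup G] [NormedSpace ℝ G] [CompleteSpace Z] [CompleteSpace G]

/-- The weight `s^{1/8}`. -/
noncomputable def eighth : C(I, ℝ) :=
  ⟨fun s => (s : ℝ) ^ (1 / 8 : ℝ),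
    Continuous.rpow_const continuous_subtype_val fun _ => Or.inr (by norm_num)⟩

/-- The Duhamel operator. -/
noncomputable def duhamel (Q : SmoothingFamily B W Z) : C(I, B) →L[ℝ] C(I, W) →L[ℝ] C(I, Z) :=
  (ContinuousLinearMap.compL ℝ C(I, W) C(I, Z) C(I, Z)
    (bilinC I (ContinuousLinearMap.lsmul ℝ ℝ) eighth)).comp (duh Q)

theorem duhamel_apply (Q : SmoothingFamily B W Z) (b : C(I, B)) (F : C(I, W)) (s : I) :
    duhamel Q b F s = (s : ℝ) ^ (1 / 8 : ℝ) • duh Q b F s := rfl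

theorem integral_triangle {f : ℝ → ℝ → G} (hf : Continuous (Function.uncurry f)) {s : ℝ}
    (hs : 0 ≤ s) :
    ∫ r in (0 : ℝ)..s, ∫ q in (0 : ℝ)..r, f r q = ∫ q in (0 : ℝ)..s, ∫ r in q..s, f r q := by
  have hm : MeasurableSet {p : ℝ × ℝ | p.2 ≤ p.1} := measurableSet_le measurable_snd measurable_fst
  have hi : Integrable (({p : ℝ × ℝ | p.2 ≤ p.1}).indicator (Function.uncurry f))
      ((volume.restrict (Ioc 0 s)).prod (volume.restrict (Ioc 0 s))) := by
    rw [Measure.prod_restrict]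
    refine IntegrableOn.integrable ?_ |>.indicator hm
    exact (hf.continuousOn.integrableOn_compact (isCompact_Icc.prod isCompact_Icc)).mono_set
      (prod_mono Ioc_subset_Icc_self Ioc_subset_Icc_self)
  have h := integral_integral_swap (f := fun r q => ({p : ℝ × ℝ | p.2 ≤ p.1}).indicator
    (Function.uncurry f) (r, q)) hi
  rw [intervalIntegral.integral_of_le hs, intervalIntegral.integral_of_le hs]
  have e1 : ∫ r in Ioc 0 s, ∫ q in (0 : ℝ)..r, f r q = ∫ r in Ioc 0 s, ∫ q in Ioc 0 s,
      ({p : ℝ × ℝ | p.2 ≤ p.1}).indicator (Function.uncurry f) (r, q) := by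
    refine setIntegral_congr_fun measurableSet_Ioc fun r hr => ?_
    have e : (fun q => ({p : ℝ × ℝ | p.2 ≤ p.1}).indicator (Function.uncurry f) (r, q)) =
        (Iic r).indicator (f r) := by
      funext q; by_cases hq : q ≤ r <;> simp [indicator, hq]
    rw [e, setIntegral_indicator measurableSet_Iic, Ioc_inter_Iic, min_eq_right hr.2,
      intervalIntegral.integral_of_le hr.1.le]
  have e2 : ∫ q in Ioc 0 s, ∫ r in q..s, f r q = ∫ q in Ioc 0 s, ∫ r in Ioc 0 s,
      ({p : ℝ × ℝ | p.2 ≤ p.1}).indicator (Function.uncurry f) (r, q) := by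
    refine setIntegral_congr_fun measurableSet_Ioc fun q hq => ?_
    have e : (fun r => ({p : ℝ × ℝ | p.2 ≤ p.1}).indicator (Function.uncurry f) (r, q)) =
        (Ici q).indicator (fun r => f r q) := by
      funext r; by_cases hr : q ≤ r <;> simp [indicator, hr]
    rw [e, setIntegral_indicator measurableSet_Ici, intervalIntegral.integral_of_le hq.2,
      ← integral_Icc_eq_integral_Ioc]
    have : Ioc 0 s ∩ Ici q = Icc q s := by
      ext r
      simp only [mem_inter_iff, mem_Ioc, mem_Ici, mem_Icc]
      constructor
      · rintro ⟨⟨_, h⟩, h'⟩; exact ⟨h', h⟩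
      · rintro ⟨h', h⟩; exact ⟨⟨hq.1.trans_le h', h⟩, h'⟩
    rw [this]
  rw [e1, e2, h]

/-- Undoes the substitution `r = s ρ`: the split powers recombine to `s^{1/8} s^{7/8} = s`, the
Jacobian. -/
theorem map_duhamel_const (Q : SmoothingFamily B W Z) (b : B) (F : C(I, W)) (Θ : Z →L[ℝ] G)
    (s : I) : Θ (duhamel Q (ContinuousMap.const I b) F s) =
      ∫ q in (0 : ℝ)..s, Θ (Q.op √(s - q) b (F (projIcc 0 1 zero_le_one q))) := by
  rw [duhamel_apply, duh_apply, map_smul, ← Θ.integral_comp_comm (duhInt_integrable Q _ F s.2)]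
  have h := intervalIntegral.smul_integral_comp_mul_left (a := 0) (b := 1)
    (fun q => Θ (Q.op √(s - q) b (F (projIcc 0 1 zero_le_one q)))) (s : ℝ)
  rw [mul_zero, mul_one] at h
  rw [← h, intervalIntegral.integral_of_le zero_le_one, integral_Ioc_eq_integral_Ioo,
    ← integral_smul, ← integral_smul]
  refine setIntegral_congr_fun measurableSet_Ioo fun ρ hρ => ?_
  simp only [duhInt, ContinuousMap.const_apply, map_smul, smul_smul]
  rw [← Real.rpow_add_of_nonneg s.2.1 (by norm_num) (by norm_num)]
  norm_num
  rw [mul_sub, mul_one]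

attribute [irreducible] duhamel

end Duhamel

/-! ### The free heat flow -/

section Heat

variable {V F : Type*} [NormedAddCommGroup V] [NormedSpace ℝ V] [CompleteSpace V] [TransRep V]
  [NormedAddCommGroup F] [NormedSpace ℝ F] [CompleteSpace F]

theorem hasDerivAt_heat_gauss (v : V) {s : ℝ} (hs : s ∈ Ioo (0 : ℝ) 1) :
    HasDerivAt (fun s => cv √s (wker gauss 0) v) (s⁻¹ • cv √s (wker (slap gauss) 0) v) s := by
  have h := hasDerivAt_heat isHeatKernel_gauss v hs
  have e : s ^ (-((0 + 2 : ℕ) : ℝ) / 2) = s⁻¹ := by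
    rw [← Real.rpow_neg_one]; norm_num
  rw [e] at h
  simpa using h

/-- `ℓ' = ℓ ∘ Δ` on averaged vectors. -/
def IsLapPair (ℓ ℓ' : V →L[ℝ] F) : Prop :=
  ∀ (l : ℝ) (k : 𝓢(E3, ℝ)) (v : V), 0 < l →
    ℓ' (cv l (wker k 0) v) = (l ^ 2)⁻¹ • ℓ (cv l (wker (slap k) 0) v)

/-- The derivative in `s` is known only for `s > 0`, but after moving the Laplacian to the
functional it extends continuously to `s = 0`, so no regularity of `v` is required. -/
theorem IsLapPair.heat {ℓ ℓ' : V →L[ℝ] F} (h : IsLapPair ℓ ℓ') (v : V) {s : ℝ}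
    (hs : s ∈ Icc (0 : ℝ) 1) :
    ℓ (cv √s (wker gauss 0) v) - ℓ v = ∫ r in (0 : ℝ)..s, ℓ' (cv √r (wker gauss 0) v) := by
  have hc : ∀ ℓ : V →L[ℝ] F, Continuous fun r : ℝ => ℓ (cv √r (wker gauss 0) v) := fun ℓ =>
    ℓ.continuous.comp ((continuous_cv _ v).comp Real.continuous_sqrt)
  have := intervalIntegral.integral_eq_sub_of_hasDerivAt_of_le hs.1
    (f := fun r => ℓ (cv √r (wker gauss 0) v)) (f' := fun r => ℓ' (cv √r (wker gauss 0) v))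
    (hc ℓ).continuousOn (fun r hr => ?_) ((hc ℓ').intervalIntegrable _ _)
  · rw [this, Real.sqrt_zero, cv_zero_gauss]
  · have h1 := ℓ.hasFDerivAt.comp_hasDerivAt r
      (hasDerivAt_heat_gauss v ⟨hr.1, hr.2.trans_le hs.2⟩)
    rw [h _ _ _ (Real.sqrt_pos.2 hr.1), Real.sq_sqrt hr.1.le, ← map_smul]
    exact h1

/-- The heat flow as a curve. -/
noncomputable def evo : Bd →L[ℝ] V →L[ℝ] C(I, V) :=
  LinearMap.mkContinuous₂
    (LinearMap.mk₂ ℝ (fun (b : Bd) (v : V) =>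
      (⟨fun s => cv √(s : ℝ) b v, (continuous_cv b v).comp (by fun_prop)⟩ : C(I, V)))
      (fun _ _ _ => by ext; simp) (fun _ _ _ => by ext; simp)
      (fun _ _ _ => by ext; simp) (fun _ _ _ => by ext; simp)) (∫ z, wt z) (fun b v => by
      have := integral_wt_nonneg
      exact (ContinuousMap.norm_le _ (by positivity)).2 fun s => norm_cv_le _ b v)

theorem evo_apply (b : Bd) (v : V) (s : I) : evo b v s = cv √(s : ℝ) b v := rfl

attribute [irreducible] evo

end Heat

/-! ### Weak form of the linear heat equation with source -/

section Pairing

variable {F : Type*} [NormedAddCommGroup F] [InnerProductSpace ℝ F] [FiniteDimensional ℝ F]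
  {p : ℝ≥0∞} [Fact (1 ≤ p)] [Fact (p ≠ ⊤)]

theorem pr_lap (φ : Test) (u : Lp F p (volume : Measure E3)) :
    pr φ.lap u = ∑ j, pr ((φ.pd j).pd j) u := by
  simp only [pr_apply, Test.lap_apply, Finset.sum_smul]
  exact integral_finsetSum _ fun j _ => integrable_test_smul (Lp.locallyIntegrable' u)
    ((φ.pd j).pd j).continuous ((φ.pd j).pd j).2.2

theorem wker_slap (k : 𝓢(E3, ℝ)) (h : E3) :
    wker (slap k) h = ∑ j, wker (∂_{ej j} (∂_{ej j} k)) h := by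
  ext z
  simp only [wker_apply, slap, BoundedContinuousFunction.coe_sum, Finset.sum_apply,
    sum_apply, Finset.mul_sum]

theorem cv_slap {V : Type*} [NormedAddCommGroup V] [NormedSpace ℝ V] [CompleteSpace V] [TransRep V]
    (l : ℝ) (k : 𝓢(E3, ℝ)) (h : E3) (v : V) :
    cv l (wker (slap k) h) v = ∑ j, cv l (wker (∂_{ej j} (∂_{ej j} k)) h) v := by
  rw [wker_slap, map_sum, sum_apply]

theorem pr_pd_cv (ψ : Test) {l : ℝ} (hl : 0 < l) (k : 𝓢(E3, ℝ)) (v : Lp F p (volume : Measure E3)) (j : Fin 3) :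
    pr (ψ.pd j) (cv l (wker k 0) v) = l⁻¹ • pr ψ (cv l (wker (∂_{ej j} k) 0) v) := by
  have h2 := (hasTD_cv hl.ne' k v).hasWeakDeriv j
  obtain ⟨x, hx⟩ : ∃ x, x = cv l (wker (∂_{ej j} k) 0) v := ⟨_, rfl⟩
  rw [← hx] at h2 ⊢
  have h1 := hasWeakDeriv_iff.1 h2 ψ
  have h3 : pr ψ (-l⁻¹ • x) = -(l⁻¹ • pr ψ x) := by
    rw [ContinuousLinearMap.map_smul, neg_smul]
  rw [h3] at h1
  exact (neg_injective h1).symm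

theorem pr_pd_pd_cv (φ : Test) {l : ℝ} (hl : 0 < l) (k : 𝓢(E3, ℝ))
    (v : Lp F p (volume : Measure E3)) (j : Fin 3) : pr ((φ.pd j).pd j) (cv l (wker k 0) v) =
      (l ^ 2)⁻¹ • pr φ (cv l (wker (∂_{ej j} (∂_{ej j} k)) 0) v) := by
  have e : (l ^ 2)⁻¹ = l⁻¹ * l⁻¹ := by rw [sq, mul_inv]
  rw [pr_pd_cv _ hl, pr_pd_cv _ hl, e, smul_smul]

set_option maxHeartbeats 1000000 in
theorem isLapPair_pr (φ : Test) : IsLapPair (pr φ : Lp F p (volume : Measure E3) →L[ℝ] F)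
    (pr φ.lap) := by
  intro l k v hl
  have e1 : cv l (wker (slap k) 0) v = ∑ j, cv l (wker (∂_{ej j} (∂_{ej j} k)) 0) v := cv_slap l k 0 v
  obtain ⟨x, hx⟩ : ∃ x : Fin 3 → Lp F p (volume : Measure E3),
    x = fun j => cv l (wker (∂_{ej j} (∂_{ej j} k)) 0) v := ⟨_, rfl⟩
  have e2 : pr φ (cv l (wker (slap k) 0) v) = ∑ j, pr φ (x j) := by
    rw [e1, ← map_sum, hx]
  have h4 : ∀ j, pr ((φ.pd j).pd j) (cv l (wker k 0) v) = (l ^ 2)⁻¹ • pr φ (x j) := by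
    intro j; rw [hx]; exact pr_pd_pd_cv φ hl k v j
  rw [pr_lap, e2, Finset.smul_sum]
  exact Finset.sum_congr rfl fun j _ => h4 j

/-- Pairing of a source term with a test function. -/
noncomputable def prS (φ : Test) : Src F →L[ℝ] F :=
  (pr φ).comp (ContinuousLinearMap.fst ℝ (V32 F) (V2 F)) +
    (pr φ).comp (ContinuousLinearMap.snd ℝ (V32 F) (V2 F))

theorem prS_apply (φ : Test) (w : Src F) : prS φ w = pr φ w.1 + pr φ w.2 := rfl

theorem cv_src (l : ℝ) (b : Bd) (w : Src F) : cv l b w = (cv l b w.1, cv l b w.2) :=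
  Prod.ext (map_cv (ContinuousLinearMap.fst ℝ (V32 F) (V2 F)) (fun _ _ => rfl) l b w)
    (map_cv (ContinuousLinearMap.snd ℝ (V32 F) (V2 F)) (fun _ _ => rfl) l b w)

theorem isLapPair_prS (φ : Test) : IsLapPair (prS φ : Src F →L[ℝ] F) (prS φ.lap) := by
  intro l k w hl
  simp only [prS_apply, cv_src, isLapPair_pr φ l k _ hl, smul_add]

theorem pr_emb6_smZ (φ : Test) {l : ℝ} (hl : 0 < l) (w : Src F) :
    pr φ (emb6 F (smZ.op l (gker gauss 0) w)) = prS φ (cv l (wker gauss 0) w) := by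
  have h := (smZ_spec hl gauss w).1
  rw [← emb6_apply] at h
  rw [pr_congr h φ, cvW_apply, map_add, prS_apply, cv_src]
  congr 1
  exact pr_congr (coeFn_cvT hl _ w.1) φ

theorem continuous_prS_cv (φ : Test) (w : C(I, Src F)) : Continuous (Function.uncurry fun r q : ℝ =>
    prS φ (cv √(r - q) (wker gauss 0) (w (projIcc 0 1 zero_le_one q)))) := by
  have h1 : Continuous fun p : ℝ × ℝ => (√(p.1 - p.2), w (projIcc 0 1 zero_le_one p.2)) :=
    (Real.continuous_sqrt.comp (continuous_fst.sub continuous_snd)).prodMk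
      (w.continuous.comp (continuous_projIcc.comp continuous_snd))
  have h2 := (continuous_cv_uncurry (V := Src F) (wker gauss 0)).comp h1
  have h3 := (prS φ).continuous.comp h2
  exact h3

/-- Pairing turns the Duhamel term into `∫_0^s` of the heat flow of `w(q)` at time `s - q`. The
order of integration over the triangle `q ≤ r ≤ s` is exchanged, and the inner integral telescopes.
-/
theorem weak_duhamel (φ : Test) (w : C(I, Src F)) (s : I) :
    pr φ (emb6 F (duhamel smZ (ContinuousMap.const I (gker gauss 0)) w s)) =
      ∫ r in (0 : ℝ)..s, (pr φ.lap (emb6 F (duhamel smZ (ContinuousMap.const I (gker gauss 0)) w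
        (projIcc 0 1 zero_le_one r))) + prS φ (w (projIcc 0 1 zero_le_one r))) := by
  have hD : ∀ (φ : Test) (s : I),
      pr φ (emb6 F (duhamel smZ (ContinuousMap.const I (gker gauss 0)) w s)) =
      ∫ q in (0 : ℝ)..s, prS φ (cv √(s - q) (wker gauss 0) (w (projIcc 0 1 zero_le_one q))) := by
    intro φ s
    have h := map_duhamel_const smZ (gker gauss 0) w ((pr φ).comp (emb6 F)) s
    simp only [ContinuousLinearMap.comp_apply] at h
    rw [h, intervalIntegral.integral_of_le s.2.1, intervalIntegral.integral_of_le s.2.1,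
      integral_Ioc_eq_integral_Ioo, integral_Ioc_eq_integral_Ioo]
    refine setIntegral_congr_fun measurableSet_Ioo fun q hq => ?_
    exact pr_emb6_smZ φ (Real.sqrt_pos.2 (by linarith [hq.2])) _
  have hw : Continuous fun q : ℝ => w (projIcc 0 1 zero_le_one q) :=
    w.continuous.comp continuous_projIcc
  have hG := fun φ => continuous_prS_cv φ w
  have e1 : ∫ r in (0 : ℝ)..s, pr φ.lap (emb6 F (duhamel smZ (ContinuousMap.const I (gker gauss 0))
      w (projIcc 0 1 zero_le_one r))) = ∫ r in (0 : ℝ)..s, ∫ q in (0 : ℝ)..r,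
      prS φ.lap (cv √(r - q) (wker gauss 0) (w (projIcc 0 1 zero_le_one q))) := by
    refine intervalIntegral.integral_congr fun r hr => ?_
    rw [uIcc_of_le s.2.1] at hr
    have hr' : r ∈ Icc (0 : ℝ) 1 := ⟨hr.1, hr.2.trans s.2.2⟩
    beta_reduce
    rw [hD, projIcc_of_mem _ hr']
  -- The heat flow started at time `q`, integrated from `q` to `s`; the term lost at `r = q` is
  -- exactly the source.
  have e2 : ∀ q ∈ Icc (0 : ℝ) s,
      ∫ r in q..s, prS φ.lap (cv √(r - q) (wker gauss 0) (w (projIcc 0 1 zero_le_one q))) =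
      prS φ (cv √(s - q) (wker gauss 0) (w (projIcc 0 1 zero_le_one q))) -
        prS φ (w (projIcc 0 1 zero_le_one q)) := by
    intro q hq
    have h1 := intervalIntegral.integral_comp_sub_right (a := q) (b := s)
      (fun t => prS φ.lap (cv √t (wker gauss 0) (w (projIcc 0 1 zero_le_one q)))) q
    rw [sub_self] at h1
    rw [(isLapPair_prS φ).heat _ (s := s - q) ⟨by linarith [hq.2], by linarith [hq.1, s.2.2]⟩, h1]
  rw [intervalIntegral.integral_add, e1, integral_triangle (hG φ.lap) s.2.1, hD,
    ← intervalIntegral.integral_add]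
  · refine intervalIntegral.integral_congr fun q hq => ?_
    rw [uIcc_of_le s.2.1] at hq
    beta_reduce
    rw [e2 q hq, sub_add_cancel]
  · refine ContinuousOn.intervalIntegrable ?_
    rw [uIcc_of_le s.2.1]
    refine ContinuousOn.congr (f := fun q => prS φ (cv √(s - q) (wker gauss 0)
      (w (projIcc 0 1 zero_le_one q))) - prS φ (w (projIcc 0 1 zero_le_one q))) ?_ e2
    have h1 : Continuous fun q : ℝ => ((s : ℝ), q) := by fun_prop
    have h2 := (hG φ).comp h1
    have h3 := h2.sub ((prS φ).continuous.comp hw)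
    exact h3.continuousOn
  · exact ((prS φ).continuous.comp hw).intervalIntegrable _ _
  · have h1 : Continuous fun r : ℝ => duhamel smZ (ContinuousMap.const I (gker gauss 0)) w
        (projIcc 0 1 zero_le_one r) := (ContinuousMap.continuous _).comp continuous_projIcc
    have h2 := ((pr φ.lap).comp (emb6 F)).continuous.comp h1
    exact h2.intervalIntegrable _ _
  · exact ((prS φ).continuous.comp hw).intervalIntegrable _ _

theorem weak_evo (φ : Test) (a : HDot1 F) (s : I) :
    pr φ (emb6 F (evo (wker gauss 0) a s)) - pr φ (emb6 F a) =
      ∫ r in (0 : ℝ)..s, pr φ.lap (emb6 F (evo (wker gauss 0) a (projIcc 0 1 zero_le_one r))) := by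
  have e : ∀ s : I, emb6 F (evo (wker gauss 0) a s) = cv √(s : ℝ) (wker gauss 0) (emb6 F a) :=
    fun s => by
      rw [evo_apply]; exact map_cv (emb6 F) (fun k u => emb6_tr k u) _ _ _
  rw [e, (isLapPair_pr φ).heat _ s.2]
  refine intervalIntegral.integral_congr fun r hr => ?_
  rw [uIcc_of_le s.2.1] at hr
  have hr' : r ∈ Icc (0 : ℝ) 1 := ⟨hr.1, hr.2.trans s.2.2⟩
  beta_reduce
  rw [e, projIcc_of_mem _ hr']

end Pairing

/-! ### Uniqueness for the weak linear heat equation -/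

section Primitive

variable {V G : Type*} [NormedAddCommGroup V] [NormedSpace ℝ V] [CompleteSpace V]
  [NormedAddCommGroup G] [NormedSpace ℝ G] [CompleteSpace G]

theorem hasDerivAt_primitive (d : C(I, V)) (r : ℝ) :
    HasDerivAt (fun s => ∫ r in (0 : ℝ)..s, d (projIcc 0 1 zero_le_one r))
      (d (projIcc 0 1 zero_le_one r)) r :=
  have hdc : Continuous fun r : ℝ => d (projIcc 0 1 zero_le_one r) :=
    d.continuous.comp continuous_projIcc
  intervalIntegral.integral_hasDerivAt_right (hdc.intervalIntegrable _ _)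
    hdc.stronglyMeasurable.stronglyMeasurableAtFilter hdc.continuousAt

theorem map_primitive (Θ : V →L[ℝ] G) (d : C(I, V)) (s : ℝ) :
    Θ (∫ r in (0 : ℝ)..s, d (projIcc 0 1 zero_le_one r)) =
      ∫ r in (0 : ℝ)..s, Θ (d (projIcc 0 1 zero_le_one r)) :=
  have hdc : Continuous fun r : ℝ => d (projIcc 0 1 zero_le_one r) :=
    d.continuous.comp continuous_projIcc
  (Θ.intervalIntegral_comp_comm (hdc.intervalIntegrable _ _)).symm

end Primitive

section Abstract

variable {V G : Type*} [NormedAddCommGroup V] [NormedSpace ℝ V] [CompleteSpace V] [TransRep V]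
  [NormedAddCommGroup G] [NormedSpace ℝ G] [CompleteSpace G]

theorem map_cv_integral (Θ : V →L[ℝ] G) (l : ℝ) (b : Bd) (v : V) :
    Θ (cv l b v) = ∫ z, (wt z * b z) • Θ (tr (l • z) v) := by
  rw [cv_apply, ← Θ.integral_comp_comm (integrable_cv l b v)]
  simp only [map_smul]

theorem cv_comm (l l' : ℝ) (b b' : Bd) (v : V) : cv l b (cv l' b' v) = cv l' b' (cv l b v) :=
  map_cv (cv l b) (fun h u => (tr_cv h l b u).symm) l' b' v

/-- Uniqueness of the zero solution of `∂ v = Δ v`, `v 0 = 0`. -/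
theorem eq_zero_of_heat {v x : ℝ → V} (hv0 : v 0 = 0) (hv : ∀ r, HasDerivAt v (x r) r)
    (h : ∀ r ∈ Icc (0 : ℝ) 1, ∀ l : ℝ, 0 < l →
      (l ^ 2)⁻¹ • cv l (wker (slap gauss) 0) (v r) = cv l (wker gauss 0) (x r)) {s : ℝ}
    (hs : s ∈ Icc (0 : ℝ) 1) : v s = 0 := by
  have hvc : Continuous v := continuous_iff_continuousAt.2 fun r => (hv r).continuousAt
  have hsq : Continuous fun r : ℝ => √(s - r) :=
    Real.continuous_sqrt.comp (continuous_const.sub continuous_id)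
  -- `g(r) = e^{(s-r)Δ} v(r)` joins `0` at `r = 0` to `v(s)` at `r = s`; the two contributions to
  -- its derivative cancel.
  obtain ⟨g, hg⟩ : ∃ g : ℝ → V, g = fun r => cv √(s - r) (wker gauss 0) (v r) := ⟨_, rfl⟩
  have hgc : Continuous g := by
    rw [hg]
    have h2 := (continuous_cv_uncurry (V := V) (wker gauss 0)).comp (hsq.prodMk hvc)
    exact h2
  have hgd : ∀ r ∈ Ioo (0 : ℝ) s, HasDerivAt g 0 r := by
    intro r hr
    have hr1 : r ∈ Icc (0 : ℝ) 1 := ⟨hr.1.le, hr.2.le.trans hs.2⟩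
    have hsr : (s : ℝ) - r ∈ Ioo (0 : ℝ) 1 := ⟨by linarith [hr.2], by linarith [hr.1, hs.2]⟩
    have h1' : HasDerivAt (fun r' : ℝ => cv √(s - r') (wker gauss 0) (v r))
        (-(cv √(s - r) (wker gauss 0) (x r))) r := by
      have h2 : HasDerivAt (fun r' : ℝ => (s : ℝ) - r') (-1) r := by
        simpa using (hasDerivAt_id r).const_sub (s : ℝ)
      have h3 := (hasDerivAt_heat_gauss (v r) hsr).scomp r h2
      have e : (s - r : ℝ)⁻¹ • cv √(s - r) (wker (slap gauss) 0) (v r) =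
          cv √(s - r) (wker gauss 0) (x r) := by
        rw [← h r hr1 _ (Real.sqrt_pos.2 hsr.1), Real.sq_sqrt hsr.1.le]
      rw [neg_one_smul, e] at h3
      exact h3
    rw [hasDerivAt_iff_tendsto_slope] at h1' ⊢
    have h4 := hasDerivAt_iff_tendsto_slope.1 (hv r)
    -- The difference quotient of `g` is the flow at time `s - r'` applied to the quotient of `v`,
    -- plus the quotient of the flow at the fixed vector `v(r)`; the first needs joint continuity of
    -- the averages.
    have h5 : Tendsto (fun r' : ℝ => (√(s - r'), slope v r r')) (𝓝[≠] r)
        (𝓝 (√(s - r), x r)) :=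
      Tendsto.prodMk_nhds ((hsq.tendsto r).mono_left nhdsWithin_le_nhds) h4
    have h6 := ((continuous_cv_uncurry (V := V) (wker gauss 0)).tendsto _).comp h5
    have h7 := h6.add h1'
    simp only [add_neg_cancel] at h7
    refine h7.congr fun r' => ?_
    simp only [Function.comp_apply, slope_def_module, hg]
    rw [map_smul, ← smul_add, map_sub, sub_add_sub_cancel]
  have hfin := intervalIntegral.integral_eq_sub_of_hasDerivAt_of_le hs.1
    hgc.continuousOn hgd (continuous_const.intervalIntegrable _ _)
  rw [intervalIntegral.integral_zero] at hfin
  have hgs : g s = v s := by rw [hg]; simp only [sub_self, Real.sqrt_zero, cv_zero_gauss]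
  have hg0 : g 0 = 0 := by simp only [hg, hv0, map_zero]
  rw [hgs, hg0, sub_zero] at hfin
  exact hfin.symm

/-- Averaging transfers the Laplacian to the kernel, so a curve satisfying the equation only in
integrated form becomes the average of its own primitive. That primitive is differentiable, and the
strong uniqueness result applies. -/
theorem cv_eq_zero_of_heat {d : C(I, V)} {k : 𝓢(E3, ℝ)}
    (h : ∀ s : I, cv 1 (wker k 0) (d s) = cv 1 (wker (slap k) 0)
      (∫ r in (0 : ℝ)..s, d (projIcc 0 1 zero_le_one r)))
    (h' : ∀ (l : ℝ) (x : V), 0 < l → (l ^ 2)⁻¹ • cv l (wker (slap gauss) 0) (cv 1 (wker k 0) x) =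
      cv l (wker gauss 0) (cv 1 (wker (slap k) 0) x)) (s : I) : cv 1 (wker k 0) (d s) = 0 := by
  rw [h]
  refine eq_zero_of_heat (v := fun s => cv 1 (wker (slap k) 0)
      (∫ r in (0 : ℝ)..s, d (projIcc 0 1 zero_le_one r)))
    (x := fun r => cv 1 (wker (slap k) 0) (d (projIcc 0 1 zero_le_one r))) ?_ ?_ ?_ s.2
  · simp
  · intro r
    exact ((cv 1 (wker (slap k) 0) : V →L[ℝ] V)).hasFDerivAt.comp_hasDerivAt r
      (hasDerivAt_primitive d r)
  · intro r hr l hl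
    have := h ⟨r, hr⟩
    simp only at this
    rw [← this, h' l _ hl, projIcc_of_mem _ hr]

theorem IsLapPair.at_one {ℓ ℓ' : V →L[ℝ] G} (h : IsLapPair ℓ ℓ') (k : 𝓢(E3, ℝ)) (v : V) :
    ℓ' (cv 1 (wker k 0) v) = ℓ (cv 1 (wker (slap k) 0) v) := by
  rw [h 1 k v one_pos, one_pow, inv_one, one_smul]

end Abstract


section Uniqueness

variable {F : Type*} [NormedAddCommGroup F] [InnerProductSpace ℝ F] [FiniteDimensional ℝ F]
  {p : ℝ≥0∞} [Fact (1 ≤ p)] [Fact (p ≠ ⊤)]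

theorem pd_shift (φ : Test) (h : E3) (j : Fin 3) : (φ.shift h).pd j = (φ.pd j).shift h := by
  refine Subtype.ext (funext fun x => ?_)
  simp only [Test.pd, Test.shift, pd]
  rw [fderiv_comp_sub]

theorem lap_shift (φ : Test) (h : E3) : (φ.shift h).lap = φ.lap.shift h := by
  refine Subtype.ext (funext fun x => ?_)
  rw [Test.lap_apply]
  simp only [pd_shift]
  rfl

/-- If `u = Δ U` weakly then averages of `u` and `U` against test functions are related. -/
theorem cv_one_of_weak_lap {u U : Lp F p (volume : Measure E3)}
    (h : ∀ φ : Test, pr φ u = pr φ.lap U) (k : 𝓢(E3, ℝ)) :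
    cv 1 (wker k 0) u = cv 1 (wker (slap k) 0) U := by
  refine pr_ext fun φ => ?_
  have h1 := (isLapPair_pr φ).at_one k U
  refine Eq.trans ?_ h1
  refine (map_cv_integral (pr φ) 1 (wker k 0) u).trans
    (Eq.trans ?_ (map_cv_integral (pr φ.lap) 1 (wker k 0) U).symm)
  have e : ∀ z : E3, pr φ (tr z u) = pr φ.lap (tr z U) := fun z => by
    rw [pr_tr_eq_shift, pr_tr_eq_shift, ← lap_shift, h]
  simp only [e]

theorem heat_lap_comm (k : 𝓢(E3, ℝ)) (d : Lp F p (volume : Measure E3)) {l : ℝ} (hl : 0 < l) :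
    (l ^ 2)⁻¹ • cv l (wker (slap gauss) 0) (cv 1 (wker k 0) d) =
      cv l (wker gauss 0) (cv 1 (wker (slap k) 0) d) := by
  refine pr_ext fun φ => ?_
  have h1 := isLapPair_pr φ l gauss (cv 1 (wker k 0) d) hl
  have h2 := (isLapPair_pr φ).at_one k (cv l (wker gauss 0) d)
  refine (ContinuousLinearMap.map_smul (pr φ) _ _).trans (h1.symm.trans ?_)
  have e1 := congrArg (pr φ.lap) (cv_comm l 1 (wker gauss 0) (wker k 0) d)
  have e2 := congrArg (pr φ) (cv_comm l 1 (wker gauss 0) (wker (slap k) 0) d)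
  exact e1.trans (h2.trans e2.symm)

/-- The average has the continuous representative `x ↦ ∫ η(· - x) u`, which must vanish everywhere;
its value at the origin is the pairing with `η`. -/
theorem eq_zero_of_cv_toS {u : Lp F p (volume : Measure E3)}
    (h : ∀ η : Test, cv 1 (wker η.toS 0) u = 0) : u = 0 := by
  refine pr_ext fun η => ?_
  have h1 := coeFn_cv_toS η one_pos u
  rw [h] at h1
  have h2 := (Lp.coeFn_zero F p volume).symm.trans h1
  have hc : Continuous fun x => pr (η.dil 1 one_pos) (tr x u) :=
    (pr (η.dil 1 one_pos)).continuous.comp (continuous_tr u)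
  have h3 := ((continuous_const (y := (0 : F))).ae_eq_iff_eq (μ := (volume : Measure E3)) hc).1 h2
  have h4 := congrFun h3 0
  rw [tr_zero] at h4
  have h5 : η.dil 1 one_pos = η := by
    refine Subtype.ext (funext fun x => ?_)
    simp [Test.dil]
  rw [h5] at h4
  rw [← h4, ContinuousLinearMap.map_zero]

/-- The weak heat equation with zero data has only the zero solution. -/
theorem eq_zero_of_weak_heat {d : C(I, Lp F p (volume : Measure E3))}
    (h : ∀ (φ : Test) (s : I), pr φ (d s) =
      ∫ r in (0 : ℝ)..s, pr φ.lap (d (projIcc 0 1 zero_le_one r))) (s : I) : d s = 0 := by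
  refine eq_zero_of_cv_toS fun η => ?_
  refine cv_eq_zero_of_heat (fun s => ?_) (fun l x hl => heat_lap_comm η.toS x hl) s
  refine cv_one_of_weak_lap (fun φ => ?_) η.toS
  rw [h φ s]
  exact (map_primitive (pr φ.lap) d s).symm

end Uniqueness

/-! ### Components of the Duhamel operator and its pointwise bound -/

section DuhamelPi

variable {B W Z : Type*} [NormedAddCommGroup B] [NormedSpace ℝ B]
    [NormedAddCommGroup W] [NormedSpace ℝ W] [NormedAddCommGroup Z] [NormedSpace ℝ Z]
    [CompleteSpace Z]

/-- A component of a curve. -/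
def compC (F : C(I, Fin 3 → W)) (i : Fin 3) : C(I, W) :=
  ⟨fun s => F s i, (continuous_apply i).comp F.continuous⟩

theorem compC_apply (F : C(I, Fin 3 → W)) (i : Fin 3) (s : I) : compC F i s = F s i := rfl

theorem duhamel_pi_apply (Q : SmoothingFamily B W Z) (b : C(I, B)) (F : C(I, Fin 3 → W)) (s : I)
    (i : Fin 3) : duhamel Q.pi b F s i = duhamel Q b (compC F i) s := by
  rw [duhamel_apply, duhamel_apply, Pi.smul_apply, duh_apply, duh_apply]
  congr 1
  have h := (ContinuousLinearMap.proj (R := ℝ) (φ := fun _ : Fin 3 => Z) i).integral_comp_comm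
    (duhInt_integrable Q.pi b F s.2)
  simp only [ContinuousLinearMap.proj_apply] at h
  rw [← h]
  simp only [duhInt, Pi.smul_apply, SmoothingFamily.pi_apply]
  rfl

/-- The norm of `F` stays under the integral, in the form required by `eq_zero_of_volterra`. -/
theorem norm_duhamel_le (Q : SmoothingFamily B W Z) (b : C(I, B)) (F : C(I, W)) (s : I) :
    ‖duhamel Q b F s‖ ≤ (s : ℝ) ^ (1 / 8 : ℝ) * ∫ ρ in Ioo (0 : ℝ) 1,
      (s : ℝ) ^ (1 / 8 : ℝ) * (1 - ρ) ^ (-(3 / 4) : ℝ) *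
        (Q.const * ‖b‖ * ‖F (projIcc 0 1 zero_le_one (s * ρ))‖) := by
  have h0 : 0 ≤ (s : ℝ) ^ (1 / 8 : ℝ) := Real.rpow_nonneg s.2.1 _
  rw [duhamel_apply, norm_smul, Real.norm_of_nonneg h0]
  refine mul_le_mul_of_nonneg_left ?_ h0
  rw [duh_apply]
  have hc : Continuous fun ρ : ℝ => Q.const * ‖b‖ * ‖F (projIcc 0 1 zero_le_one (s * ρ))‖ :=
    continuous_const.mul (F.continuous.comp (continuous_projIcc.comp (by fun_prop))).norm
  refine norm_integral_le_of_norm_le ?_ ?_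
  · refine Integrable.mono' ((integrable_singular.const_mul ((s : ℝ) ^ (1 / 8 : ℝ))).mul_const
      (Q.const * ‖b‖ * ‖F‖)) ?_ ?_
    · exact (integrable_singular.const_mul _).aestronglyMeasurable.mul hc.aestronglyMeasurable
    · filter_upwards [ae_restrict_mem measurableSet_Ioo] with ρ hρ
      have h1 : 0 ≤ (1 - ρ) ^ (-(3 / 4) : ℝ) := Real.rpow_nonneg (by linarith [hρ.2]) _
      have h2 := Q.const_nonneg
      rw [Real.norm_of_nonneg (by positivity)]
      gcongr
      exact F.norm_coe_le_norm _
  · filter_upwards [ae_restrict_mem measurableSet_Ioo] with ρ hρ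
    rcases s.2.1.eq_or_lt with h | h
    · have e : duhInt Q b F s ρ = 0 := by
        rw [duhInt, ← h, Real.zero_rpow (by norm_num), zero_smul]
      have h1 : 0 ≤ (1 - ρ) ^ (-(3 / 4) : ℝ) := Real.rpow_nonneg (by linarith [hρ.2]) _
      have h2 := Q.const_nonneg
      rw [e, norm_zero]
      positivity
    · exact norm_duhInt_le' Q b F ⟨h, s.2.2⟩ hρ

end DuhamelPi

/-! ### Equivalence of weak and mild solutions, and uniqueness -/

section Mild

variable {𝔤 : Type*} [InvariantLieAlgebra 𝔤] [FiniteDimensional ℝ 𝔤]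

/-- The family of kernels `gker gauss (c h)`. -/
noncomputable def kerC (h : E3) : C(I, Fin 3 → Bd) :=
  ⟨fun c => gker gauss ((c : ℝ) • h), (contDiff_gker gauss).continuous.comp (by fun_prop)⟩

theorem kerC_apply (h : E3) (c : I) : kerC h c = gker gauss ((c : ℝ) • h) := rfl

theorem kerC_zero : kerC 0 = ContinuousMap.const I (gker gauss 0) := by
  ext1 c; rw [kerC_apply, smul_zero]; rfl

/-- The nonlinearity along a curve. -/
noncomputable def nlC (A : ConnFlow 𝔤) : C(I, Fin 3 → Src 𝔤) :=
  (⟨nl, contDiff_nl.continuous⟩ : C(Conn 𝔤, Fin 3 → Src 𝔤)).comp A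

theorem nlC_apply (A : ConnFlow 𝔤) (s : I) : nlC A s = nl (A s) := rfl

/-- Mild solutions. -/
def IsMild (a : Conn 𝔤) (A : ConnFlow 𝔤) : Prop :=
  A = evo (wker gauss 0) a + duhamel smZ.pi (kerC 0) (nlC A)

theorem slice_apply (A : ConnFlow 𝔤) (i : Fin 3) (s : ℝ) :
    A.slice i s = A (projIcc 0 1 zero_le_one s) i := rfl

theorem integral_nonlin (A : Conn 𝔤) (i : Fin 3) (φ : Test) :
    ∫ x, φ x • nonlin A i x = prS φ (nl A i) := by
  have h : ∫ x, φ x • nonlin A i x = ∫ x, (φ x • (nl A i).1 x + φ x • (nl A i).2 x) := by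
    refine integral_congr_ae ((nl_ae A i).mono fun x hx => ?_)
    simp only [hx, smul_add]
  rw [h, integral_add, prS_apply, pr_apply, pr_apply]
  · exact integrable_test_smul (Lp.locallyIntegrable' _) φ.continuous φ.2.2
  · exact integrable_test_smul (Lp.locallyIntegrable' _) φ.continuous φ.2.2

/-- The weak form of the flow. -/
def IsWeak (a : Conn 𝔤) (A : ConnFlow 𝔤) : Prop :=
  ∀ (i : Fin 3) (φ : Test) (s : I), pr φ (emb6 𝔤 (A s i)) - pr φ (emb6 𝔤 (a i)) =
    ∫ r in (0 : ℝ)..s, (pr φ.lap (emb6 𝔤 (A (projIcc 0 1 zero_le_one r) i)) +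
      prS φ (nl (A (projIcc 0 1 zero_le_one r)) i))

theorem pr_emb6 (φ : Test) (u : HDot1 𝔤) : pr φ (emb6 𝔤 u) = ∫ x, φ x • u.fn x := by
  rw [pr_apply, emb6_apply]

theorem isWeak_iff {a : Conn 𝔤} {A : ConnFlow 𝔤} : IsWeak a A ↔
    ∀ (i : Fin 3) (φ : E3 → ℝ), ContDiff ℝ ∞ φ → HasCompactSupport φ →
    ∀ s ∈ Icc (0 : ℝ) 1,
      (∫ x, φ x • (A.slice i s).fn x) - ∫ x, φ x • (a i).fn x =
        ∫ r in (0 : ℝ)..s, ((∫ x, lap φ x • (A.slice i r).fn x) +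
          ∫ x, φ x • nonlin (fun k => A.slice k r) i x) := by
  have key : ∀ (i : Fin 3) (φ : Test) (s : I), (pr φ (emb6 𝔤 (A s i)) - pr φ (emb6 𝔤 (a i)) =
    ∫ r in (0 : ℝ)..s, (pr φ.lap (emb6 𝔤 (A (projIcc 0 1 zero_le_one r) i)) +
      prS φ (nl (A (projIcc 0 1 zero_le_one r)) i))) ↔
      ((∫ x, φ x • (A.slice i s).fn x) - ∫ x, φ x • (a i).fn x =
        ∫ r in (0 : ℝ)..s, ((∫ x, lap φ x • (A.slice i r).fn x) +
          ∫ x, φ x • nonlin (fun k => A.slice k r) i x)) := by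
    intro i φ s
    simp only [integral_nonlin, pr_emb6, slice_apply, projIcc_val]
    rfl
  refine ⟨fun h i φ hφ hc s hs => (key i (Test.mk φ hφ hc) ⟨s, hs⟩).1 (h i _ _), fun h i φ s => ?_⟩
  exact (key i φ s).2 (h i φ φ.2.1 φ.2.2 s s.2)

theorem evo_comp (a : Conn 𝔤) (s : I) (i : Fin 3) :
    evo (wker gauss 0) a s i = evo (wker gauss 0) (a i) s := by
  rw [evo_apply, evo_apply]
  exact map_cv (ContinuousLinearMap.proj (R := ℝ) (φ := fun _ : Fin 3 => HDot1 𝔤) i)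
    (fun _ _ => rfl) _ _ _

/-- The source is arbitrary: the lemma serves the nonlinear equation, the comparison argument for
weak solutions, and later the equation for the derivative in the parameter. -/
theorem weak_linear (a : Conn 𝔤) (w : C(I, Fin 3 → Src 𝔤)) {B : ConnFlow 𝔤}
    (hB : B = evo (wker gauss 0) a + duhamel smZ.pi (kerC 0) w) (i : Fin 3) (φ : Test) (s : I) :
    pr φ (emb6 𝔤 (B s i)) - pr φ (emb6 𝔤 (a i)) =
    ∫ r in (0 : ℝ)..s, (pr φ.lap (emb6 𝔤 (B (projIcc 0 1 zero_le_one r) i)) +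
      prS φ (w (projIcc 0 1 zero_le_one r) i)) := by
  have hBi : ∀ s, B s i = evo (wker gauss 0) (a i) s +
      duhamel smZ (ContinuousMap.const I (gker gauss 0)) (compC w i) s := by
    intro s
    rw [hB, ContinuousMap.add_apply, Pi.add_apply, evo_comp, duhamel_pi_apply, kerC_zero]
  have h1 := weak_evo φ (a i) s
  have h2 := weak_duhamel φ (compC w i) s
  have hc : ∀ (E : C(I, HDot1 𝔤)) (ψ : Test), IntervalIntegrable
      (fun r => pr ψ (emb6 𝔤 (E (projIcc 0 1 zero_le_one r)))) volume 0 s := by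
    intro E ψ
    have h1 : Continuous fun r : ℝ => E (projIcc 0 1 zero_le_one r) :=
      E.continuous.comp continuous_projIcc
    have h2 := ((pr ψ).comp (emb6 𝔤)).continuous.comp h1
    exact h2.intervalIntegrable _ _
  have hw : IntervalIntegrable (fun r => prS φ (compC w i (projIcc 0 1 zero_le_one r)))
      volume 0 s := by
    have h1 : Continuous fun r : ℝ => compC w i (projIcc 0 1 zero_le_one r) :=
      (compC w i).continuous.comp continuous_projIcc
    exact ((prS φ).continuous.comp h1).intervalIntegrable _ _
  simp only [hBi, map_add, ← compC_apply]
  rw [add_sub_right_comm, h1, h2, ← intervalIntegral.integral_add (hc _ _) ((hc _ _).add hw)]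
  simp only [add_assoc]

theorem IsMild.isWeak {a : Conn 𝔤} {A : ConnFlow 𝔤} (h : IsMild a A) : IsWeak a A :=
  fun i φ s => weak_linear a (nlC A) h i φ s

/-- Let `B` be the mild expression with source `N(A)`. Then `A` and `B` solve the same weak linear
equation, so their difference solves the homogeneous one in `L⁶` with zero data. -/
theorem IsWeak.isMild {a : Conn 𝔤} {A : ConnFlow 𝔤} (h : IsWeak a A) : IsMild a A := by
  obtain ⟨B, hB⟩ : ∃ B, B = evo (wker gauss 0) a + duhamel smZ.pi (kerC 0) (nlC A) := ⟨_, rfl⟩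
  have hw := weak_linear a (nlC A) hB
  rw [IsMild, ← hB]
  ext1 s
  funext i
  have hd : ∀ s : I, emb6 𝔤 (A s i - B s i) = 0 := by
    have hcA : Continuous fun s : I => A s i - B s i :=
      ((continuous_apply i).comp A.continuous).sub ((continuous_apply i).comp B.continuous)
    refine eq_zero_of_weak_heat (d := ⟨fun s => emb6 𝔤 (A s i - B s i),
      (emb6 𝔤).continuous.comp hcA⟩) fun φ s => ?_
    have h1 := h i φ s
    have h2 := hw i φ s
    have hc : ∀ (E : ConnFlow 𝔤), IntervalIntegrable
      (fun r => pr φ.lap (emb6 𝔤 (E (projIcc 0 1 zero_le_one r) i)) +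
        prS φ (nl (A (projIcc 0 1 zero_le_one r)) i)) volume 0 s := by
      intro E
      have h1 : Continuous fun r : ℝ => compC E i (projIcc 0 1 zero_le_one r) :=
        (compC E i).continuous.comp continuous_projIcc
      have h2 := ((pr φ.lap).comp (emb6 𝔤)).continuous.comp h1
      have h3 : Continuous fun r : ℝ => compC (nlC A) i (projIcc 0 1 zero_le_one r) :=
        (compC (nlC A) i).continuous.comp continuous_projIcc
      exact (h2.add ((prS φ).continuous.comp h3)).intervalIntegrable _ _
    simp only [nlC_apply] at h2
    have h3 := congrArg₂ (fun x y => x - y) h1 h2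
    simp only [sub_sub_sub_cancel_right] at h3
    rw [← intervalIntegral.integral_sub (hc A) (hc B)] at h3
    simp only [add_sub_add_right_eq_sub] at h3
    simp only [ContinuousMap.coe_mk, map_sub]
    exact h3
  exact sub_eq_zero.1 (emb6_injective ((hd s).trans (map_zero _).symm))

/-- The segments joining `A'(s)` to `A(s)` sweep out a compact set, on which the derivative of the
nonlinearity is bounded. No smallness enters. -/
theorem exists_lipschitz_nl (A A' : ConnFlow 𝔤) : ∃ K : ℝ, 0 ≤ K ∧
    ∀ s, ‖nl (A s) - nl (A' s)‖ ≤ K * ‖A s - A' s‖ := by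
  have hf : Continuous (fderiv ℝ (nl : Conn 𝔤 → Fin 3 → Src 𝔤)) :=
    contDiff_nl.continuous_fderiv (by simp)
  have hK : IsCompact (range fun p : I × I => A' p.1 + (p.2 : ℝ) • (A p.1 - A' p.1)) := by
    refine isCompact_range ?_
    exact (A'.continuous.comp continuous_fst).add ((continuous_subtype_val.comp continuous_snd).smul
      ((A.continuous.comp continuous_fst).sub (A'.continuous.comp continuous_fst)))
  have hfn : Continuous fun x : Conn 𝔤 => ‖fderiv ℝ (nl : Conn 𝔤 → Fin 3 → Src 𝔤) x‖ :=
    (continuous_norm (E := Conn 𝔤 →L[ℝ] (Fin 3 → Src 𝔤))).comp hf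
  obtain ⟨K, hK1⟩ := hK.bddAbove_image hfn.continuousOn
  refine ⟨max K 0, le_max_right _ _, fun s => ?_⟩
  refine Convex.norm_image_sub_le_of_norm_fderiv_le (𝕜 := ℝ) (s := segment ℝ (A' s) (A s))
    (fun x _ => (contDiff_nl.differentiable (by simp)) x) (fun x hx => ?_) (convex_segment _ _)
    (left_mem_segment _ _ _) (right_mem_segment _ _ _)
  rw [segment_eq_image'] at hx
  obtain ⟨θ, hθ, rfl⟩ := hx
  exact (hK1 ⟨_, ⟨(s, ⟨θ, hθ⟩), rfl⟩, rfl⟩).trans (le_max_left _ _)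

/-- The free parts cancel, and the difference satisfies the homogeneous Volterra inequality with a
constant depending on both curves. -/
theorem IsMild.unique {a : Conn 𝔤} {A A' : ConnFlow 𝔤} (h : IsMild a A) (h' : IsMild a A') :
    A = A' := by
  obtain ⟨K, hK0, hK⟩ := exists_lipschitz_nl A A'
  have hQ := (smZ (F := 𝔤)).pi.const_nonneg
  have hd : A - A' = duhamel smZ.pi (kerC 0) (nlC A - nlC A') := by
    conv_lhs => rw [h, h']
    rw [add_sub_add_left_eq_sub, ← map_sub]
  ext1 s
  refine sub_eq_zero.1 (norm_eq_zero.1 ?_)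
  refine eq_zero_of_volterra (g := fun s => ‖A s - A' s‖)
    (C := (smZ (F := 𝔤)).pi.const * ‖kerC 0‖ * K)
    (A.continuous.sub A'.continuous).norm (fun s => norm_nonneg _) (by positivity)
    (fun s => ?_) s
  have h1 := norm_duhamel_le smZ.pi (kerC 0) (nlC A - nlC A') s
  rw [← hd, ContinuousMap.sub_apply] at h1
  refine h1.trans (mul_le_mul_of_nonneg_left ?_ (Real.rpow_nonneg s.2.1 _))
  have hcont : ∀ g : I → ℝ, Continuous g → IntegrableOn (fun ρ : ℝ => (s : ℝ) ^ (1 / 8 : ℝ) *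
      (1 - ρ) ^ (-(3 / 4) : ℝ) * g (projIcc 0 1 zero_le_one (s * ρ))) (Ioo 0 1) := by
    intro g hg
    obtain ⟨M, hM⟩ := isCompact_univ.exists_bound_of_continuousOn hg.continuousOn
    have hgc : Continuous fun ρ : ℝ => g (projIcc 0 1 zero_le_one (s * ρ)) :=
      hg.comp (continuous_projIcc.comp (by fun_prop))
    refine Integrable.mul_bdd (c := M) (integrable_singular.const_mul _)
      hgc.aestronglyMeasurable (Eventually.of_forall fun ρ => hM _ (mem_univ _))
  refine setIntegral_mono_on
    (hcont (fun s => (smZ (F := 𝔤)).pi.const * ‖kerC 0‖ * ‖(nlC A - nlC A') s‖)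
      (continuous_const.mul (ContinuousMap.continuous _).norm))
    (hcont (fun s => (smZ (F := 𝔤)).pi.const * ‖kerC 0‖ * K * ‖A s - A' s‖)
      (continuous_const.mul (A.continuous.sub A'.continuous).norm)) measurableSet_Ioo
    fun ρ hρ => ?_
  have h7 : 0 ≤ (1 - ρ) ^ (-(3 / 4) : ℝ) := Real.rpow_nonneg (by linarith [hρ.2]) _
  have h8 : 0 ≤ (s : ℝ) ^ (1 / 8 : ℝ) := Real.rpow_nonneg s.2.1 _
  refine mul_le_mul_of_nonneg_left ?_ (mul_nonneg h8 h7)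
  rw [mul_assoc _ K]
  refine mul_le_mul_of_nonneg_left ?_ (by positivity)
  exact hK _

end Mild

/-! ### Translations by `√s h` -/

section ParabolicTranslation

variable {V : Type*} [NormedAddCommGroup V] [NormedSpace ℝ V] [TransRep V]

/-- The parabolic translation `(s ↦ f s) ↦ (s ↦ f s (· + √s h))`. -/
noncomputable def trC (h : E3) : C(I, V) →L[ℝ] C(I, V) :=
  LinearMap.mkContinuous
    { toFun := fun f => ⟨fun s => tr (√(s : ℝ) • h) (f s),
        continuous_tr_uncurry.comp
          (Continuous.prodMk (by fun_prop : Continuous fun s : I => √(s : ℝ) • h) f.continuous)⟩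
      map_add' := fun _ _ => by ext1 s; exact (tr _).map_add _ _
      map_smul' := fun _ _ => by ext1 s; exact (tr _).map_smul _ _ } 1 fun f => by
    refine (ContinuousMap.norm_le _ (by positivity)).2 fun s => ?_
    rw [one_mul]
    exact (norm_tr _ _).trans_le (f.norm_coe_le_norm s)

theorem trC_apply (h : E3) (f : C(I, V)) (s : I) : trC h f s = tr (√(s : ℝ) • h) (f s) := rfl

theorem norm_trC_le (h : E3) (f : C(I, V)) : ‖trC h f‖ ≤ ‖f‖ :=
  (ContinuousMap.norm_le _ (norm_nonneg _)).2 fun s => (norm_tr _ _).trans_le (f.norm_coe_le_norm s)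

theorem trC_add (h k : E3) (f : C(I, V)) : trC (h + k) f = trC h (trC k f) := by
  ext1 s; rw [trC_apply, trC_apply, trC_apply, smul_add, tr_add]

/-- If the parabolic translates of `f` depend smoothly on `h` then `f s` has translation derivatives
of size `s^{-1/2}`. -/
theorem hasTD_of_trC {f : C(I, V)} {Φ : E3 → C(I, V)} (hΦ : ∀ᶠ h in 𝓝 0, trC h f = Φ h)
    (hd : DifferentiableAt ℝ Φ 0) {s : I} (hs : 0 < (s : ℝ)) :
    HasTD (f s) fun j => (√(s : ℝ))⁻¹ • fderiv ℝ Φ 0 (ej j) s := by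
  have h0 : √(s : ℝ) ≠ 0 := (Real.sqrt_pos.2 hs).ne'
  refine HasTD.of_zero ?_
  have h1 : HasFDerivAt (fun h => trC h f) (fderiv ℝ Φ 0) 0 :=
    hd.hasFDerivAt.congr_of_eventuallyEq hΦ
  have h2 : HasFDerivAt (fun h : E3 => (√(s : ℝ))⁻¹ • h)
      ((√(s : ℝ))⁻¹ • ContinuousLinearMap.id ℝ E3) 0 :=
    ((√(s : ℝ))⁻¹ • ContinuousLinearMap.id ℝ E3).hasFDerivAt
  have h3 : HasFDerivAt (fun h => trC h f) (fderiv ℝ Φ 0) ((√(s : ℝ))⁻¹ • (0 : E3)) := by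
    rw [smul_zero]; exact h1
  have h4 := (ContinuousMap.evalCLM ℝ s).hasFDerivAt.comp (0 : E3) (h3.comp (0 : E3) h2)
  have e : (fun h => tr h (f s)) = (ContinuousMap.evalCLM ℝ s) ∘ (fun h => trC h f) ∘
      (fun h : E3 => (√(s : ℝ))⁻¹ • h) := by
    funext h
    simp only [Function.comp_apply, ContinuousMap.evalCLM_apply, trC_apply, smul_smul,
      mul_inv_cancel₀ h0, one_smul]
  rw [e]
  refine h4.congr_fderiv ?_
  ext v
  conv_lhs => rw [E3.sum_coord v, map_sum]
  simp only [map_smul, sum_apply, ContinuousLinearMap.smulRight_apply, PiLp.proj_apply,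
    ContinuousLinearMap.comp_apply, smul_apply, ContinuousLinearMap.id_apply,
    ContinuousMap.evalCLM_apply]

/-- From `trC (h + k) = trC h ∘ trC k`, the derivative at `h` is `trC h` applied to the derivative
at `0`. Hence derivatives in `h` are again covariant and the argument can be repeated. -/
theorem trC_fderiv {f : C(I, V)} {Φ : E3 → C(I, V)} {s : Set E3} (hs : IsOpen s) (h0 : (0 : E3) ∈ s)
    (hΦ : ∀ h ∈ s, trC h f = Φ h) (hd : DifferentiableOn ℝ Φ s) (v : E3) {h : E3} (hh : h ∈ s) :
    trC h (fderiv ℝ Φ 0 v) = fderiv ℝ Φ h v := by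
  have h1 : HasFDerivAt (fun k => trC k f) (fderiv ℝ Φ 0) 0 :=
    ((hd 0 h0).differentiableAt (hs.mem_nhds h0)).hasFDerivAt.congr_of_eventuallyEq
      (eventually_of_mem (hs.mem_nhds h0) hΦ)
  have h2 : HasFDerivAt (fun k => trC k f) (fderiv ℝ Φ h) h :=
    ((hd h hh).differentiableAt (hs.mem_nhds hh)).hasFDerivAt.congr_of_eventuallyEq
      (eventually_of_mem (hs.mem_nhds hh) hΦ)
  have h3 := (trC h : C(I, V) →L[ℝ] C(I, V)).hasFDerivAt.comp (0 : E3) h1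
  have h4 : HasFDerivAt (fun k : E3 => h + k) (ContinuousLinearMap.id ℝ E3) 0 :=
    (hasFDerivAt_id (0 : E3)).const_add h
  have h5 := HasFDerivAt.comp (g := fun k => trC k f) (0 : E3)
    (by rw [add_zero]; exact h2) h4
  have e : (fun k => trC k f) ∘ (fun k : E3 => h + k) = trC h ∘ (fun k => trC k f) := by
    funext k; exact trC_add h k f
  rw [e] at h5
  exact congrArg (fun L => L v) (h3.unique h5)

end ParabolicTranslation

/-! ### Parabolic translates of solutions and the local solution map -/

section Solution

variable {𝔤 : Type*} [InvariantLieAlgebra 𝔤] [FiniteDimensional ℝ 𝔤]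

/-- A superposition operator with a smooth kernel family, composed with the linear map sending `h`
to the curve `c ↦ c h`. -/
theorem contDiff_kerC : ContDiff ℝ ∞ kerC := by
  obtain ⟨L, hL⟩ : ∃ L : E3 →L[ℝ] C(I, E3), ∀ h c, L h c = (c : ℝ) • h :=
    ⟨LinearMap.mkContinuous
      { toFun := fun h => ⟨fun c => (c : ℝ) • h, by fun_prop⟩
        map_add' := fun _ _ => by ext1 s; exact smul_add _ _ _
        map_smul' := fun _ _ => by ext1 s; exact smul_comm _ _ _ } 1 fun h => by
      refine (ContinuousMap.norm_le _ (by positivity)).2 fun c => ?_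
      refine (norm_smul_le _ _).trans (mul_le_mul_of_nonneg_right ?_ (norm_nonneg _))
      rw [Real.norm_of_nonneg c.2.1]; exact c.2.2, fun _ _ => rfl⟩
  have h := (contDiff_postcomp (K := I) (contDiff_gker gauss)).comp L.contDiff
  have e : kerC = (fun f : C(I, E3) => (⟨gker gauss, (contDiff_gker gauss).continuous⟩ :
      C(E3, Fin 3 → Bd)).comp f) ∘ L := by
    funext h
    ext1 c
    change gker gauss _ = gker gauss _
    rw [hL]
  rw [e]
  exact h

theorem contDiff_nlC : ContDiff ℝ ∞ (nlC : ConnFlow 𝔤 → C(I, Fin 3 → Src 𝔤)) :=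
  contDiff_postcomp contDiff_nl

theorem nlC_zero : nlC (0 : ConnFlow 𝔤) = 0 := by
  ext1 s; exact nl_zero

theorem hasFDerivAt_nlC_zero : HasFDerivAt (nlC : ConnFlow 𝔤 → C(I, Fin 3 → Src 𝔤))
    (0 : ConnFlow 𝔤 →L[ℝ] C(I, Fin 3 → Src 𝔤)) 0 := by
  have h := hasFDerivAt_postcomp (K := I) ((contDiff_nl (𝔤 := 𝔤)).of_le (m := 1)
    (by exact_mod_cast le_top)) 0
  refine h.congr_fderiv ?_
  ext1 f; ext1 s
  change fderiv ℝ nl (0 : Conn 𝔤) (f s) = 0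
  rw [hasFDerivAt_nl_zero.fderiv]; rfl

/-- The nonlinear part of the solution without the factor `s^{1/8}`. -/
noncomputable def duhN (h : E3) (A : ConnFlow 𝔤) : ConnFlow 𝔤 := duh smZ.pi (kerC h) (nlC A)

theorem trC_evo (h : E3) (a : Conn 𝔤) : trC h (evo (wker gauss 0) a) = evo (wker gauss h) a := by
  ext1 s
  rw [trC_apply, evo_apply, evo_apply, tr_cv_wker, zero_add]

theorem nlC_trC (h : E3) (A : ConnFlow 𝔤) : nlC (trC h A) = trC h (nlC A) := by
  ext1 s
  rw [nlC_apply, trC_apply, trC_apply, nl_tr, nlC_apply]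

theorem map_smZ_pi {l : ℝ} (hl : 0 < l) (c : ℝ) (h : E3) (w : Fin 3 → Src 𝔤) :
    tr (l • (c • h)) (smZ.pi.op l (gker gauss 0) w) = smZ.pi.op l (gker gauss (c • h)) w := by
  funext i
  rw [tr_pi_apply, SmoothingFamily.pi_apply, SmoothingFamily.pi_apply, tr_smZ_gker hl]

theorem tr_smZ_pi {l : ℝ} (hl : 0 < l) (h : E3) (w : Fin 3 → Src 𝔤) :
    tr h (smZ.pi.op l (gker gauss 0) w) = smZ.pi.op l (gker gauss 0) (tr h w) := by
  funext i
  rw [tr_pi_apply, SmoothingFamily.pi_apply, SmoothingFamily.pi_apply, tr_smZ hl, tr_pi_apply]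

/-- The translation by `√s h` is split into a part `√r h`, carried by the source at time `r`, and a
part that is a multiple `c ≤ 1` of `√(s - r) h`, absorbed by recentring the heat kernel at `c h`.
This explains why kernels are curves over the ratio `c`. -/
theorem trC_duh (h : E3) (w : C(I, Fin 3 → Src 𝔤)) :
    trC h (duh smZ.pi (kerC 0) w) = duh smZ.pi (kerC h) (trC h w) := by
  ext1 s
  rw [trC_apply, duh_apply, duh_apply, ← (tr (√(s : ℝ) • h)).integral_comp_comm
    (duhInt_integrable _ _ _ s.2)]
  refine setIntegral_congr_fun measurableSet_Ioo fun ρ hρ => ?_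
  simp only [duhInt, map_smul]
  rcases s.2.1.eq_or_lt with h0 | h0
  · rw [← h0, Real.zero_rpow (by norm_num), zero_smul, zero_smul]
  congr 1
  have hl := (sqrt_mem_Ioc ⟨h0, s.2.2⟩ hρ).1
  have hsρ : (s : ℝ) * ρ ∈ Icc (0 : ℝ) 1 :=
    ⟨mul_nonneg s.2.1 hρ.1.le, mul_le_one₀ s.2.2 hρ.1.le hρ.2.le⟩
  -- `√s = √(s - r) c + √r` with `r = s ρ` and `c = cpar ρ`.
  have e : √(s : ℝ) • h = √((s : ℝ) * (1 - ρ)) • ((cpar ρ : ℝ) • h) + √((s : ℝ) * ρ) • h := by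
    rw [smul_smul, ← add_smul, Real.sqrt_mul s.2.1, Real.sqrt_mul s.2.1, mul_assoc,
      mul_comm _ (cpar ρ : ℝ), coe_cpar hρ]
    congr 1; ring
  have e2 : trC h w (projIcc 0 1 zero_le_one (s * ρ)) =
      tr (√((s : ℝ) * ρ) • h) (w (projIcc 0 1 zero_le_one (s * ρ))) := by
    rw [trC_apply, projIcc_of_mem _ hsρ]
  rw [e2, kerC_apply, kerC_apply, smul_zero, e, tr_add, tr_smZ_pi hl, map_smZ_pi hl]

theorem trC_duhN (h : E3) (A : ConnFlow 𝔤) : trC h (duhN 0 A) = duhN h (trC h A) := by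
  rw [duhN, trC_duh, duhN, nlC_trC]

/-- The equation keeps its form, with `h` entering only through the kernels; hence `h` can serve as
a parameter next to the data. -/
theorem trC_mild {a : Conn 𝔤} {A : ConnFlow 𝔤} (hA : IsMild a A) (h : E3) :
    trC h A = evo (wker gauss h) a + duhamel smZ.pi (kerC h) (nlC (trC h A)) := by
  conv_lhs => rw [hA]
  rw [map_add, trC_evo]
  congr 1
  ext1 s
  rw [trC_apply, duhamel_apply, duhamel_apply, map_smul, ← trC_apply, trC_duh, nlC_trC]

theorem contDiff_evo {V : Type*} [NormedAddCommGroup V] [NormedSpace ℝ V] [CompleteSpace V]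
    [TransRep V] : ContDiff ℝ ∞ fun h : E3 => (evo (wker gauss h) : V →L[ℝ] C(I, V)) := by
  have h := ContinuousLinearMap.contDiff (𝕜 := ℝ) (E := Bd) (F := V →L[ℝ] C(I, V)) (n := ∞)
    (evo (V := V))
  exact h.comp (contDiff_wker gauss)

theorem contDiff_duhamel {W Z : Type*} [NormedAddCommGroup W] [NormedSpace ℝ W]
    [NormedAddCommGroup Z] [NormedSpace ℝ Z] [CompleteSpace Z]
    (Q : SmoothingFamily (Fin 3 → Bd) W Z) :
    ContDiff ℝ ∞ fun h : E3 => duhamel Q (kerC h) := by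
  have h := ContinuousLinearMap.contDiff (𝕜 := ℝ) (E := C(I, Fin 3 → Bd)) (F := C(I, W) →L[ℝ] C(I, Z))
    (n := ∞) (duhamel Q)
  exact h.comp contDiff_kerC

variable (𝔤) in
/-- The local solution map together with its parabolic translates. -/
theorem exists_solution_map : ∃ (S : E3 × Conn 𝔤 → ConnFlow 𝔤) (δ : ℝ), 0 < δ ∧
    ContDiffOn ℝ ∞ S (Metric.ball 0 δ ×ˢ Metric.ball 0 δ) ∧
    (∀ a ∈ Metric.ball (0 : Conn 𝔤) δ, IsMild a (S (0, a))) ∧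
    (∀ a ∈ Metric.ball (0 : Conn 𝔤) δ, ∀ h ∈ Metric.ball (0 : E3) δ,
      trC h (S (0, a)) = S (h, a)) := by
  have hE : ContDiff ℝ ∞ fun h : E3 => (evo (wker gauss h) : Conn 𝔤 →L[ℝ] ConnFlow 𝔤) :=
    contDiff_evo
  have hD : ContDiff ℝ ∞ fun h : E3 => (duhamel smZ.pi (kerC h) :
      C(I, Fin 3 → Src 𝔤) →L[ℝ] ConnFlow 𝔤) :=
    contDiff_duhamel _
  obtain ⟨U, S, ε, hU, h0, hS, hS0, hε, hsol, huniq⟩ :=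
    exists_smooth_solution hE hD contDiff_nlC nlC_zero hasFDerivAt_nlC_zero
  have hc : ContinuousAt S 0 := (hS.continuousOn 0 h0).continuousAt (hU.mem_nhds h0)
  have h1 : ∀ᶠ p in 𝓝 (0 : E3 × Conn 𝔤), ‖S p‖ < ε := by
    have h2 : ‖S 0‖ < ε := by rw [hS0, norm_zero]; exact hε
    exact hc.norm.eventually (gt_mem_nhds h2)
  obtain ⟨δ, hδ, hb⟩ := Metric.eventually_nhds_iff_ball.1 (h1.and (hU.mem_nhds h0))
  have hsub : Metric.ball (0 : E3) δ ×ˢ Metric.ball (0 : Conn 𝔤) δ ⊆ Metric.ball 0 δ := by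
    intro p hp
    rw [mem_prod, mem_ball_zero_iff, mem_ball_zero_iff] at hp
    rw [mem_ball_zero_iff, Prod.norm_def]
    exact max_lt hp.1 hp.2
  refine ⟨S, δ, hδ, hS.mono fun p hp => (hb p (hsub hp)).2, fun a ha => ?_, fun a ha h hh => ?_⟩
  · have hp : ((0 : E3), a) ∈ U := (hb _ (hsub (mk_mem_prod (Metric.mem_ball_self hδ) ha))).2
    have h := hsol _ hp
    exact h
  · have hp := hb _ (hsub (mk_mem_prod (Metric.mem_ball_self hδ) ha))
    have hA : IsMild a (S (0, a)) := hsol _ hp.2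
    have hp' := hb _ (hsub (mk_mem_prod hh ha))
    -- Parabolic translation does not increase the norm, so the translate stays in the ball where
    -- small solutions with parameter `(h, a)` are unique.
    have h := huniq _ hp'.2 (trC h (S (0, a))) ((norm_trC_le _ _).trans_lt hp.1)
    exact h (trC_mild hA _)

end Solution

/-! ### Energy identities for the free heat flow -/

section Energy

variable {V : Type*} [NormedAddCommGroup V] [InnerProductSpace ℝ V] [CompleteSpace V] [TransRep V]

theorem inner_tr (h : E3) (u v : V) : inner ℝ (tr h u) (tr h v) = inner ℝ u v := by
  rw [real_inner_eq_norm_add_mul_self_sub_norm_mul_self_sub_norm_mul_self_div_two,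
    real_inner_eq_norm_add_mul_self_sub_norm_mul_self_sub_norm_mul_self_div_two, ← map_add,
    norm_tr, norm_tr, norm_tr]

/-- Translations preserve the inner product, so the derivative of `h ↦ ⟨τ_h u, τ_h v⟩` vanishes:
integration by parts. -/
theorem inner_hasTD {u v : V} {p q : Fin 3 → V} (hu : HasTD u p) (hv : HasTD v q) (j : Fin 3) :
    inner ℝ u (q j) + inner ℝ (p j) v = 0 := by
  have h1 := (hu 0).inner ℝ (hv 0)
  have h2 : HasFDerivAt (fun h : E3 => inner ℝ (tr h u) (tr h v)) (0 : E3 →L[ℝ] ℝ) 0 := by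
    simp only [inner_tr]; exact hasFDerivAt_const _ _
  have h3 := congrArg (fun L => L (ej j)) (h1.unique h2)
  simpa [ej, tr_zero, Pi.single_apply, Finset.sum_ite_eq] using h3

theorem inner_cv_lap {l : ℝ} (hl : l ≠ 0) (k : 𝓢(E3, ℝ)) (v : V) (j : Fin 3) :
    inner ℝ (cv l (wker k 0) v) (cv l (wker (∂_{ej j} (∂_{ej j} k)) 0) v) =
      -‖cv l (wker (∂_{ej j} k) 0) v‖ ^ 2 := by
  have h := inner_hasTD (hasTD_cv hl k v) (hasTD_cv hl (∂_{ej j} k) v) j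
  rw [real_inner_smul_left, real_inner_smul_right, real_inner_self_eq_norm_sq, ← mul_add] at h
  have h2 := (mul_eq_zero.1 h).resolve_left (neg_ne_zero.2 (inv_ne_zero hl))
  linarith

/-- One derivative of the Laplacian is moved to the other factor. Stating it for every heat kernel,
not only the Gaussian, makes it available for derivatives of the flow. -/
theorem hasDerivAt_energy {n : ℕ} {k : 𝓢(E3, ℝ)} (hk : IsHeatKernel n k) (v : V) {s : ℝ}
    (hs : s ∈ Ioo (0 : ℝ) 1) :
    HasDerivAt (fun s : ℝ => ‖s ^ (-(n : ℝ) / 2) • cv √s (wker k 0) v‖ ^ 2)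
      (-2 * ∑ j, ‖s ^ (-((n + 1 : ℕ) : ℝ) / 2) • cv √s (wker (∂_{ej j} k) 0) v‖ ^ 2) s := by
  have h := (hasDerivAt_heat hk v hs).norm_sq
  refine h.congr_deriv ?_
  have h0 : √s ≠ 0 := (Real.sqrt_pos.2 hs.1).ne'
  have e1 : s ^ (-(n : ℝ) / 2) * s ^ (-((n + 2 : ℕ) : ℝ) / 2) =
      (s ^ (-((n + 1 : ℕ) : ℝ) / 2)) ^ 2 := by
    rw [← Real.rpow_natCast, ← Real.rpow_mul hs.1.le, ← Real.rpow_add hs.1]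
    congr 1; push_cast; ring
  rw [cv_slap, real_inner_smul_left, real_inner_smul_right, inner_sum]
  simp only [inner_cv_lap h0, norm_smul, mul_pow, Real.norm_eq_abs, sq_abs, ← Finset.mul_sum,
    Finset.sum_neg_distrib]
  rw [← e1]; ring

/-- The squared first derivatives of the heat flow. -/
noncomputable def heatG1 (v : V) (s : ℝ) : ℝ :=
  ∑ j, ‖(√s)⁻¹ • cv √s (wker (∂_{ej j} gauss) 0) v‖ ^ 2

/-- The weighted squared second derivatives of the heat flow. -/
noncomputable def heatG2 (v : V) (s : ℝ) : ℝ :=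
  ∑ l, s * ∑ j, ‖s⁻¹ • cv √s (wker (∂_{ej j} (∂_{ej l} gauss)) 0) v‖ ^ 2

theorem rpow_neg_half {s : ℝ} (hs : 0 ≤ s) : s ^ (-((0 + 1 : ℕ) : ℝ) / 2) = (√s)⁻¹ := by
  rw [Real.sqrt_eq_rpow, ← Real.rpow_neg hs]; norm_num

theorem rpow_neg_two_half {s : ℝ} : s ^ (-((0 + 1 + 1 : ℕ) : ℝ) / 2) = s⁻¹ := by
  rw [← Real.rpow_neg_one]; norm_num

theorem continuous_norm_cv (k : 𝓢(E3, ℝ)) (v : V) :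
    Continuous fun s : ℝ => ‖cv √s (wker k 0) v‖ ^ 2 :=
  ((continuous_cv (wker k 0) v).comp Real.continuous_sqrt).norm.pow 2

theorem hasDerivAt_energy_zero (v : V) {s : ℝ} (hs : s ∈ Ioo (0 : ℝ) 1) :
    HasDerivAt (fun s : ℝ => ‖cv √s (wker gauss 0) v‖ ^ 2) (-2 * heatG1 v s) s := by
  have h := hasDerivAt_energy isHeatKernel_gauss v hs
  rw [rpow_neg_half hs.1.le] at h
  simpa [heatG1] using h

/-- Here `‖cv √s (wker (∂_{ej l} gauss) 0) v‖²` is `s` times the squared norm of the `l`-th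
derivative of the flow; the product rule gives the two terms. -/
theorem hasDerivAt_energy_one (v : V) {s : ℝ} (hs : s ∈ Ioo (0 : ℝ) 1) :
    HasDerivAt (fun s : ℝ => ∑ l, ‖cv √s (wker (∂_{ej l} gauss) 0) v‖ ^ 2)
      (heatG1 v s - 2 * heatG2 v s) s := by
  have h1 : ∀ l : Fin 3, HasDerivAt (fun s : ℝ => ‖cv √s (wker (∂_{ej l} gauss) 0) v‖ ^ 2)
      (‖(√s)⁻¹ • cv √s (wker (∂_{ej l} gauss) 0) v‖ ^ 2 -
        2 * (s * ∑ j, ‖s⁻¹ • cv √s (wker (∂_{ej j} (∂_{ej l} gauss)) 0) v‖ ^ 2)) s := by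
    intro l
    have h := (hasDerivAt_id s).mul (hasDerivAt_energy (isHeatKernel_gauss.lineDeriv l) v hs)
    rw [rpow_neg_half hs.1.le, rpow_neg_two_half] at h
    refine (h.congr_of_eventuallyEq ?_).congr_deriv (by simp only [id]; ring)
    filter_upwards [lt_mem_nhds hs.1] with r hr
    simp only [Pi.mul_apply, id]
    rw [rpow_neg_half hr.le, norm_smul, mul_pow, norm_inv, Real.norm_of_nonneg (Real.sqrt_nonneg r),
      inv_pow, Real.sq_sqrt hr.le, mul_inv_cancel_left₀ hr.ne']
  refine (HasDerivAt.fun_sum fun l _ => h1 l).congr_deriv ?_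
  rw [Finset.sum_sub_distrib, heatG1, heatG2, Finset.mul_sum]

theorem heatG1_nonneg (v : V) (s : ℝ) : 0 ≤ heatG1 v s := Finset.sum_nonneg fun _ _ => by positivity

theorem heatG2_nonneg (v : V) {s : ℝ} (hs : 0 ≤ s) : 0 ≤ heatG2 v s :=
  Finset.sum_nonneg fun _ _ => mul_nonneg hs (Finset.sum_nonneg fun _ _ => by positivity)

/-- `-E` is monotone, so integrability of its nonnegative derivative up to the endpoints comes for
free. -/
theorem integral_le_of_energy {E G : ℝ → ℝ} (hc : Continuous E)
    (hd : ∀ s ∈ Ioo (0 : ℝ) 1, HasDerivAt E (-G s) s) (hG : ∀ s ∈ Ioo (0 : ℝ) 1, 0 ≤ G s)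
    (hE : 0 ≤ E 1) : IntegrableOn G (Ioc 0 1) ∧ ∫ s in Ioc (0 : ℝ) 1, G s ≤ E 0 := by
  have h1 : ∀ s ∈ Ioo (0 : ℝ) 1, HasDerivAt (fun s => -E s) (G s) s := fun s hs => by
    have := (hd s hs).neg
    rw [neg_neg] at this
    exact this
  have h2 := intervalIntegral.integrableOn_deriv_of_nonneg hc.neg.continuousOn h1 hG
  refine ⟨h2, ?_⟩
  have h3 := intervalIntegral.integral_eq_sub_of_hasDerivAt_of_le zero_le_one
    hc.neg.continuousOn h1 ((intervalIntegrable_iff_integrableOn_Ioc_of_le zero_le_one).2 h2)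
  rw [intervalIntegral.integral_of_le zero_le_one, Pi.neg_apply, Pi.neg_apply] at h3
  linarith

theorem heatG1_integral (v : V) : IntegrableOn (heatG1 v) (Ioc 0 1) ∧
    ∫ s in Ioc (0 : ℝ) 1, heatG1 v s ≤ ‖v‖ ^ 2 := by
  have h := integral_le_of_energy (E := fun s => 1 / 2 * ‖cv √s (wker gauss 0) v‖ ^ 2)
    (G := heatG1 v) (continuous_const.mul (continuous_norm_cv _ v))
    (fun s hs => ((hasDerivAt_energy_zero v hs).const_mul (1 / 2)).congr_deriv (by ring))
    (fun s _ => heatG1_nonneg v s) (by positivity)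
  refine ⟨h.1, h.2.trans ?_⟩
  simp only [Real.sqrt_zero, cv_zero_gauss]
  nlinarith [sq_nonneg ‖v‖]

/-- A bound for the averages with the derivatives of the heat kernel of order at most two. -/
noncomputable def heatC : ℝ := (∫ z, wt z) * (‖wker gauss 0‖ + ∑ l, ‖wker (∂_{ej l} gauss) 0‖ +
  ∑ l, ∑ j, ‖wker (∂_{ej j} (∂_{ej l} gauss)) 0‖)

theorem heatC_nonneg : 0 ≤ heatC := by
  have := integral_wt_nonneg
  unfold heatC; positivity

theorem norm_cv_gauss_le (l : ℝ) (v : V) : ‖cv l (wker gauss 0) v‖ ≤ heatC * ‖v‖ := by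
  refine (norm_cv_le _ _ _).trans (mul_le_mul_of_nonneg_right ?_ (norm_nonneg _))
  refine mul_le_mul_of_nonneg_left ?_ integral_wt_nonneg
  rw [add_assoc]
  exact le_add_of_nonneg_right (by positivity)

theorem norm_cv_gauss_one_le (l : ℝ) (j : Fin 3) (v : V) :
    ‖cv l (wker (∂_{ej j} gauss) 0) v‖ ≤ heatC * ‖v‖ := by
  refine (norm_cv_le _ _ _).trans (mul_le_mul_of_nonneg_right ?_ (norm_nonneg _))
  refine mul_le_mul_of_nonneg_left ?_ integral_wt_nonneg
  obtain ⟨f, hf⟩ : ∃ f : Fin 3 → ℝ, f = fun l => ‖wker (∂_{ej l} gauss) 0‖ := ⟨_, rfl⟩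
  obtain ⟨c, hc⟩ : ∃ c : ℝ, c = ∑ l, ∑ j, ‖wker (∂_{ej j} (∂_{ej l} gauss)) 0‖ := ⟨_, rfl⟩
  have h0 : 0 ≤ c := by
    rw [hc]; exact Finset.sum_nonneg fun _ _ => Finset.sum_nonneg fun _ _ => norm_nonneg _
  have h1 : f j ≤ ∑ l, f l := Finset.single_le_sum
    (fun l _ => by rw [hf]; exact norm_nonneg _) (Finset.mem_univ j)
  have h3 := norm_nonneg (wker gauss 0)
  rw [← hc]
  rw [hf] at h1
  linarith

/-- In `‖u‖²/4 + (s/2) ‖∇u‖²`, with gradient squares summed, the terms in `‖∇u‖²` cancel on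
differentiation and only the weighted second derivatives remain. -/
theorem heatG2_integral (v : V) : IntegrableOn (heatG2 v) (Ioc 0 1) ∧
    ∫ s in Ioc (0 : ℝ) 1, heatG2 v s ≤ (1 + 3 * heatC ^ 2) * ‖v‖ ^ 2 := by
  have h := integral_le_of_energy (E := fun s => 1 / 4 * ‖cv √s (wker gauss 0) v‖ ^ 2 +
      1 / 2 * ∑ l, ‖cv √s (wker (∂_{ej l} gauss) 0) v‖ ^ 2)
    (G := heatG2 v) ((continuous_const.mul (continuous_norm_cv _ v)).add
      (continuous_const.mul (continuous_finsetSum _ fun l _ => continuous_norm_cv _ v)))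
    (fun s hs => (((hasDerivAt_energy_zero v hs).const_mul (1 / 4)).add
      ((hasDerivAt_energy_one v hs).const_mul (1 / 2))).congr_deriv (by ring))
    (fun s hs => heatG2_nonneg v hs.1.le) (by positivity)
  refine ⟨h.1, h.2.trans ?_⟩
  simp only [Real.sqrt_zero, cv_zero_gauss]
  have h2 : ∑ l, ‖cv 0 (wker (∂_{ej l} gauss) 0) v‖ ^ 2 ≤ ∑ _l : Fin 3, (heatC * ‖v‖) ^ 2 :=
    Finset.sum_le_sum fun l _ => pow_le_pow_left₀ (norm_nonneg _) (norm_cv_gauss_one_le 0 l v) 2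
  rw [Finset.sum_const, Finset.card_univ, Fintype.card_fin, mul_pow] at h2
  have h3 : 0 ≤ heatC ^ 2 * ‖v‖ ^ 2 := by positivity
  simp only [nsmul_eq_mul] at h2
  push_cast at h2
  nlinarith [sq_nonneg ‖v‖]

end Energy

/-! ### The `𝓟^{3/4} 𝓗²` norm of a heat flow plus a smoothing remainder -/

section Norms

variable {F : Type*} [NormedAddCommGroup F] [InnerProductSpace ℝ F] [FiniteDimensional ℝ F]

theorem derivNorm_le {k : ℕ} {u : E3 → F} {c : ℝ} (h : ∀ J : Fin k → Fin 3, ∃ v : V2 F,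
    HasWeakDeriv (List.ofFn J) u v ∧ ‖v‖ ≤ c) : derivNorm k u ≤ ENNReal.ofReal c := by
  refine iSup_le fun J => ?_
  obtain ⟨v, hv, hc⟩ := h J
  refine (iInf₂_le _ hv).trans ?_
  rw [← Lp.enorm_def, ← ofReal_norm]
  exact ENNReal.ofReal_le_ofReal hc

theorem ae_mem_of_withDensity {s : Set ℝ} (hs : MeasurableSet s) {ρ : ℝ → ℝ≥0∞} :
    ∀ᵐ x ∂((volume.restrict s).withDensity ρ), x ∈ s :=
  (withDensity_absolutelyContinuous _ _).ae_le (ae_restrict_mem hs)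

theorem ofReal_weight {s : ℝ} (hs : 0 < s) (k : ℕ) (u : E3 → F) :
    ENNReal.ofReal (s ^ (3 / 4 : ℝ)) * pHdot k s u = ENNReal.ofReal (s ^ ((k : ℝ) / 2)) *
      derivNorm k u := by
  rw [pHdot, ← mul_assoc, ← ENNReal.ofReal_mul (Real.rpow_nonneg hs.le _), ← Real.rpow_add hs]
  congr 3; ring

theorem pLs_top_le {k : ℕ} {ψ : ℝ → E3 → F} {b : ℝ} (h : ∀ s ∈ Ioc (0 : ℝ) 1,
    ENNReal.ofReal (s ^ ((k : ℝ) / 2)) * derivNorm k (ψ s) ≤ ENNReal.ofReal b) :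
    pLs (3 / 4) ⊤ (Ioc 0 1) (fun s => pHdot k s (ψ s)) ≤ ENNReal.ofReal b := by
  rw [pLs, eLpNorm_exponent_top]
  refine essSup_le_of_ae_le _ ?_
  filter_upwards [ae_mem_of_withDensity measurableSet_Ioc] with s hs
  rw [ofReal_weight hs.1, enorm_eq_self]
  exact h s hs

/-- After the weight `s^{k/2}` is squared and combined with `ds / s`, the factor `s^{1-k}` is
exactly what leaves the plain integral of `G`. -/
theorem pLs_two_le {k : ℕ} {ψ : ℝ → E3 → F} {G : ℝ → ℝ} {b : ℝ} (hb : 0 ≤ b)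
    (h : ∀ s ∈ Ioc (0 : ℝ) 1, derivNorm k (ψ s) ≤ ENNReal.ofReal √(s ^ (1 - (k : ℝ)) * G s))
    (hG0 : ∀ s ∈ Ioc (0 : ℝ) 1, 0 ≤ G s)
    (hG : IntegrableOn G (Ioc 0 1)) (hGb : ∫ s in Ioc (0 : ℝ) 1, G s ≤ b ^ 2) :
    pLs (3 / 4) 2 (Ioc 0 1) (fun s => pHdot k s (ψ s)) ≤ ENNReal.ofReal b := by
  rw [pLs, eLpNorm_eq_lintegral_rpow_enorm_toReal (by simp) (by simp)]
  have h1 : ∫⁻ s, ‖ENNReal.ofReal (s ^ (3 / 4 : ℝ)) * pHdot k s (ψ s)‖ₑ ^ (2 : ℝ≥0∞).toReal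
      ∂((volume.restrict (Ioc (0 : ℝ) 1)).withDensity fun s => ENNReal.ofReal (1 / s)) ≤
      ENNReal.ofReal (b ^ 2) := by
    have hm : Measurable fun s : ℝ => ENNReal.ofReal (1 / s) :=
      ENNReal.measurable_ofReal.comp (measurable_const.div measurable_id)
    rw [lintegral_withDensity_eq_lintegral_mul_non_measurable _ hm
      (Eventually.of_forall fun _ => ENNReal.ofReal_lt_top)]
    refine (lintegral_mono_ae (g := fun s => ENNReal.ofReal (G s)) ?_).trans ?_
    · filter_upwards [ae_restrict_mem measurableSet_Ioc] with s hs
      rw [Pi.mul_apply, ofReal_weight hs.1, enorm_eq_self]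
      have h2 := h s hs
      have e0 : 0 ≤ s ^ ((k : ℝ) / 2) := Real.rpow_nonneg hs.1.le _
      have e1 : 0 ≤ s ^ (1 - (k : ℝ)) := Real.rpow_nonneg hs.1.le _
      have h3 : ENNReal.ofReal (s ^ ((k : ℝ) / 2)) * derivNorm k (ψ s) ≤
          ENNReal.ofReal (s ^ ((k : ℝ) / 2) * √(s ^ (1 - (k : ℝ)) * G s)) := by
        rw [ENNReal.ofReal_mul e0]
        exact mul_le_mul' le_rfl h2
      have h4 := ENNReal.rpow_le_rpow h3 (z := (2 : ℝ≥0∞).toReal) (by simp)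
      refine (mul_le_mul' le_rfl h4).trans (le_of_eq ?_)
      rw [ENNReal.toReal_ofNat, ENNReal.ofReal_rpow_of_nonneg (by positivity) (by norm_num),
        ← ENNReal.ofReal_mul (by have := hs.1; positivity)]
      congr 1
      rw [Real.rpow_two, mul_pow, Real.sq_sqrt (mul_nonneg e1 (hG0 s hs)), ← Real.rpow_natCast,
        ← Real.rpow_mul hs.1.le]
      have e2 : s ^ ((k : ℝ) / 2 * (2 : ℕ)) * s ^ (1 - (k : ℝ)) = s := by
        rw [← Real.rpow_add hs.1]
        rw [show (k : ℝ) / 2 * (2 : ℕ) + (1 - k) = 1 by push_cast; ring, Real.rpow_one]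
      have e3 := hs.1.ne'
      generalize s ^ ((k : ℝ) / 2 * (2 : ℕ)) = x at *
      generalize s ^ (1 - (k : ℝ)) = y at *
      calc 1 / s * (x * (y * G s)) = 1 / s * (x * y) * G s := by ring
        _ = G s := by rw [e2]; field_simp
    · rw [← ofReal_integral_eq_lintegral_ofReal hG
        ((ae_restrict_mem measurableSet_Ioc).mono fun s hs => hG0 s hs)]
      exact ENNReal.ofReal_le_ofReal hGb
  refine (ENNReal.rpow_le_rpow h1 (by simp)).trans (le_of_eq ?_)
  rw [ENNReal.toReal_ofNat, ENNReal.ofReal_rpow_of_nonneg (by positivity) (by norm_num),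
    ← Real.rpow_natCast, ← Real.rpow_mul hb]
  norm_num

/-- The contribution of the derivatives of the inhomogeneous part. -/
noncomputable def duhG (M s : ℝ) : ℝ := 2 * M ^ 2 * s ^ (-(3 / 4) : ℝ)

theorem duhG_integral (M : ℝ) : IntegrableOn (duhG M) (Ioc 0 1) ∧
    ∫ s in Ioc (0 : ℝ) 1, duhG M s = 8 * M ^ 2 := by
  have h := intervalIntegral.intervalIntegrable_rpow' (a := 0) (b := 1) (r := -(3 / 4))
    (by norm_num)
  refine ⟨((intervalIntegrable_iff_integrableOn_Ioc_of_le zero_le_one).1 h).const_mul _, ?_⟩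
  simp only [duhG]
  rw [integral_const_mul, ← intervalIntegral.integral_of_le zero_le_one,
    integral_rpow (Or.inl (by norm_num))]
  norm_num
  ring

theorem norm_add_sq_le {V : Type*} [NormedAddCommGroup V] {x y : V} {a b : ℝ} (hx : ‖x‖ ^ 2 ≤ a)
    (hy : ‖y‖ ^ 2 ≤ b) : ‖x + y‖ ^ 2 ≤ 2 * a + 2 * b := by
  have h := norm_add_le x y
  have h0 := norm_nonneg (x + y)
  nlinarith [sq_nonneg (‖x‖ - ‖y‖)]

theorem sq_rpow_le {x M s e e' : ℝ} (hs : 0 < s) (hx : x ≤ M * s ^ e) (hx0 : 0 ≤ x)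
    (he : e + e = e') : x ^ 2 ≤ M ^ 2 * s ^ e' := by
  refine (pow_le_pow_left₀ hx0 hx 2).trans (le_of_eq ?_)
  rw [mul_pow, ← he, Real.rpow_add hs, sq (s ^ e)]

variable (F) in
/-- A curve in `L²` that is the sum of a heat flow and of a part with the smoothing properties of
the Duhamel term. -/
structure HeatSplit (M : ℝ) (ψ : ℝ → E3 → F) where
  v : V2 F
  n0 : ℝ → V2 F
  n1 : Fin 3 → ℝ → V2 F
  n2 : Fin 3 → Fin 3 → ℝ → V2 F
  norm_v : ‖v‖ ≤ M
  eq : ∀ s ∈ Ioc (0 : ℝ) 1, ψ s = (cv √s (wker gauss 0) v + n0 s : V2 F)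
  norm_n0 : ∀ s ∈ Ioc (0 : ℝ) 1, ‖n0 s‖ ≤ M
  norm_n1 : ∀ k, ∀ s ∈ Ioc (0 : ℝ) 1, ‖n1 k s‖ ≤ M * s ^ (-(3 / 8) : ℝ)
  norm_n2 : ∀ k l, ∀ s ∈ Ioc (0 : ℝ) 1, ‖n2 k l s‖ ≤ M * s ^ (-(7 / 8) : ℝ)
  weak_n1 : ∀ k, ∀ s ∈ Ioc (0 : ℝ) 1, HasWeakDeriv [k] (n0 s) (n1 k s)
  weak_n2 : ∀ k l, ∀ s ∈ Ioc (0 : ℝ) 1, HasWeakDeriv [l] (n1 k s) (n2 k l s)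

theorem HasWeakDeriv.lp_add {j : Fin 3} {u v u' v' : V2 F} (h : HasWeakDeriv [j] u v)
    (h' : HasWeakDeriv [j] u' v') : HasWeakDeriv [j] (u + u' : V2 F) (v + v' : V2 F) :=
  hasWeakDeriv_congr (Lp.coeFn_add _ _).symm (Lp.coeFn_add _ _).symm (hasWeakDeriv_add h h')

theorem hasWeakDeriv_nil (u : V2 F) : HasWeakDeriv [] u u :=
  ⟨Lp.locallyIntegrable' u, Lp.locallyIntegrable' u, fun φ _ _ => by simp [iterPd]⟩

namespace HeatSplit

variable {M : ℝ} {ψ : ℝ → E3 → F} (h : HeatSplit F M ψ)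

theorem nonneg (h : HeatSplit F M ψ) : 0 ≤ M := (norm_nonneg _).trans h.norm_v

/-- The first derivatives. -/
noncomputable def d1 (k : Fin 3) (s : ℝ) : V2 F :=
  -(√s)⁻¹ • cv √s (wker (∂_{ej k} gauss) 0) h.v + h.n1 k s

/-- The second derivatives. -/
noncomputable def d2 (k l : Fin 3) (s : ℝ) : V2 F :=
  s⁻¹ • cv √s (wker (∂_{ej l} (∂_{ej k} gauss)) 0) h.v + h.n2 k l s

theorem weak_d1 (k : Fin 3) {s : ℝ} (hs : s ∈ Ioc (0 : ℝ) 1) :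
    HasWeakDeriv [k] (ψ s) (h.d1 k s) := by
  rw [h.eq s hs]
  exact ((hasTD_cv (Real.sqrt_pos.2 hs.1).ne' gauss h.v).hasWeakDeriv k).lp_add (h.weak_n1 k s hs)

theorem weak_d2 (k l : Fin 3) {s : ℝ} (hs : s ∈ Ioc (0 : ℝ) 1) :
    HasWeakDeriv [l] (h.d1 k s) (h.d2 k l s) := by
  have h1 := ((hasTD_cv (Real.sqrt_pos.2 hs.1).ne' (∂_{ej k} gauss) h.v).smul
    (-(√s)⁻¹)).hasWeakDeriv l
  have e : (-(√s)⁻¹ • fun j => -(√s)⁻¹ • cv √s (wker (∂_{ej j} (∂_{ej k} gauss)) 0) h.v) l =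
      s⁻¹ • cv √s (wker (∂_{ej l} (∂_{ej k} gauss)) 0) h.v := by
    rw [Pi.smul_apply, smul_smul, neg_mul_neg, ← mul_inv, Real.mul_self_sqrt hs.1.le]
  rw [e] at h1
  exact h1.lp_add (h.weak_n2 k l s hs)

theorem norm_d1_sq_le (k : Fin 3) {s : ℝ} (hs : s ∈ Ioc (0 : ℝ) 1) :
    ‖h.d1 k s‖ ^ 2 ≤ 2 * heatG1 h.v s + duhG M s := by
  have h1 : ‖-(√s)⁻¹ • cv √s (wker (∂_{ej k} gauss) 0) h.v‖ ^ 2 ≤ heatG1 h.v s := by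
    rw [neg_smul, norm_neg]
    exact Finset.single_le_sum
      (f := fun j => ‖(√s)⁻¹ • cv √s (wker (∂_{ej j} gauss) 0) h.v‖ ^ 2)
      (fun _ _ => sq_nonneg _) (Finset.mem_univ k)
  have h2 := norm_add_sq_le h1 (sq_rpow_le hs.1 (h.norm_n1 k s hs) (norm_nonneg _)
    (show (-(3 / 8) + -(3 / 8) : ℝ) = -(3 / 4) by norm_num))
  rw [duhG, mul_assoc]
  exact h2

theorem norm_d2_sq_le (k l : Fin 3) {s : ℝ} (hs : s ∈ Ioc (0 : ℝ) 1) :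
    s * ‖h.d2 k l s‖ ^ 2 ≤ 2 * heatG2 h.v s + duhG M s := by
  have h1 : s * ‖s⁻¹ • cv √s (wker (∂_{ej l} (∂_{ej k} gauss)) 0) h.v‖ ^ 2 ≤ heatG2 h.v s := by
    refine le_trans ?_ (Finset.single_le_sum
      (f := fun k => s * ∑ j, ‖s⁻¹ • cv √s (wker (∂_{ej j} (∂_{ej k} gauss)) 0) h.v‖ ^ 2)
      (fun _ _ => mul_nonneg hs.1.le (Finset.sum_nonneg fun _ _ => sq_nonneg _))
      (Finset.mem_univ k))
    refine mul_le_mul_of_nonneg_left ?_ hs.1.le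
    exact Finset.single_le_sum
      (f := fun j => ‖s⁻¹ • cv √s (wker (∂_{ej j} (∂_{ej k} gauss)) 0) h.v‖ ^ 2)
      (fun _ _ => sq_nonneg _) (Finset.mem_univ l)
  have h2 := norm_add_sq_le le_rfl (sq_rpow_le hs.1 (h.norm_n2 k l s hs) (norm_nonneg _)
    (show (-(7 / 8) + -(7 / 8) : ℝ) = -(7 / 4) by norm_num))
    (x := s⁻¹ • cv √s (wker (∂_{ej l} (∂_{ej k} gauss)) 0) h.v)
  -- Weighted by `s`, the second derivatives of the remainder have the same integrable size
  -- `s^{-3/4}` as the first derivatives squared.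
  have e : s * (M ^ 2 * s ^ (-(7 / 4) : ℝ)) = M ^ 2 * s ^ (-(3 / 4) : ℝ) := by
    rw [mul_left_comm]
    congr 1
    conv_lhs => rw [← Real.rpow_one s, ← Real.rpow_mul hs.1.le, ← Real.rpow_add hs.1]
    norm_num
  have h3 := mul_le_mul_of_nonneg_left h2 hs.1.le
  refine h3.trans ?_
  rw [duhG]
  nlinarith [h1, e]

theorem d1_integral : IntegrableOn (fun s => 2 * heatG1 h.v s + duhG M s) (Ioc 0 1) ∧
    ∫ s in Ioc (0 : ℝ) 1, (2 * heatG1 h.v s + duhG M s) ≤ 10 * M ^ 2 := by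
  have h1 := heatG1_integral h.v
  have h2 := duhG_integral M
  refine ⟨(h1.1.const_mul 2).add h2.1, ?_⟩
  rw [integral_add (h1.1.const_mul 2) h2.1, integral_const_mul, h2.2]
  have h3 := pow_le_pow_left₀ (norm_nonneg _) h.norm_v 2
  linarith [h1.2]

theorem d2_integral : IntegrableOn (fun s => 2 * heatG2 h.v s + duhG M s) (Ioc 0 1) ∧
    ∫ s in Ioc (0 : ℝ) 1, (2 * heatG2 h.v s + duhG M s) ≤ (10 + 6 * heatC ^ 2) * M ^ 2 := by
  have h1 := heatG2_integral h.v
  have h2 := duhG_integral M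
  refine ⟨(h1.1.const_mul 2).add h2.1, ?_⟩
  rw [integral_add (h1.1.const_mul 2) h2.1, integral_const_mul, h2.2]
  have h3 := mul_le_mul_of_nonneg_left (pow_le_pow_left₀ (norm_nonneg _) h.norm_v 2)
    (by positivity : 0 ≤ 1 + 3 * heatC ^ 2)
  linarith [h1.2]

theorem duhG_nonneg {s : ℝ} (hs : 0 ≤ s) : 0 ≤ duhG M s := by
  have := Real.rpow_nonneg hs (-(3 / 4))
  unfold duhG; positivity

theorem norm_le {s : ℝ} (hs : s ∈ Ioc (0 : ℝ) 1) :
    ‖cv √s (wker gauss 0) h.v + h.n0 s‖ ≤ (4 + 3 * heatC) * M := by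
  have h1 := norm_cv_gauss_le √s h.v
  have h2 := mul_le_mul_of_nonneg_left h.norm_v heatC_nonneg
  have h3 := mul_nonneg heatC_nonneg h.nonneg
  have h4 := h.nonneg
  refine (norm_add_le _ _).trans ?_
  linarith [h.norm_n0 s hs]

theorem norm_d1_le (k : Fin 3) {s : ℝ} (hs : s ∈ Ioc (0 : ℝ) 1) :
    √s * ‖h.d1 k s‖ ≤ (4 + 3 * heatC) * M := by
  have hs0 := Real.sqrt_pos.2 hs.1
  have h1 := norm_cv_gauss_one_le √s k h.v
  have h2 := mul_le_mul_of_nonneg_left h.norm_v heatC_nonneg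
  have h3 := mul_nonneg heatC_nonneg h.nonneg
  have h4 := h.nonneg
  have h5 : √s * ‖h.n1 k s‖ ≤ M := by
    have := mul_le_mul_of_nonneg_left (h.norm_n1 k s hs) hs0.le
    refine this.trans ?_
    rw [mul_left_comm, Real.sqrt_eq_rpow, ← Real.rpow_add hs.1]
    exact mul_le_of_le_one_right h4 (Real.rpow_le_one hs.1.le hs.2 (by norm_num))
  have h6 : √s * ‖-(√s)⁻¹ • cv √s (wker (∂_{ej k} gauss) 0) h.v‖ ≤ heatC * M := by
    rw [norm_smul, norm_neg, norm_inv, Real.norm_of_nonneg hs0.le, mul_inv_cancel_left₀ hs0.ne']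
    exact h1.trans h2
  have h7 := mul_le_mul_of_nonneg_left (norm_add_le
    (-(√s)⁻¹ • cv √s (wker (∂_{ej k} gauss) 0) h.v) (h.n1 k s)) hs0.le
  refine h7.trans ?_
  linarith

theorem derivNorm_zero_le (h : HeatSplit F M ψ) {s : ℝ} (hs : s ∈ Ioc (0 : ℝ) 1) :
    derivNorm 0 (ψ s) ≤ ENNReal.ofReal ((4 + 3 * heatC) * M) := by
  refine derivNorm_le fun J => ⟨cv √s (wker gauss 0) h.v + h.n0 s, ?_, h.norm_le hs⟩
  rw [h.eq s hs, List.ofFn_zero]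
  exact hasWeakDeriv_nil _

theorem derivNorm_one_le {s c : ℝ} (hs : s ∈ Ioc (0 : ℝ) 1) (hc : ∀ k, ‖h.d1 k s‖ ≤ c) :
    derivNorm 1 (ψ s) ≤ ENNReal.ofReal c := by
  refine derivNorm_le fun J => ⟨h.d1 (J 0) s, ?_, hc _⟩
  rw [List.ofFn_succ, List.ofFn_zero]
  exact h.weak_d1 _ hs

theorem derivNorm_two_le {s c : ℝ} (hs : s ∈ Ioc (0 : ℝ) 1) (hc : ∀ k l, ‖h.d2 k l s‖ ≤ c) :
    derivNorm 2 (ψ s) ≤ ENNReal.ofReal c := by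
  refine derivNorm_le fun J => ⟨h.d2 (J 0) (J 1) s, ?_, hc _ _⟩
  rw [List.ofFn_succ, List.ofFn_succ, List.ofFn_zero]
  exact HasWeakDeriv.append (h.weak_d1 (J 0) hs) (h.weak_d2 (J 0) (J 1) hs)

/-- The suprema use the pointwise kernel bounds and the square integrals use the energy identities.
Each of the four summands is bounded by the same quantity, hence the factor four. -/
theorem pNorm_le (h : HeatSplit F M ψ) : pNorm (3 / 4) 2 (Ioc 0 1) ψ ≤
    ENNReal.ofReal (4 * ((4 + 3 * heatC) * M)) := by
  have hb : 0 ≤ (4 + 3 * heatC) * M := by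
    have := heatC_nonneg; have := h.nonneg; positivity
  have hG1 : ∀ s ∈ Ioc (0 : ℝ) 1, 0 ≤ 2 * heatG1 h.v s + duhG M s := fun s hs => by
    have := heatG1_nonneg h.v s; have := duhG_nonneg (M := M) hs.1.le; positivity
  have hG2 : ∀ s ∈ Ioc (0 : ℝ) 1, 0 ≤ 2 * heatG2 h.v s + duhG M s := fun s hs => by
    have := heatG2_nonneg h.v hs.1.le; have := duhG_nonneg (M := M) hs.1.le; positivity
  have hM := sq_nonneg M
  have hH := heatC_nonneg
  have t1 : pLs (3 / 4) ⊤ (Ioc 0 1) (fun s => pHdot 0 s (ψ s)) ≤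
      ENNReal.ofReal ((4 + 3 * heatC) * M) := pLs_top_le fun s hs => by
    simpa using h.derivNorm_zero_le hs
  have t2 : pLs (3 / 4) 2 (Ioc 0 1) (fun s => pHdot 1 s (ψ s)) ≤
      ENNReal.ofReal ((4 + 3 * heatC) * M) := by
    refine pLs_two_le (G := fun s => 2 * heatG1 h.v s + duhG M s) hb (fun s hs => ?_) hG1
      h.d1_integral.1 (h.d1_integral.2.trans ?_)
    · refine h.derivNorm_one_le hs fun k => ?_
      simpa using Real.le_sqrt_of_sq_le (h.norm_d1_sq_le k hs)
    · nlinarith [mul_nonneg hH hM, mul_nonneg (sq_nonneg heatC) hM]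
  have t3 : pLs (3 / 4) ⊤ (Ioc 0 1) (fun s => pHdot 1 s (ψ s)) ≤
      ENNReal.ofReal ((4 + 3 * heatC) * M) := pLs_top_le fun s hs => by
    have h0 := Real.sqrt_pos.2 hs.1
    have h1 := h.derivNorm_one_le (c := (√s)⁻¹ * ((4 + 3 * heatC) * M)) hs fun k =>
      (le_inv_mul_iff₀ h0).2 (h.norm_d1_le k hs)
    refine (mul_le_mul' le_rfl h1).trans ?_
    rw [Nat.cast_one, ← Real.sqrt_eq_rpow, ← ENNReal.ofReal_mul h0.le, mul_inv_cancel_left₀ h0.ne']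
  have t4 : pLs (3 / 4) 2 (Ioc 0 1) (fun s => pHdot 2 s (ψ s)) ≤
      ENNReal.ofReal ((4 + 3 * heatC) * M) := by
    refine pLs_two_le (G := fun s => 2 * heatG2 h.v s + duhG M s) hb (fun s hs => ?_) hG2
      h.d2_integral.1 (h.d2_integral.2.trans ?_)
    · refine h.derivNorm_two_le hs fun k l => Real.le_sqrt_of_sq_le ?_
      have e : s ^ (1 - ((2 : ℕ) : ℝ)) = s⁻¹ := by rw [← Real.rpow_neg_one]; norm_num
      rw [e]
      exact (le_inv_mul_iff₀ hs.1).2 (h.norm_d2_sq_le k l hs)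
    · nlinarith [mul_nonneg hH hM, mul_nonneg (sq_nonneg heatC) hM]
  rw [pNorm, Finset.sum_range_succ, Finset.sum_range_succ, Finset.sum_range_zero, zero_add]
  refine (add_le_add (add_le_add t1 t2) (add_le_add t3 t4)).trans (le_of_eq ?_)
  rw [← ENNReal.ofReal_add hb hb, ← ENNReal.ofReal_add (by positivity) (by positivity)]
  congr 1; ring

end HeatSplit

end Norms

/-! ### Smooth families covariant under parabolic translation -/

section Families

variable {V D : Type*} [NormedAddCommGroup V] [NormedSpace ℝ V] [TransRep V]
  [NormedAddCommGroup D] [NormedSpace ℝ D]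

theorem HasTD.sub {v w : V} {g g' : Fin 3 → V} (h : HasTD v g) (h' : HasTD w g') :
    HasTD (v - w) (g - g') := by
  have := h.add (h'.smul (-1))
  rwa [neg_one_smul, neg_one_smul, ← sub_eq_add_neg, ← sub_eq_add_neg] at this

/-- The derivative of a family of curves in the translation parameter. -/
noncomputable def dh (j : Fin 3) (Φ : E3 × D → C(I, V)) (p : E3 × D) : C(I, V) :=
  fderiv ℝ Φ p (ej j, 0)

/-- A smooth family of curves that are covariant under parabolic translations. -/
structure IsParabolic (δ : ℝ) (Φ : E3 × D → C(I, V)) : Prop where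
  pos : 0 < δ
  smooth : ContDiffOn ℝ ∞ Φ (Metric.ball 0 δ ×ˢ Metric.ball 0 δ)
  tr : ∀ a ∈ Metric.ball (0 : D) δ, ∀ h ∈ Metric.ball (0 : E3) δ, trC h (Φ (0, a)) = Φ (h, a)

namespace IsParabolic

variable {δ : ℝ} {Φ : E3 × D → C(I, V)}

theorem isOpen (δ : ℝ) : IsOpen (Metric.ball (0 : E3) δ ×ˢ Metric.ball (0 : D) δ) :=
  Metric.isOpen_ball.prod Metric.isOpen_ball

theorem hasFDerivAt_left (hΦ : IsParabolic δ Φ) {a : D} (ha : a ∈ Metric.ball (0 : D) δ) {h : E3}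
    (hh : h ∈ Metric.ball (0 : E3) δ) : HasFDerivAt (fun h => Φ (h, a))
      ((fderiv ℝ Φ (h, a)).comp (ContinuousLinearMap.inl ℝ E3 D)) h := by
  have h1 : HasFDerivAt Φ (fderiv ℝ Φ (h, a)) (h, a) :=
    ((hΦ.smooth.differentiableOn (by simp) (h, a) (mk_mem_prod hh ha)).differentiableAt
      ((isOpen δ).mem_nhds (mk_mem_prod hh ha))).hasFDerivAt
  exact h1.comp h (hasFDerivAt_prodMk_left h a)

theorem fderiv_left (hΦ : IsParabolic δ Φ) {a : D} (ha : a ∈ Metric.ball (0 : D) δ) {h : E3}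
    (hh : h ∈ Metric.ball (0 : E3) δ) (j : Fin 3) :
    fderiv ℝ (fun h => Φ (h, a)) h (ej j) = dh j Φ (h, a) := by
  rw [(hΦ.hasFDerivAt_left ha hh).fderiv]; rfl

/-- Covariance of the derivative is `trC_fderiv`, so the class is closed under differentiation in
`h`. Each such derivative stands for `√s` times a spatial derivative. -/
theorem dh (hΦ : IsParabolic δ Φ) (j : Fin 3) : IsParabolic δ (dh j Φ) where
  pos := hΦ.pos
  smooth := (hΦ.smooth.fderiv_of_isOpen (isOpen δ) (m := ∞) (by simp)).clm_apply contDiffOn_const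
  tr a ha h hh := by
    rw [← hΦ.fderiv_left ha hh, ← hΦ.fderiv_left ha (Metric.mem_ball_self hΦ.pos)]
    exact trC_fderiv Metric.isOpen_ball (Metric.mem_ball_self hΦ.pos) (hΦ.tr a ha)
      (fun k hk => (hΦ.hasFDerivAt_left ha hk).differentiableAt.differentiableWithinAt) _ hh

theorem hasTD (hΦ : IsParabolic δ Φ) {a : D} (ha : a ∈ Metric.ball (0 : D) δ) {s : I}
    (hs : 0 < (s : ℝ)) :
    HasTD (Φ (0, a) s) fun j => (√(s : ℝ))⁻¹ • YMHeat.dh j Φ (0, a) s := by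
  have h0 := Metric.mem_ball_self (x := (0 : E3)) hΦ.pos
  have h := hasTD_of_trC (eventually_of_mem (Metric.isOpen_ball.mem_nhds h0) (hΦ.tr a ha))
    (hΦ.hasFDerivAt_left ha h0).differentiableAt hs
  simpa only [hΦ.fderiv_left ha h0] using h

theorem contDiffAt (hΦ : IsParabolic δ Φ) : ContDiffAt ℝ 1 (fun a => Φ (0, a)) 0 := by
  have h0 : ((0 : E3), (0 : D)) ∈ Metric.ball (0 : E3) δ ×ˢ Metric.ball (0 : D) δ :=
    mk_mem_prod (Metric.mem_ball_self hΦ.pos) (Metric.mem_ball_self hΦ.pos)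
  have h1 := ((hΦ.smooth _ h0).contDiffAt ((isOpen δ).mem_nhds h0)).of_le (m := 1)
    (by exact_mod_cast le_top)
  exact h1.comp (0 : D) (contDiffAt_const.prodMk contDiffAt_id)

theorem exists_lipschitz (hΦ : IsParabolic δ Φ) : ∃ (K r : ℝ), 0 < K ∧ 0 < r ∧ r < δ ∧
    ∀ a ∈ Metric.ball (0 : D) r, ∀ a' ∈ Metric.ball (0 : D) r,
      ‖Φ (0, a) - Φ (0, a')‖ ≤ K * ‖a - a'‖ ∧
      (∀ k, ‖YMHeat.dh k Φ (0, a) - YMHeat.dh k Φ (0, a')‖ ≤ K * ‖a - a'‖) ∧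
      ∀ k l, ‖YMHeat.dh l (YMHeat.dh k Φ) (0, a) - YMHeat.dh l (YMHeat.dh k Φ) (0, a')‖ ≤
        K * ‖a - a'‖ := by
  have h1 : ContDiffAt ℝ 1 (fun a : D => (Φ (0, a), (fun k => YMHeat.dh k Φ (0, a)),
      fun k l => YMHeat.dh l (YMHeat.dh k Φ) (0, a))) 0 :=
    hΦ.contDiffAt.prodMk ((contDiffAt_pi.2 fun k => (hΦ.dh k).contDiffAt).prodMk
      (contDiffAt_pi.2 fun k => contDiffAt_pi.2 fun l => ((hΦ.dh k).dh l).contDiffAt))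
  obtain ⟨K, t, ht, hK⟩ := h1.exists_lipschitzOnWith
  obtain ⟨r, hr, hrt⟩ := Metric.mem_nhds_iff.1 ht
  refine ⟨K + 1, min r (δ / 2), by positivity, lt_min hr (half_pos hΦ.pos),
    (min_le_right _ _).trans_lt (half_lt_self hΦ.pos), fun a ha a' ha' => ?_⟩
  have h2 := hK.norm_sub_le (hrt (Metric.ball_subset_ball (min_le_left _ _) ha))
    (hrt (Metric.ball_subset_ball (min_le_left _ _) ha'))
  have h3 : (K : ℝ) * ‖a - a'‖ ≤ (K + 1) * ‖a - a'‖ := by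
    nlinarith [norm_nonneg (a - a')]
  replace h2 := h2.trans h3
  refine ⟨(norm_fst_le _).trans h2, fun k => ?_, fun k l => ?_⟩
  · exact (norm_le_pi_norm (fun k => YMHeat.dh k Φ (0, a) - YMHeat.dh k Φ (0, a')) k).trans
      ((norm_fst_le _).trans ((norm_snd_le _).trans h2))
  · refine (norm_le_pi_norm (fun l => YMHeat.dh l (YMHeat.dh k Φ) (0, a) -
      YMHeat.dh l (YMHeat.dh k Φ) (0, a')) l).trans ?_
    exact (norm_le_pi_norm (fun k l => YMHeat.dh l (YMHeat.dh k Φ) (0, a) -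
      YMHeat.dh l (YMHeat.dh k Φ) (0, a')) k).trans
      ((norm_snd_le _).trans ((norm_snd_le _).trans h2))

end IsParabolic

end Families

/-! ### Splitting the gradient of a difference of solutions -/

section Estimates

variable {𝔤 : Type*} [InvariantLieAlgebra 𝔤] [FiniteDimensional ℝ 𝔤]

variable (𝔤) in
/-- The component `∂_j A_i`. -/
noncomputable def gradComp (i j : Fin 3) : Conn 𝔤 →L[ℝ] V2 𝔤 :=
  (ContinuousLinearMap.proj (R := ℝ) (φ := fun _ : Fin 3 => V2 𝔤) j).comp ((gradL 𝔤).comp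
    (ContinuousLinearMap.proj (R := ℝ) (φ := fun _ : Fin 3 => HDot1 𝔤) i))

theorem gradComp_apply (i j : Fin 3) (z : Conn 𝔤) : gradComp 𝔤 i j z = HDot1.grad 𝔤 (z i) j := rfl

theorem gradComp_tr (i j : Fin 3) (h : E3) (z : Conn 𝔤) :
    gradComp 𝔤 i j (tr h z) = tr h (gradComp 𝔤 i j z) := rfl

theorem norm_gradComp_le (i j : Fin 3) (z : Conn 𝔤) : ‖gradComp 𝔤 i j z‖ ≤ ‖z‖ :=
  (norm_le_pi_norm (gradL 𝔤 (z i)) j).trans ((norm_gradL _).trans_le (norm_le_pi_norm z i))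

theorem norm_gradComp_curve_le (i j : Fin 3) (z : ConnFlow 𝔤) {c M s e : ℝ} (hs : 0 ≤ s)
    (r : I) (hz : ‖z‖ ≤ M) (hc : c = s ^ e) :
    ‖c • gradComp 𝔤 i j (z r)‖ ≤ M * s ^ e := by
  have h0 := Real.rpow_nonneg hs e
  rw [norm_smul, hc, Real.norm_of_nonneg h0, mul_comm]
  exact mul_le_mul_of_nonneg_right
    ((norm_gradComp_le i j _).trans ((z.norm_coe_le_norm r).trans hz)) h0

/-- The splitting of the derivatives of the difference of two curves. -/
noncomputable def heatSplit {δ K : ℝ} {Y : E3 × Conn 𝔤 → ConnFlow 𝔤} (hY : IsParabolic δ Y)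
    (hK : 0 < K) {a a' : Conn 𝔤} (ha : a ∈ Metric.ball (0 : Conn 𝔤) δ)
    (ha' : a' ∈ Metric.ball (0 : Conn 𝔤) δ)
    (h0 : ‖Y (0, a) - Y (0, a')‖ ≤ K * ‖a - a'‖)
    (h1 : ∀ k, ‖dh k Y (0, a) - dh k Y (0, a')‖ ≤ K * ‖a - a'‖)
    (h2 : ∀ k l, ‖dh l (dh k Y) (0, a) - dh l (dh k Y) (0, a')‖ ≤ K * ‖a - a'‖)
    {A A' : ConnFlow 𝔤}
    (hA : ∀ s : I, A s = evo (wker gauss 0) a s + (s : ℝ) ^ (1 / 8 : ℝ) • Y (0, a) s)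
    (hA' : ∀ s : I, A' s = evo (wker gauss 0) a' s + (s : ℝ) ^ (1 / 8 : ℝ) • Y (0, a') s)
    (i j : Fin 3) : HeatSplit 𝔤 ((K + 1) * ‖a - a'‖)
      (fun s => HDot1.grad 𝔤 ((A - A').slice i s) j) where
  v := gradComp 𝔤 i j (a - a')
  n0 s := s ^ (1 / 8 : ℝ) • gradComp 𝔤 i j
    ((Y (0, a) - Y (0, a')) (projIcc 0 1 zero_le_one s))
  n1 k s := s ^ (1 / 8 : ℝ) • gradComp 𝔤 i j
    ((√s)⁻¹ • (dh k Y (0, a) - dh k Y (0, a')) (projIcc 0 1 zero_le_one s))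
  n2 k l s := s ^ (1 / 8 : ℝ) • gradComp 𝔤 i j
    ((√s)⁻¹ • (√s)⁻¹ • (dh l (dh k Y) (0, a) - dh l (dh k Y) (0, a'))
      (projIcc 0 1 zero_le_one s))
  norm_v := (norm_gradComp_le i j _).trans (by nlinarith [norm_nonneg (a - a')])
  eq s hs := by
    have hs' : s ∈ Icc (0 : ℝ) 1 := Ioc_subset_Icc_self hs
    have e1 : (A - A') ⟨s, hs'⟩ = cv √s (wker gauss 0) (a - a') +
        s ^ (1 / 8 : ℝ) • (Y (0, a) - Y (0, a')) ⟨s, hs'⟩ := by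
      rw [ContinuousMap.sub_apply, ContinuousMap.sub_apply, hA, hA', evo_apply, evo_apply,
        map_sub, smul_sub]
      abel
    have e2 : HDot1.grad 𝔤 ((A - A').slice i s) j = gradComp 𝔤 i j ((A - A') ⟨s, hs'⟩) := by
      rw [slice_apply, projIcc_of_mem _ hs', gradComp_apply]
    beta_reduce
    rw [e2, e1, map_add, map_smul, projIcc_of_mem _ hs',
      map_cv (gradComp 𝔤 i j) (gradComp_tr i j)]
  norm_n0 s hs := by
    have h := norm_gradComp_curve_le i j (Y (0, a) - Y (0, a')) hs.1.le
      (projIcc 0 1 zero_le_one s) h0 (rfl : s ^ (1 / 8 : ℝ) = s ^ (1 / 8 : ℝ))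
    have h3 : s ^ (1 / 8 : ℝ) ≤ 1 := Real.rpow_le_one hs.1.le hs.2 (by norm_num)
    have h4 : 0 ≤ K * ‖a - a'‖ := by positivity
    nlinarith [norm_nonneg (a - a')]
  -- Each spatial derivative costs `s^{-1/2}` against the spare factor: `1/8 - 1/2 = -3/8` here and
  -- `1/8 - 1 = -7/8` for second derivatives.
  norm_n1 k s hs := by
    rw [map_smul, smul_smul]
    have h5 := Real.rpow_nonneg hs.1.le (-(3 / 8))
    refine (norm_gradComp_curve_le i j _ hs.1.le (projIcc 0 1 zero_le_one s) (h1 k)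
      (e := -(3 / 8)) ?_).trans (mul_le_mul_of_nonneg_right (by nlinarith [norm_nonneg (a - a')]) h5)
    rw [Real.sqrt_eq_rpow, ← Real.rpow_neg hs.1.le, ← Real.rpow_add hs.1]; norm_num
  norm_n2 k l s hs := by
    rw [map_smul, map_smul, smul_smul, smul_smul]
    have h5 := Real.rpow_nonneg hs.1.le (-(7 / 8))
    refine (norm_gradComp_curve_le i j _ hs.1.le (projIcc 0 1 zero_le_one s) (h2 k l)
      (e := -(7 / 8)) ?_).trans (mul_le_mul_of_nonneg_right (by nlinarith [norm_nonneg (a - a')]) h5)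
    rw [Real.sqrt_eq_rpow, ← Real.rpow_neg hs.1.le, ← Real.rpow_add hs.1, ← Real.rpow_add hs.1]
    norm_num
  weak_n1 k s hs := by
    have hs' : s ∈ Icc (0 : ℝ) 1 := Ioc_subset_Icc_self hs
    have h := ((((hY.hasTD ha (s := ⟨s, hs'⟩) hs.1).sub (hY.hasTD ha' (s := ⟨s, hs'⟩) hs.1)).map (gradComp 𝔤 i j)
      (gradComp_tr i j)).smul (s ^ (1 / 8 : ℝ))).hasWeakDeriv k
    rw [projIcc_of_mem _ hs']
    simpa only [Pi.smul_apply, Pi.sub_apply, ← smul_sub, ← ContinuousMap.sub_apply] using h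
  weak_n2 k l s hs := by
    have hs' : s ∈ Icc (0 : ℝ) 1 := Ioc_subset_Icc_self hs
    have h := (((((hY.dh k).hasTD ha (s := ⟨s, hs'⟩) hs.1).sub ((hY.dh k).hasTD ha' (s := ⟨s, hs'⟩) hs.1)).smul
      (√s)⁻¹).map (gradComp 𝔤 i j) (gradComp_tr i j)).smul (s ^ (1 / 8 : ℝ)) |>.hasWeakDeriv l
    rw [projIcc_of_mem _ hs']
    simpa only [Pi.smul_apply, Pi.sub_apply, ← smul_sub, ← ContinuousMap.sub_apply] using h

theorem gradPNorm_le {M : ℝ} {A : ConnFlow 𝔤}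
    (h : ∀ i j, Nonempty (HeatSplit 𝔤 M (fun s => HDot1.grad 𝔤 (A.slice i s) j))) :
    gradPNorm A ≤ ENNReal.ofReal (4 * ((4 + 3 * heatC) * M)) :=
  iSup_le fun i => iSup_le fun j => (h i j).some.pNorm_le

/-- The second derivatives of `A_i` are first derivatives of its gradient, so the unweighted
first-order energy bound suffices. -/
theorem l2_hdot2_of_heatSplit {M : ℝ} {A : ConnFlow 𝔤}
    (h : ∀ i j, HeatSplit 𝔤 M (fun s => HDot1.grad 𝔤 (A.slice i s) j)) (i : Fin 3) :
    ∫⁻ s in Ioc (0 : ℝ) 1, derivNorm 2 (A.slice i s).fn ^ 2 < ⊤ := by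
  have hi : IntegrableOn (fun s => ∑ j, (2 * heatG1 (h i j).v s + duhG M s)) (Ioc 0 1) :=
    integrable_finsetSum _ fun j _ => (h i j).d1_integral.1
  refine lt_of_le_of_lt (lintegral_mono_ae ?_) hi.lintegral_lt_top
  filter_upwards [ae_restrict_mem measurableSet_Ioc] with s hs
  have h0 : ∀ j, 0 ≤ 2 * heatG1 (h i j).v s + duhG M s := fun j => by
    have := heatG1_nonneg (h i j).v s; have := HeatSplit.duhG_nonneg (M := M) hs.1.le; positivity
  have h1 : derivNorm 2 (A.slice i s).fn ≤
      ENNReal.ofReal √(∑ j, (2 * heatG1 (h i j).v s + duhG M s)) := by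
    refine derivNorm_le fun J => ⟨(h i (J 0)).d1 (J 1) s, ?_, Real.le_sqrt_of_sq_le ?_⟩
    · rw [List.ofFn_succ, List.ofFn_succ, List.ofFn_zero]
      exact HasWeakDeriv.append ((A.slice i s).2 (J 0)) ((h i (J 0)).weak_d1 (J 1) hs)
    · exact ((h i (J 0)).norm_d1_sq_le (J 1) hs).trans
        (Finset.single_le_sum (fun j _ => h0 j) (Finset.mem_univ (J 0)))
  refine (pow_le_pow_left' h1 2).trans (le_of_eq ?_)
  rw [← ENNReal.ofReal_pow (Real.sqrt_nonneg _), Real.sq_sqrt (Finset.sum_nonneg fun j _ => h0 j)]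

end Estimates

/-! ### Well-posedness and the a priori estimates -/

section WellPosed

variable {𝔤 : Type*} [InvariantLieAlgebra 𝔤] [FiniteDimensional ℝ 𝔤]

theorem IsMild.apply {a : Conn 𝔤} {A : ConnFlow 𝔤} (h : IsMild a A) (s : I) :
    A s = evo (wker gauss 0) a s + (s : ℝ) ^ (1 / 8 : ℝ) • duhN 0 A s := by
  conv_lhs => rw [h]
  rw [ContinuousMap.add_apply, duhamel_apply]; rfl

theorem IsMild.initial {a : Conn 𝔤} {A : ConnFlow 𝔤} (h : IsMild a A) : A 0 = a := by
  rw [h.apply, evo_apply, Set.Icc.coe_zero, Real.sqrt_zero, cv_zero_gauss,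
    Real.zero_rpow (by norm_num), zero_smul, add_zero]

theorem isMild_zero : IsMild (0 : Conn 𝔤) 0 := by
  unfold IsMild
  rw [nlC_zero, map_zero, map_zero, add_zero]

theorem IsDeTurckSolution.isMild {a : Conn 𝔤} {A : ConnFlow 𝔤} (h : IsDeTurckSolution a A) :
    IsMild a A :=
  (isWeak_iff.2 h.equation).isMild

/-- The Duhamel part divided by `s^{1/8}` is still smooth and covariant, so its parabolic
derivatives are bounded; this preserves the spare power that makes the square integrals converge. -/
theorem isParabolic_duhN {S : E3 × Conn 𝔤 → ConnFlow 𝔤} {δ : ℝ} (hδ : 0 < δ)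
    (hS : ContDiffOn ℝ ∞ S (Metric.ball 0 δ ×ˢ Metric.ball 0 δ))
    (htr : ∀ a ∈ Metric.ball (0 : Conn 𝔤) δ, ∀ h ∈ Metric.ball (0 : E3) δ,
      trC h (S (0, a)) = S (h, a)) : IsParabolic δ fun p => duhN p.1 (S p) where
  pos := hδ
  smooth := by
    have h := ContinuousLinearMap.contDiff (𝕜 := ℝ) (E := C(I, Fin 3 → Bd))
      (F := C(I, Fin 3 → Src 𝔤) →L[ℝ] ConnFlow 𝔤) (n := ∞) (duh smZ.pi)
    have h1 : ContDiffOn ℝ ∞ (fun p : E3 × Conn 𝔤 => (duh smZ.pi (kerC p.1) :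
        C(I, Fin 3 → Src 𝔤) →L[ℝ] ConnFlow 𝔤)) (Metric.ball 0 δ ×ˢ Metric.ball 0 δ) :=
      ((h.comp contDiff_kerC).comp contDiff_fst).contDiffOn
    exact h1.clm_apply (contDiff_nlC.comp_contDiffOn hS)
  tr a ha h hh := by
    rw [trC_duhN, htr a ha h hh]

variable (𝔤) in
/-- Well-posedness of the flow for small data. -/
theorem exists_solution : ∃ (S : Conn 𝔤 → ConnFlow 𝔤) (r C : ℝ), 0 < r ∧ 0 < C ∧
    ContDiffOn ℝ ∞ S (Metric.ball 0 r) ∧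
    (∀ a ∈ Metric.ball (0 : Conn 𝔤) r, IsDeTurckSolution a (S a)) ∧
    (∀ a ∈ Metric.ball (0 : Conn 𝔤) r, ∀ A, IsDeTurckSolution a A → A = S a) ∧
    (∀ a ∈ Metric.ball (0 : Conn 𝔤) r, gradPNorm (S a) ≤ ENNReal.ofReal (C * ‖a‖)) ∧
    (∀ a ∈ Metric.ball (0 : Conn 𝔤) r, ∀ a' ∈ Metric.ball (0 : Conn 𝔤) r,
      gradPNorm (S a - S a') ≤ ENNReal.ofReal (C * ‖a - a'‖)) := by
  obtain ⟨S, δ, hδ, hS, hmild, htr⟩ := exists_solution_map 𝔤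
  have hY := isParabolic_duhN hδ hS htr
  obtain ⟨K, r, hK, hr, hrδ, hlip⟩ := hY.exists_lipschitz
  have hsub : Metric.ball (0 : Conn 𝔤) r ⊆ Metric.ball 0 δ := Metric.ball_subset_ball hrδ.le
  have split : ∀ a ∈ Metric.ball (0 : Conn 𝔤) r, ∀ a' ∈ Metric.ball (0 : Conn 𝔤) r, ∀ i j,
      HeatSplit 𝔤 ((K + 1) * ‖a - a'‖)
        (fun s => HDot1.grad 𝔤 ((S (0, a) - S (0, a')).slice i s) j) :=
    fun a ha a' ha' i j => heatSplit hY hK (hsub ha) (hsub ha') (hlip a ha a' ha').1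
      (hlip a ha a' ha').2.1 (hlip a ha a' ha').2.2 (hmild a (hsub ha)).apply
      (hmild a' (hsub ha')).apply i j
  -- The zero curve solves with zero data, so the a priori bound is the difference estimate against
  -- `a' = 0`.
  have h0 : S (0, 0) = 0 :=
    (hmild 0 (Metric.mem_ball_self hδ)).unique isMild_zero
  have split0 : ∀ a ∈ Metric.ball (0 : Conn 𝔤) r, ∀ i j,
      HeatSplit 𝔤 ((K + 1) * ‖a‖) (fun s => HDot1.grad 𝔤 ((S (0, a)).slice i s) j) := by
    intro a ha i j
    have h := split a ha 0 (Metric.mem_ball_self hr) i j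
    rwa [h0, sub_zero, sub_zero] at h
  refine ⟨fun a => S (0, a), r, 4 * ((4 + 3 * heatC) * (K + 1)), hr, ?_, ?_, ?_, ?_, ?_, ?_⟩
  · have := heatC_nonneg; positivity
  · exact hS.comp (contDiff_const.prodMk contDiff_id).contDiffOn
      fun a ha => mk_mem_prod (Metric.mem_ball_self hδ) (hsub ha)
  · exact fun a ha => ⟨(hmild a (hsub ha)).initial, l2_hdot2_of_heatSplit (split0 a ha),
      isWeak_iff.1 (hmild a (hsub ha)).isWeak⟩
  · exact fun a ha A hA => hA.isMild.unique (hmild a (hsub ha))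
  · intro a ha
    refine (gradPNorm_le fun i j => ⟨split0 a ha i j⟩).trans (le_of_eq ?_)
    ring_nf
  · intro a ha a' ha'
    refine (gradPNorm_le fun i j => ⟨split a ha a' ha' i j⟩).trans (le_of_eq ?_)
    ring_nf

/-- Translates of mild solutions are mild solutions. -/
theorem IsMild.translate {a : Conn 𝔤} {A : ConnFlow 𝔤} (hA : IsMild a A) (h : E3) :
    IsMild (tr h a) (((tr h : Conn 𝔤 →L[ℝ] Conn 𝔤) : C(Conn 𝔤, Conn 𝔤)).comp A) := by
  unfold IsMild
  ext1 s
  rw [ContinuousMap.comp_apply, ContinuousMap.add_apply, evo_apply, duhamel_apply]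
  conv_lhs => rw [hA.apply]
  change tr h _ = _
  rw [map_add, map_smul, evo_apply, tr_cv, duhN, duh_apply, duh_apply,
    ← (tr h).integral_comp_comm (duhInt_integrable _ _ _ s.2)]
  congr 2
  refine setIntegral_congr_fun measurableSet_Ioo fun ρ hρ => ?_
  simp only [duhInt, map_smul]
  rcases s.2.1.eq_or_lt with h0 | h0
  · rw [← h0, Real.zero_rpow (by norm_num), zero_smul, zero_smul]
  congr 1
  have hl := (sqrt_mem_Ioc ⟨h0, s.2.2⟩ hρ).1
  rw [kerC_zero, ContinuousMap.const_apply, tr_smZ_pi hl, nlC_apply, nlC_apply, ← nl_tr]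
  rfl

end WellPosed

/-! ### Curves as primitives of their derivative in `s` -/

section Primitive

variable {V : Type*} [NormedAddCommGroup V] [NormedSpace ℝ V]

/-- Constant curves. -/
noncomputable def constC (V : Type*) [NormedAddCommGroup V] [NormedSpace ℝ V] : V →L[ℝ] C(I, V) :=
  LinearMap.mkContinuous
    { toFun := fun v => ContinuousMap.const I v
      map_add' := fun _ _ => rfl
      map_smul' := fun _ _ => rfl } 1 fun v => by
    rw [one_mul]
    exact (ContinuousMap.norm_le _ (norm_nonneg v)).2 fun _ => le_rfl

theorem constC_apply (v : V) (s : I) : constC V v s = v := rfl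

variable [CompleteSpace V]

/-- The primitive of a curve. -/
noncomputable def primC (V : Type*) [NormedAddCommGroup V] [NormedSpace ℝ V] [CompleteSpace V] :
    C(I, V) →L[ℝ] C(I, V) :=
  LinearMap.mkContinuous
    { toFun := fun d => ⟨fun s => ∫ r in (0 : ℝ)..s, d (projIcc 0 1 zero_le_one r),
        (continuous_iff_continuousAt.2 fun r => (hasDerivAt_primitive d r).continuousAt).comp
          continuous_subtype_val⟩
      map_add' := fun d d' => by
        ext1 s
        exact intervalIntegral.integral_add
          ((d.continuous.comp continuous_projIcc).intervalIntegrable _ _)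
          ((d'.continuous.comp continuous_projIcc).intervalIntegrable _ _)
      map_smul' := fun c d => by
        ext1 s
        exact intervalIntegral.integral_smul c _ } 1 fun d => by
    rw [one_mul]
    refine (ContinuousMap.norm_le _ (norm_nonneg d)).2 fun s => ?_
    refine (intervalIntegral.norm_integral_le_of_norm_le_const
      fun r _ => d.norm_coe_le_norm _).trans ?_
    rw [sub_zero, abs_of_nonneg s.2.1]
    exact mul_le_of_le_one_right (norm_nonneg _) s.2.2

theorem primC_apply (d : C(I, V)) (s : I) :
    primC V d s = ∫ r in (0 : ℝ)..s, d (projIcc 0 1 zero_le_one r) := rfl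

attribute [irreducible] primC constC

theorem hasDerivAt_of_primC (f p : C(I, V)) (r : ℝ) :
    HasDerivAt (fun r => f 0 + ∫ q in (0 : ℝ)..r, p (projIcc 0 1 zero_le_one q))
      (p (projIcc 0 1 zero_le_one r)) r :=
  (hasDerivAt_primitive p r).const_add _

theorem apply_of_primC {f p : C(I, V)} (h : f = constC V (f 0) + primC V p) {r : ℝ}
    (hr : r ∈ Icc (0 : ℝ) 1) : f (projIcc 0 1 zero_le_one r) =
      f 0 + ∫ q in (0 : ℝ)..r, p (projIcc 0 1 zero_le_one q) := by
  conv_lhs => rw [h]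
  rw [ContinuousMap.add_apply, constC_apply, primC_apply, projIcc_of_mem _ hr]

/-- The chain rule and the fundamental theorem of calculus, used on the extension of `f` by its
primitive, which is differentiable at the endpoints too. -/
theorem postcomp_primC {W : Type*} [NormedAddCommGroup W] [NormedSpace ℝ W] [CompleteSpace W]
    {N : V → W} (hN : ContDiff ℝ ∞ N) {f p : C(I, V)} {q : C(I, W)}
    (h : f = constC V (f 0) + primC V p) (hq : ∀ s, q s = fderiv ℝ N (f s) (p s)) :
    (⟨N, hN.continuous⟩ : C(V, W)).comp f = constC W (N (f 0)) + primC W q := by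
  ext1 s
  rw [ContinuousMap.add_apply, constC_apply, primC_apply]
  change N (f s) = _
  have hd : ∀ r ∈ uIcc (0 : ℝ) s, HasDerivAt
      (fun r => N (f 0 + ∫ q in (0 : ℝ)..r, p (projIcc 0 1 zero_le_one q)))
      (q (projIcc 0 1 zero_le_one r)) r := by
    intro r hr
    rw [uIcc_of_le s.2.1] at hr
    have hr' : r ∈ Icc (0 : ℝ) 1 := ⟨hr.1, hr.2.trans s.2.2⟩
    have h1 := ((hN.differentiable (by simp) _).hasFDerivAt).comp_hasDerivAt r
      (hasDerivAt_of_primC f p r)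
    rw [← apply_of_primC h hr', ← hq] at h1
    exact h1
  have h2 := intervalIntegral.integral_eq_sub_of_hasDerivAt hd
    ((q.continuous.comp continuous_projIcc).intervalIntegrable _ _)
  rw [intervalIntegral.integral_same, add_zero] at h2
  have h3 := apply_of_primC h s.2
  rw [projIcc_of_mem _ s.2] at h3
  rw [h2, ← h3]
  exact (add_sub_cancel _ _).symm

end Primitive

/-! ### Directional derivatives -/

section Directional

variable {X V : Type*} [NormedAddCommGroup X] [NormedSpace ℝ X] [NormedAddCommGroup V]
  [NormedSpace ℝ V]

/-- The derivative in the direction `v`. -/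
noncomputable def dX (v : X) (f : X → V) (x : X) : V := fderiv ℝ f x v

theorem contDiffOn_dX {U : Set X} (hU : IsOpen U) (v : X) {f : X → V} (hf : ContDiffOn ℝ ∞ f U) :
    ContDiffOn ℝ ∞ (dX v f) U :=
  (hf.fderiv_of_isOpen hU (m := ∞) (by simp)).clm_apply contDiffOn_const

end Directional

/-! ### Joint smoothness in the parameter and in `s` -/

section Smooth

universe u

variable {X : Type} [NormedAddCommGroup X] [NormedSpace ℝ X]

/-- `f : U → C([0,1], V)` is smooth and `n` times differentiable in `s` with smooth derivatives. -/
def TReg (U : Set X) : ∀ (_ : ℕ) {V : Type u} [NormedAddCommGroup V] [NormedSpace ℝ V]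
    [CompleteSpace V] (_ : X → C(I, V)), Prop
  | 0, _, _, _, _, f => ContDiffOn ℝ ∞ f U
  | n + 1, V, _, _, _, f => ContDiffOn ℝ ∞ f U ∧ ∃ p : X → C(I, V), TReg U n p ∧
      ∀ x ∈ U, f x = constC V (f x 0) + primC V (p x)

namespace TReg

variable {U : Set X} {V W : Type u} [NormedAddCommGroup V] [NormedSpace ℝ V] [CompleteSpace V]
  [NormedAddCommGroup W] [NormedSpace ℝ W] [CompleteSpace W]

theorem smooth {n : ℕ} {f : X → C(I, V)} (hf : TReg U n f) : ContDiffOn ℝ ∞ f U := by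
  cases n with
  | zero => exact hf
  | succ n => exact hf.1

theorem pred {n : ℕ} {f : X → C(I, V)} (hf : TReg U (n + 1) f) : TReg U n f := by
  induction n generalizing f with
  | zero => exact hf.1
  | succ n ih =>
    obtain ⟨h1, p, hp, h2⟩ := hf
    exact ⟨h1, p, ih hp, h2⟩

theorem prodMk {n : ℕ} {f : X → C(I, V)} {g : X → C(I, W)} (hf : TReg U n f) (hg : TReg U n g) :
    TReg U n fun x => (f x).prodMk (g x) := by
  have hs : ∀ {f : X → C(I, V)} {g : X → C(I, W)}, ContDiffOn ℝ ∞ f U → ContDiffOn ℝ ∞ g U →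
      ContDiffOn ℝ ∞ (fun x => (f x).prodMk (g x)) U := by
    intro f g hf hg
    have h1 := ((ContinuousLinearMap.inl ℝ V W).compLeftContinuous ℝ I).contDiff
      (n := ∞) |>.comp_contDiffOn hf
    have h2 := ((ContinuousLinearMap.inr ℝ V W).compLeftContinuous ℝ I).contDiff
      (n := ∞) |>.comp_contDiffOn hg
    refine (h1.add h2).congr fun x _ => ?_
    ext1 s
    exact Prod.ext (add_zero _).symm (zero_add _).symm
  induction n generalizing f g with
  | zero => exact hs hf hg
  | succ n ih =>
    obtain ⟨h1, p, hp, h2⟩ := hf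
    obtain ⟨h3, q, hq, h4⟩ := hg
    refine ⟨hs h1 h3, _, ih hp hq, fun x hx => ?_⟩
    ext1 s
    rw [ContinuousMap.add_apply, constC_apply, primC_apply]
    have e1 := congrArg (fun c : C(I, V) => c s) (h2 x hx)
    have e2 := congrArg (fun c : C(I, W) => c s) (h4 x hx)
    simp only [ContinuousMap.add_apply, constC_apply, primC_apply] at e1 e2
    refine Prod.ext (e1.trans ?_) (e2.trans ?_)
    · have := map_primitive (ContinuousLinearMap.fst ℝ V W) ((p x).prodMk (q x)) s
      rw [Prod.fst_add]
      exact congrArg _ this.symm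
    · have := map_primitive (ContinuousLinearMap.snd ℝ V W) ((p x).prodMk (q x)) s
      rw [Prod.snd_add]
      exact congrArg _ this.symm

theorem postcomp {n : ℕ} {V W : Type u} [NormedAddCommGroup V] [NormedSpace ℝ V] [CompleteSpace V]
    [NormedAddCommGroup W] [NormedSpace ℝ W] [CompleteSpace W] {f : X → C(I, V)}
    (hf : TReg U n f) {N : V → W} (hN : ContDiff ℝ ∞ N) :
    TReg U n fun x => (⟨N, hN.continuous⟩ : C(V, W)).comp (f x) := by
  induction n generalizing V W with
  | zero => exact (contDiff_postcomp hN).comp_contDiffOn hf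
  | succ n ih =>
    have hf' := hf.pred
    obtain ⟨h1, p, hp, h2⟩ := hf
    -- The `s`-derivative of `N ∘ f` is `(v, w) ↦ DN(v) w` applied to the pair of `f` and its
    -- derivative. The source space changes, which is why the induction ranges over all spaces.
    have hD : ContDiff ℝ ∞ fun v : V × V => fderiv ℝ N v.1 v.2 :=
      ((hN.fderiv_right (m := ∞) (by simp)).comp contDiff_fst).clm_apply contDiff_snd
    exact ⟨(contDiff_postcomp hN).comp_contDiffOn h1, _, ih (hf'.prodMk hp) hD,
      fun x hx => postcomp_primC hN (h2 x hx) fun s => rfl⟩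

theorem clm {n : ℕ} {f : X → C(I, V)} (hf : TReg U n f) (L : V →L[ℝ] W) :
    TReg U n fun x => (L : C(V, W)).comp (f x) :=
  hf.postcomp L.contDiff

theorem add {n : ℕ} {f g : X → C(I, V)} (hf : TReg U n f) (hg : TReg U n g) :
    TReg U n fun x => f x + g x :=
  (hf.prodMk hg).clm (ContinuousLinearMap.fst ℝ V V + ContinuousLinearMap.snd ℝ V V)

theorem sum_three {n : ℕ} {f : Fin 3 → X → C(I, V)} (hf : ∀ j, TReg U n (f j)) :
    TReg U n fun x => ∑ j, f j x := by
  simp only [Fin.sum_univ_three]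
  exact ((hf 0).add (hf 1)).add (hf 2)

/-- Taking constants and taking primitives are continuous linear operations, so they commute with
differentiation in the parameter. -/
theorem derivX (hU : IsOpen U) (v : X) {n : ℕ} {f : X → C(I, V)} (hf : TReg U n f) :
    TReg U n (YMHeat.dX v f) := by
  induction n generalizing f with
  | zero => exact contDiffOn_dX hU v hf
  | succ n ih =>
    obtain ⟨h1, p, hp, h2⟩ := hf
    refine ⟨contDiffOn_dX hU v h1, _, ih hp, fun x hx => ?_⟩
    have d1 : DifferentiableAt ℝ f x :=
      (h1.differentiableOn (by simp) x hx).differentiableAt (hU.mem_nhds hx)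
    have d2 : DifferentiableAt ℝ p x :=
      (hp.smooth.differentiableOn (by simp) x hx).differentiableAt (hU.mem_nhds hx)
    have d3 := (((constC V).comp (ContinuousMap.evalCLM ℝ (0 : I))).hasFDerivAt.comp x
      d1.hasFDerivAt).add ((primC V).hasFDerivAt.comp x d2.hasFDerivAt)
    have e : f =ᶠ[𝓝 x] ((constC V).comp (ContinuousMap.evalCLM ℝ (0 : I)) ∘ f + primC V ∘ p) :=
      eventually_of_mem (hU.mem_nhds hx) h2
    exact congrArg (fun L => L v) (e.fderiv_eq.trans d3.fderiv)

end TReg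

/-- A finite system of coordinates. -/
structure Coord (X : Type) [NormedAddCommGroup X] [NormedSpace ℝ X] (d : ℕ) where
  vec : Fin d → X
  form : Fin d → X →L[ℝ] ℝ
  sum_eq : ∀ x, x = ∑ m, form m x • vec m

variable {V : Type u} [NormedAddCommGroup V] [NormedSpace ℝ V] [CompleteSpace V]

theorem Coord.fderiv_eq {d : ℕ} (c : Coord X d) {W : Type*} [NormedAddCommGroup W]
    [NormedSpace ℝ W] (f : X → W) (x : X) :
    fderiv ℝ f x = ∑ m, (c.form m).smulRight (dX (c.vec m) f x) := by
  ext v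
  conv_lhs => rw [c.sum_eq v, map_sum]
  simp only [map_smul, sum_apply, ContinuousLinearMap.smulRight_apply]; rfl

/-- Write `f(y)(s') = (f(y) - f(x))(s') + f(x)(s')`. The first term is expanded uniformly in `s'`,
since `f` takes values in continuous curves with the supremum norm, and only the continuity in `s'`
of the partial derivatives is needed; the second term is a primitive. -/
theorem hasFDerivWithinAt_joint {d : ℕ} (c : Coord X d) {U : Set X} {f : X → C(I, V)}
    {p : C(I, V)} {x : X} (hf : DifferentiableAt ℝ f x) (hp : f x = constC V (f x 0) + primC V p)
    (hx : x ∈ U) {s : ℝ} (hs : s ∈ Icc (0 : ℝ) 1) :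
    HasFDerivWithinAt (fun y : X × ℝ => f y.1 (projIcc 0 1 zero_le_one y.2))
      ((∑ m, ((c.form m).comp (ContinuousLinearMap.fst ℝ X ℝ)).smulRight
        (dX (c.vec m) f x (projIcc 0 1 zero_le_one s))) +
        (ContinuousLinearMap.snd ℝ X ℝ).smulRight (p (projIcc 0 1 zero_le_one s)))
      (U ×ˢ Icc 0 1) (x, s) := by
  set P : ℝ → I := projIcc 0 1 zero_le_one with hP
  have h1 : HasFDerivAt (fun y : X × ℝ => f x 0 + ∫ q in (0 : ℝ)..y.2, p (P q))
      ((ContinuousLinearMap.snd ℝ X ℝ).smulRight (p (P s))) (x, s) := by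
    have := (hasDerivAt_of_primC (f x) p s).hasFDerivAt.comp (x, s)
      (hasFDerivAt_snd (𝕜 := ℝ) (E := X) (F := ℝ) (p := (x, s)))
    refine this.congr_fderiv ?_
    ext v <;> simp [hP]
  have h2 : HasFDerivAt (fun y : X × ℝ => f y.1 (P y.2) - f x (P y.2))
      (∑ m, ((c.form m).comp (ContinuousLinearMap.fst ℝ X ℝ)).smulRight
        (dX (c.vec m) f x (P s))) (x, s) := by
    rw [hasFDerivAt_iff_isLittleO]
    have i1 : (fun y : X × ℝ => f y.1 - f x - fderiv ℝ f x (y.1 - x)) =o[𝓝 (x, s)]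
        fun y => y - (x, s) := by
      have h3 := (hasFDerivAt_iff_isLittleO.1 hf.hasFDerivAt).comp_tendsto
        (continuous_fst.tendsto (x, s))
      refine h3.trans_isBigO (Asymptotics.isBigO_of_le _ fun y => ?_)
      exact norm_fst_le (y - (x, s))
    have i2 : ∀ m, (fun y : X × ℝ => c.form m (y.1 - x) •
        (dX (c.vec m) f x (P y.2) - dX (c.vec m) f x (P s))) =o[𝓝 (x, s)] fun y => y - (x, s) := by
      intro m
      have i3 : (fun y : X × ℝ => c.form m (y.1 - x)) =O[𝓝 (x, s)] fun y => y - (x, s) :=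
        ((c.form m).comp (ContinuousLinearMap.fst ℝ X ℝ)).isBigO_comp (fun y => y - (x, s)) _
      have i4 : (fun y : X × ℝ => dX (c.vec m) f x (P y.2) - dX (c.vec m) f x (P s)) =o[𝓝 (x, s)]
          fun _ => (1 : ℝ) := by
        rw [Asymptotics.isLittleO_one_iff]
        have hc : Continuous fun y : X × ℝ =>
            dX (c.vec m) f x (P y.2) - dX (c.vec m) f x (P s) :=
          ((dX (c.vec m) f x).continuous.comp (continuous_projIcc.comp continuous_snd)).sub
            continuous_const
        have := hc.tendsto (x, s)
        rwa [sub_self] at this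
      have := (i3.norm_right).smul_isLittleO i4
      simpa using this.norm_right
    have i3 : (fun y : X × ℝ => ∑ m, c.form m (y.1 - x) •
        (dX (c.vec m) f x (P y.2) - dX (c.vec m) f x (P s))) =o[𝓝 (x, s)] fun y => y - (x, s) :=
      Asymptotics.IsLittleO.fun_sum fun m _ => i2 m
    refine ((Asymptotics.IsBigO.trans_isLittleO (Asymptotics.isBigO_of_le _ fun y => ?_) i1).add
      i3).congr_left
      (f₁ := fun y => (f y.1 - f x - fderiv ℝ f x (y.1 - x)) (P y.2) +
        ∑ m, c.form m (y.1 - x) • (dX (c.vec m) f x (P y.2) - dX (c.vec m) f x (P s))) fun y => ?_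
    · exact ContinuousMap.norm_coe_le_norm _ _
    · rw [c.fderiv_eq f x]
      simp only [ContinuousMap.sub_apply, sum_apply, ContinuousLinearMap.smulRight_apply,
        ContinuousMap.sum_apply, ContinuousMap.smul_apply, smul_sub, Finset.sum_sub_distrib,
        ContinuousLinearMap.comp_apply, ContinuousLinearMap.coe_fst']
      abel
  refine ((h2.add h1).hasFDerivWithinAt).congr' (fun y hy => ?_) (mk_mem_prod hx hs)

  have := apply_of_primC hp hy.2
  change _ = f y.1 (P y.2) - f x (P y.2) + (f x 0 + ∫ q in (0 : ℝ)..y.2, p (P q))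
  rw [← this, sub_add_cancel]

/-- Joint smoothness. -/
theorem TReg.contDiffOn_joint {d : ℕ} (c : Coord X d) {U : Set X} (hU : IsOpen U) {n : ℕ}
    {f : X → C(I, V)} (hf : TReg U n f) :
    ContDiffOn ℝ n (fun y : X × ℝ => f y.1 (projIcc 0 1 zero_le_one y.2)) (U ×ˢ Icc 0 1) := by
  have hS : UniqueDiffOn ℝ (U ×ˢ Icc (0 : ℝ) 1) :=
    hU.uniqueDiffOn.prod (uniqueDiffOn_Icc zero_lt_one)
  induction n generalizing f with
  | zero =>
    refine contDiffOn_zero.2 ?_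
    have h1 : ContinuousOn (fun y : X × ℝ => (f y.1, projIcc (0 : ℝ) 1 zero_le_one y.2))
        (U ×ˢ Icc 0 1) :=
      (hf.smooth.continuousOn.comp continuousOn_fst fun y hy => hy.1).prodMk
        (continuous_projIcc.comp continuous_snd).continuousOn
    exact (ContinuousEval.continuous_eval (F := C(I, V))).comp_continuousOn h1
  | succ n ih =>
    have hf' := hf.pred
    obtain ⟨h1, p, hp, h2⟩ := hf
    have hg : ∀ y ∈ U ×ˢ Icc (0 : ℝ) 1, HasFDerivWithinAt
        (fun y : X × ℝ => f y.1 (projIcc 0 1 zero_le_one y.2)) _ (U ×ˢ Icc 0 1) y :=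
      fun y hy => hasFDerivWithinAt_joint c
        ((h1.differentiableOn (by simp) y.1 hy.1).differentiableAt (hU.mem_nhds hy.1))
        (h2 y.1 hy.1) hy.1 hy.2
    have e : ((n + 1 : ℕ) : WithTop ℕ∞) = (n : WithTop ℕ∞) + 1 := by push_cast; rfl
    rw [e, contDiffOn_succ_iff_fderivWithin hS]
    refine ⟨fun x hx => (hg x hx).differentiableWithinAt, by simp, ?_⟩
    have : ContDiffOn ℝ n (fun y : X × ℝ =>
        (∑ m, ((c.form m).comp (ContinuousLinearMap.fst ℝ X ℝ)).smulRight
          (dX (c.vec m) f y.1 (projIcc 0 1 zero_le_one y.2))) +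
          (ContinuousLinearMap.snd ℝ X ℝ).smulRight (p y.1 (projIcc 0 1 zero_le_one y.2)))
        (U ×ˢ Icc 0 1) := by
      refine ContDiffOn.add (ContDiffOn.sum fun m _ => ?_) ?_
      · exact (ContinuousLinearMap.smulRightL ℝ (X × ℝ) V _).contDiff.comp_contDiffOn
          (ih (hf'.derivX hU _))
      · exact (ContinuousLinearMap.smulRightL ℝ (X × ℝ) V _).contDiff.comp_contDiffOn (ih hp)
    exact this.congr fun x hx => (hg x hx).fderivWithin (hS x hx)

end Smooth

/-! ### Translation-covariant families and the Laplacian -/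

section Covariant

variable {T : Type} [NormedAddCommGroup T] [NormedSpace ℝ T] {V W : Type*}
  [NormedAddCommGroup V] [NormedSpace ℝ V] [TransRep V]
  [NormedAddCommGroup W] [NormedSpace ℝ W] [TransRep W]

variable (T) in
/-- The spatial directions. -/
noncomputable def dirE (j : Fin 3) : E3 × T := (ej j, 0)

/-- Families of curves that are covariant under translations. -/
def Cov (S : Set T) (f : E3 × T → C(I, V)) : Prop :=
  ∀ h k : E3, ∀ t ∈ S, ∀ s, f (h + k, t) s = tr k (f (h, t) s)

/-- Varying the base point translates the vector, so parameter derivatives in the spatial directions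
are derivatives in the sense of translations. -/
theorem Cov.hasTD {S : Set T} {f : E3 × T → C(I, V)} (hf : Cov S f) {x : E3 × T} (hx : x.2 ∈ S)
    (hd : DifferentiableAt ℝ f x) (s : I) : HasTD (f x s) fun j => dX (dirE T j) f x s := by
  refine HasTD.of_zero ?_
  have e : (fun k => tr k (f x s)) =
      (ContinuousMap.evalCLM ℝ s) ∘ f ∘ fun k : E3 => x + ContinuousLinearMap.inl ℝ E3 T k := by
    funext k
    have : x + ContinuousLinearMap.inl ℝ E3 T k = (x.1 + k, x.2) := by
      ext <;> simp
    simp only [Function.comp_apply, ContinuousMap.evalCLM_apply, this]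
    exact (hf _ _ _ hx s).symm
  have h1 : HasFDerivAt (fun k : E3 => x + ContinuousLinearMap.inl ℝ E3 T k)
      (ContinuousLinearMap.inl ℝ E3 T) 0 :=
    (ContinuousLinearMap.inl ℝ E3 T).hasFDerivAt.const_add x
  have h2 : HasFDerivAt f (fderiv ℝ f x) (x + ContinuousLinearMap.inl ℝ E3 T 0) := by
    rw [map_zero, add_zero]; exact hd.hasFDerivAt
  rw [e]
  refine ((ContinuousMap.evalCLM ℝ s).hasFDerivAt.comp (0 : E3)
    (h2.comp (0 : E3) h1)).congr_fderiv ?_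
  ext v
  conv_lhs => rw [E3.sum_coord v, map_sum]
  simp only [map_smul, sum_apply, ContinuousLinearMap.smulRight_apply, PiLp.proj_apply]
  rfl

theorem Cov.dX {S : Set T} (hS : IsOpen S) {f : E3 × T → C(I, V)} (hf : Cov S f)
    (hd : DifferentiableOn ℝ f (univ ×ˢ S)) (v : E3 × T) : Cov S (dX v f) := by
  intro h k t ht s
  have hU : IsOpen ((univ : Set E3) ×ˢ S) := isOpen_univ.prod hS
  have hx : (h, t) ∈ (univ : Set E3) ×ˢ S := mk_mem_prod (mem_univ _) ht
  have e : (fun y => f (y + (k, 0))) =ᶠ[𝓝 (h, t)]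
      (tr k : V →L[ℝ] V).compLeftContinuous ℝ I ∘ f := by
    refine eventually_of_mem (hU.mem_nhds hx) fun y hy => ?_
    ext1 s
    have : y + ((k, 0) : E3 × T) = (y.1 + k, y.2) := by ext <;> simp
    simp only [this]
    exact hf _ _ _ hy.2 s
  have h1 := e.fderiv_eq (𝕜 := ℝ)
  rw [fderiv_comp_add_right] at h1
  have h2 := ((tr k : V →L[ℝ] V).compLeftContinuous ℝ I).hasFDerivAt.comp (h, t)
    ((hd _ hx).differentiableAt (hU.mem_nhds hx)).hasFDerivAt
  rw [h2.fderiv] at h1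
  have e2 : ((h, t) : E3 × T) + (k, 0) = (h + k, t) := by ext <;> simp
  rw [e2] at h1
  exact congrArg (fun L : E3 × T →L[ℝ] C(I, V) => L v s) h1

theorem Cov.map {S : Set T} {f : E3 × T → C(I, V)} (hf : Cov S f) (N : C(V, W))
    (hN : ∀ k u, N (tr k u) = tr k (N u)) : Cov S fun x => N.comp (f x) := by
  intro h k t ht s
  rw [ContinuousMap.comp_apply, hf h k t ht s, hN]; rfl

/-- The Laplacian with respect to translations. -/
noncomputable def lapX (f : E3 × T → C(I, V)) (x : E3 × T) : C(I, V) :=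
  ∑ j, dX (dirE T j) (YMHeat.dX (dirE T j) f) x

/-- `μ' = μ ∘ Δ`. -/
def IsLap {F : Type*} [NormedAddCommGroup F] [NormedSpace ℝ F] (μ μ' : V →L[ℝ] F) : Prop :=
  ∀ (v : V) (g : Fin 3 → V) (g' : Fin 3 → Fin 3 → V), HasTD v g → (∀ j, HasTD (g j) (g' j)) →
    μ' v = ∑ j, μ (g' j j)

theorem IsLap.comp {F : Type*} [NormedAddCommGroup F] [NormedSpace ℝ F] {μ μ' : W →L[ℝ] F}
    (h : IsLap μ μ') (Λ : V →L[ℝ] W) (hΛ : ∀ k u, Λ (tr k u) = tr k (Λ u)) :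
    IsLap (μ.comp Λ) (μ'.comp Λ) := fun v g g' h1 h2 =>
  h (Λ v) (fun j => Λ (g j)) (fun j k => Λ (g' j k)) (h1.map Λ hΛ) fun j => (h2 j).map Λ hΛ

theorem IsLap.add {F : Type*} [NormedAddCommGroup F] [NormedSpace ℝ F] {μ μ' τ τ' : V →L[ℝ] F}
    (h : IsLap μ μ') (h' : IsLap τ τ') : IsLap (μ + τ) (μ' + τ') := fun v g g' h1 h2 => by
  simp only [add_apply, Finset.sum_add_distrib, h v g g' h1 h2, h' v g g' h1 h2]

variable [CompleteSpace V] [CompleteSpace W]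

theorem IsLap.isLapPair {F : Type*} [NormedAddCommGroup F] [NormedSpace ℝ F] {μ μ' : V →L[ℝ] F}
    (h : IsLap μ μ') : IsLapPair μ μ' := by
  intro l k v hl
  rw [h _ _ _ (hasTD_cv hl.ne' k v) fun j => (hasTD_cv hl.ne' (∂_{ej j} k) v).smul (-l⁻¹),
    cv_slap, map_sum, Finset.smul_sum]
  refine Finset.sum_congr rfl fun j _ => ?_
  simp only [Pi.smul_apply, map_smul, smul_smul]
  congr 1
  rw [neg_mul_neg, sq, mul_inv]

theorem IsLap.apply_cv {F : Type*} [NormedAddCommGroup F] [NormedSpace ℝ F] {μ μ' : V →L[ℝ] F}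
    (hμ : IsLap μ μ') {v : V} {g : Fin 3 → V} {g' : Fin 3 → Fin 3 → V} (h : HasTD v g)
    (h' : ∀ j, HasTD (g j) (g' j)) (l : ℝ) (b : Bd) :
    μ' (cv l b v) = μ (cv l b (∑ j, g' j j)) := by
  have ht : ∀ k (u : V), cv l b (tr k u) = tr k (cv l b u) := fun k u => (tr_cv _ _ _ _).symm
  rw [hμ _ _ _ (h.map _ ht) fun j => (h' j).map _ ht, map_sum, map_sum]

/-- `v = e^{Δ} v - ∫_0^1 e^{(1-q)Δ} Δv dq` after applying `μ`. It expresses `v` through averages of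
`v` and `Δv`, which are smoother than the vectors themselves. -/
theorem IsLap.heat_one {F : Type*} [NormedAddCommGroup F] [NormedSpace ℝ F] [CompleteSpace F]
    {μ μ' : V →L[ℝ] F} (hμ : IsLap μ μ') {v : V} {g : Fin 3 → V} {g' : Fin 3 → Fin 3 → V}
    (h : HasTD v g) (h' : ∀ j, HasTD (g j) (g' j)) :
    ∫ q in Ioo (0 : ℝ) 1, μ (cv √(1 - q) (wker gauss 0) (∑ j, g' j j)) =
      μ (cv 1 (wker gauss 0) v) - μ v := by
  have h1 := hμ.isLapPair.heat v (s := 1) ⟨zero_le_one, le_rfl⟩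
  have e4 := intervalIntegral.integral_comp_sub_left (a := 0) (b := 1)
    (fun r => μ' (cv √r (wker gauss 0) v)) 1
  rw [sub_self, sub_zero] at e4
  rw [Real.sqrt_one, ← e4, intervalIntegral.integral_of_le zero_le_one,
    integral_Ioc_eq_integral_Ioo] at h1
  rw [h1]
  exact setIntegral_congr_fun measurableSet_Ioo fun q _ => (hμ.apply_cv h h' _ _).symm

end Covariant

/-! ### From the weak equation to an equation in the solution space -/

section Strong

universe u

/-- The data relating the weak and the strong form of the heat equation in `V` with source terms
in `W`. -/
structure HeatPair (V W F B : Type*) [NormedAddCommGroup V] [NormedSpace ℝ V]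
    [TransRep V] [NormedAddCommGroup W] [NormedSpace ℝ W] [CompleteSpace W] [TransRep W]
    [NormedAddCommGroup F] [NormedSpace ℝ F] [NormedAddCommGroup B] [NormedSpace ℝ B] where
  ι : Type
  Λ : ι → V →L[ℝ] F
  Λ' : ι → V →L[ℝ] F
  μ : ι → W →L[ℝ] F
  μ' : ι → W →L[ℝ] F
  Q : SmoothingFamily B W V
  b : B
  sep : ∀ v v', (∀ i, Λ i v = Λ i v') → v = v'
  isLap : ∀ i, IsLap (Λ i) (Λ' i)
  isLap_source : ∀ i, IsLap (μ i) (μ' i)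
  spec : ∀ i l w, 0 < l → Λ i (Q.op l b w) = μ i (cv l (wker gauss 0) w)

namespace HeatPair

variable {V W F B : Type u} [NormedAddCommGroup V] [NormedSpace ℝ V] [CompleteSpace V]
  [TransRep V] [NormedAddCommGroup W] [NormedSpace ℝ W] [CompleteSpace W] [TransRep W]
  [NormedAddCommGroup F] [NormedSpace ℝ F] [CompleteSpace F]
  {B : Type*} [NormedAddCommGroup B] [NormedSpace ℝ B] (H : HeatPair V W F B)

/-- The element of `V` represented by `w`, in terms of `w` and `Δ w`. -/
noncomputable def recon : W × W →L[ℝ] V :=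
  (H.Q.op 1 H.b).comp (ContinuousLinearMap.fst ℝ W W) -
    (((ContinuousMap.evalCLM ℝ (1 : I)).comp (duhamel H.Q (ContinuousMap.const I H.b))).comp
      (constC W)).comp (ContinuousLinearMap.snd ℝ W W)

theorem recon_spec {w : W} {g : Fin 3 → W} {g' : Fin 3 → Fin 3 → W} (h : HasTD w g)
    (h' : ∀ j, HasTD (g j) (g' j)) (i : H.ι) : H.Λ i (H.recon (w, ∑ j, g' j j)) = H.μ i w := by
  have e1 : H.recon (w, ∑ j, g' j j) = H.Q.op 1 H.b w -
      duhamel H.Q (ContinuousMap.const I H.b) (constC W (∑ j, g' j j)) 1 := rfl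
  rw [e1, map_sub, H.spec i 1 w one_pos, map_duhamel_const, Set.Icc.coe_one,
    intervalIntegral.integral_of_le zero_le_one, integral_Ioc_eq_integral_Ioo]
  have e3 : ∫ q in Ioo (0 : ℝ) 1, H.Λ i (H.Q.op √(1 - q) H.b
      (constC W (∑ j, g' j j) (projIcc 0 1 zero_le_one q))) =
      ∫ q in Ioo (0 : ℝ) 1, H.μ i (cv √(1 - q) (wker gauss 0) (∑ j, g' j j)) := by
    refine setIntegral_congr_fun measurableSet_Ioo fun q hq => ?_
    simp only [constC_apply]
    exact H.spec _ _ _ (Real.sqrt_pos.2 (by linarith [hq.2]))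
  rw [e3, (H.isLap_source i).heat_one h h', sub_sub_cancel]

variable {T : Type} [NormedAddCommGroup T] [NormedSpace ℝ T] {S : Set T}

theorem strong (hS : IsOpen S) {f : E3 × T → C(I, V)} {w : E3 × T → C(I, W)}
    (hf : ContDiffOn ℝ ∞ f (univ ×ˢ S)) (hw : ContDiffOn ℝ ∞ w (univ ×ˢ S)) (cf : Cov S f)
    (cw : Cov S w) (h : ∀ x ∈ (univ : Set E3) ×ˢ S, ∀ i (s : I),
      H.Λ i (f x s) - H.Λ i (f x 0) = ∫ r in (0 : ℝ)..s,
        (H.Λ' i (f x (projIcc 0 1 zero_le_one r)) + H.μ i (w x (projIcc 0 1 zero_le_one r))))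
    {x : E3 × T} (hx : x ∈ (univ : Set E3) ×ˢ S) : f x = constC V (f x 0) +
      primC V (lapX f x + (H.recon : C(W × W, V)).comp ((w x).prodMk (lapX w x))) := by
  have hU : IsOpen ((univ : Set E3) ×ˢ S) := isOpen_univ.prod hS
  have hd : ∀ {V' : Type u} [NormedAddCommGroup V'] [NormedSpace ℝ V'] {f : E3 × T → C(I, V')},
      ContDiffOn ℝ ∞ f (univ ×ˢ S) → DifferentiableOn ℝ f (univ ×ˢ S) :=
    fun hf => hf.differentiableOn (by simp)
  have td : ∀ {V' : Type u} [NormedAddCommGroup V'] [NormedSpace ℝ V'] [TransRep V']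
      {f : E3 × T → C(I, V')}, ContDiffOn ℝ ∞ f (univ ×ˢ S) → Cov S f → ∀ s,
      HasTD (f x s) (fun j => dX (dirE T j) f x s) ∧
      ∀ j, HasTD (dX (dirE T j) f x s) fun k => dX (dirE T k) (dX (dirE T j) f) x s := by
    intro V' _ _ _ f hf cf s
    exact ⟨cf.hasTD hx.2 ((hd hf x hx).differentiableAt (hU.mem_nhds hx)) s, fun j =>
      (cf.dX hS (hd hf) _).hasTD hx.2
        ((hd (contDiffOn_dX hU _ hf) x hx).differentiableAt (hU.mem_nhds hx)) s⟩
  ext1 s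
  refine H.sep _ _ fun i => ?_
  rw [ContinuousMap.add_apply, constC_apply, primC_apply, map_add, map_primitive, ← sub_eq_iff_eq_add',
    h x hx i s]
  refine intervalIntegral.integral_congr fun r _ => ?_
  have h1 := td hf cf (projIcc 0 1 zero_le_one r)
  have h2 := td hw cw (projIcc 0 1 zero_le_one r)
  have h3 := H.recon_spec h2.1 h2.2 i
  have h4 := H.isLap i _ _ _ h1.1 h1.2
  rw [h4, ← h3, ContinuousMap.add_apply, map_add]
  congr 1
  · rw [lapX, ContinuousMap.sum_apply, map_sum]

theorem treg_succ (hS : IsOpen S) {f : E3 × T → C(I, V)} {w : E3 × T → C(I, W)} {n : ℕ}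
    (hf : TReg (univ ×ˢ S) n f) (hw : TReg (univ ×ˢ S) n w) (cf : Cov S f)
    (cw : Cov S w) (h : ∀ x ∈ (univ : Set E3) ×ˢ S, ∀ i (s : I),
      H.Λ i (f x s) - H.Λ i (f x 0) = ∫ r in (0 : ℝ)..s,
        (H.Λ' i (f x (projIcc 0 1 zero_le_one r)) + H.μ i (w x (projIcc 0 1 zero_le_one r)))) :
    TReg (univ ×ˢ S) (n + 1) f := by
  have hU : IsOpen ((univ : Set E3) ×ˢ S) := isOpen_univ.prod hS
  refine ⟨hf.smooth, _, ?_, fun x hx => H.strong hS hf.smooth hw.smooth cf cw h hx⟩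
  refine TReg.add (TReg.sum_three fun j => (hf.derivX hU _).derivX hU _) ?_
  exact (hw.prodMk (TReg.sum_three fun j => (hw.derivX hU _).derivX hU _)).clm H.recon

end HeatPair

end Strong

/-! ### Test functions and the Laplacian of translations -/

section Pairings

variable {F : Type*} [NormedAddCommGroup F] [InnerProductSpace ℝ F] [FiniteDimensional ℝ F]
  {p : ℝ≥0∞} [Fact (1 ≤ p)] [Fact (p ≠ ⊤)]

theorem isLap_pr (φ : Test) :
    IsLap (pr φ : Lp F p (volume : Measure E3) →L[ℝ] F) (pr φ.lap) := by
  intro u g g' h h'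
  rw [pr_lap]
  refine Finset.sum_congr rfl fun j _ => ?_
  have h1 := hasWeakDeriv_iff.1 (h.hasWeakDeriv j) (φ.pd j)
  have h2 := hasWeakDeriv_iff.1 ((h' j).hasWeakDeriv j) φ
  exact (neg_eq_iff_eq_neg.2 h1).symm.trans h2.symm

theorem isLap_prS (φ : Test) : IsLap (prS φ : Src F →L[ℝ] F) (prS φ.lap) :=
  ((isLap_pr φ).comp (ContinuousLinearMap.fst ℝ (V32 F) (V2 F)) fun _ _ => rfl).add
    ((isLap_pr φ).comp (ContinuousLinearMap.snd ℝ (V32 F) (V2 F)) fun _ _ => rfl)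

end Pairings

attribute [local irreducible] cvEval

/-! ### Point evaluation on twice differentiable elements of `L⁶` -/

section Evaluation

variable {F : Type*} [NormedAddCommGroup F] [InnerProductSpace ℝ F] [FiniteDimensional ℝ F]

/-- The point evaluations of averages as a smoothing family. -/
noncomputable def smEv : SmoothingFamily Bd (V6 F) F where
  op := cvEval
  const := (wtMass ^ (5 / 6 : ℝ)).toReal
  const_nonneg := ENNReal.toReal_nonneg
  bound l hl b u := by
    rw [cvEval_apply hl.1]
    refine (norm_cvf_le hl.1 b u 0).trans ?_
    have h := rpow_half_le hl
    gcongr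
  cont := continuousOn_cvEval

/-- The value at the origin of `u ∈ L⁶`, in terms of `u` and `Δ u`. -/
noncomputable def evPt (F : Type*) [NormedAddCommGroup F] [InnerProductSpace ℝ F]
    [FiniteDimensional ℝ F] : V6 F × V6 F →L[ℝ] F :=
  (cvEval 1 (wker gauss 0)).comp (ContinuousLinearMap.fst ℝ (V6 F) (V6 F)) -
    (((ContinuousMap.evalCLM ℝ (1 : I)).comp
      (duhamel smEv (ContinuousMap.const I (wker gauss 0)))).comp (constC (V6 F))).comp
        (ContinuousLinearMap.snd ℝ (V6 F) (V6 F))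

theorem evPt_apply (u u' : V6 F) : evPt F (u, u') = cvEval 1 (wker gauss 0) u -
    ∫ q in Ioo (0 : ℝ) 1, cvEval √(1 - q) (wker gauss 0) u' := by
  have e1 : evPt F (u, u') = cvEval 1 (wker gauss 0) u -
      duhamel smEv (ContinuousMap.const I (wker gauss 0)) (constC (V6 F) u') 1 := rfl
  have h := map_duhamel_const smEv (wker gauss 0) (constC (V6 F) u') (ContinuousLinearMap.id ℝ F) 1
  rw [Set.Icc.coe_one, intervalIntegral.integral_of_le zero_le_one,
    integral_Ioc_eq_integral_Ioo] at h
  simp only [constC_apply, ContinuousLinearMap.id_apply] at h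
  rw [e1, h]; rfl

/-- The singularity `(1 - q)^{-3/4}` from the smoothing bound is integrable and `φ` has compact
support; this is the hypothesis of Fubini. -/
theorem integrable_eval (φ : Test) (u : V6 F) : Integrable (fun y : E3 × ℝ =>
    φ y.1 • cvEval √(1 - y.2) (wker gauss 0) (tr y.1 u))
      (volume.prod (volume.restrict (Ioo 0 1))) := by
  have hl : ∀ q ∈ Ioo (0 : ℝ) 1, √(1 - q) ∈ Ioc (0 : ℝ) 1 := fun q hq =>
    ⟨Real.sqrt_pos.2 (by linarith [hq.2]), Real.sqrt_le_one.2 (by linarith [hq.1])⟩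
  have hb := ((φ.continuous.integrable_of_hasCompactSupport (μ := volume) φ.2.2).norm).mul_prod
    (integrable_singular.const_mul ((smEv (F := F)).const * ‖wker gauss 0‖ * ‖u‖))
  have hr : (volume : Measure E3).prod ((volume : Measure ℝ).restrict (Ioo 0 1)) =
      (volume.prod volume).restrict (univ ×ˢ Ioo 0 1) := by
    rw [← Measure.prod_restrict, Measure.restrict_univ]
  have hm : MeasurableSet ((univ : Set E3) ×ˢ Ioo (0 : ℝ) 1) := MeasurableSet.univ.prod measurableSet_Ioo
  refine hb.mono' ?_ ?_
  · rw [hr]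
    refine ContinuousOn.aestronglyMeasurable ?_ hm
    refine (φ.continuous.comp continuous_fst).continuousOn.smul ?_
    have h1 := smEv (F := F).continuousOn.comp
      (f := fun y : E3 × ℝ => (√(1 - y.2), wker gauss 0, tr y.1 u)) (s := univ ×ˢ Ioo 0 1)
      (Continuous.continuousOn (Continuous.prodMk (by fun_prop)
        (continuous_const.prodMk ((continuous_tr u).comp continuous_fst))))
      fun y hy => ⟨hl y.2 hy.2, mem_univ _⟩
    exact h1
  · rw [hr]
    filter_upwards [ae_restrict_mem hm] with y hy
    rw [norm_smul]
    refine mul_le_mul_of_nonneg_left ?_ (norm_nonneg _)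
    have h1 := smEv.bound _ (hl y.2 hy.2) (wker gauss 0) (tr y.1 u)
    have e : √(1 - y.2) ^ (-(3 / 2) : ℝ) = (1 - y.2) ^ (-(3 / 4) : ℝ) := by
      rw [Real.sqrt_eq_rpow, ← Real.rpow_mul (by linarith [hy.2.2])]; norm_num
    rw [norm_tr, e] at h1
    refine h1.trans (le_of_eq ?_)
    ring

theorem pr_eval (φ : Test) {l : ℝ} (hl : 0 < l) (u : V6 F) :
    ∫ x, φ x • cvEval l (wker gauss 0) (tr x u) = pr φ (cv l (wker gauss 0) u) := by
  rw [pr_apply]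
  refine integral_congr_ae ((coeFn_cv l (wker gauss 0) u).mono fun x hx => ?_)
  simp only [cvEval_tr hl, hx]

theorem continuous_evPt (u u' : V6 F) : Continuous fun x => evPt F (tr x u, tr x u') :=
  (evPt F).continuous.comp ((continuous_tr u).prodMk (continuous_tr u'))

theorem integral_eval_swap (φ : Test) (u : V6 F) :
    ∫ x, ∫ q in Ioo (0 : ℝ) 1, φ x • cvEval √(1 - q) (wker gauss 0) (tr x u) =
      ∫ q in Ioo (0 : ℝ) 1, pr φ (cv √(1 - q) (wker gauss 0) u) := by
  have sw := integral_integral_swap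
    (f := fun x q => φ x • cvEval √(1 - q) (wker gauss 0) (tr x u)) (integrable_eval φ u)
  refine sw.trans (setIntegral_congr_fun measurableSet_Ioo fun q hq => ?_)
  exact pr_eval φ (Real.sqrt_pos.2 (by linarith [hq.2])) u

/-- Twice differentiable elements of `L⁶` are represented by continuous functions. -/
theorem coeFn_eq_evPt {u : V6 F} {g : Fin 3 → V6 F} {g' : Fin 3 → Fin 3 → V6 F} (h : HasTD u g)
    (h' : ∀ j, HasTD (g j) (g' j)) :
    (u : E3 → F) =ᵐ[volume] fun x => evPt F (tr x u, tr x (∑ j, g' j j)) := by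
  have hone := fun φ : Test => (isLap_pr φ).heat_one h h'
  generalize ∑ j, g' j j = u' at hone ⊢
  refine EventuallyEq.symm (ae_eq_of_integral_contDiff_smul_eq
    (continuous_evPt u u').locallyIntegrable (Lp.locallyIntegrable' u) fun φ hφ hc => ?_)
  -- The continuous candidate is tested against `φ`; Fubini turns its two parts into the two sides
  -- of `IsLap.heat_one`, and their difference is the pairing with `u`.
  have key : ∀ φ : Test, ∫ x, φ x • evPt F (tr x u, tr x u') = pr φ u := by
    intro φ
    have hi := integrable_eval φ u'
    have i1 : Integrable fun x => φ x • cvEval 1 (wker gauss 0) (tr x u) :=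
      (φ.continuous.smul ((cvEval 1 (wker gauss 0)).continuous.comp
        (continuous_tr u))).integrable_of_hasCompactSupport φ.2.2.smul_right
    have i2 := hi.integral_prod_left
    have e1 : ∀ x, φ x • evPt F (tr x u, tr x u') = φ x • cvEval 1 (wker gauss 0) (tr x u) -
        ∫ q in Ioo (0 : ℝ) 1, φ x • cvEval √(1 - q) (wker gauss 0) (tr x u') := fun x => by
      rw [evPt_apply, smul_sub, integral_smul]
    have e3 := (integral_eval_swap φ u').trans (hone φ)
    have e4 := (integral_congr_ae (Eventually.of_forall e1)).trans (integral_sub i1 i2)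
    have e5 := pr_eval φ one_pos u
    exact e4.trans ((congrArg₂ (· - ·) e5 e3).trans (sub_sub_cancel _ _))
  have := key (Test.mk φ hφ hc)
  rw [pr_apply] at this
  exact this

end Evaluation

/-! ### Iterated spatial derivatives of covariant families -/

section Iterated

variable {T : Type} [NormedAddCommGroup T] [NormedSpace ℝ T]
  {F : Type*} [NormedAddCommGroup F] [InnerProductSpace ℝ F] [FiniteDimensional ℝ F]

/-- Iterated spatial derivatives. -/
noncomputable def iterX {V : Type*} [NormedAddCommGroup V] [NormedSpace ℝ V] (J : List (Fin 3))
    (f : E3 × T → C(I, V)) : E3 × T → C(I, V) :=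
  J.foldl (fun g j => dX (dirE T j) g) f

theorem iterX_append {V : Type*} [NormedAddCommGroup V] [NormedSpace ℝ V] (J : List (Fin 3))
    (j : Fin 3) (f : E3 × T → C(I, V)) : iterX (J ++ [j]) f = dX (dirE T j) (iterX J f) := by
  simp [iterX]

theorem iterX_spec {S : Set T} (hS : IsOpen S) {f : E3 × T → C(I, V2 F)}
    (cf : Cov S f) (J : List (Fin 3)) {k : ℕ}
    (hf : ContDiffOn ℝ (J.length + k : ℕ) f (univ ×ˢ S)) :
    ContDiffOn ℝ k (iterX J f) (univ ×ˢ S) ∧ Cov S (iterX J f) ∧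
      ∀ x ∈ (univ : Set E3) ×ˢ S, ∀ s, HasWeakDeriv J (f x s) (iterX J f x s) := by
  have hU : IsOpen ((univ : Set E3) ×ˢ S) := isOpen_univ.prod hS
  induction J using List.reverseRecOn generalizing k with
  | nil =>
    rw [List.length_nil, zero_add] at hf
    exact ⟨hf, cf, fun x _ s => hasWeakDeriv_nil _⟩
  | append_singleton J j ih =>
    have e : (J ++ [j]).length + k = J.length + (k + 1) := by simp; omega
    rw [e] at hf
    obtain ⟨h1, h2, h3⟩ := ih hf
    have hd : DifferentiableOn ℝ (iterX J f) (univ ×ˢ S) := h1.differentiableOn (by simp)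
    rw [iterX_append]
    refine ⟨(h1.fderiv_of_isOpen hU (m := k) (by simp)).clm_apply contDiffOn_const,
      h2.dX hS hd _, fun x hx s => (h3 x hx s).append ?_⟩
    exact (h2.hasTD hx.2 ((hd x hx).differentiableAt (hU.mem_nhds hx)) s).hasWeakDeriv j

theorem TReg.iterX {V : Type*} [NormedAddCommGroup V] [NormedSpace ℝ V] [CompleteSpace V]
    {S : Set T} (hS : IsOpen S) {n : ℕ} {f : E3 × T → C(I, V)} (hf : TReg (univ ×ˢ S) n f)
    (J : List (Fin 3)) : TReg (univ ×ˢ S) n (iterX J f) := by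
  induction J using List.reverseRecOn with
  | nil => exact hf
  | append_singleton J j ih =>
    rw [iterX_append]
    exact ih.derivX (isOpen_univ.prod hS) _

end Iterated

/-! ### Sobolev regularity as differentiability of translations -/

section MemH

variable {F : Type*} [NormedAddCommGroup F] [InnerProductSpace ℝ F] [FiniteDimensional ℝ F]

/-- Iterated derivatives of a test function. -/
noncomputable def Test.iter (J : List (Fin 3)) (φ : Test) : Test := J.foldr Test.pd φ

theorem Test.iter_coe (J : List (Fin 3)) (φ : Test) : (φ.iter J : E3 → ℝ) = iterPd J φ := by
  induction J with
  | nil => rfl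
  | cons j J ih =>
    change YMHeat.pd j (φ.iter J) = YMHeat.pd j (iterPd J φ)
    rw [ih]

theorem hasWeakDeriv_iff_iter {J : List (Fin 3)} {u v : V2 F} : HasWeakDeriv J u v ↔
    ∀ φ : Test, pr (φ.iter J) u = (-1 : ℝ) ^ J.length • pr φ v := by
  simp only [pr_apply, Test.iter_coe]
  exact ⟨fun h φ => h.2.2 φ φ.2.1 φ.2.2, fun h => ⟨Lp.locallyIntegrable' u, Lp.locallyIntegrable' v,
    fun φ hφ hc => h (Test.mk φ hφ hc)⟩⟩

theorem HasWeakDeriv.of_cons {j : Fin 3} {J : List (Fin 3)} {u v w : E3 → F}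
    (h : HasWeakDeriv [j] u v) (h' : HasWeakDeriv (j :: J) u w) : HasWeakDeriv J v w := by
  refine ⟨h.2.1, h'.2.1, fun φ hφ hc => ?_⟩
  have e1 := h.2.2 _ ((Test.mk φ hφ hc).iter J).2.1 ((Test.mk φ hφ hc).iter J).2.2
  have e2 := h'.2.2 φ hφ hc
  rw [Test.iter_coe] at e1
  have e3 : iterPd [j] (iterPd J φ) = iterPd (j :: J) φ := rfl
  change ∫ x, iterPd [j] (iterPd J φ) x • u x = _ at e1
  rw [e3, e2, List.length_cons, pow_succ, List.length_singleton, pow_one, mul_smul, neg_one_smul,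
    smul_neg, neg_one_smul, neg_inj] at e1
  exact e1.symm

/-- The derivative of `h ↦ τ_h u` consists of translates of the first weak derivatives, which have
one order of Sobolev regularity less; induct on `m`. -/
theorem contDiff_tr_of_memH {m : ℕ} {u : V2 F} (hu : MemH m u) :
    ContDiff ℝ m fun h => tr h u := by
  induction m generalizing u with
  | zero => exact contDiff_zero.2 (continuous_tr u)
  | succ m ih =>
    choose v hv hw using fun j : Fin 3 => hu [j] (by simp)
    have hw' : ∀ j, HasWeakDeriv [j] u ((hv j).toLp (v j) : V2 F) := fun j =>
      hasWeakDeriv_congr EventuallyEq.rfl (hv j).coeFn_toLp.symm (hw j)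
    have hm : ∀ j, MemH m ((hv j).toLp (v j) : V2 F) := fun j J hJ => by
      obtain ⟨w, h1, h2⟩ := hu (j :: J) (by simpa using hJ)
      exact ⟨w, h1, (hw' j).of_cons h2⟩
    have e : ((m + 1 : ℕ) : WithTop ℕ∞) = (m : WithTop ℕ∞) + 1 := by push_cast; rfl
    rw [e, contDiff_succ_iff_hasFDerivAt]
    refine ⟨fun h => ∑ j, (EuclideanSpace.proj j : E3 →L[ℝ] ℝ).smulRight
      (tr h ((hv j).toLp (v j) : V2 F)), ContDiff.sum fun j _ => ?_,
      fun h => hasTD_of_hasWeakDeriv hw' h⟩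
    exact (ContinuousLinearMap.smulRightL ℝ E3 (V2 F) _).contDiff.comp (ih (hm j))

end MemH

/-! ### Persistence of regularity -/

section Persistence

variable {𝔤 : Type*} [InvariantLieAlgebra 𝔤] [FiniteDimensional ℝ 𝔤]

/-- Lets smoothness of translates in `Ḣ¹` be deduced from smoothness of translates of the gradient
in `L²`. -/
theorem tr_eq_gradInv (h : E3) (z : HDot1 𝔤) :
    tr h z = gradInv 𝔤 fun j => tr h (HDot1.grad 𝔤 z j) := by
  rw [← gradInv_gradL (tr h z), gradL_tr]; rfl

theorem gradComp_C_apply (i j : Fin 3) (A : ConnFlow 𝔤) (s : ℝ) :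
    ((gradComp 𝔤 i j : C(Conn 𝔤, V2 𝔤)).comp A) (projIcc 0 1 zero_le_one s) =
      HDot1.grad 𝔤 (A.slice i s) j := rfl

/-- Translates of `a` are a `C^m` family in `Ḣ¹`, and the smooth solution map carries it to a `C^m`
family of curves. By uniqueness these are the translates of the solution, so their derivatives at
the origin are its weak derivatives, continuous in `s`. -/
theorem persistence {S : Conn 𝔤 → ConnFlow 𝔤} {r : ℝ} (hS : ContDiffOn ℝ ∞ S (Metric.ball 0 r))
    (hsol : ∀ a ∈ Metric.ball (0 : Conn 𝔤) r, IsMild a (S a)) {a : Conn 𝔤} (ha : ‖a‖ < r) {m : ℕ}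
    (hm : ∀ i j, MemH m (HDot1.grad 𝔤 (a i) j)) (i j : Fin 3) :
    IsCkHm 0 m (Icc (0 : ℝ) 1) fun s => HDot1.grad 𝔤 ((S a).slice i s) j := by
  have hb : ∀ h : E3, tr h a ∈ Metric.ball (0 : Conn 𝔤) r := fun h => by
    rwa [mem_ball_zero_iff, norm_tr]
  have h1 : ContDiff ℝ m fun h : E3 => tr h a := by
    refine contDiff_pi.2 fun i => ?_
    have e : (fun h : E3 => tr h a i) = fun h => gradInv 𝔤 fun j => tr h (HDot1.grad 𝔤 (a i) j) := by
      funext h; rw [tr_pi_apply, tr_eq_gradInv]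
    rw [e]
    exact (gradInv 𝔤).contDiff.comp (contDiff_pi.2 fun j => contDiff_tr_of_memH (hm i j))
  have h2 : ContDiff ℝ m fun h : E3 => S (tr h a) := by
    rw [← contDiffOn_univ]
    exact (hS.of_le (by exact_mod_cast le_top)).comp h1.contDiffOn fun h _ => hb h
  have htr : ∀ (h : E3) s, S (tr h a) s = tr h (S a s) := fun h s => by
    have := ((hsol a (by simpa using ha)).translate h).unique (hsol _ (hb h))
    rw [← this]; rfl
  obtain ⟨f, hf⟩ : ∃ f : E3 × ℝ → C(I, V2 𝔤),
    f = fun x => (gradComp 𝔤 i j : C(Conn 𝔤, V2 𝔤)).comp (S (tr x.1 a)) := ⟨_, rfl⟩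
  have h3 : ContDiffOn ℝ m f (univ ×ˢ univ) := by
    rw [hf]
    exact (((gradComp 𝔤 i j).compLeftContinuous ℝ I).contDiff.comp
      (h2.comp contDiff_fst)).contDiffOn
  have cf : Cov univ f := by
    intro h k t _ s
    rw [hf]
    change gradComp 𝔤 i j (S (tr (h + k) a) s) = tr k (gradComp 𝔤 i j (S (tr h a) s))
    rw [htr, htr, ← gradComp_tr, ← tr_add, add_comm]
  intro J hJ
  obtain ⟨k, rfl⟩ := Nat.exists_eq_add_of_le hJ
  obtain ⟨-, -, h4⟩ := iterX_spec isOpen_univ cf J h3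
  refine ⟨fun s => iterX J f (0, 0) (projIcc 0 1 zero_le_one s), ?_, fun s _ => ?_⟩
  · exact contDiffOn_zero.2
      ((ContinuousMap.continuous _).comp continuous_projIcc).continuousOn
  · have h5 := h4 (0, 0) (mk_mem_prod (mem_univ _) (mem_univ _)) (projIcc 0 1 zero_le_one s)
    have e : f (0, 0) (projIcc 0 1 zero_le_one s) = HDot1.grad 𝔤 ((S a).slice i s) j := by
      rw [hf, ← gradComp_C_apply]
      simp only [tr_zero]
    rw [e] at h5
    exact h5

end Persistence

/-! ### Regular one-parameter data -/

section Coordinates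

/-- The coordinates of `ℝ³ × ℝ`. -/
noncomputable def coordXT : Coord (E3 × ℝ) 4 where
  vec := Fin.cons (0, 1) (dirE ℝ)
  form := Fin.cons (ContinuousLinearMap.snd ℝ E3 ℝ)
    fun j => (EuclideanSpace.proj j : E3 →L[ℝ] ℝ).comp (ContinuousLinearMap.fst ℝ E3 ℝ)
  sum_eq x := by
    rw [Fin.sum_univ_succ]
    simp only [Fin.cons_zero, Fin.cons_succ, dirE]
    refine Prod.ext ?_ ?_
    · simpa [Prod.fst_sum] using E3.sum_coord x.1
    · simp [Prod.snd_sum]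

end Coordinates

section Data

variable {F : Type*} [NormedAddCommGroup F] [InnerProductSpace ℝ F] [FiniteDimensional ℝ F]
  {S : Set ℝ}

/-- The time increment is estimated uniformly in `x` because translations are isometries; the
translation of the fixed vector `u'` varies continuously. -/
theorem hasFDerivAt_tr_curve {V : Type*} [NormedAddCommGroup V] [NormedSpace ℝ V] [TransRep V]
    {u : ℝ → V} {u' : V} {g : Fin 3 → V} {t : ℝ} (hu : HasDerivAt u u' t) (hg : HasTD (u t) g)
    (h : E3) : HasFDerivAt (fun x : E3 × ℝ => tr x.1 (u x.2))
      (∑ m, (coordXT.form m).smulRight ((Fin.cons (tr h u') fun j => tr h (g j) : Fin 4 → V) m))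
      (h, t) := by
  have h1 : HasFDerivAt (fun x : E3 × ℝ => tr x.1 (u t)) ((∑ j : Fin 3,
      (EuclideanSpace.proj j : E3 →L[ℝ] ℝ).smulRight (tr h (g j))).comp
        (ContinuousLinearMap.fst ℝ E3 ℝ)) (h, t) :=
    HasFDerivAt.comp (g := fun h => tr h (u t)) (f := Prod.fst) (h, t) (hg h) hasFDerivAt_fst
  have h2 : HasFDerivAt (fun x : E3 × ℝ => tr x.1 (u x.2 - u t))
      ((ContinuousLinearMap.snd ℝ E3 ℝ).smulRight (tr h u')) (h, t) := by
    rw [hasFDerivAt_iff_isLittleO]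
    have i1 : (fun x : E3 × ℝ => tr x.1 (u x.2 - u t - (x.2 - t) • u')) =o[𝓝 (h, t)]
        fun x => x - (h, t) := by
      have h3 := (hasDerivAt_iff_isLittleO.1 hu).comp_tendsto (continuous_snd.tendsto (h, t))
      refine Asymptotics.IsBigO.trans_isLittleO (Asymptotics.isBigO_of_le _ fun x => ?_)
        (h3.trans_isBigO (Asymptotics.isBigO_of_le _ fun x => norm_snd_le (x - (h, t))))
      exact (norm_tr _ _).le
    have i2 : (fun x : E3 × ℝ => (x.2 - t) • (tr x.1 u' - tr h u')) =o[𝓝 (h, t)]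
        fun x => x - (h, t) := by
      have i3 : (fun x : E3 × ℝ => x.2 - t) =O[𝓝 (h, t)] fun x => x - (h, t) :=
        Asymptotics.isBigO_of_le _ fun x => norm_snd_le (x - (h, t))
      have i4 : (fun x : E3 × ℝ => tr x.1 u' - tr h u') =o[𝓝 (h, t)] fun _ => (1 : ℝ) := by
        rw [Asymptotics.isLittleO_one_iff]
        have hc : Continuous fun x : E3 × ℝ => tr x.1 u' - tr h u' :=
          ((continuous_tr u').comp continuous_fst).sub continuous_const
        have := hc.tendsto (h, t)
        rwa [sub_self] at this
      have := (i3.norm_right).smul_isLittleO i4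
      simpa using this.norm_right
    refine (i1.add i2).congr_left fun x => ?_
    simp only [ContinuousLinearMap.smulRight_apply, ContinuousLinearMap.coe_snd', sub_self,
      map_zero, map_sub, map_smul, smul_sub, sub_smul]
    abel
  have e : (fun x : E3 × ℝ => tr x.1 (u x.2)) =
      fun x => tr x.1 (u x.2 - u t) + tr x.1 (u t) := by
    funext x; rw [map_sub, sub_add_cancel]
  rw [e]
  refine (h2.add h1).congr_fderiv ?_
  rw [Fin.sum_univ_succ (n := 3)]
  ext v <;> simp [coordXT]

/-- Curves in `L²` all whose spatial derivatives are smooth curves in `L²`. -/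
def RegCurve (S : Set ℝ) (u : ℝ → V2 F) : Prop :=
  ∀ J : List (Fin 3), ∃ v : ℝ → V2 F, ContDiffOn ℝ ∞ v S ∧ ∀ t ∈ S, HasWeakDeriv J (u t) (v t)

theorem HasWeakDeriv.nil_ae {u v : E3 → F} (h : HasWeakDeriv [] u v) : u =ᵐ[volume] v := by
  refine ae_eq_of_integral_contDiff_smul_eq h.1 h.2.1 fun φ hφ hc => ?_
  simpa [iterPd] using h.2.2 φ hφ hc

/-- The representing curves may depend on the order `k`, but weak derivatives are unique almost
everywhere, so the curve chosen for `k = 0` has every order of smoothness. -/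
theorem IsRegular.exists_regCurve {ψ : ℝ → E3 → F} (h : IsRegular S ψ) :
    ∃ u : ℝ → V2 F, RegCurve S u ∧ ∀ t ∈ S, ψ t =ᵐ[volume] u t := by
  choose Φ hΦ hw using fun (k : ℕ) (J : List (Fin 3)) => h k J.length J le_rfl
  have hae : ∀ t ∈ S, ψ t =ᵐ[volume] Φ 0 [] t := fun t ht => (hw 0 [] t ht).nil_ae
  refine ⟨Φ 0 [], fun J => ⟨Φ 0 J, contDiffOn_infty.2 fun k => ?_, fun t ht =>
    hasWeakDeriv_congr (hae t ht) EventuallyEq.rfl (hw 0 J t ht)⟩, hae⟩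
  exact (hΦ k J).congr fun t ht => Lp.ext ((hw 0 J t ht).unique (hw k J t ht))

namespace RegCurve

variable {u : ℝ → V2 F}

theorem contDiffOn (hu : RegCurve S u) : ContDiffOn ℝ ∞ u S := by
  obtain ⟨v, hv, hw⟩ := hu []
  exact hv.congr fun t ht => Lp.ext (hw t ht).nil_ae

theorem exists_grad (hu : RegCurve S u) : ∃ g : Fin 3 → ℝ → V2 F, (∀ j, RegCurve S (g j)) ∧
    ∀ t ∈ S, ∀ j, HasWeakDeriv [j] (u t) (g j t) := by
  choose g hg hw using fun j : Fin 3 => hu [j]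
  refine ⟨g, fun j J => ?_, fun t ht j => hw j t ht⟩
  obtain ⟨v, hv, hv'⟩ := hu (j :: J)
  exact ⟨v, hv, fun t ht => (hw j t ht).of_cons (hv' t ht)⟩

/-- The identity defining a weak derivative, tested against a fixed `φ`, is differentiated in `t`.
-/
theorem deriv (hS : IsOpen S) (hu : RegCurve S u) : RegCurve S (_root_.deriv u) := by
  have hd : ∀ {v : ℝ → V2 F}, ContDiffOn ℝ ∞ v S → ∀ t ∈ S, HasDerivAt v (_root_.deriv v t) t :=
    fun hv t ht => ((hv.differentiableOn (by simp) t ht).differentiableAt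
      (hS.mem_nhds ht)).hasDerivAt
  intro J
  obtain ⟨v, hv, hw⟩ := hu J
  refine ⟨_root_.deriv v, hv.deriv_of_isOpen hS (by simp), fun t ht => ?_⟩
  rw [hasWeakDeriv_iff_iter]
  intro φ
  have h1 := (pr (φ.iter J)).hasFDerivAt.comp_hasDerivAt t (hd hu.contDiffOn t ht)
  have h2 := (((-1 : ℝ) ^ J.length • pr φ : V2 F →L[ℝ] F)).hasFDerivAt.comp_hasDerivAt t (hd hv t ht)
  refine h1.unique (h2.congr_of_eventuallyEq (eventually_of_mem (hS.mem_nhds ht) fun r hr => ?_))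
  exact hasWeakDeriv_iff_iter.1 (hw r hr) φ

/-- Partial derivatives in time and space replace `u` by its time derivative or a gradient
component, both again regular curves. The family is closed under differentiation. -/
theorem contDiffOn_tr (hS : IsOpen S) (hu : RegCurve S u) :
    ContDiffOn ℝ ∞ (fun x : E3 × ℝ => tr x.1 (u x.2)) (univ ×ˢ S) := by
  refine contDiffOn_of_closed_family (isOpen_univ.prod hS).uniqueDiffOn coordXT.form
    {f : E3 × ℝ → V2 F | ∃ u : ℝ → V2 F, RegCurve S u ∧ f = fun x => tr x.1 (u x.2)} ?_
    ⟨u, hu, rfl⟩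
  rintro f ⟨u, hu, rfl⟩
  obtain ⟨g, hg, hw⟩ := hu.exists_grad
  refine ⟨fun m x => tr x.1 ((Fin.cons (_root_.deriv u) g : Fin 4 → ℝ → V2 F) m x.2),
    fun m => ⟨_, ?_, rfl⟩, fun x hx => ?_⟩
  · refine Fin.cases ?_ (fun j => ?_) m
    · exact hu.deriv hS
    · exact hg j
  · have h1 : HasDerivAt u (_root_.deriv u x.2) x.2 :=
      ((hu.contDiffOn.differentiableOn (by simp) x.2 hx.2).differentiableAt
        (hS.mem_nhds hx.2)).hasDerivAt
    have h2 := hasFDerivAt_tr_curve h1 (hasTD_of_hasWeakDeriv (hw x.2 hx.2)) x.1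
    refine h2.hasFDerivWithinAt.congr_fderiv (Finset.sum_congr rfl fun m _ => ?_)
    congr 1
    refine Fin.cases ?_ (fun j => ?_) m <;> rfl

end RegCurve

/-- Differentiation of pairings with smooth functions. -/
theorem hasDerivAt_integral_test (hS : IsOpen S) {b : ℝ × E3 → F}
    (hb : ContDiffOn ℝ ∞ b (S ×ˢ univ)) (φ : Test) {t : ℝ} (ht : t ∈ S) :
    HasDerivAt (fun t => ∫ x, φ x • b (t, x)) (∫ x, φ x • _root_.deriv (fun t => b (t, x)) t) t := by
  have hU : IsOpen (S ×ˢ (univ : Set E3)) := hS.prod isOpen_univ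
  have hd : ∀ t ∈ S, ∀ x, HasDerivAt (fun t => b (t, x)) (fderiv ℝ b (t, x) (1, 0)) t := by
    intro t ht x
    have h1 := ((hb.differentiableOn (by simp) (t, x) (mk_mem_prod ht (mem_univ x))).differentiableAt
      (hU.mem_nhds (mk_mem_prod ht (mem_univ x)))).hasFDerivAt
    exact (h1.comp t (hasFDerivAt_prodMk_left t x)).hasDerivAt
  have hc : ContinuousOn (fun y : ℝ × E3 => fderiv ℝ b y (1, 0)) (S ×ˢ univ) :=
    (hb.continuousOn_fderiv_of_isOpen hU (by simp)).clm_apply continuousOn_const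
  obtain ⟨ε, hε, hεS⟩ := Metric.nhds_basis_closedBall.mem_iff.1 (hS.mem_nhds ht)
  obtain ⟨M, hM⟩ := ((isCompact_closedBall t ε).prod φ.2.2.isCompact).exists_bound_of_continuousOn
    (hc.mono (prod_mono hεS (subset_univ _)))
  have hφ : ∀ x, x ∉ tsupport φ → φ x = 0 := fun x hx => image_eq_zero_of_notMem_tsupport hx
  have hcb : ∀ t ∈ S, Continuous fun x => b (t, x) := fun t ht =>
    continuousOn_univ.1 (hb.continuousOn.comp (by fun_prop) fun x _ => mk_mem_prod ht (mem_univ x))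
  have hcd : ∀ t ∈ S, Continuous fun x => fderiv ℝ b (t, x) (1, 0) := fun t ht =>
    continuousOn_univ.1 (hc.comp (f := fun x : E3 => (t, x)) (by fun_prop)
      fun x _ => mk_mem_prod ht (mem_univ x))
  have key := hasDerivAt_integral_of_dominated_loc_of_deriv_le (μ := (volume : Measure E3))
    (F := fun t x => φ x • b (t, x)) (F' := fun t x => φ x • fderiv ℝ b (t, x) (1, 0)) (x₀ := t)
    (bound := fun x => ‖φ x‖ * M) (s := Metric.closedBall t ε) (Metric.closedBall_mem_nhds t hε)
    ?_ ?_ ?_ ?_ ?_ ?_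
  · refine key.2.congr_deriv (integral_congr_ae (Eventually.of_forall fun x => ?_))
    simp only [(hd t ht x).deriv]
  · exact eventually_of_mem (hS.mem_nhds ht) fun r hr =>
      (φ.continuous.smul (hcb r hr)).aestronglyMeasurable
  · exact (φ.continuous.smul (hcb t ht)).integrable_of_hasCompactSupport φ.2.2.smul_right
  · exact (φ.continuous.smul (hcd t ht)).aestronglyMeasurable
  · refine Eventually.of_forall fun x r hr => ?_
    rw [norm_smul]
    by_cases hx : x ∈ tsupport φ
    · exact mul_le_mul_of_nonneg_left (hM (r, x) (mk_mem_prod hr hx)) (norm_nonneg _)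
    · rw [hφ x hx, norm_zero, zero_mul, zero_mul]
  · exact (φ.continuous.integrable_of_hasCompactSupport φ.2.2).norm.mul_const M
  · exact Eventually.of_forall fun x r hr => (hd r (hεS hr) x).const_smul (φ x)

end Data

/-! ### Classical and weak derivatives -/

section Classical

variable {F : Type*} [NormedAddCommGroup F] [InnerProductSpace ℝ F] [FiniteDimensional ℝ F]
  {S : Set ℝ} {p : ℝ≥0∞} [Fact (1 ≤ p)] [Fact (p ≠ ⊤)]

theorem hasWeakDeriv_pd {b : E3 → F} (hb : ContDiff ℝ ∞ b) (j : Fin 3) :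
    HasWeakDeriv [j] b (pd j b) := by
  have hc : Continuous (pd j b) :=
    (hb.continuous_fderiv (by simp)).clm_apply continuous_const
  refine ⟨hb.continuous.locallyIntegrable, hc.locallyIntegrable, fun φ hφ hs => ?_⟩
  have hs' : HasCompactSupport (pd j φ) := hasCompactSupport_pd hs
  have h := integral_smul_fderiv_eq_neg_fderiv_smul_of_integrable (μ := (volume : Measure E3))
    (f := φ) (g := b) (v := ej j)
    (((contDiff_pd hφ).continuous.smul hb.continuous).integrable_of_hasCompactSupport
      hs'.smul_right)
    ((hφ.continuous.smul hc).integrable_of_hasCompactSupport hs.smul_right)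
    ((hφ.continuous.smul hb.continuous).integrable_of_hasCompactSupport hs.smul_right)
    (fun x _ => hφ.differentiable (by simp) x) (fun x _ => hb.differentiable (by simp) x)
  rw [List.length_singleton, pow_one, neg_one_smul]
  exact (neg_eq_iff_eq_neg.2 h).symm

/-- The time derivative of each pairing is computed once from the smooth representative and once
from the curve in `L^p`. -/
theorem ae_deriv (hS : IsOpen S) {b : ℝ × E3 → F} (hb : ContDiffOn ℝ ∞ b (S ×ˢ univ))
    {v : ℝ → Lp F p (volume : Measure E3)} {v' : Lp F p (volume : Measure E3)} {t : ℝ} (ht : t ∈ S)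
    (hv : ∀ t ∈ S, (v t : E3 → F) =ᵐ[volume] fun x => b (t, x)) (hd : HasDerivAt v v' t) :
    (fun x => _root_.deriv (fun t => b (t, x)) t) =ᵐ[volume] v' := by
  have hU : IsOpen (S ×ˢ (univ : Set E3)) := hS.prod isOpen_univ
  have hc : Continuous fun x => _root_.deriv (fun t => b (t, x)) t := by
    have e : (fun x => _root_.deriv (fun t => b (t, x)) t) = fun x => fderiv ℝ b (t, x) (1, 0) := by
      funext x
      have h1 := ((hb.differentiableOn (by simp) (t, x)
        (mk_mem_prod ht (mem_univ x))).differentiableAt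
        (hU.mem_nhds (mk_mem_prod ht (mem_univ x)))).hasFDerivAt
      exact (h1.comp t (hasFDerivAt_prodMk_left t x)).hasDerivAt.deriv
    have hc : ContinuousOn (fun y : ℝ × E3 => fderiv ℝ b y (1, 0)) (S ×ˢ univ) :=
      (hb.continuousOn_fderiv_of_isOpen hU (by simp)).clm_apply continuousOn_const
    rw [e]
    exact continuousOn_univ.1 (hc.comp (f := fun x : E3 => (t, x)) (by fun_prop)
      fun x _ => mk_mem_prod ht (mem_univ x))
  refine ae_eq_of_integral_contDiff_smul_eq hc.locallyIntegrable (Lp.locallyIntegrable' v')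
    fun φ hφ hs => ?_
  have h1 := hasDerivAt_integral_test hS hb (Test.mk φ hφ hs) ht
  have h2 := (pr (Test.mk φ hφ hs)).hasFDerivAt.comp_hasDerivAt t hd
  have h3 := h1.unique (h2.congr_of_eventuallyEq (eventually_of_mem (hS.mem_nhds ht) fun r hr => ?_))
  · rw [pr_apply] at h3; exact h3
  · rw [Function.comp_apply, pr_apply]
    exact integral_congr_ae ((hv r hr).mono fun x hx => by simp only [hx])

end Classical

/-! ### The heat equation in `Ḣ¹` and in `L²`, and smooth representatives -/

section Pairs

variable (𝔤 : Type*) [InvariantLieAlgebra 𝔤] [FiniteDimensional ℝ 𝔤]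

/-- The component `i`. -/
noncomputable abbrev cmp (V : Type*) [NormedAddCommGroup V] [NormedSpace ℝ V] (i : Fin 3) :
    (Fin 3 → V) →L[ℝ] V := ContinuousLinearMap.proj (R := ℝ) (φ := fun _ : Fin 3 => V) i

/-- The heat equation in `Ḣ¹`. -/
noncomputable def heatZ : HeatPair (Conn 𝔤) (Fin 3 → Src 𝔤) 𝔤 (Fin 3 → Bd) where
  ι := Fin 3 × Test
  Λ i := (pr i.2).comp ((emb6 𝔤).comp (cmp (HDot1 𝔤) i.1))
  Λ' i := (pr i.2.lap).comp ((emb6 𝔤).comp (cmp (HDot1 𝔤) i.1))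
  μ i := (prS i.2).comp (cmp (Src 𝔤) i.1)
  μ' i := (prS i.2.lap).comp (cmp (Src 𝔤) i.1)
  Q := smZ.pi
  b := gker gauss 0
  sep v v' h := funext fun i => emb6_injective (pr_ext fun φ => h (i, φ))
  isLap i := (isLap_pr i.2).comp _ fun _ _ => rfl
  isLap_source i := (isLap_prS i.2).comp _ fun _ _ => rfl
  spec i l w hl := by
    have h := pr_emb6_smZ i.2 hl (w i.1)
    rw [← SmoothingFamily.pi_apply] at h
    refine h.trans (congrArg (prS i.2) ?_)
    exact (map_cv (cmp (Src 𝔤) i.1) (fun _ _ => rfl) l _ w).symm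

variable {𝔤} in
theorem pr_cvW (φ : Test) {l : ℝ} (hl : 0 < l) (b : Bd) (w : Src 𝔤) :
    pr φ (cvW l b w) = prS φ (cv l b w) := by
  rw [cvW_apply, map_add, prS_apply, cv_src]
  congr 1
  exact pr_congr (coeFn_cvT hl _ w.1) φ

/-- The heat equation in `L²`. -/
noncomputable def heatL : HeatPair (Fin 3 → V2 𝔤) (Fin 3 → Src 𝔤) 𝔤 Bd where
  ι := Fin 3 × Test
  Λ i := (pr i.2).comp (cmp (V2 𝔤) i.1)
  Λ' i := (pr i.2.lap).comp (cmp (V2 𝔤) i.1)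
  μ i := (prS i.2).comp (cmp (Src 𝔤) i.1)
  μ' i := (prS i.2.lap).comp (cmp (Src 𝔤) i.1)
  Q := smL2.pi
  b := wker gauss 0
  sep v v' h := funext fun i => pr_ext fun φ => h (i, φ)
  isLap i := (isLap_pr i.2).comp _ fun _ _ => rfl
  isLap_source i := (isLap_prS i.2).comp _ fun _ _ => rfl
  spec i l w hl := by
    have h := pr_cvW i.2 hl (wker gauss 0) (w i.1)
    have e : smL2.pi.op l (wker gauss 0) w i.1 = cvW l (wker gauss 0) (w i.1) :=
      SmoothingFamily.pi_apply _ _ _ _ _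
    refine (congrArg (pr i.2) e).trans (h.trans (congrArg (prS i.2) ?_))
    exact (map_cv (cmp (Src 𝔤) i.1) (fun _ _ => rfl) l _ w).symm

/-- Evaluation of a component at the origin. -/
noncomputable def evZ (i : Fin 3) : Conn 𝔤 × Conn 𝔤 →L[ℝ] 𝔤 :=
  (evPt 𝔤).comp (((emb6 𝔤).comp (cmp (HDot1 𝔤) i)).prodMap ((emb6 𝔤).comp (cmp (HDot1 𝔤) i)))

variable {𝔤} {S : Set ℝ}

/-- By covariance the value at `x` is the value at the origin of the family member based at `x`, so
a fixed continuous linear evaluation reads off the function everywhere. -/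
theorem coeFn_eq_evZ (hS : IsOpen S) {f : E3 × ℝ → ConnFlow 𝔤}
    (hf : ContDiffOn ℝ ∞ f (univ ×ˢ S)) (cf : Cov S f) {t : ℝ} (ht : t ∈ S) (s : I) (i : Fin 3) :
    (f (0, t) s i).fn =ᵐ[volume] fun x => evZ 𝔤 i (f (x, t) s, lapX f (x, t) s) := by
  have hU : IsOpen ((univ : Set E3) ×ˢ S) := isOpen_univ.prod hS
  have hx : ((0 : E3), t) ∈ (univ : Set E3) ×ˢ S := mk_mem_prod (mem_univ _) ht
  have hd : ∀ {f : E3 × ℝ → ConnFlow 𝔤}, ContDiffOn ℝ ∞ f (univ ×ˢ S) →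
    DifferentiableOn ℝ f (univ ×ˢ S) := fun hf => hf.differentiableOn (by simp)
  have h1 := cf.hasTD (x := (0, t)) ht ((hd hf _ hx).differentiableAt (hU.mem_nhds hx)) s
  have h2 : ∀ j, HasTD _ _ := fun j => (cf.dX hS (hd hf) (dirE ℝ j)).hasTD (x := (0, t)) ht
    ((hd (contDiffOn_dX hU _ hf) _ hx).differentiableAt (hU.mem_nhds hx)) s
  have h3 := h1.map ((emb6 𝔤).comp (cmp (HDot1 𝔤) i)) fun _ _ => rfl
  have h4 := fun j => (h2 j).map ((emb6 𝔤).comp (cmp (HDot1 𝔤) i)) fun _ _ => rfl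
  have h5 := coeFn_eq_evPt h3 h4
  refine h5.trans (Eventually.of_forall fun x => ?_)
  have e1 : f (x, t) s = tr x (f (0, t) s) := by rw [← cf 0 x t ht s, zero_add]
  have e2 : lapX f (x, t) s = tr x (lapX f (0, t) s) := by
    rw [lapX, lapX, ContinuousMap.sum_apply, ContinuousMap.sum_apply, map_sum]
    refine Finset.sum_congr rfl fun j _ => ?_
    have := (cf.dX hS (hd hf) (dirE ℝ j)).dX hS (hd (contDiffOn_dX hU _ hf)) (dirE ℝ j) 0 x t ht s
    rwa [zero_add] at this
  beta_reduce
  rw [e1, e2]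
  have e3 : lapX f (0, t) s = ∑ j, dX (dirE ℝ j) (dX (dirE ℝ j) f) (0, t) s := by
    rw [lapX, ContinuousMap.sum_apply]
  rw [e3, ← map_sum]
  rfl

theorem duhamel_zero {B W Z : Type*} [NormedAddCommGroup B] [NormedSpace ℝ B]
    [NormedAddCommGroup W] [NormedSpace ℝ W] [NormedAddCommGroup Z] [NormedSpace ℝ Z]
    [CompleteSpace Z] (Q : SmoothingFamily B W Z) (b : C(I, B)) (w : C(I, W)) :
    duhamel Q b w 0 = 0 := by
  rw [duhamel_apply, Set.Icc.coe_zero, Real.zero_rpow (by norm_num), zero_smul]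

theorem linear_initial {a : Conn 𝔤} {w : C(I, Fin 3 → Src 𝔤)} {B : ConnFlow 𝔤}
    (hB : B = evo (wker gauss 0) a + duhamel smZ.pi (kerC 0) w) : B 0 = a := by
  rw [hB, ContinuousMap.add_apply, duhamel_zero, add_zero, evo_apply, Set.Icc.coe_zero,
    Real.sqrt_zero, cv_zero_gauss]

/-- The `L²` and the `Ḣ¹` solutions of the linear heat equation agree. -/
theorem linear_ae {a : Conn 𝔤} {e : Fin 3 → V2 𝔤} (ha : ∀ i, (a i).fn =ᵐ[volume] e i)
    {w : C(I, Fin 3 → Src 𝔤)} {B : ConnFlow 𝔤} {q : C(I, Fin 3 → V2 𝔤)}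
    (hB : B = evo (wker gauss 0) a + duhamel smZ.pi (kerC 0) w)
    (hq : q = evo (wker gauss 0) e + duhamel smL2.pi (ContinuousMap.const I (wker gauss 0)) w)
    (s : I) (i : Fin 3) : (emb6 𝔤 (B s i) : E3 → 𝔤) =ᵐ[volume] q s i := by
  refine ae_eq_of_pr fun φ => ?_
  have e1 : pr φ (emb6 𝔤 (evo (wker gauss 0) a s i)) = pr φ (evo (wker gauss 0) e s i) := by
    have h1 : emb6 𝔤 (evo (wker gauss 0) a s i) = cv √(s : ℝ) (wker gauss 0) (emb6 𝔤 (a i)) := by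
      rw [evo_apply]
      exact map_cv ((emb6 𝔤).comp (cmp (HDot1 𝔤) i)) (fun _ _ => rfl) _ _ _
    have h2 : evo (wker gauss 0) e s i = cv √(s : ℝ) (wker gauss 0) (e i) := by
      rw [evo_apply]
      exact map_cv (cmp (V2 𝔤) i) (fun _ _ => rfl) _ _ _
    rw [h1, h2]
    -- At `s = 0` the average has width zero and the pointwise formula, which needs positive width,
    -- is replaced by the agreement of the data.
    rcases s.2.1.eq_or_lt with h0 | h0
    · rw [← h0, Real.sqrt_zero, cv_zero_gauss, cv_zero_gauss]
      exact pr_congr (ha i) φ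
    · refine pr_congr ((coeFn_cv _ _ _).trans (EventuallyEq.trans ?_ (coeFn_cv _ _ _).symm)) φ
      exact EventuallyEq.of_eq (cvf_congr (Real.sqrt_pos.2 h0).ne' _ (ha i))
  have e2 : pr φ (emb6 𝔤 (duhamel smZ.pi (kerC 0) w s i)) =
      pr φ (duhamel smL2.pi (ContinuousMap.const I (wker gauss 0)) w s i) := by
    have h1 := map_duhamel_const smZ.pi (gker gauss 0) w ((heatZ 𝔤).Λ (i, φ)) s
    have h2 := map_duhamel_const smL2.pi (wker gauss 0) w ((heatL 𝔤).Λ (i, φ)) s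
    rw [← kerC_zero] at h1
    refine h1.trans (Eq.trans ?_ h2.symm)
    rw [intervalIntegral.integral_of_le s.2.1, intervalIntegral.integral_of_le s.2.1,
      integral_Ioc_eq_integral_Ioo, integral_Ioc_eq_integral_Ioo]
    refine setIntegral_congr_fun measurableSet_Ioo fun r hr => ?_
    have hl := Real.sqrt_pos.2 (sub_pos.2 hr.2)
    exact ((heatZ 𝔤).spec (i, φ) _ _ hl).trans ((heatL 𝔤).spec (i, φ) _ _ hl).symm
  rw [hB, hq, ContinuousMap.add_apply, ContinuousMap.add_apply, Pi.add_apply, Pi.add_apply, map_add,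
    map_add, e1, e2, ← map_add]

end Pairs

/-! ### Regularity of one-parameter families of solutions -/

section RegularFamilies

variable {𝔤 : Type*} [InvariantLieAlgebra 𝔤] [FiniteDimensional ℝ 𝔤] {T : Set ℝ}

/-- The classical gradients of the representative are the weak gradients in `L²`. Their translates
are smooth in `(x, t)`, and `gradInv` reassembles them in `Ḣ¹`. -/
theorem contDiffOn_tr_data (hT : IsOpen T) {a : ℝ → Conn 𝔤} (ha : IsRegularDataFamily T a) :
    ContDiffOn ℝ ∞ (fun x : E3 × ℝ => tr x.1 (a x.2)) (univ ×ˢ T) := by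
  obtain ⟨b, hb⟩ := ha
  refine contDiffOn_pi.2 fun i => ?_
  choose u hu hae using fun j : Fin 3 => ((hb i).2.2.2 j).exists_regCurve
  have hgrad : ∀ t ∈ T, ∀ j, HDot1.grad 𝔤 (a t i) j = u j t := by
    intro t ht j
    have hbt : ContDiff ℝ ∞ fun x => b i (t, x) := contDiffOn_univ.1
      ((hb i).1.comp (f := fun x : E3 => (t, x)) (contDiff_const.prodMk contDiff_id).contDiffOn
        fun x _ => mk_mem_prod ht (mem_univ x))
    have h1 : HasWeakDeriv [j] (a t i).fn (HDot1.grad 𝔤 (a t i) j) := (a t i).2 j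
    have h2 := hasWeakDeriv_congr ((hb i).2.1 t ht).symm (hae j t ht) (hasWeakDeriv_pd hbt j)
    exact Lp.ext (h1.unique h2)
  have h3 : ContDiffOn ℝ ∞ (fun x : E3 × ℝ => gradInv 𝔤 fun j => tr x.1 (u j x.2)) (univ ×ˢ T) :=
    (gradInv 𝔤).contDiff.comp_contDiffOn (contDiffOn_pi.2 fun j => (hu j).contDiffOn_tr hT)
  refine h3.congr fun x hx => ?_
  rw [tr_pi_apply, tr_eq_gradInv]
  simp only [hgrad x.2 hx.2]

theorem hasDerivAt_right (hT : IsOpen T) {V : Type*} [NormedAddCommGroup V] [NormedSpace ℝ V]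
    {f : E3 × ℝ → V} (hf : ContDiffOn ℝ ∞ f (univ ×ˢ T)) (h : E3) {t : ℝ} (ht : t ∈ T) :
    HasDerivAt (fun t => f (h, t)) (dX (0, 1) f (h, t)) t := by
  have h1 := ((hf.differentiableOn (by simp) (h, t) (mk_mem_prod (mem_univ h) ht)).differentiableAt
    ((isOpen_univ.prod hT).mem_nhds (mk_mem_prod (mem_univ h) ht))).hasFDerivAt
  exact (h1.comp t (hasFDerivAt_prodMk_right h t)).hasDerivAt

/-- The derivative of the data in `t` exists in `Ḣ¹`, hence in `L⁶`, and agrees almost everywhere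
with the classical derivative, which is assumed to be a regular curve in `L²`. -/
theorem exists_time_data (hT : IsOpen T) {a : ℝ → Conn 𝔤} (ha : IsRegularDataFamily T a) :
    ∃ e : Fin 3 → ℝ → V2 𝔤, (∀ i, RegCurve T (e i)) ∧ ∀ x ∈ (univ : Set E3) ×ˢ T, ∀ i,
      (dX (0, 1) (fun x : E3 × ℝ => tr x.1 (a x.2)) x i).fn =ᵐ[volume]
        (tr x.1 (e i x.2) : V2 𝔤) := by
  have hg := contDiffOn_tr_data hT ha
  obtain ⟨b, hb⟩ := ha
  choose e he hae using fun i : Fin 3 => (hb i).2.2.1.exists_regCurve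
  refine ⟨e, he, fun x hx i => ?_⟩
  obtain ⟨h, t⟩ := x
  have h0 := hasDerivAt_right hT hg 0 hx.2
  have h1 := hasDerivAt_right hT hg h hx.2
  simp only [tr_zero] at h0
  have h2 := (tr h : Conn 𝔤 →L[ℝ] Conn 𝔤).hasFDerivAt.comp_hasDerivAt t h0
  rw [h1.unique h2]
  have h3 := ae_deriv hT (hb i).1 hx.2 (v := fun t => emb6 𝔤 (a t i)) (hb i).2.1
    (((emb6 𝔤).comp (cmp (HDot1 𝔤) i)).hasFDerivAt.comp_hasDerivAt t h0)
  exact tr_ae_congr (h3.symm.trans (hae i t hx.2)) h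

variable {g : E3 × ℝ → Conn 𝔤} {f : E3 × ℝ → ConnFlow 𝔤}

theorem cov_nlC (cf : Cov T f) : Cov T fun x => nlC (f x) :=
  cf.map ⟨nl, contDiff_nl.continuous⟩ nl_tr

/-- Bootstrap: the nonlinearity inherits the regularity of `f`, and the strong equation then adds
one derivative in `s`. -/
theorem treg_flow (hT : IsOpen T) (hf : ContDiffOn ℝ ∞ f (univ ×ˢ T)) (cf : Cov T f)
    (hm : ∀ x ∈ (univ : Set E3) ×ˢ T, IsMild (g x) (f x)) (n : ℕ) : TReg (univ ×ˢ T) n f := by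
  induction n with
  | zero => exact hf
  | succ n ih =>
    refine (heatZ 𝔤).treg_succ hT ih (ih.postcomp contDiff_nl) cf (cov_nlC cf) fun x hx i s => ?_
    have h := (hm x hx).isWeak i.1 i.2 s
    rw [← (hm x hx).initial] at h
    exact h

/-- Differentiating the mild equation in `t` gives a linear equation whose source is already known
and smooth. Solving it with the `L²` data defines `q`; `linear_ae` identifies it with the derivative
in `Ḣ¹`, and the weak equation is transported to `q` for the bootstrap. -/
theorem exists_time_flow (hT : IsOpen T) (hf : ContDiffOn ℝ ∞ f (univ ×ˢ T)) (cf : Cov T f)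
    (hg : ContDiffOn ℝ ∞ g (univ ×ˢ T)) (hm : ∀ x ∈ (univ : Set E3) ×ˢ T, IsMild (g x) (f x))
    {e : Fin 3 → ℝ → V2 𝔤} (he : ∀ i, RegCurve T (e i))
    (hge : ∀ x ∈ (univ : Set E3) ×ˢ T, ∀ i,
      (dX (0, 1) g x i).fn =ᵐ[volume] (tr x.1 (e i x.2) : V2 𝔤)) :
    ∃ q : E3 × ℝ → C(I, Fin 3 → V2 𝔤), (∀ n, TReg (univ ×ˢ T) n q) ∧ Cov T q ∧
      ∀ x ∈ (univ : Set E3) ×ˢ T, ∀ s i,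
        (emb6 𝔤 (dX (0, 1) f x s i) : E3 → 𝔤) =ᵐ[volume] q x s i := by
  have hU : IsOpen ((univ : Set E3) ×ˢ T) := isOpen_univ.prod hT
  have hd : ∀ {V : Type _} [NormedAddCommGroup V] [NormedSpace ℝ V] {f : E3 × ℝ → V},
      ContDiffOn ℝ ∞ f (univ ×ˢ T) → ∀ x ∈ (univ : Set E3) ×ˢ T, DifferentiableAt ℝ f x :=
    fun hf x hx => (hf.differentiableOn (by simp) x hx).differentiableAt (hU.mem_nhds hx)
  have hw : ∀ n, TReg (univ ×ˢ T) n fun x => nlC (f x) := fun n =>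
    (treg_flow hT hf cf hm n).postcomp contDiff_nl
  have hwt : ∀ n, TReg (univ ×ˢ T) n (dX (0, 1) fun x => nlC (f x)) := fun n =>
    (hw n).derivX hU _
  have cft : Cov T (dX (0, 1) f) := cf.dX hT (hf.differentiableOn (by simp)) _
  have cwt : Cov T (dX (0, 1) fun x => nlC (f x)) :=
    (cov_nlC cf).dX hT ((hw 0).smooth.differentiableOn (by simp)) _
  have hlin : ∀ x ∈ (univ : Set E3) ×ˢ T, dX (0, 1) f x = evo (wker gauss 0) (dX (0, 1) g x) +
      duhamel smZ.pi (kerC 0) (dX (0, 1) (fun x => nlC (f x)) x) := by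
    intro x hx
    have h1 := (((evo (wker gauss 0) : Conn 𝔤 →L[ℝ] ConnFlow 𝔤)).hasFDerivAt.comp x
      (hd hg x hx).hasFDerivAt).add ((duhamel smZ.pi (kerC 0) :
        C(I, Fin 3 → Src 𝔤) →L[ℝ] ConnFlow 𝔤).hasFDerivAt.comp x
      (hd (hw 0).smooth x hx).hasFDerivAt)
    have h2 := h1.congr_of_eventuallyEq (eventually_of_mem (hU.mem_nhds hx) hm)
    have h3 := h2.fderiv
    exact congrArg (fun L : E3 × ℝ →L[ℝ] ConnFlow 𝔤 => L (0, 1)) h3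
  obtain ⟨q, hq⟩ : ∃ q : E3 × ℝ → C(I, Fin 3 → V2 𝔤), ∀ x, q x =
      evo (wker gauss 0) (fun i => (tr x.1 (e i x.2) : V2 𝔤)) +
      duhamel smL2.pi (ContinuousMap.const I (wker gauss 0)) (dX (0, 1) (fun x => nlC (f x)) x) :=
    ⟨_, fun _ => rfl⟩
  have hae : ∀ x ∈ (univ : Set E3) ×ˢ T, ∀ s i,
      (emb6 𝔤 (dX (0, 1) f x s i) : E3 → 𝔤) =ᵐ[volume] q x s i :=
    fun x hx s i => linear_ae (hge x hx) (hlin x hx) (hq x) s i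
  have hqs : ContDiffOn ℝ ∞ q (univ ×ˢ T) := by
    have h1 : ContDiffOn ℝ ∞ (fun x : E3 × ℝ => fun i => (tr x.1 (e i x.2) : V2 𝔤)) (univ ×ˢ T) :=
      contDiffOn_pi.2 fun i => (he i).contDiffOn_tr hT
    have h2 := (evo (wker gauss 0) : (Fin 3 → V2 𝔤) →L[ℝ] C(I, Fin 3 → V2 𝔤)).contDiff
      (n := ∞) |>.comp_contDiffOn h1
    have h3 := (duhamel smL2.pi (ContinuousMap.const I (wker gauss 0)) :
      C(I, Fin 3 → Src 𝔤) →L[ℝ] C(I, Fin 3 → V2 𝔤)).contDiff (n := ∞) |>.comp_contDiffOn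
        (hwt 0).smooth
    exact (h2.add h3).congr fun x _ => hq x
  have cq : Cov T q := by
    intro h k t ht s
    funext i
    refine Lp.ext ((hae (h + k, t) (mk_mem_prod (mem_univ _) ht) s i).symm.trans ?_)
    rw [cft h k t ht s]
    exact tr_ae_congr (hae (h, t) (mk_mem_prod (mem_univ _) ht) s i) k
  refine ⟨q, fun n => ?_, cq, hae⟩
  induction n with
  | zero => exact hqs
  | succ n ih =>
    refine (heatL 𝔤).treg_succ hT ih (hwt n) cq cwt fun x hx i s => ?_
    have h1 := weak_linear _ _ (hlin x hx) i.1 i.2 s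
    rw [← linear_initial (hlin x hx)] at h1
    have h2 : ∀ s (φ : Test), pr φ (q x s i.1) = pr φ (emb6 𝔤 (dX (0, 1) f x s i.1)) :=
      fun s φ => (pr_congr (hae x hx s i.1) φ).symm
    rw [← h2, ← h2] at h1
    refine h1.trans (intervalIntegral.integral_congr fun r _ => ?_)
    exact congrArg (· + _) (h2 _ _).symm

theorem TReg.contDiffOn_zero_slice (hT : IsOpen T) {V : Type*} [NormedAddCommGroup V]
    [NormedSpace ℝ V] [CompleteSpace V] {n : ℕ} {Φ : E3 × ℝ → C(I, V)}
    (hΦ : TReg (univ ×ˢ T) n Φ) :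
    ContDiffOn ℝ n (fun p : ℝ × ℝ => Φ (0, p.1) (projIcc 0 1 zero_le_one p.2)) (T ×ˢ Icc 0 1) := by
  have h := hΦ.contDiffOn_joint coordXT (isOpen_univ.prod hT)
  exact h.comp (f := fun p : ℝ × ℝ => (((0 : E3), p.1), p.2))
    (((contDiff_const.prodMk contDiff_fst).prodMk contDiff_snd).contDiffOn)
    fun p hp => ⟨mk_mem_prod (mem_univ _) hp.1, hp.2⟩

/-- Spatial derivatives of the family at the base point `0` are weak derivatives, and joint
smoothness in `(t, s)` is inherited from the family. -/
theorem isRegular_of_treg (hT : IsOpen T) {Φ : E3 × ℝ → C(I, V2 𝔤)}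
    (hΦ : ∀ n, TReg (univ ×ˢ T) n Φ) (cΦ : Cov T Φ) {ψ : ℝ × ℝ → E3 → 𝔤}
    (h : ∀ p ∈ T ×ˢ Icc (0 : ℝ) 1, (Φ (0, p.1) (projIcc 0 1 zero_le_one p.2) : E3 → 𝔤)
      =ᵐ[volume] ψ p) : IsRegular (T ×ˢ Icc (0 : ℝ) 1) ψ := by
  intro k m J _
  refine ⟨_, ((hΦ k).iterX hT J).contDiffOn_zero_slice hT, fun p hp => ?_⟩
  have h1 := (iterX_spec hT cΦ J (k := 0)
    ((hΦ 0).smooth.of_le (by exact_mod_cast le_top))).2.2 (0, p.1)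
      (mk_mem_prod (mem_univ _) hp.1) (projIcc 0 1 zero_le_one p.2)
  exact hasWeakDeriv_congr (h p hp) EventuallyEq.rfl h1

/-- Everything is applied to `f(x, t) = S(τ_x a(t))`: uniqueness makes it covariant, composition
makes it smooth, and its restriction to `x = 0` is the given family of solutions. -/
theorem regular_family {S : Conn 𝔤 → ConnFlow 𝔤} {r : ℝ} (hS : ContDiffOn ℝ ∞ S (Metric.ball 0 r))
    (hsol : ∀ a ∈ Metric.ball (0 : Conn 𝔤) r, IsMild a (S a)) (hT : IsOpen T) {a : ℝ → Conn 𝔤}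
    (ha : IsRegularDataFamily T a) (hb : ∀ t ∈ T, ‖a t‖ < r) {A : ℝ → ConnFlow 𝔤}
    (hA : ∀ t ∈ T, A t = S (a t)) : IsRegularFlowFamily T A := by
  have hU : IsOpen ((univ : Set E3) ×ˢ T) := isOpen_univ.prod hT
  have hg := contDiffOn_tr_data hT ha
  have hball : ∀ x ∈ (univ : Set E3) ×ˢ T, tr x.1 (a x.2) ∈ Metric.ball (0 : Conn 𝔤) r :=
    fun x hx => by rw [mem_ball_zero_iff, norm_tr]; exact hb x.2 hx.2
  obtain ⟨f, hfe⟩ : ∃ f : E3 × ℝ → ConnFlow 𝔤, ∀ x, f x = S (tr x.1 (a x.2)) :=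
    ⟨_, fun _ => rfl⟩
  have hm : ∀ x ∈ (univ : Set E3) ×ˢ T, IsMild (tr x.1 (a x.2)) (f x) := fun x hx => by
    rw [hfe]; exact hsol _ (hball x hx)
  have hf : ContDiffOn ℝ ∞ f (univ ×ˢ T) := (hS.comp hg hball).congr fun x _ => hfe x
  have cf : Cov T f := by
    intro h k t ht s
    have h1 := (hm (h, t) (mk_mem_prod (mem_univ _) ht)).translate k
    have h2 := hm (h + k, t) (mk_mem_prod (mem_univ _) ht)
    simp only [← tr_add, add_comm k h] at h1
    rw [h2.unique h1]; rfl
  have hfA : ∀ t ∈ T, ∀ s i, (A t).slice i s = f (0, t) (projIcc 0 1 zero_le_one s) i := by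
    intro t ht s i
    rw [slice_apply, hfe, hA t ht, tr_zero]
  have htf := treg_flow hT hf cf hm
  obtain ⟨e, he, hge⟩ := exists_time_data hT ha
  obtain ⟨q, hq, cq, hqe⟩ := exists_time_flow hT hf cf hg hm he hge
  -- The smooth representative: evaluation at the origin of the member of the family based at `x`,
  -- using its Laplacian.
  obtain ⟨B, hB⟩ : ∃ B : Fin 3 → ℝ × E3 × ℝ → 𝔤, ∀ i y, B i y =
      evZ 𝔤 i (f (y.2.1, y.1) (projIcc 0 1 zero_le_one y.2.2),
        lapX f (y.2.1, y.1) (projIcc 0 1 zero_le_one y.2.2)) := ⟨_, fun _ _ => rfl⟩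
  have hBs : ∀ i, ContDiffOn ℝ ∞ (B i) (T ×ˢ univ ×ˢ Icc 0 1) := by
    intro i
    refine contDiffOn_infty.2 fun n => ?_
    have h1 := (htf n).contDiffOn_joint coordXT hU
    have h2 : TReg (univ ×ˢ T) n (lapX f) :=
      TReg.sum_three fun j => ((htf n).derivX hU (dirE ℝ j)).derivX hU (dirE ℝ j)
    have h3 := (evZ 𝔤 i).contDiff (n := n) |>.comp_contDiffOn
      (h1.prodMk (h2.contDiffOn_joint coordXT hU))
    refine (h3.comp (f := fun y : ℝ × E3 × ℝ => ((y.2.1, y.1), y.2.2)) ?_ fun y hy =>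
      ⟨mk_mem_prod (mem_univ _) hy.1, hy.2.2⟩).congr fun y _ => hB i y
    exact (((contDiff_fst.comp contDiff_snd).prodMk contDiff_fst).prodMk
      (contDiff_snd.comp contDiff_snd)).contDiffOn
  have hae : ∀ t ∈ T, ∀ s i, (f (0, t) (projIcc 0 1 zero_le_one s) i).fn =ᵐ[volume]
      fun x => B i (t, x, s) := by
    intro t ht s i
    simp only [hB]
    exact coeFn_eq_evZ hT hf cf ht _ i
  refine ⟨B, fun i => ⟨hBs i, fun t ht s _ => ?_, ?_, fun j => ?_⟩⟩
  · rw [hfA t ht]; exact hae t ht s i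
  · refine isRegular_of_treg hT (Φ := fun x => (cmp (V2 𝔤) i : C(Fin 3 → V2 𝔤, V2 𝔤)).comp (q x))
      (fun n => (hq n).clm _) (cq.map _ fun _ _ => rfl) fun p hp => ?_
    have hBp : ContDiffOn ℝ ∞ (fun y : ℝ × E3 => B i (y.1, y.2, p.2)) (T ×ˢ univ) :=
      (hBs i).comp (contDiff_fst.prodMk (contDiff_snd.prodMk contDiff_const)).contDiffOn
        fun y hy => ⟨hy.1, mem_univ _, hp.2⟩
    have h1 := hasDerivAt_right hT hf 0 hp.1
    have h2 := (((emb6 𝔤).comp (cmp (HDot1 𝔤) i)).comp (ContinuousMap.evalCLM ℝ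
      (projIcc (0 : ℝ) 1 zero_le_one p.2))).hasFDerivAt.comp_hasDerivAt p.1 h1
    have h3 := ae_deriv hT hBp hp.1 (v := fun t => emb6 𝔤 (f (0, t) (projIcc 0 1 zero_le_one p.2) i))
      (fun t ht => hae t ht p.2 i) h2
    have h4 := hqe (0, p.1) (mk_mem_prod (mem_univ _) hp.1) (projIcc 0 1 zero_le_one p.2) i
    exact h4.symm.trans h3.symm
  · refine isRegular_of_treg hT
      (Φ := fun x => (gradComp 𝔤 i j : C(Conn 𝔤, V2 𝔤)).comp (f x))
      (fun n => (htf n).clm _) (cf.map _ (gradComp_tr i j)) fun p hp => ?_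
    have hBp : ContDiff ℝ ∞ fun x : E3 => B i (p.1, x, p.2) :=
      contDiffOn_univ.1 ((hBs i).comp (f := fun x : E3 => (p.1, x, p.2))
        (contDiff_const.prodMk (contDiff_id.prodMk contDiff_const)).contDiffOn
        fun x _ => ⟨hp.1, mem_univ _, hp.2⟩)
    have h1 := (f (0, p.1) (projIcc 0 1 zero_le_one p.2) i).2 j
    exact HasWeakDeriv.unique (hasWeakDeriv_congr (hae p.1 hp.1 p.2 i) EventuallyEq.rfl h1)
      (hasWeakDeriv_pd hBp j)

end RegularFamilies

end YMHeat

/-! ### The theorem -/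

theorem mainTheorem5 (𝔤 : Type*) [InvariantLieAlgebra 𝔤] [FiniteDimensional ℝ 𝔤] :
    ∃ δP : ℝ, 0 < δP ∧
      -- existence, uniqueness and the a priori estimate
      (∃ C : ℝ, 0 < C ∧ ∀ a : Conn 𝔤, ‖a‖ ≤ δP →
        ∃ A : ConnFlow 𝔤, IsDeTurckSolution a A ∧
          (∀ A' : ConnFlow 𝔤, IsDeTurckSolution a A' → A' = A) ∧
          gradPNorm A ≤ ENNReal.ofReal (C * ‖a‖)) ∧
      -- the difference estimate
      (∃ C : ℝ → ℝ → ℝ, (∀ p q, 0 < C p q) ∧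
        (∀ p p' q q', p ≤ p' → q ≤ q' → C p q ≤ C p' q') ∧
        ∀ a a' : Conn 𝔤, ‖a‖ ≤ δP → ‖a'‖ ≤ δP →
          ∀ A A' : ConnFlow 𝔤, IsDeTurckSolution a A → IsDeTurckSolution a' A' →
            gradPNorm (A - A') ≤ ENNReal.ofReal (C ‖a‖ ‖a'‖ * ‖a - a'‖)) ∧
      -- persistence of regularity
      (∀ (m : ℕ) (a : Conn 𝔤), ‖a‖ ≤ δP → (∀ i j, MemH m (HDot1.grad 𝔤 (a i) j)) →
        ∀ A : ConnFlow 𝔤, IsDeTurckSolution a A →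
          ∀ i j, IsCkHm 0 m (Set.Icc (0 : ℝ) 1) fun s => HDot1.grad 𝔤 (A.slice i s) j) ∧
      -- smooth dependence on the initial data
      (∃ S : Conn 𝔤 → ConnFlow 𝔤, ContDiffOn ℝ ∞ S (Metric.closedBall 0 δP) ∧
        ∀ a : Conn 𝔤, ‖a‖ ≤ δP → IsDeTurckSolution a (S a)) ∧
      -- one parameter families of regular data
      (∀ (I : Set ℝ), IsOpen I → I.OrdConnected →
        ∀ (a : ℝ → Conn 𝔤) (A : ℝ → ConnFlow 𝔤), IsRegularDataFamily I a →
          (∀ t ∈ I, ‖a t‖ ≤ δP ∧ IsDeTurckSolution (a t) (A t)) →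
            IsRegularFlowFamily I A) := by
  obtain ⟨S, r, C, hr, hC, hS, hsol, huniq, hest, hdiff⟩ := exists_solution 𝔤
  have hmem : ∀ {a : Conn 𝔤}, ‖a‖ ≤ r / 2 → a ∈ Metric.ball 0 r := fun {a} h =>
    mem_ball_zero_iff.2 (by linarith)
  have hmild : ∀ a ∈ Metric.ball 0 r, IsMild a (S a) := fun a ha => (hsol a ha).isMild
  -- Half of the radius, so that the closed ball of data lies in the open ball on which the solution
  -- map is smooth. The constant of the difference estimate can be taken independent of the data.
  refine ⟨r / 2, half_pos hr, ⟨C, hC, fun a ha => ?_⟩, ⟨fun _ _ => C, fun _ _ => hC,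
    fun _ _ _ _ _ _ => le_rfl, fun a a' ha ha' A A' hA hA' => ?_⟩, fun m a ha hm A hA i j => ?_,
    ⟨S, hS.mono (Metric.closedBall_subset_ball (half_lt_self hr)),
      fun a ha => hsol a (hmem ha)⟩, fun I hI _ a A ha hA => ?_⟩
  · exact ⟨S a, hsol a (hmem ha), huniq a (hmem ha), hest a (hmem ha)⟩
  · rw [huniq a (hmem ha) A hA, huniq a' (hmem ha') A' hA']
    exact hdiff a (hmem ha) a' (hmem ha')
  · rw [huniq a (hmem ha) A hA]
    exact persistence hS hmild (mem_ball_zero_iff.1 (hmem ha)) hm i j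
  · exact regular_family hS hmild hI ha (fun t ht => mem_ball_zero_iff.1 (hmem (hA t ht).1))
      fun t ht => huniq _ (hmem (hA t ht).1) _ (hA t ht).2
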